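/- Let $N\ge 1$, let $\log q, k\in\mathbb C$, write $q^x=e^{x\log q}$, $[x]=\frac{q^x-q^{-x}}{q-q^{-1}}$, $g=N$, and assume $|q|<1$ and $|p|<1$ where $p=q^{2(k+g)}$. Let $(a_{ij})$ be the Cartan matrix of $sl_N$. **Bosons.** Let $a^i$ $(1\le i\le N-1)$, $b^{ij},c^{ij}$ $(1\le i<j\le N)$ be free bosons with modes $x_n$ $(n\neq0)$, $\hat p_x,\hat q_x$ and the only nonzero commutators $[a^i_n,a^j_m]=\frac1n[(k+g)n][a_{ij}n]\delta_{n+m,0}$, $[\hat p_a^i,\hat q_a^j]=(k+g)a_{ij}$; $[b^{ij}_n,b^{ij}_m]=-\frac1n[n]^2\delta_{n+m,0}$, $[\hat p_b^{ij},\hat q_b^{ij}]=-1$; $[c^{ij}_n,c^{ij}_m]=\frac1n[n]^2\delta_{n+m,0}$, $[\hat p_c^{ij},\hat q_c^{ij}]=1$. Put $\big(\tfrac1M x\big)(z;\alpha)=-\sum_{n\ne0}\frac{x_n}{[Mn]}q^{-\alpha|n|}z^{-n}+\frac1M(\hat q_x+\hat p_x\log z)$, $x(z)=(\tfrac11x)(z;0)$,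 $x_\pm(z)=\pm\big((q-q^{-1})\sum_{\pm n>0}x_nz^{-n}+\hat p_x\log q\big)$, $b^{ii}=c^{ii}=0$, $(b+c)^{ij}=b^{ij}+c^{ij}$. Normal ordering $:\ :$ puts $x_n$ $(n<0)$ and $\hat q_x$ on the left, $x_n$ $(n>0)$ and $\hat p_x$ on the right. The operators act on the sum of the Fock spaces $F(p_a,p_b,p_c)$ (polynomials in the $x_{-n}$, $n>0$, on a highest weight state with these $\hat p$-eigenvalues), over all complex $p_a,p_b,p_c$ with $p_b^{ij}+p_c^{ij}\in\mathbb Z$; a *basis state* is a monomial in the $x_{-n}$ applied to such a highest weight state. **Realization of $U_q(\widehat{sl_N})$.** Let $\mathcal U$ be the unital algebra generated by the following operators, $1\le i\le N-1$ (the Drinfeld generators in the free boson realization of level $k$, where $\gamma=q^k$): $$H^i_n=\sum_{j=1}^i\big(b^{j,i+1}_nq^{-(\frac k2+j-1)|n|}-b^{j,i}_nq^{-(\frac k2+j)|n|}\big)+a^i_nq^{-\frac g2|n|}+\sum_{j=i+1}^N\big(b^{i,j}_nq^{-(\frac k2+j)|n|}-b^{i+1,j}_nq^{-(\frac k2+j-1)|n|}\big)\quad(n\ne0),$$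 $K_i^{\pm1}$ with $K_i=q^{\sum_{j=1}^i(\hat p_b^{j,i+1}-\hat p_b^{j,i})+\hat p_a^i+\sum_{j=i+1}^N(\hat p_b^{i,j}-\hat p_b^{i+1,j})}$, and the modes $E^{\pm,i}_n$ $(n\in\mathbb Z)$ of $E^{\pm,i}(z)=\sum_nE^{\pm,i}_nz^{-n-1}$, where $$E^{+,i}(z)=\tfrac{-1}{(q-q^{-1})z}\sum_{j=1}^i\sum_{\epsilon=\pm}\epsilon:\exp\Big((b+c)^{j,i}(q^{j-1}z)+b^{j,i+1}_\epsilon(q^{j-1}z)-(b+c)^{j,i+1}(q^{j-1+\epsilon}z)+\sum_{\ell=1}^{j-1}\big(b_+^{\ell,i+1}(q^{\ell-1}z)-b_+^{\ell,i}(q^\ell z)\big)\Big):,$$ and, with $T^i_{\pm,j}(z)=a^i_\pm(q^{\pm\frac{k+g}2}z)+\sum_{\ell=j}^N\big(b_\pm^{i,\ell}(q^{\pm(k+\ell)}z)-b_\pm^{i+1,\ell}(q^{\pm(k+\ell-1)}z)\big)$, $$\begin{aligned}E^{-,i}(z)=\tfrac{-1}{(q-q^{-1})z}\Big\{&\sum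_{j=1}^{i-1}\sum_{\epsilon=\pm}(-\epsilon):\exp\Big((b+c)^{j,i+1}(q^{-(k+j)}z)-b^{j,i}_\epsilon(q^{-(k+j)}z)-(b+c)^{j,i}(q^{-(k+j)-\epsilon}z)\\&\qquad+\sum_{\ell=j+1}^i\big(b_-^{\ell,i+1}(q^{-(k+\ell-1)}z)-b_-^{\ell,i}(q^{-(k+\ell)}z)\big)+T^i_{-,i+1}(z)\Big):\\&+:\exp\big((b+c)^{i,i+1}(q^{-(k+i)}z)+T^i_{-,i+1}(z)\big):-:\exp\big((b+c)^{i,i+1}(q^{k+i}z)+T^i_{+,i+1}(z)\big):\\&-\sum_{j=i+2}^N\sum_{\epsilon=\pm}\epsilon:\exp\Big((b+c)^{i,j}(q^{k+j-1}z)+b_\epsilon^{i+1,j}(q^{k+j-1}z)-(b+c)^{i+1,j}(q^{k+j-1+\epsilon}z)+T^i_{+,j}(z)\Big):\Big\}.\end{aligned}$$ **Screening currents.** $$S^i(z)=\tfrac{-1}{(q-q^{-1})z}:\exp\Big(-\big(\tfrac1{k+g}a^i\big)(z;\tfrac{k+g}2)\Big):\sum_{j=i+1}^N\sum_{\epsilon=\pm}(-\epsilon):\exp\Big((b+c)^{i+1,j}(q^{N-j}z)-b_\epsilon^{i,j}(q^{N-j}z)-(b+c)^{i,j}(q^{N-j-\epsilon}z)+\sum_{\ell=j+1}^N\big(b_-^{i+1,\ell}(q^{N-\ell+1}z)-b_-^{i,\ell}(q^{N-\ell}z)\big)\Big):$$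 For $s\in\mathbb C^\times$ with a chosen logarithm let $\int_0^{s\infty}f(z)\,d_pz=s(1-p)\sum_{m\in\mathbb Z}f(sp^m)p^m$ (two-sided convergence; non-integral powers of $z=sp^m$ are taken with $\log z=\log s+2m(k+g)\log q$). **Statement.** Fix $i$ and $s$. Let $\langle\varphi|$ and $|v\rangle$ be possibly infinite linear combinations of (dual) basis states (for example finite ones, or superpositions of infinitely many momenta). Suppose that the Jackson integral $\int_0^{s\infty}S^i(z)\,d_pz$ converges in the matrix elements between the states generated from them by $\mathcal U$: for all $X,Y\in\mathcal U$ the sum over basis states defining $\langle\varphi|Y\,S^i(z)\,X|v\rangle$ converges absolutely for all $z\in sp^{\mathbb Z}$, and $\int_0^{s\infty}\langle\varphi|Y\,S^i(z)\,X|v\rangle\,d_pz$ converges. Then the screening charge commutes with $U_q(\widehat{sl_N})$ in these matrix elements: for all $X,Y,Z\in\mathcal U$ both integrals below converge and $$\int_0^{s\infty}\langle\varphi|\,Y\,X\,S^i(z)\,Z|v\rangle\,d_pz=\int_0^{s\infty}\langle\varphi|\,Y\,S^i(z)\,X\,Z|v\rangle\,d_pz .$$ -/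

import Mathlib

noncomputable section

namespace FreeBoson

/-- The rank parameter `N` of `sl_N`, a fixed choice `logq` of the logarithm of `q` (so that
`q ^ x = exp (x * logq)` for complex `x`), and the level `k`. -/
structure Params where
  N : ℕ
  logq : ℂ
  k : ℂ

/-- Nodes `1 ≤ i ≤ N - 1` of the Dynkin diagram of `sl_N`. -/
abbrev Node (P : Params) : Type := ↥(Finset.Ico 1 P.N)

/-- Index pairs `(i, j)` with `1 ≤ i < j ≤ N`. -/
abbrev Root (P : Params) : Type :=
  ↥((Finset.Icc 1 P.N ×ˢ Finset.Icc 1 P.N).filter fun ij => ij.1 < ij.2)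

/-- The `N ^ 2 - 1` free bosons `a^i`, `b^{ij}`, `c^{ij}`. -/
inductive Boson (P : Params) : Type where
  | a (i : Node P) : Boson P
  | b (r : Root P) : Boson P
  | c (r : Root P) : Boson P
deriving DecidableEq, Fintype

section Numbers

variable (P : Params)

/-- `q ^ x`. -/
def Params.qpow (x : ℂ) : ℂ := Complex.exp (x * P.logq)

/-- `q - q⁻¹`. -/
def Params.qdiff : ℂ := P.qpow 1 - P.qpow (-1)

/-- `[x] = (q ^ x - q ^ (-x)) / (q - q⁻¹)`. -/
def Params.br (x : ℂ) : ℂ := (P.qpow x - P.qpow (-x)) / P.qdiff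

/-- `k + g`, where the dual Coxeter number is `g = N`. -/
def Params.kg : ℂ := P.k + P.N

/-- The logarithm of `p = q ^ (2 (k + g))`. -/
def Params.logp : ℂ := 2 * P.kg * P.logq

end Numbers

/-- Cartan matrix of type `A`. -/
def cartan (i j : ℕ) : ℂ := if i = j then 2 else if i + 1 = j ∨ j + 1 = i then -1 else 0

/-- The scalar `[x_n, y_{-n}]` for `n > 0`; all other commutators of nonzero modes vanish. -/
def comm (P : Params) (x y : Boson P) (n : ℕ) : ℂ :=
  match x, y with
  | .a i, .a j => 1 / (n : ℂ) * P.br (P.kg * n) * P.br (cartan i.1 j.1 * n)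
  | .b r, .b r' => if r = r' then -(1 / (n : ℂ) * P.br n ^ 2) else 0
  | .c r, .c r' => if r = r' then 1 / (n : ℂ) * P.br n ^ 2 else 0
  | _, _ => 0

/-- The scalar `[p̂_x, q̂_y]`; all other commutators involving a zero mode vanish. -/
def zeroComm (P : Params) (x y : Boson P) : ℂ :=
  match x, y with
  | .a i, .a j => P.kg * cartan i.1 j.1
  | .b r, .b r' => if r = r' then -1 else 0
  | .c r, .c r' => if r = r' then 1 else 0
  | _, _ => 0

/-! ### Fock states -/

/-- Eigenvalues of the `p̂_x`. The numbers `p_b^{ij} + p_c^{ij}` are integers, so that the currents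
`E^{±,i}(z)` have integral powers of `z`; otherwise the momenta are arbitrary complex numbers. -/
abbrev Momentum (P : Params) : Type :=
  {μ : Boson P → ℂ // ∀ r : Root P, ∃ m : ℤ, μ (.b r) + μ (.c r) = m}

/-- `(x, n)` stands for the creation oscillator `x_{-n}`, `n ≥ 1`. -/
abbrev Osc (P : Params) : Type := Boson P × ℕ+

/-- The Fock space `F(p_a, p_b, p_c)` generated by the creation oscillators over the highest weight
state of given momentum is the polynomial ring in these oscillators, and the monomials are its
standard basis. -/
abbrev Fock (P : Params) : Type := MvPolynomial (Osc P) ℂ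

/-- The basis of the sum of all Fock spaces: a momentum and a monomial in the oscillators. -/
abbrev Basis (P : Params) : Type := Momentum P × (Osc P →₀ ℕ)

/-- An operator, given by its matrix elements: `T b' b` is the coefficient of `b'` in `T b`. The
vector `T b` may be an infinite combination of basis vectors. -/
abbrev Kernel (P : Params) : Type := Basis P → Basis P → ℂ

/-- Product of operators. (In each product used below one of the factors has finite rows and
columns.) -/
def Kernel.mul {P : Params} (S T : Kernel P) : Kernel P :=
  fun b' b => ∑ᶠ c : Basis P, S b' c * T c b

open Classical in
/-- The identity operator. -/
def Kernel.one (P : Params) : Kernel P := fun b' b => if b' = b then 1 else 0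

open Classical in
/-- The diagonal operator `f(p̂)`. -/
def diag {P : Params} (f : Momentum P → ℂ) : Kernel P :=
  fun b' b => if b' = b then f b.1 else 0

/-- The action of the mode `x_n` on the Fock space of momentum `μ`: `x_{-n}` (`n > 0`) is a
multiplication operator, `x_n` (`n > 0`) the derivation determined by the commutation relations, and
`x_0 = (2 log q / (q - q⁻¹)) p̂_x`. -/
def oscOp (P : Params) (μ : Momentum P) (x : Boson P) : ℤ → (Fock P →ₗ[ℂ] Fock P)
  | Int.ofNat 0 => (2 * P.logq / P.qdiff * μ.1 x) • LinearMap.id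
  | Int.ofNat (n + 1) =>
      ∑ y : Boson P, comm P x y (n + 1) • (MvPolynomial.pderiv (y, n.succPNat)).toLinearMap
  | Int.negSucc n => LinearMap.mulLeft ℂ (MvPolynomial.X (x, n.succPNat))

open Classical in
/-- The mode `x_n` as an operator. -/
def oscKernel (P : Params) (x : Boson P) (n : ℤ) : Kernel P :=
  fun b' b => if b'.1 = b.1 then
    MvPolynomial.coeff b'.2 (oscOp P b.1 x n (MvPolynomial.monomial b.2 1)) else 0

/-! ### Normal ordered exponentials -/

/-- The symbols `x_n` (`n ≠ 0`), `q̂_x`, `p̂_x`. -/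
inductive Mode (P : Params) : Type where
  | osc (x : Boson P) (n : ℤ) : Mode P
  | qhat (x : Boson P) : Mode P
  | phat (x : Boson P) : Mode P

/-- A formal linear combination of the modes, given by its coefficients. The coefficients of the
symbols `x_0` are not used. -/
abbrev LinForm (P : Params) : Type := Mode P → ℂ

/-- `exp` of the creation part `∑_{x, n > 0} L(x_{-n}) x_{-n}`, a power series in the creation
oscillators. -/
def expCreation {P : Params} (L : LinForm P) : MvPowerSeries (Osc P) ℂ :=
  fun m => m.prod fun o r => L (.osc o.1 (-(o.2 : ℤ))) ^ r / (r.factorial : ℂ)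

/-- `exp` of the annihilation part `∑_{x, n > 0} L(x_n) x_n`. The annihilation part is a derivation
with constant values on the variables, so its exponential is the translation by these values. -/
def expAnnihilation {P : Params} (L : LinForm P) : Fock P →ₐ[ℂ] Fock P :=
  MvPolynomial.aeval fun o : Osc P =>
    MvPolynomial.X o + MvPolynomial.C (∑ x : Boson P, L (.osc x o.2) * comm P x o.1 o.2)

/-- `exp (∑ L(q̂_x) q̂_x)` shifts the eigenvalue of `p̂_x` by this amount. -/
def momentumShift {P : Params} (L : LinForm P) (x : Boson P) : ℂ :=
  ∑ y : Boson P, L (.qhat y) * zeroComm P x y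

open Classical in
/-- The normal ordered exponential `:exp L:`, with the creation oscillators and the `q̂` on the left
and the annihilation oscillators and the `p̂` on the right. -/
def vertex {P : Params} (L : LinForm P) : Kernel P := fun b' b =>
  if b'.1.1 = b.1.1 + momentumShift L then
    Complex.exp (∑ x : Boson P, L (.phat x) * b.1.1 x) *
      MvPowerSeries.coeff b'.2
        (expCreation L * (expAnnihilation L (MvPolynomial.monomial b.2 1) : MvPowerSeries (Osc P) ℂ))
  else 0

/-! ### Boson fields

The fields are multivalued in `z` and are written as functions of `u = log z`; the argument
`q ^ α * z` is `u + α * log q`. -/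

open Classical in
/-- `((L / M) x)(z; α) = - ∑_{n ≠ 0} ([L n] / [M n]) (x_n / [n]) q^{- α |n|} z^{-n}
+ (L / M) (q̂_x + p̂_x log z)`. -/
def field {P : Params} (L M : ℂ) (x : Boson P) (α u : ℂ) : LinForm P
  | .osc y n => if y = x ∧ n ≠ 0 then
      -(P.br (L * n) / P.br (M * n) / P.br n * P.qpow (-(α * |n|)) * Complex.exp (-(n * u))) else 0
  | .qhat y => if y = x then L / M else 0
  | .phat y => if y = x then L / M * u else 0

open Classical in
/-- `x_+(z) = (q - q⁻¹) ∑_{n > 0} x_n z^{-n} + p̂_x log q`. -/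
def plusField {P : Params} (x : Boson P) (u : ℂ) : LinForm P
  | .osc y n => if y = x ∧ 0 < n then P.qdiff * Complex.exp (-(n * u)) else 0
  | .qhat _ => 0
  | .phat y => if y = x then P.logq else 0

open Classical in
/-- `x_-(z) = - ((q - q⁻¹) ∑_{n < 0} x_n z^{-n} + p̂_x log q)`. -/
def minusField {P : Params} (x : Boson P) (u : ℂ) : LinForm P
  | .osc y n => if y = x ∧ n < 0 then -(P.qdiff * Complex.exp (-(n * u))) else 0
  | .qhat _ => 0
  | .phat y => if y = x then -P.logq else 0

section Currents

variable (P : Params)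

/-- `(b + c)^{ij}(q^α z)`, zero for `i = j`. -/
def bc (i j : ℕ) (α u : ℂ) : LinForm P :=
  if h : (i, j) ∈ (Finset.Icc 1 P.N ×ˢ Finset.Icc 1 P.N).filter fun ij => ij.1 < ij.2 then
    field 1 1 (.b ⟨(i, j), h⟩) 0 (u + α * P.logq) + field 1 1 (.c ⟨(i, j), h⟩) 0 (u + α * P.logq)
  else 0

/-- `b^{ij}_+(q^α z)`, zero for `i = j`. -/
def bPlus (i j : ℕ) (α u : ℂ) : LinForm P :=
  if h : (i, j) ∈ (Finset.Icc 1 P.N ×ˢ Finset.Icc 1 P.N).filter fun ij => ij.1 < ij.2 then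
    plusField (.b ⟨(i, j), h⟩) (u + α * P.logq) else 0

/-- `b^{ij}_-(q^α z)`, zero for `i = j`. -/
def bMinus (i j : ℕ) (α u : ℂ) : LinForm P :=
  if h : (i, j) ∈ (Finset.Icc 1 P.N ×ˢ Finset.Icc 1 P.N).filter fun ij => ij.1 < ij.2 then
    minusField (.b ⟨(i, j), h⟩) (u + α * P.logq) else 0

/-- `b^{ij}_n`, zero for `i = j`. -/
def bMode (i j : ℕ) (n : ℤ) : Kernel P :=
  if h : (i, j) ∈ (Finset.Icc 1 P.N ×ˢ Finset.Icc 1 P.N).filter fun ij => ij.1 < ij.2 then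
    oscKernel P (.b ⟨(i, j), h⟩) n else 0

/-- The eigenvalue of `p̂^{ij}_b`, zero for `i = j`. -/
def bMomentum (μ : Momentum P) (i j : ℕ) : ℂ :=
  if h : (i, j) ∈ (Finset.Icc 1 P.N ×ˢ Finset.Icc 1 P.N).filter fun ij => ij.1 < ij.2 then
    μ.1 (.b ⟨(i, j), h⟩) else 0

/-- `a^i_+(q^α z)`. -/
def aPlus (i : Node P) (α u : ℂ) : LinForm P := plusField (.a i) (u + α * P.logq)

/-- `a^i_-(q^α z)`. -/
def aMinus (i : Node P) (α u : ℂ) : LinForm P := minusField (.a i) (u + α * P.logq)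

/-- The prefactor `-1 / ((q - q⁻¹) z)`. -/
def prefactor (u : ℂ) : ℂ := -1 / (P.qdiff * Complex.exp u)

/-- `H^i_n`, the coefficient of `z^{-n-1}` in `H^i(z)`. -/
def H (i : Node P) (n : ℤ) : Kernel P :=
  ∑ j ∈ Finset.Icc 1 i.1,
      (P.qpow (-((P.k / 2 + j - 1) * |n|)) • bMode P j (i + 1) n
        - P.qpow (-((P.k / 2 + j) * |n|)) • bMode P j i n)
    + P.qpow (-((P.N : ℂ) / 2 * |n|)) • oscKernel P (.a i) n
    + ∑ j ∈ Finset.Icc (i.1 + 1) P.N,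
      (P.qpow (-((P.k / 2 + j) * |n|)) • bMode P i j n
        - P.qpow (-((P.k / 2 + j - 1) * |n|)) • bMode P (i + 1) j n)

/-- The exponent of `q` in `K_i`. -/
def weight (i : Node P) (μ : Momentum P) : ℂ :=
  ∑ j ∈ Finset.Icc 1 i.1, (bMomentum P μ j (i + 1) - bMomentum P μ j i)
    + μ.1 (.a i)
    + ∑ j ∈ Finset.Icc (i.1 + 1) P.N, (bMomentum P μ i j - bMomentum P μ (i + 1) j)

/-- `K_i`. -/
def K (i : Node P) : Kernel P := diag fun μ => P.qpow (weight P i μ)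

/-- `K_i⁻¹`. -/
def Kinv (i : Node P) : Kernel P := diag fun μ => P.qpow (-weight P i μ)

/-- The current `E^{+,i}(z)`, `z = exp u`. -/
def Eplus (i : Node P) (u : ℂ) : Kernel P :=
  prefactor P u • ∑ j ∈ Finset.Icc 1 i.1,
    (vertex (bc P j i (j - 1) u
        + (bPlus P j (i + 1) (j - 1) u - bc P j (i + 1) j u)
        + ∑ l ∈ Finset.Ico 1 j, (bPlus P l (i + 1) (l - 1) u - bPlus P l i l u))
      - vertex (bc P j i (j - 1) u
        + (bMinus P j (i + 1) (j - 1) u - bc P j (i + 1) (j - 2) u)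
        + ∑ l ∈ Finset.Ico 1 j, (bPlus P l (i + 1) (l - 1) u - bPlus P l i l u)))

/-- `a^i_-(q^{-(k+g)/2} z) + ∑_{l=i+1}^N (b^{i,l}_-(q^{-(k+l)} z) - b^{i+1,l}_-(q^{-(k+l-1)} z))`. -/
def tailMinus (i : Node P) (u : ℂ) : LinForm P :=
  aMinus P i (-(P.kg / 2)) u
    + ∑ l ∈ Finset.Icc (i.1 + 1) P.N,
      (bMinus P i l (-(P.k + l)) u - bMinus P (i + 1) l (-(P.k + l - 1)) u)

/-- `a^i_+(q^{(k+g)/2} z) + ∑_{l=j}^N (b^{i,l}_+(q^{k+l} z) - b^{i+1,l}_+(q^{k+l-1} z))`. -/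
def tailPlus (i : Node P) (j : ℕ) (u : ℂ) : LinForm P :=
  aPlus P i (P.kg / 2) u
    + ∑ l ∈ Finset.Icc j P.N,
      (bPlus P i l (P.k + l) u - bPlus P (i + 1) l (P.k + l - 1) u)

/-- The current `E^{-,i}(z)`, `z = exp u`. -/
def Eminus (i : Node P) (u : ℂ) : Kernel P :=
  prefactor P u •
    (∑ j ∈ Finset.Ico 1 i.1,
        (vertex (bc P j (i + 1) (-(P.k + j)) u
            + (-bMinus P j i (-(P.k + j)) u - bc P j i (-(P.k + j - 1)) u)
            + ∑ l ∈ Finset.Icc (j + 1) i.1,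
              (bMinus P l (i + 1) (-(P.k + l - 1)) u - bMinus P l i (-(P.k + l)) u)
            + tailMinus P i u)
          - vertex (bc P j (i + 1) (-(P.k + j)) u
            + (-bPlus P j i (-(P.k + j)) u - bc P j i (-(P.k + j + 1)) u)
            + ∑ l ∈ Finset.Icc (j + 1) i.1,
              (bMinus P l (i + 1) (-(P.k + l - 1)) u - bMinus P l i (-(P.k + l)) u)
            + tailMinus P i u))
      + vertex (bc P i (i + 1) (-(P.k + i)) u + tailMinus P i u)
      - vertex (bc P i (i + 1) (P.k + i) u + tailPlus P i (i + 1) u)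
      - ∑ j ∈ Finset.Icc (i.1 + 2) P.N,
        (vertex (bc P i j (P.k + j - 1) u
            + (bPlus P (i + 1) j (P.k + j - 1) u - bc P (i + 1) j (P.k + j) u)
            + tailPlus P i j u)
          - vertex (bc P i j (P.k + j - 1) u
            + (bMinus P (i + 1) j (P.k + j - 1) u - bc P (i + 1) j (P.k + j - 2) u)
            + tailPlus P i j u)))

/-- The mode `A_n` of a current `A(z) = ∑ A_n z^{-n-1}`: the contour integral
`(1 / 2πi) ∮ z^n A(z) dz` over the unit circle, taken on matrix elements. -/
def mode (A : ℂ → Kernel P) (n : ℤ) : Kernel P := fun b' b =>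
  1 / (2 * (Real.pi : ℂ)) * ∫ θ in (0 : ℝ)..(2 * Real.pi),
    Complex.exp ((n + 1) * (θ * Complex.I)) * A (θ * Complex.I) b' b

/-- The screening current `S^i(z)`, `z = exp u`. Its factor in the boson `a^i` commutes with the
factor in `b`, `c`, so their product is one normal ordered exponential in each summand. -/
def screening (i : Node P) (u : ℂ) : Kernel P :=
  prefactor P u • ∑ j ∈ Finset.Icc (i.1 + 1) P.N,
    (vertex (-field 1 P.kg (.a i) (P.kg / 2) u
        + bc P (i + 1) j (P.N - j) u
        + (-bMinus P i j (P.N - j) u - bc P i j (P.N - j + 1) u)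
        + ∑ l ∈ Finset.Icc (j + 1) P.N,
          (bMinus P (i + 1) l (P.N - l + 1) u - bMinus P i l (P.N - l) u))
      - vertex (-field 1 P.kg (.a i) (P.kg / 2) u
        + bc P (i + 1) j (P.N - j) u
        + (-bPlus P i j (P.N - j) u - bc P i j (P.N - j - 1) u)
        + ∑ l ∈ Finset.Icc (j + 1) P.N,
          (bMinus P (i + 1) l (P.N - l + 1) u - bMinus P i l (P.N - l) u)))

/-- The Drinfeld generators in the realization (the central element `γ` is the scalar `q ^ k`). -/
inductive IsGenerator : Kernel P → Prop
  | H (i : Node P) (n : ℤ) (hn : n ≠ 0) : IsGenerator (H P i n)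
  | K (i : Node P) : IsGenerator (K P i)
  | Kinv (i : Node P) : IsGenerator (Kinv P i)
  | Eplus (i : Node P) (n : ℤ) : IsGenerator (mode P (Eplus P i) n)
  | Eminus (i : Node P) (n : ℤ) : IsGenerator (mode P (Eminus P i) n)

/-- The image of `U_q(sl_N^)` in the realization: the unital algebra generated by the Drinfeld
generators. -/
inductive IsUq : Kernel P → Prop
  | gen (X : Kernel P) (hX : IsGenerator P X) : IsUq X
  | one : IsUq (Kernel.one P)
  | smul (t : ℂ) (X : Kernel P) (hX : IsUq X) : IsUq (t • X)
  | add (X Y : Kernel P) (hX : IsUq X) (hY : IsUq Y) : IsUq (X + Y)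
  | mul (X Y : Kernel P) (hX : IsUq X) (hY : IsUq Y) : IsUq (X.mul Y)

end Currents

/-! ### Jackson integrals of matrix elements -/

/-- A bra or a ket: a possibly infinite combination of basis vectors. -/
abbrev State (P : Params) : Type := Basis P → ℂ

/-- The sum `⟨φ|T|v⟩ = ∑ φ(b') T(b', b) v(b)` converges absolutely. -/
def MatrixElementConverges {P : Params} (φ : State P) (T : Kernel P) (v : State P) : Prop :=
  Summable fun b : Basis P × Basis P => φ b.1 * T b.1 b.2 * v b.2

/-- `⟨φ|T|v⟩`. -/
def matrixElement {P : Params} (φ : State P) (T : Kernel P) (v : State P) : ℂ :=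
  ∑' b : Basis P × Basis P, φ b.1 * T b.1 b.2 * v b.2

/-- The Jackson integral `∫_0^{s∞} f(z) d_p z = s (1 - p) ∑_{m ∈ ℤ} f(s p^m) p^m` converges, as a
two-sided series, to `l`. Here `s = exp logs`, `p = exp logp`, and `f` is a function of `log z`. -/
def HasJacksonIntegral (logs logp : ℂ) (f : ℂ → ℂ) (l : ℂ) : Prop :=
  HasSum (fun m : ℤ => Complex.exp logs * (1 - Complex.exp logp) *
    (f (logs + m * logp) * Complex.exp (m * logp))) l (SummationFilter.conditional ℤ)

/-- The Jackson integral of `S^i(z)` with `p = q ^ (2 (k + g))` converges between `φ` and `v`, that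
is, in all matrix elements `⟨φ|Y S^i(z) X|v⟩` between the states generated from `φ` and `v` by
`U_q(sl_N^)`. -/
def ScreeningChargeConverges (P : Params) (i : Node P) (logs : ℂ) (φ v : State P) : Prop :=
  ∀ X Y : Kernel P, IsUq P X → IsUq P Y →
    (∀ m : ℤ, MatrixElementConverges φ
      ((Y.mul (screening P i (logs + m * P.logp))).mul X) v) ∧
    ∃ l : ℂ, HasJacksonIntegral logs P.logp
      (fun u => matrixElement φ ((Y.mul (screening P i u)).mul X) v) l

end FreeBoson

end

/-! Each summand of the currents `Eplus`, `Eminus` and `screening` is a normal ordered exponential.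
For a summand `L` of a current and a summand `M` of the screening current, n times the contraction
at energy n is either zero or of the form β^n - α^n. Contracting therefore produces the single
factor (1 - αt)/(1 - βt), where t is the ratio of the arguments, and the products in the two orders
are the expansions of one rational function at t = 0 and at t = ∞. Their difference is a delta
function at the one pole, so the commutator of a mode of `:exp L:` with `:exp M(z):` is a scalar
times the normal ordered exponential in which `L` is evaluated at the pole. This is `gradedProd_sub`
for the oscillators and `selection_vertex_commutator` once the zero modes are added;
`HasOPE.bracket_eq` is the form in which it is applied.

What remains is a finite list of contractions and a list of coincidences among the exponents at the
poles. The residues cancel for all modes of E^{+,m}, and for E^{-,m} with m ≠ i. The generators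
H^m_n and K_m commute with every summand of the screening current, because the relevant contractions
vanish. For E^{-,i} the residues with j > i telescope in j, and those with j ≤ i reduce to one; the
two survivors are the same operator at z and at pz, so that [E^{-,i}_n, S^i(z)] is 1/((q - q⁻¹)z)
times the difference of `boundary` at pz and at z (`bracket_Eminus_screening_self`). The number p =
q^{2(k+g)} enters through `field_kg_sub`, which converts an exponent at z into the corresponding one
at pz.

In the Jackson integral the weight z cancels the factor 1/z, and the commutator contributes a
two-sided telescoping series with terms x^n W, where x is proportional to z and W does not depend on
n. The convergence hypothesis applies to every E^{-,i}_n, so each of these series converges; hence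
x^n W is bounded at both ends for every integer n. Changing n by one gains a factor x or x⁻¹ that
tends to zero, so the boundary terms themselves tend to zero (`tendsto_telescope_zero`). The passage
from generators to the algebra is by linearity and by moving the factors of a product across the
screening current one at a time (`chargeCommutes`).

Infinite matrices need care: the screening current has infinite rows or columns, and only products
with a factor of finite rows and columns (`IsFinitary`) are manipulated. Elements of the algebra
have this property. -/

noncomputable section

namespace FreeBoson

/-! ### The grading of the Fock spaces -/

section Grading

variable {P : Params}

/-- The energy of a monomial in the creation oscillators. -/
def deg : (Osc P →₀ ℕ) →+ ℕ := Finsupp.weight fun o : Osc P => (o.2 : ℕ)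

lemma deg_single (o : Osc P) (r : ℕ) : deg (Finsupp.single o r) = r * o.2 := by
  simp [deg, Finsupp.weight_single]

/-- There are finitely many bosons and each oscillator has energy at least 1, so a bound on the
energy bounds both the mode numbers and the exponents. All finiteness of rows and columns below
rests on this. -/
lemma finite_deg_le (D : ℕ) : {m : Osc P →₀ ℕ | deg m ≤ D}.Finite := by
  classical
  refine Set.Finite.subset (Finset.finite_toSet
    ((Finset.univ ×ˢ (Finset.Icc (1 : ℕ+) D.succPNat)).finsupp
      (fun _ : Osc P => Finset.range (D + 1)))) ?_
  intro m hm
  have hm : deg m ≤ D := hm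
  simp only [Finset.mem_coe, Finset.mem_finsupp_iff]
  have h1 : ∀ o, m o ≠ 0 → (o.2 : ℕ) ≤ D := fun o ho =>
    (Finsupp.le_weight_of_ne_zero' (fun o : Osc P => (o.2 : ℕ)) ho).trans hm
  constructor
  · intro o ho
    have h2 := h1 o (by simpa using ho)
    refine Finset.mem_product.2 ⟨Finset.mem_univ _, Finset.mem_Icc.2 ⟨one_le, ?_⟩⟩
    exact (PNat.coe_le_coe _ _).1 (h2.trans (Nat.le_succ D))
  · intro o _
    have h3 : m o ≤ deg m := Finsupp.le_weight (fun o : Osc P => (o.2 : ℕ)) o.2.ne_zero m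
    simp only [Finset.mem_range]
    omega

/-- The monomials of energy `D`. -/
def degFinset (P : Params) (D : ℕ) : Finset (Osc P →₀ ℕ) :=
  ((finite_deg_le (P := P) D).subset (t := {m | deg m = D})
    fun m (h : deg m = D) => (h.le : deg m ≤ D)).toFinset

@[simp] lemma mem_degFinset {D : ℕ} {m : Osc P →₀ ℕ} : m ∈ degFinset P D ↔ deg m = D := by
  simp [degFinset]

/-- The homogeneous component of energy `D` of a power series in the creation oscillators. -/
def hom (D : ℕ) (F : MvPowerSeries (Osc P) ℂ) : Fock P :=
  ∑ m ∈ degFinset P D, MvPolynomial.monomial m (MvPowerSeries.coeff m F)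

lemma coeff_hom (D : ℕ) (F : MvPowerSeries (Osc P) ℂ) (m : Osc P →₀ ℕ) :
    MvPolynomial.coeff m (hom D F) = if deg m = D then MvPowerSeries.coeff m F else 0 := by
  classical
  simp only [hom, MvPolynomial.coeff_sum, MvPolynomial.coeff_monomial]
  rw [Finset.sum_ite_eq']
  simp

/-- Energy is additive on monomials, so homogeneous components multiply like the coefficients of a
power series. A series in infinitely many oscillators thereby becomes a power series in one variable
with polynomial coefficients. -/
lemma hom_mul (D : ℕ) (F G : MvPowerSeries (Osc P) ℂ) :
    hom D (F * G) = ∑ p ∈ Finset.HasAntidiagonal.antidiagonal D, hom p.1 F * hom p.2 G := by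
  classical
  ext m
  simp only [coeff_hom, MvPolynomial.coeff_sum, MvPolynomial.coeff_mul, MvPowerSeries.coeff_mul]
  rw [Finset.sum_comm]
  split_ifs with h
  · refine Finset.sum_congr rfl fun q hq => ?_
    have hq' : q.1 + q.2 = m := Finset.HasAntidiagonal.mem_antidiagonal.1 hq
    rw [Finset.sum_eq_single (deg q.1, deg q.2)]
    · simp
    · rintro ⟨a, b⟩ - hne
      by_cases h1 : deg q.1 = a
      · by_cases h2 : deg q.2 = b
        · exact absurd (by rw [h1, h2]) hne
        · simp [h2]
      · simp [h1]
    · intro hn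
      exfalso
      apply hn
      rw [Finset.HasAntidiagonal.mem_antidiagonal, ← map_add, hq', h]
  · symm
    refine Finset.sum_eq_zero fun q hq => Finset.sum_eq_zero fun p hp => ?_
    have hq' : q.1 + q.2 = m := Finset.HasAntidiagonal.mem_antidiagonal.1 hq
    have hp' : p.1 + p.2 = D := Finset.HasAntidiagonal.mem_antidiagonal.1 hp
    by_cases h1 : deg q.1 = p.1
    · by_cases h2 : deg q.2 = p.2
      · exact absurd (by rw [← hq', map_add, h1, h2, hp']) h
      · simp [h2]
    · simp [h1]

/-- The generating function of the homogeneous components. -/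
def genF (F : MvPowerSeries (Osc P) ℂ) : PowerSeries (Fock P) := PowerSeries.mk fun D => hom D F

lemma genF_mul (F G : MvPowerSeries (Osc P) ℂ) : genF (F * G) = genF F * genF G := by
  ext1 D
  simp [genF, PowerSeries.coeff_mul, hom_mul]

end Grading

/-! ### Exponentials as solutions of a differential equation -/

section LogDeriv

variable {R : Type*} [CommRing R]

open PowerSeries in
/-- `f = 1 + ...` solves `t f' = g f`. -/
def IsExpOf (g f : PowerSeries R) : Prop :=
  PowerSeries.constantCoeff f = 1 ∧ PowerSeries.X * PowerSeries.derivative R f = g * f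

lemma IsExpOf.mul {g₁ g₂ f₁ f₂ : PowerSeries R} (h₁ : IsExpOf g₁ f₁) (h₂ : IsExpOf g₂ f₂) :
    IsExpOf (g₁ + g₂) (f₁ * f₂) := by
  refine ⟨by simp [h₁.1, h₂.1], ?_⟩
  rw [Derivation.leibniz, smul_eq_mul, smul_eq_mul]
  linear_combination f₁ * h₂.2 + f₂ * h₁.2

lemma coeff_X_mul_derivative (f : PowerSeries R) (n : ℕ) :
    PowerSeries.coeff n (PowerSeries.X * PowerSeries.derivative R f)
      = n * PowerSeries.coeff n f := by
  cases n with
  | zero => simp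
  | succ n =>
    rw [PowerSeries.coeff_succ_X_mul, PowerSeries.coeff_derivative]
    push_cast
    ring

/-- Comparing coefficients gives n f_n as a combination of earlier coefficients, since `g` has no
constant term; characteristic zero allows division by n. -/
lemma IsExpOf.unique [IsDomain R] [CharZero R] {g f₁ f₂ : PowerSeries R}
    (hg : PowerSeries.constantCoeff g = 0) (h₁ : IsExpOf g f₁) (h₂ : IsExpOf g f₂) : f₁ = f₂ := by
  ext n
  induction n using Nat.strong_induction_on with
  | _ n ih =>
    rcases Nat.eq_zero_or_pos n with rfl | hn
    · simpa using h₁.1.trans h₂.1.symm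
    · have e₁ := congrArg (PowerSeries.coeff n) h₁.2
      have e₂ := congrArg (PowerSeries.coeff n) h₂.2
      rw [coeff_X_mul_derivative, PowerSeries.coeff_mul] at e₁ e₂
      have : (n : R) * PowerSeries.coeff n f₁ = n * PowerSeries.coeff n f₂ := by
        rw [e₁, e₂]
        refine Finset.sum_congr rfl fun p hp => ?_
        have hp' : p.1 + p.2 = n := Finset.HasAntidiagonal.mem_antidiagonal.1 hp
        rcases Nat.eq_zero_or_pos p.1 with h0 | h0
        · have : PowerSeries.coeff p.1 g = 0 := by rw [h0]; simpa using hg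
          rw [this, zero_mul, zero_mul]
        · rw [ih p.2 (by omega)]
      exact mul_left_cancel₀ (Nat.cast_ne_zero.2 hn.ne') this

lemma IsExpOf.map {S : Type*} [CommRing S] (φ : R →+* S) {g f : PowerSeries R}
    (h : IsExpOf g f) : IsExpOf (PowerSeries.map φ g) (PowerSeries.map φ f) := by
  refine ⟨?_, ?_⟩
  · rw [← PowerSeries.coeff_zero_eq_constantCoeff_apply, PowerSeries.coeff_map,
      PowerSeries.coeff_zero_eq_constantCoeff_apply, h.1, map_one]
  · rw [← map_mul, ← h.2]
    ext n
    rw [coeff_X_mul_derivative, PowerSeries.coeff_map, PowerSeries.coeff_map,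
      coeff_X_mul_derivative, map_mul, map_natCast]

/-- The expansion of `(1 - α t) / (1 - β t)`. -/
def ratCoeff (α β : R) : ℕ → R
  | 0 => 1
  | n + 1 => β ^ n * (β - α)

lemma ratCoeff_succ (α β : R) (n : ℕ) : ratCoeff α β (n + 1) = β ^ n * (β - α) := rfl

/-- The logarithmic derivative of (1 - αt)/(1 - βt), multiplied by t, is the difference of the
geometric series of βt and αt. This is the link between contractions of the form β^n - α^n and a
rational function with one simple pole. -/
lemma isExpOf_ratCoeff (α β : R) :
    IsExpOf (PowerSeries.mk fun n => if n = 0 then 0 else β ^ n - α ^ n)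
      (PowerSeries.mk (ratCoeff α β)) := by
  refine ⟨by simp [ratCoeff], ?_⟩
  ext n
  rw [coeff_X_mul_derivative, PowerSeries.coeff_mul]
  simp only [PowerSeries.coeff_mk]
  cases n with
  | zero => simp
  | succ n =>
    rw [Finset.Nat.sum_antidiagonal_succ]
    simp only [if_pos, zero_mul, zero_add, Nat.succ_ne_zero, if_false, ratCoeff_succ]
    rw [Finset.Nat.sum_antidiagonal_eq_sum_range_succ
      (fun a b => (β ^ (a + 1) - α ^ (a + 1)) * ratCoeff α β b)]
    -- In each product the power of β coming from the first factor completes to β^m, giving m equal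
    -- terms; the powers of α form a geometric sum.
    have key : ∀ m : ℕ, ∑ k ∈ Finset.range m, (β ^ (k + 1) - α ^ (k + 1)) *
        (β ^ (m - 1 - k) * (β - α)) = m * β ^ m * (β - α) - α * (β ^ m - α ^ m) := by
      intro m
      cases m with
      | zero => simp
      | succ m =>
        have h2 := (Commute.all α β).geom_sum₂_mul (m + 1)
        rw [Nat.add_sub_cancel]
        have h1 : ∑ k ∈ Finset.range (m + 1), (β ^ (k + 1) - α ^ (k + 1)) *
            (β ^ (m - k) * (β - α)) = ∑ k ∈ Finset.range (m + 1), β ^ (m + 1) * (β - α)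
              - α * (β - α) * ∑ k ∈ Finset.range (m + 1), α ^ k * β ^ (m + 1 - 1 - k) := by
          rw [Finset.mul_sum, ← Finset.sum_sub_distrib]
          refine Finset.sum_congr rfl fun k hk => ?_
          have hk' : k ≤ m := Nat.lt_succ_iff.1 (Finset.mem_range.1 hk)
          obtain ⟨r, rfl⟩ := Nat.exists_eq_add_of_le hk'
          simp only [Nat.add_sub_cancel, Nat.add_sub_cancel_left]
          ring
        rw [h1, Finset.sum_const, Finset.card_range, nsmul_eq_mul]
        push_cast at h2 ⊢
        linear_combination α * h2
    -- The last term is split off because the zeroth coefficient is 1 and does not follow the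
    -- formula of the others.
    rw [Finset.sum_range_succ]
    have h3 : ∑ k ∈ Finset.range n, (β ^ (k + 1) - α ^ (k + 1)) * ratCoeff α β (n - k)
        = ∑ k ∈ Finset.range n, (β ^ (k + 1) - α ^ (k + 1)) * (β ^ (n - 1 - k) * (β - α)) := by
      refine Finset.sum_congr rfl fun k hk => ?_
      have hk' := Finset.mem_range.1 hk
      rw [show n - k = (n - 1 - k) + 1 by omega]
      rfl
    rw [h3, key, Nat.sub_self]
    simp only [ratCoeff]
    push_cast
    ring

end LogDeriv

section Symbols

variable {P : Params}

/-! ### Creation and annihilation exponentials -/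

lemma coeff_expCreation (L : LinForm P) (m : Osc P →₀ ℕ) :
    MvPowerSeries.coeff m (expCreation L)
      = m.prod fun o r => L (.osc o.1 (-(o.2 : ℤ))) ^ r / (r.factorial : ℂ) := rfl

lemma constantCoeff_expCreation (L : LinForm P) :
    MvPowerSeries.constantCoeff (expCreation L) = 1 := by
  rw [← MvPowerSeries.coeff_zero_eq_constantCoeff_apply, coeff_expCreation, Finsupp.prod_zero_index]

lemma coeff_expCreation_add_single (L : LinForm P) (m : Osc P →₀ ℕ) (o : Osc P) :
    MvPowerSeries.coeff (m + Finsupp.single o 1) (expCreation L) * (m o + 1)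
      = L (.osc o.1 (-(o.2 : ℤ))) * MvPowerSeries.coeff m (expCreation L) := by
  classical
  have h (m : Osc P →₀ ℕ) := (Finsupp.mul_prod_erase' m o
    (fun o r => L (.osc o.1 (-(o.2 : ℤ))) ^ r / (r.factorial : ℂ)) (fun _ => by simp))
  rw [coeff_expCreation, coeff_expCreation, ← h m, ← h (m + Finsupp.single o 1)]
  have he : (m + Finsupp.single o 1).erase o = m.erase o := by
    ext i
    by_cases hi : i = o
    · simp [hi]
    · simp [Finsupp.erase_ne hi]
  rw [he]
  have hf : (((m o + 1).factorial : ℕ) : ℂ) = (m o + 1) * (m o).factorial := by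
    push_cast [Nat.factorial_succ]; ring
  have h0 : ((m o).factorial : ℂ) ≠ 0 := by exact_mod_cast (m o).factorial_ne_zero
  have h1 : (m o + 1 : ℂ) ≠ 0 := by exact_mod_cast (m o).succ_ne_zero
  simp only [Finsupp.add_apply, Finsupp.single_eq_same, hf]
  field_simp
  ring

lemma pderiv_expCreation (L : LinForm P) (o : Osc P) :
    MvPowerSeries.pderiv ℂ o (expCreation L) = L (.osc o.1 (-(o.2 : ℤ))) • expCreation L := by
  ext m
  rw [MvPowerSeries.coeff_pderiv, coeff_expCreation_add_single]
  simp

/-- The equations determine the coefficient of a monomial from that of the monomial with one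
oscillator removed, so induction on the energy applies. -/
lemma expCreation_unique {L : LinForm P} {F : MvPowerSeries (Osc P) ℂ}
    (h0 : MvPowerSeries.constantCoeff F = 1)
    (hF : ∀ o, MvPowerSeries.pderiv ℂ o F = L (.osc o.1 (-(o.2 : ℤ))) • F) :
    F = expCreation L := by
  classical
  ext m
  induction hn : deg m using Nat.strong_induction_on generalizing m with
  | _ n ih =>
    by_cases hm : m = 0
    · rw [hm, MvPowerSeries.coeff_zero_eq_constantCoeff_apply, h0,
        MvPowerSeries.coeff_zero_eq_constantCoeff_apply, constantCoeff_expCreation]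
    · obtain ⟨o, ho⟩ : ∃ o, m o ≠ 0 := by
        by_contra! hc
        exact hm (Finsupp.ext hc)
      obtain ⟨m', rfl⟩ : ∃ m', m = m' + Finsupp.single o 1 :=
        ⟨m - Finsupp.single o 1, (tsub_add_cancel_of_le (by
          rw [Finsupp.single_le_iff]; omega)).symm⟩
      have h1 : (m' o + 1 : ℂ) ≠ 0 := by exact_mod_cast (m' o).succ_ne_zero
      apply mul_right_cancel₀ h1
      rw [coeff_expCreation_add_single]
      have h2 := congrArg (MvPowerSeries.coeff m') (hF o)
      rw [MvPowerSeries.coeff_pderiv] at h2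
      rw [h2, MvPowerSeries.coeff_smul, ih (deg m') _ m' rfl]
      rw [← hn, map_add, deg_single]
      have := o.2.pos
      omega

lemma expCreation_add (L M : LinForm P) :
    expCreation (L + M) = expCreation L * expCreation M := by
  symm
  apply expCreation_unique
  · simp [constantCoeff_expCreation]
  · intro o
    rw [Derivation.leibniz, pderiv_expCreation, pderiv_expCreation]
    simp only [smul_eq_mul, Pi.add_apply, add_smul, Algebra.mul_smul_comm]
    rw [mul_comm (expCreation M), add_comm]

/-- The value of the annihilation part of `L` on the creation oscillator `o`. -/
def transl (L : LinForm P) (o : Osc P) : ℂ :=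
  ∑ x : Boson P, L (.osc x o.2) * comm P x o.1 o.2

lemma expAnnihilation_X (L : LinForm P) (o : Osc P) :
    expAnnihilation L (MvPolynomial.X o) = MvPolynomial.X o + MvPolynomial.C (transl L o) := by
  simp [expAnnihilation, transl]

lemma transl_add (L M : LinForm P) (o : Osc P) : transl (L + M) o = transl L o + transl M o := by
  simp [transl, add_mul, Finset.sum_add_distrib]

/-- The matrix elements of `:exp L:` between monomials in the oscillators. -/
def symbol (L : LinForm P) (m' m : Osc P →₀ ℕ) : ℂ :=
  MvPowerSeries.coeff m'
    (expCreation L * (expAnnihilation L (MvPolynomial.monomial m 1) : MvPowerSeries (Osc P) ℂ))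

/-! ### Rescaling by the energy -/

/-- The form `L(s z)`, up to the zero modes. -/
def scale (s : ℂ) (L : LinForm P) : LinForm P
  | .osc x n => L (.osc x n) * s ^ (-n)
  | .qhat x => L (.qhat x)
  | .phat x => L (.phat x)

/-- `s` to the power of the energy. -/
def scaleHom (s : ℂ) : Fock P →ₐ[ℂ] Fock P :=
  MvPolynomial.aeval fun o : Osc P => MvPolynomial.C (s ^ (o.2 : ℕ)) * MvPolynomial.X o

lemma prod_pow_deg (s : ℂ) (m : Osc P →₀ ℕ) :
    (m.prod fun o r => (s ^ (o.2 : ℕ)) ^ r) = s ^ deg m := by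
  rw [deg, Finsupp.weight_apply, Finsupp.sum, ← Finset.prod_pow_eq_pow_sum, Finsupp.prod]
  refine Finset.prod_congr rfl fun o _ => ?_
  rw [← pow_mul, smul_eq_mul, mul_comm]

lemma scaleHom_monomial (s : ℂ) (m : Osc P →₀ ℕ) (c : ℂ) :
    scaleHom s (MvPolynomial.monomial m c) = MvPolynomial.monomial m (s ^ deg m * c) := by
  rw [scaleHom, MvPolynomial.aeval_monomial, MvPolynomial.algebraMap_eq]
  simp only [mul_pow]
  rw [Finsupp.prod_mul, ← prod_pow_deg, Finsupp.prod, Finsupp.prod, Finsupp.prod]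
  simp only [← map_pow]
  rw [← map_prod, ← mul_assoc, ← map_mul, mul_comm c, MvPolynomial.monomial_eq]
  rfl

lemma coeff_scaleHom (s : ℂ) (m : Osc P →₀ ℕ) (p : Fock P) :
    MvPolynomial.coeff m (scaleHom s p) = s ^ deg m * MvPolynomial.coeff m p := by
  classical
  induction p using MvPolynomial.induction_on' with
  | monomial u a =>
    rw [scaleHom_monomial, MvPolynomial.coeff_monomial, MvPolynomial.coeff_monomial]
    split_ifs with h
    · rw [h]
    · simp
  | add p q hp hq => rw [map_add, MvPolynomial.coeff_add, MvPolynomial.coeff_add, hp, hq, mul_add]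

/-- `s` to the power of the energy, on power series. -/
def rescale (s : ℂ) : MvPowerSeries (Osc P) ℂ →+* MvPowerSeries (Osc P) ℂ :=
  MvPowerSeries.rescale fun o : Osc P => s ^ (o.2 : ℕ)

lemma coeff_rescale (s : ℂ) (m : Osc P →₀ ℕ) (F : MvPowerSeries (Osc P) ℂ) :
    MvPowerSeries.coeff m (rescale s F) = s ^ deg m * MvPowerSeries.coeff m F := by
  rw [rescale, MvPowerSeries.coeff_rescale, ← prod_pow_deg]

lemma rescale_coe (s : ℂ) (p : Fock P) :
    rescale s (p : MvPowerSeries (Osc P) ℂ) = (scaleHom s p : Fock P) := by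
  ext m
  rw [coeff_rescale, MvPolynomial.coeff_coe, MvPolynomial.coeff_coe, coeff_scaleHom]

lemma rescale_expCreation (s : ℂ) (L : LinForm P) :
    rescale s (expCreation L) = expCreation (scale s L) := by
  ext m
  rw [coeff_rescale, coeff_expCreation, coeff_expCreation, ← prod_pow_deg, ← Finsupp.prod_mul]
  refine Finsupp.prod_congr fun o _ => ?_
  simp only [scale, neg_neg, zpow_natCast, mul_pow]
  ring

lemma transl_scale {s : ℂ} (L : LinForm P) (o : Osc P) :
    transl (scale s L) o = s⁻¹ ^ (o.2 : ℕ) * transl L o := by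
  simp only [transl, Finset.mul_sum, scale, zpow_neg, zpow_natCast, inv_pow]
  exact Finset.sum_congr rfl fun x _ => by ring

lemma scale_scale (s t : ℂ) (L : LinForm P) : scale s (scale t L) = scale (s * t) L := by
  funext x
  cases x with
  | osc x n => simp only [scale, mul_zpow]; ring
  | qhat x => rfl
  | phat x => rfl

lemma scale_one (L : LinForm P) : scale 1 L = L := by
  funext x
  cases x <;> simp [scale]

lemma scale_add (s : ℂ) (L M : LinForm P) : scale s (L + M) = scale s L + scale s M := by
  funext x
  cases x <;> simp [scale, add_mul]

lemma scaleHom_expAnnihilation {s : ℂ} (hs : s ≠ 0) (L : LinForm P) (p : Fock P) :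
    scaleHom s (expAnnihilation L p) = expAnnihilation (scale s L) (scaleHom s p) := by
  have : (scaleHom s).comp (expAnnihilation L)
      = (expAnnihilation (scale s L)).comp (scaleHom s) := by
    apply MvPolynomial.algHom_ext
    intro o
    simp only [AlgHom.comp_apply, expAnnihilation_X, map_add, scaleHom, MvPolynomial.aeval_X,
      MvPolynomial.algHom_C, map_mul, transl_scale, mul_add, MvPolynomial.algebraMap_eq]
    rw [← mul_assoc (MvPolynomial.C (s ^ (o.2 : ℕ))), ← map_mul MvPolynomial.C, ← mul_pow,
      mul_inv_cancel₀ hs, one_pow, map_one, one_mul]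
  exact DFunLike.congr_fun this p

/-- Conjugation by s^{energy} multiplies x_{-n} by s^n and x_n by s^{-n}, which is what `scale` does
to the coefficients of the form. -/
lemma symbol_scale {s : ℂ} (hs : s ≠ 0) (L : LinForm P) (m' m : Osc P →₀ ℕ) :
    symbol (scale s L) m' m = s ^ ((deg m' : ℤ) - deg m) * symbol L m' m := by
  have h : s ^ deg m * symbol (scale s L) m' m = s ^ deg m' * symbol L m' m := by
    rw [symbol, symbol, ← coeff_rescale, map_mul (rescale s), rescale_expCreation, rescale_coe,
      scaleHom_expAnnihilation hs, scaleHom_monomial, mul_one, ← MvPowerSeries.coeff_C_mul]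
    congr 1
    have : (MvPolynomial.monomial m (s ^ deg m) : Fock P)
        = MvPolynomial.C (s ^ deg m) * MvPolynomial.monomial m 1 := by
      rw [MvPolynomial.C_mul_monomial, mul_one]
    rw [this, map_mul, MvPolynomial.algHom_C, MvPolynomial.algebraMap_eq, MvPolynomial.coe_mul,
      MvPolynomial.coe_C]
    ring
  rw [zpow_sub₀ hs, zpow_natCast, zpow_natCast]
  field_simp
  linear_combination h

end Symbols

section Products

variable {P : Params}

/-! ### The contraction of two exponentials -/

/-- The logarithmic derivative of the generating function of the homogeneous components of
`expCreation M`. -/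
def creationForm (M : LinForm P) : PowerSeries (Fock P) :=
  PowerSeries.mk fun D => match D with
    | 0 => 0
    | n + 1 => ∑ x : Boson P, MvPolynomial.C ((n + 1 : ℂ) * M (.osc x (-(n + 1 : ℤ)))) *
        MvPolynomial.X (x, n.succPNat)

/-- Arranges the energy by mode number, the shape in which it appears when the logarithmic
derivative of `expCreation` is compared coefficientwise. -/
lemma deg_eq_sum {m : Osc P →₀ ℕ} {D : ℕ} (hD : deg m ≤ D) :
    deg m = ∑ a ∈ Finset.range D, ∑ x : Boson P, (a + 1) * m (x, a.succPNat) := by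
  classical
  have hinj : Function.Injective Nat.succPNat := Nat.succPNat_injective
  rw [deg, Finsupp.weight_apply, Finsupp.sum_of_support_subset m
    (s := Finset.univ ×ˢ (Finset.range D).map ⟨Nat.succPNat, hinj⟩), Finset.sum_product,
    Finset.sum_comm, Finset.sum_map]
  · refine Finset.sum_congr rfl fun a _ => Finset.sum_congr rfl fun x _ => ?_
    simp [mul_comm]
  · intro o ho
    have h2 : (o.2 : ℕ) ≤ D := (Finsupp.le_weight_of_ne_zero' (fun o : Osc P => (o.2 : ℕ))
      (by simpa using ho)).trans hD
    refine Finset.mem_product.2 ⟨Finset.mem_univ _, Finset.mem_map.2 ⟨(o.2 : ℕ) - 1, ?_, ?_⟩⟩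
    · have := o.2.pos
      rw [Finset.mem_range]
      omega
    · have := o.2.pos
      apply PNat.coe_injective
      simp only [Function.Embedding.coeFn_mk, Nat.succPNat_coe]
      omega
  · simp

/-- This is Euler's identity: differentiating in the grading variable counts energy, and the energy
operator applied to exp(∑ M(x_{-n}) x_{-n}) brings down ∑ n M(x_{-n}) x_{-n}. -/
lemma isExpOf_genF_expCreation (M : LinForm P) :
    IsExpOf (creationForm M) (genF (expCreation M)) := by
  classical
  refine ⟨?_, ?_⟩
  · rw [← PowerSeries.coeff_zero_eq_constantCoeff_apply, genF, PowerSeries.coeff_mk]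
    ext m
    rw [coeff_hom, MvPolynomial.coeff_one]
    have h0 : deg m = 0 ↔ 0 = m := by
      constructor
      · intro h
        ext o
        have := Finsupp.le_weight (fun o : Osc P => (o.2 : ℕ)) o.2.ne_zero m
        have h' : Finsupp.weight (fun o : Osc P => (o.2 : ℕ)) m = 0 := h
        simp only [Finsupp.coe_zero, Pi.zero_apply]
        omega
      · rintro rfl
        simp
    by_cases hm : 0 = m
    · rw [if_pos (h0.2 hm), if_pos hm, ← hm, MvPowerSeries.coeff_zero_eq_constantCoeff_apply,
        constantCoeff_expCreation]
    · rw [if_neg (fun h => hm (h0.1 h)), if_neg hm]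
  · ext D m
    rw [coeff_X_mul_derivative, PowerSeries.coeff_mul]
    cases D with
    | zero => simp [creationForm]
    | succ D =>
      rw [Finset.Nat.sum_antidiagonal_succ]
      have hz : PowerSeries.coeff 0 (creationForm M) = 0 := by simp [creationForm]
      rw [hz, zero_mul, zero_add, MvPolynomial.coeff_sum]
      simp only [genF, PowerSeries.coeff_mk, creationForm, Finset.sum_mul, MvPolynomial.coeff_sum,
        mul_assoc, MvPolynomial.coeff_C_mul, MvPolynomial.coeff_X_mul', coeff_hom]
      have hc : (((D + 1 : ℕ) : Fock P)) = MvPolynomial.C ((D + 1 : ℕ) : ℂ) := by simp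
      rw [hc, MvPolynomial.coeff_C_mul, coeff_hom]
      -- Removing one oscillator from a monomial and multiplying by its coefficient in `M`
      -- reproduces the coefficient of the monomial, weighted by the multiplicity of that
      -- oscillator.
      have key (o : Osc P) : M (.osc o.1 (-(o.2 : ℤ))) *
          (if o ∈ m.support then
            MvPowerSeries.coeff (m - Finsupp.single o 1) (expCreation M) else 0)
          = m o * MvPowerSeries.coeff m (expCreation M) := by
        split_ifs with h
        · obtain ⟨m', rfl⟩ : ∃ m', m = m' + Finsupp.single o 1 :=
            ⟨m - Finsupp.single o 1, (tsub_add_cancel_of_le (by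
              rw [Finsupp.single_le_iff]; have := Finsupp.mem_support_iff.1 h; omega)).symm⟩
          rw [add_tsub_cancel_right, ← coeff_expCreation_add_single]
          simp [mul_comm]
        · simp [Finsupp.notMem_support_iff.1 h]
      have hterm (p : ℕ × ℕ) (hp : p ∈ Finset.HasAntidiagonal.antidiagonal D) (x : Boson P) :
          (p.1 + 1 : ℂ) * (M (.osc x (-(p.1 + 1 : ℤ))) *
            (if (x, p.1.succPNat) ∈ m.support then
              if deg (m - Finsupp.single (x, p.1.succPNat) 1) = p.2 then
                MvPowerSeries.coeff (m - Finsupp.single (x, p.1.succPNat) 1) (expCreation M)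
              else 0 else 0))
          = if deg m = D + 1 then
              (((p.1 + 1) * m (x, p.1.succPNat) : ℕ) : ℂ) *
                MvPowerSeries.coeff m (expCreation M) else 0 := by
        have hp' : p.1 + p.2 = D := Finset.HasAntidiagonal.mem_antidiagonal.1 hp
        have hk := key (x, p.1.succPNat)
        simp only [Nat.succPNat_coe, Nat.succ_eq_add_one, Nat.cast_add, Nat.cast_one] at hk
        by_cases hs : (x, p.1.succPNat) ∈ m.support
        · rw [if_pos hs] at hk ⊢
          have hd : deg m = deg (m - Finsupp.single (x, p.1.succPNat) 1) + (p.1 + 1) := by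
            conv_lhs => rw [← tsub_add_cancel_of_le (b := m)
              (a := Finsupp.single (x, p.1.succPNat) 1) (by
                rw [Finsupp.single_le_iff]; have := Finsupp.mem_support_iff.1 hs; omega)]
            rw [map_add, deg_single]
            simp
          by_cases h : deg m = D + 1
          · rw [if_pos h, if_pos (by omega), hk]
            push_cast
            ring
          · rw [if_neg h, if_neg (by omega)]
            simp
        · rw [if_neg hs]
          simp [Finsupp.notMem_support_iff.1 hs]
      rw [Finset.sum_congr rfl fun p hp => Finset.sum_congr rfl fun x _ => hterm p hp x]
      split_ifs with h
      · simp only [← Finset.sum_mul, ← Nat.cast_sum]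
        rw [Finset.Nat.sum_antidiagonal_eq_sum_range_succ
          (fun a _ => ∑ x : Boson P, (a + 1) * m (x, a.succPNat)), ← deg_eq_sum h.le, h]
      · simp

/-- The contraction of the annihilation part of `L` with the creation part of `M` at energy `n`. -/
def contraction (L M : LinForm P) (n : ℕ) : ℂ :=
  ∑ y : Boson P, M (.osc y (-(n : ℤ))) * ∑ x : Boson P, L (.osc x n) * comm P x y n

/-- Translating by the annihilation part of `L` changes the logarithmic derivative only by the
scalars n · `contraction L M n`. When these are β^n - α^n, both sides solve the same differential
equation, so the effect of reordering is multiplication by the rational function. -/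
lemma map_genF_expCreation {L M : LinForm P} {α β : ℂ}
    (h : ∀ n : ℕ, 0 < n → n * contraction L M n = β ^ n - α ^ n) :
    PowerSeries.map (expAnnihilation L : Fock P →+* Fock P) (genF (expCreation M))
      = PowerSeries.map MvPolynomial.C (PowerSeries.mk (ratCoeff α β)) * genF (expCreation M) := by
  refine IsExpOf.unique ?_ ((isExpOf_genF_expCreation M).map _) ?_
  · rw [← PowerSeries.coeff_zero_eq_constantCoeff_apply, PowerSeries.coeff_map]
    simp [creationForm]
  · have := ((isExpOf_ratCoeff α β).map (MvPolynomial.C : ℂ →+* Fock P)).mul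
      (isExpOf_genF_expCreation M)
    convert! this using 1
    ext1 n
    rw [PowerSeries.coeff_map, map_add, PowerSeries.coeff_map, PowerSeries.coeff_mk]
    cases n with
    | zero => simp [creationForm]
    | succ n =>
      rw [if_neg n.succ_ne_zero, ← h (n + 1) n.succ_pos]
      simp only [creationForm, PowerSeries.coeff_mk, map_sum, map_mul, RingHom.coe_coe,
        expAnnihilation_X, MvPolynomial.algHom_C, contraction, MvPolynomial.algebraMap_eq,
        mul_add, Finset.sum_add_distrib, transl]
      rw [add_comm]
      congr 1
      rw [Finset.mul_sum]
      refine Finset.sum_congr rfl fun y _ => ?_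
      simp only [Nat.succPNat_coe, Nat.succ_eq_add_one, Nat.cast_add, Nat.cast_one]
      ring

end Products

/-! ### Products of two exponentials sorted by the energy of the intermediate state. -/

section GradedProducts

variable {P : Params}

/-- Extension by zero to negative integers. -/
def extendZero (f : ℕ → ℂ) (n : ℤ) : ℂ := if 0 ≤ n then f n.toNat else 0

lemma extendZero_natCast (f : ℕ → ℂ) (n : ℕ) : extendZero f n = f n := by simp [extendZero]

/-- Since `h` vanishes beyond `T`, the range of summation can be made independent of `n`; the
dependence on the intermediate energy is then confined to the argument of `extendZero f`, where
negative values are harmless. -/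
lemma sum_antidiagonal_eq_sum_range (f h : ℕ → ℂ) {T : ℕ} (hT : ∀ a, T ≤ a → h a = 0) (n : ℕ) :
    ∑ p ∈ Finset.HasAntidiagonal.antidiagonal n, f p.1 * h p.2
      = ∑ a ∈ Finset.range T, extendZero f ((n : ℤ) - a) * h a := by
  rw [← Finset.Nat.sum_antidiagonal_swap,
    Finset.Nat.sum_antidiagonal_eq_sum_range_succ_mk]
  have h1 : ∑ k ∈ Finset.range n.succ, f (n - k) * h k
      = ∑ k ∈ Finset.range n.succ, extendZero f ((n : ℤ) - k) * h k := by
    refine Finset.sum_congr rfl fun k hk => ?_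
    have := Finset.mem_range.1 hk
    rw [← Nat.cast_sub (by omega), extendZero_natCast]
  have h2 : ∑ k ∈ Finset.range n.succ, extendZero f ((n : ℤ) - k) * h k
      = ∑ k ∈ Finset.range (max n.succ T), extendZero f ((n : ℤ) - k) * h k := by
    refine Finset.sum_subset (Finset.range_mono (le_max_left _ _)) fun k _ hk => ?_
    rw [Finset.mem_range] at hk
    rw [extendZero, if_neg (by omega), zero_mul]
  have h3 : ∑ k ∈ Finset.range T, extendZero f ((n : ℤ) - k) * h k
      = ∑ k ∈ Finset.range (max n.succ T), extendZero f ((n : ℤ) - k) * h k := by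
    refine Finset.sum_subset (Finset.range_mono (le_max_right _ _)) fun k _ hk => ?_
    rw [Finset.mem_range] at hk
    rw [hT k (by omega), mul_zero]
  simp only [Prod.fst_swap, Prod.snd_swap]
  rw [h1, h2, h3]

/-- The contribution to a matrix element of `:exp L: :exp M:` of `a` quanta created and `e` quanta
passed on by `:exp M:`, with the contraction removed. -/
def gradedPart (L M : LinForm P) (m' m : Osc P →₀ ℕ) (a e : ℕ) : ℂ :=
  MvPowerSeries.coeff m' (expCreation L * ((hom a (expCreation M) * expAnnihilation L
    (hom e (expAnnihilation M (MvPolynomial.monomial m 1) : MvPowerSeries (Osc P) ℂ)) : Fock P) :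
      MvPowerSeries (Osc P) ℂ))

/-- The quanta created by `M` and left uncontracted are still present in the final monomial, so
there cannot be more of them than its energy. -/
lemma gradedPart_eq_zero_left (L M : LinForm P) (m' m : Osc P →₀ ℕ) {a : ℕ} (e : ℕ)
    (ha : deg m' < a) : gradedPart L M m' m a e = 0 := by
  classical
  rw [gradedPart, MvPolynomial.coe_mul, ← mul_assoc, mul_right_comm, MvPowerSeries.coeff_mul]
  refine Finset.sum_eq_zero fun p hp => ?_
  have hp' : p.1 + p.2 = m' := Finset.HasAntidiagonal.mem_antidiagonal.1 hp
  rw [MvPolynomial.coeff_coe, coeff_hom, if_neg, mul_zero]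
  rw [← hp', map_add] at ha
  omega

/-- The translation adds a constant to each variable and so never raises the energy. -/
lemma expAnnihilation_monomial_degree (M : LinForm P) (m u : Osc P →₀ ℕ) (hu : deg m < deg u) :
    MvPolynomial.coeff u (expAnnihilation M (MvPolynomial.monomial m 1)) = 0 := by
  classical
  induction m using Finsupp.induction_linear generalizing u with
  | zero =>
    have : (MvPolynomial.monomial (0 : Osc P →₀ ℕ) (1 : ℂ) : Fock P) = 1 := rfl
    rw [this, map_one, MvPolynomial.coeff_one, if_neg]
    rintro rfl
    simp at hu
  | add f g hf hg =>
    have : (MvPolynomial.monomial (f + g) (1 : ℂ) : Fock P)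
        = MvPolynomial.monomial f 1 * MvPolynomial.monomial g 1 := by
      rw [MvPolynomial.monomial_mul, one_mul]
    rw [this, map_mul, MvPolynomial.coeff_mul]
    refine Finset.sum_eq_zero fun p hp => ?_
    have hp' : p.1 + p.2 = u := Finset.HasAntidiagonal.mem_antidiagonal.1 hp
    rw [← hp', map_add, map_add] at hu
    by_cases h : deg f < deg p.1
    · rw [hf _ h, zero_mul]
    · rw [hg p.2 (by omega), mul_zero]
  | single o r =>
    rw [deg_single] at hu
    induction r generalizing u with
    | zero =>
      have : (MvPolynomial.monomial (Finsupp.single o 0) (1 : ℂ) : Fock P) = 1 := by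
        rw [Finsupp.single_zero]; rfl
      rw [this, map_one, MvPolynomial.coeff_one, if_neg]
      rintro rfl
      simp at hu
    | succ r ih =>
      have : (MvPolynomial.monomial (Finsupp.single o (r + 1)) (1 : ℂ) : Fock P)
          = MvPolynomial.monomial (Finsupp.single o r) 1 * MvPolynomial.X o := by
        rw [MvPolynomial.X, MvPolynomial.monomial_mul, one_mul, Finsupp.single_add]
      rw [this, map_mul, expAnnihilation_X, mul_add, MvPolynomial.coeff_add,
        MvPolynomial.coeff_mul_X', mul_comm _ (MvPolynomial.C _), MvPolynomial.coeff_C_mul]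
      have h1 : MvPolynomial.coeff u
          (expAnnihilation M (MvPolynomial.monomial (Finsupp.single o r) 1)) = 0 := by
        apply ih
        rw [add_mul] at hu
        omega
      rw [h1, mul_zero, add_zero]
      split_ifs with hs
      · apply ih
        have hd : deg u = deg (u - Finsupp.single o 1) + o.2 := by
          conv_lhs => rw [← tsub_add_cancel_of_le (b := u) (a := Finsupp.single o 1) (by
            rw [Finsupp.single_le_iff]; have := Finsupp.mem_support_iff.1 hs; omega)]
          rw [map_add, deg_single]
          simp
        rw [add_mul] at hu
        omega
      · rfl

lemma gradedPart_eq_zero_right (L M : LinForm P) (m' m : Osc P →₀ ℕ) (a : ℕ) {e : ℕ}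
    (he : deg m < e) : gradedPart L M m' m a e = 0 := by
  have : hom e (expAnnihilation M (MvPolynomial.monomial m 1) : MvPowerSeries (Osc P) ℂ) = 0 := by
    ext u
    rw [coeff_hom, MvPolynomial.coeff_zero]
    split_ifs with h
    · rw [MvPolynomial.coeff_coe]
      exact expAnnihilation_monomial_degree M m u (h ▸ he)
    · rfl
  rw [gradedPart, this]
  simp

/-- Summing over the intermediate monomials of energy `D` amounts to inserting the projection onto
that energy between the two exponentials. -/
lemma sum_symbol_mul_symbol_eq (L M : LinForm P) (m' m : Osc P →₀ ℕ) (D : ℕ) :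
    ∑ c ∈ degFinset P D, symbol L m' c * symbol M c m
      = MvPowerSeries.coeff m' (expCreation L * ((expAnnihilation L (hom D (expCreation M *
          (expAnnihilation M (MvPolynomial.monomial m 1) : MvPowerSeries (Osc P) ℂ))) : Fock P) :
            MvPowerSeries (Osc P) ℂ)) := by
  have h (c : Osc P →₀ ℕ) (r : ℂ) : (MvPolynomial.monomial c r : Fock P)
      = MvPolynomial.C r * MvPolynomial.monomial c 1 := by
    rw [MvPolynomial.C_mul_monomial, mul_one]
  have hcoe (s : Finset (Osc P →₀ ℕ)) (f : (Osc P →₀ ℕ) → Fock P) :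
      ((∑ c ∈ s, f c : Fock P) : MvPowerSeries (Osc P) ℂ) = ∑ c ∈ s, (f c : MvPowerSeries _ ℂ) :=
    map_sum (MvPolynomial.coeToMvPowerSeries.ringHom (R := ℂ) (σ := Osc P)) f s
  rw [hom, map_sum, hcoe, Finset.mul_sum, map_sum]
  refine Finset.sum_congr rfl fun c _ => ?_
  rw [h, map_mul (expAnnihilation L), MvPolynomial.algHom_C, MvPolynomial.algebraMap_eq, MvPolynomial.coe_mul,
    MvPolynomial.coe_C, mul_left_comm, MvPowerSeries.coeff_C_mul, mul_comm]
  rfl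

/-- The intermediate energy splits as r + a + e: r quanta are created by `M` and absorbed by `L`, a
are created by `M` and survive, and e are inherited from the initial state. The r quanta contribute
the coefficient of the rational function; a and e are bounded by the energies of the outer states.
-/
lemma sum_symbol_mul_symbol {L M : LinForm P} {α β : ℂ}
    (h : ∀ n : ℕ, 0 < n → n * contraction L M n = β ^ n - α ^ n) (m' m : Osc P →₀ ℕ) (D : ℕ) :
    ∑ c ∈ degFinset P D, symbol L m' c * symbol M c m
      = ∑ a ∈ Finset.range (deg m' + 1), ∑ e ∈ Finset.range (deg m + 1),
          extendZero (ratCoeff α β) ((D : ℤ) - (a + e : ℕ)) * gradedPart L M m' m a e := by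
  set p : MvPowerSeries (Osc P) ℂ :=
    ((expAnnihilation M (MvPolynomial.monomial m 1) : Fock P) : MvPowerSeries (Osc P) ℂ) with hp
  have h1 : expAnnihilation L (hom D (expCreation M * p))
      = ∑ x ∈ Finset.HasAntidiagonal.antidiagonal D,
          ∑ y ∈ Finset.HasAntidiagonal.antidiagonal x.1, MvPolynomial.C (ratCoeff α β y.1) *
            (hom y.2 (expCreation M) * expAnnihilation L (hom x.2 p)) := by
    have := congrArg (PowerSeries.coeff D) (congrArg (fun F => F *
      PowerSeries.map (expAnnihilation L : Fock P →+* Fock P) (genF p)) (map_genF_expCreation h))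
    beta_reduce at this
    rw [← map_mul, ← genF_mul, PowerSeries.coeff_map, PowerSeries.coeff_mul] at this
    simp only [PowerSeries.coeff_mul, PowerSeries.coeff_map, genF, PowerSeries.coeff_mk,
      RingHom.coe_coe, Finset.sum_mul, mul_assoc] at this
    exact this
  have hcoe {ι : Type} (s : Finset ι) (f : ι → Fock P) :
      ((∑ c ∈ s, f c : Fock P) : MvPowerSeries (Osc P) ℂ) = ∑ c ∈ s, (f c : MvPowerSeries _ ℂ) :=
    map_sum (MvPolynomial.coeToMvPowerSeries.ringHom (R := ℂ) (σ := Osc P)) f s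
  rw [sum_symbol_mul_symbol_eq, h1]
  simp only [hcoe, Finset.mul_sum, map_sum]
  have h2 : ∀ x ∈ Finset.HasAntidiagonal.antidiagonal D,
      ∑ y ∈ Finset.HasAntidiagonal.antidiagonal x.1,
        MvPowerSeries.coeff m' (expCreation L * ((MvPolynomial.C (ratCoeff α β y.1) *
            (hom y.2 (expCreation M) * expAnnihilation L (hom x.2 p)) : Fock P) :
              MvPowerSeries (Osc P) ℂ))
      = ∑ a ∈ Finset.range (deg m' + 1), extendZero (ratCoeff α β) ((x.1 : ℤ) - a) *
          gradedPart L M m' m a x.2 := by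
    intro x _
    rw [← sum_antidiagonal_eq_sum_range _ (fun a => gradedPart L M m' m a x.2)
      (fun a ha => gradedPart_eq_zero_left L M m' m x.2 ha)]
    refine Finset.sum_congr rfl fun y _ => ?_
    rw [MvPolynomial.coe_mul, MvPolynomial.coe_C, mul_left_comm, MvPowerSeries.coeff_C_mul]
    rfl
  rw [Finset.sum_congr rfl h2, Finset.sum_comm]
  refine Finset.sum_congr rfl fun a _ => ?_
  rw [sum_antidiagonal_eq_sum_range (fun x => extendZero (ratCoeff α β) ((x : ℤ) - a))
    (fun e => gradedPart L M m' m a e) (fun e he => gradedPart_eq_zero_right L M m' m a he)]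
  refine Finset.sum_congr rfl fun e _ => ?_
  congr 1
  -- The two nested extensions by zero collapse into one: if `D` is already below `e`, it is below
  -- `a + e` too, and both sides vanish.
  by_cases hde : 0 ≤ (D : ℤ) - e
  · rw [extendZero, if_pos hde, Int.toNat_of_nonneg hde]
    congr 1
    push_cast
    ring
  · rw [extendZero, if_neg hde, extendZero, if_neg]
    push_cast
    omega

end GradedProducts

/-! ### The two orderings of a product as expansions of one rational function. -/

section SymbolCommutator

variable {P : Params}

/-- The matrix element of `:L(z) M(t z):` as a polynomial in `t`. -/
def gradedPoly (L M : LinForm P) (m' m : Osc P →₀ ℕ) : Polynomial ℂ :=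
  ∑ a ∈ Finset.range (deg m' + 1), ∑ e ∈ Finset.range (deg m + 1),
    Polynomial.monomial (a + e) (gradedPart L M m' m a e)

lemma coe_sum_fock {ι : Type*} (s : Finset ι) (f : ι → Fock P) :
    ((∑ c ∈ s, f c : Fock P) : MvPowerSeries (Osc P) ℂ) = ∑ c ∈ s, (f c : MvPowerSeries _ ℂ) :=
  map_sum (MvPolynomial.coeToMvPowerSeries.ringHom (R := ℂ) (σ := Osc P)) f s

lemma coeff_sum_pow_hom (t : ℂ) (F : MvPowerSeries (Osc P) ℂ) (K : ℕ) (u : Osc P →₀ ℕ) :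
    MvPolynomial.coeff u (∑ a ∈ Finset.range (K + 1), MvPolynomial.C (t ^ a) * hom a F)
      = if deg u ≤ K then t ^ deg u * MvPowerSeries.coeff u F else 0 := by
  classical
  simp only [MvPolynomial.coeff_sum, MvPolynomial.coeff_C_mul, coeff_hom, mul_ite, mul_zero,
    Finset.sum_ite_eq, Finset.mem_range, Nat.lt_succ_iff]

lemma scaleHom_eq_sum_hom (t : ℂ) (p : Fock P) (K : ℕ)
    (hp : ∀ u, K < deg u → MvPolynomial.coeff u p = 0) :
    scaleHom t p = ∑ e ∈ Finset.range (K + 1), MvPolynomial.C (t ^ e) *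
      hom e (p : MvPowerSeries (Osc P) ℂ) := by
  ext u
  rw [coeff_sum_pow_hom, coeff_scaleHom, MvPolynomial.coeff_coe]
  split_ifs with h
  · rfl
  · rw [hp u (by omega), mul_zero]

/-- Both sides are algebra homomorphisms, so it suffices to compare them on the variables, where
each is a rescaling plus a translation. -/
lemma scaleHom_comp_expAnnihilation (t : ℂ) (L M : LinForm P) (p : Fock P) :
    scaleHom t (expAnnihilation (scale t⁻¹ L + M) p)
      = expAnnihilation L (scaleHom t (expAnnihilation M p)) := by
  have : (scaleHom t).comp (expAnnihilation (scale t⁻¹ L + M))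
      = (expAnnihilation L).comp ((scaleHom t).comp (expAnnihilation M)) := by
    apply MvPolynomial.algHom_ext
    intro o
    simp only [AlgHom.comp_apply, expAnnihilation_X, map_add, scaleHom, MvPolynomial.aeval_X,
      MvPolynomial.algHom_C, map_mul, transl_scale, transl_add, mul_add,
      MvPolynomial.algebraMap_eq, inv_inv]
    ring
  exact DFunLike.congr_fun this p

/-- The polynomial, defined by counting quanta, is the matrix element of a normal ordered
exponential with relatively rescaled arguments. This identifies the residue at the pole as a normal
ordered exponential. -/
lemma eval_gradedPoly {t : ℂ} (ht : t ≠ 0) (L M : LinForm P) (m' m : Osc P →₀ ℕ) :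
    (gradedPoly L M m' m).eval t = t ^ deg m' * symbol (scale t⁻¹ L + M) m' m := by
  classical
  set p : Fock P := expAnnihilation M (MvPolynomial.monomial m 1) with hp
  set G : Fock P := ∑ a ∈ Finset.range (deg m' + 1), MvPolynomial.C (t ^ a) *
    hom a (expCreation M) with hG
  have h1 : (gradedPoly L M m' m).eval t = MvPowerSeries.coeff m' (expCreation L *
      ((G * expAnnihilation L (scaleHom t p) : Fock P) : MvPowerSeries (Osc P) ℂ)) := by
    rw [scaleHom_eq_sum_hom t p (deg m) (fun u hu => expAnnihilation_monomial_degree M m u hu), hG,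
      map_sum, Finset.sum_mul_sum, gradedPoly, Polynomial.eval_finsetSum]
    simp only [Polynomial.eval_finsetSum, Polynomial.eval_monomial, coe_sum_fock,
      Finset.mul_sum, map_sum]
    refine Finset.sum_congr rfl fun a _ => Finset.sum_congr rfl fun e _ => ?_
    rw [map_mul (expAnnihilation L), MvPolynomial.algHom_C, MvPolynomial.algebraMap_eq,
      mul_mul_mul_comm, ← map_mul, MvPolynomial.coe_mul, MvPolynomial.coe_C, mul_left_comm,
      MvPowerSeries.coeff_C_mul, ← pow_add, mul_comm]
    rfl
  -- The truncation of the creation series at energy `deg m'` is invisible in the coefficient of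
  -- `m'`.
  have h2 : MvPowerSeries.coeff m' (expCreation L *
      ((G * expAnnihilation L (scaleHom t p) : Fock P) : MvPowerSeries (Osc P) ℂ))
      = MvPowerSeries.coeff m' (expCreation L * (rescale t (expCreation M) *
        ((expAnnihilation L (scaleHom t p) : Fock P) : MvPowerSeries (Osc P) ℂ))) := by
    rw [MvPolynomial.coe_mul, mul_left_comm, mul_left_comm (expCreation L),
      MvPowerSeries.coeff_mul, MvPowerSeries.coeff_mul]
    refine Finset.sum_congr rfl fun x hx => ?_
    have hx' : x.1 + x.2 = m' := Finset.HasAntidiagonal.mem_antidiagonal.1 hx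
    rw [MvPolynomial.coeff_coe, hG, coeff_sum_pow_hom, coeff_rescale, if_pos]
    rw [← hx', map_add]
    omega
  have h3 : rescale t (expCreation (scale t⁻¹ L)) = expCreation L := by
    rw [rescale_expCreation, scale_scale, mul_inv_cancel₀ ht, scale_one]
  rw [h1, h2, symbol, ← coeff_rescale, expCreation_add, map_mul (rescale t),
    map_mul (rescale t), rescale_coe, scaleHom_comp_expAnnihilation t, h3, mul_assoc]

lemma natDegree_gradedPoly_le (L M : LinForm P) (m' m : Osc P →₀ ℕ) :
    (gradedPoly L M m' m).natDegree ≤ deg m' + deg m := by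
  refine Polynomial.natDegree_sum_le_of_forall_le _ _ fun a ha =>
    Polynomial.natDegree_sum_le_of_forall_le _ _ fun e he => ?_
  have := Finset.mem_range.1 ha
  have := Finset.mem_range.1 he
  exact (Polynomial.natDegree_monomial_le _).trans (by omega)

/-- Normal ordering is symmetric in the two factors, and the polynomial depends only on the ratio of
their arguments. Exchanging the factors inverts this ratio, which reverses the coefficients; the
identity is checked at all nonzero t. -/
lemma gradedPoly_reflect (L M : LinForm P) (m' m : Osc P →₀ ℕ) :
    gradedPoly M L m' m = (gradedPoly L M m' m).reflect (deg m' + deg m) := by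
  apply Polynomial.eq_of_infinite_eval_eq
  refine Set.Infinite.mono (s := {t : ℂ | t ≠ 0}) ?_ ?_
  · intro t ht
    have ht : t ≠ 0 := ht
    have ht' : t⁻¹ ≠ 0 := inv_ne_zero ht
    let _ : Invertible t⁻¹ := invertibleOfNonzero ht'
    have h1 := Polynomial.eval₂_reflect_mul_pow (RingHom.id ℂ) t⁻¹ (deg m' + deg m)
      (gradedPoly L M m' m) (natDegree_gradedPoly_le L M m' m)
    rw [invOf_eq_inv, inv_inv, ← Polynomial.eval, ← Polynomial.eval, eval_gradedPoly ht',
      inv_inv] at h1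
    have h2 : scale t⁻¹ M + L = scale t⁻¹ (scale t L + M) := by
      rw [scale_add, scale_scale, inv_mul_cancel₀ ht, scale_one, add_comm]
    change Polynomial.eval t _ = Polynomial.eval t _
    rw [eval_gradedPoly ht, h2, symbol_scale ht', zpow_sub₀ ht', zpow_natCast, zpow_natCast]
    have h3 : t⁻¹ ^ (deg m' + deg m) ≠ 0 := pow_ne_zero _ ht'
    apply mul_right_cancel₀ h3
    rw [h1, pow_add]
    simp only [inv_pow]
    field_simp
  · exact (Set.finite_singleton (0 : ℂ)).infinite_compl

lemma sum_symbol_mul_symbol' {L M : LinForm P} {α β : ℂ}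
    (h : ∀ n : ℕ, 0 < n → n * contraction L M n = β ^ n - α ^ n) (m' m : Osc P →₀ ℕ) (D : ℕ) :
    ∑ c ∈ degFinset P D, symbol L m' c * symbol M c m
      = ∑ d ∈ Finset.range (deg m' + deg m + 1),
          extendZero (ratCoeff α β) ((D : ℤ) - d) * (gradedPoly L M m' m).coeff d := by
  rw [sum_symbol_mul_symbol h]
  simp only [gradedPoly, Polynomial.finsetSum_coeff, Polynomial.coeff_monomial, Finset.mul_sum]
  symm
  rw [Finset.sum_comm]
  refine Finset.sum_congr rfl fun a ha => ?_
  rw [Finset.sum_comm]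
  refine Finset.sum_congr rfl fun e he => ?_
  have := Finset.mem_range.1 ha
  have := Finset.mem_range.1 he
  simp only [mul_ite, mul_zero]
  rw [Finset.sum_ite_eq, if_pos (Finset.mem_range.2 (by omega))]

/-- The products of two exponentials with prescribed intermediate energy. -/
def gradedProd (L M : LinForm P) (m' m : Osc P →₀ ℕ) (D : ℤ) : ℂ :=
  if 0 ≤ D then ∑ c ∈ degFinset P D.toNat, symbol L m' c * symbol M c m else 0

lemma gradedProd_eq {L M : LinForm P} {α β : ℂ}
    (h : ∀ n : ℕ, 0 < n → n * contraction L M n = β ^ n - α ^ n) (m' m : Osc P →₀ ℕ) (D : ℤ) :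
    gradedProd L M m' m D = ∑ d ∈ Finset.range (deg m' + deg m + 1),
      extendZero (ratCoeff α β) (D - d) * (gradedPoly L M m' m).coeff d := by
  rw [gradedProd]
  split_ifs with hD
  · rw [sum_symbol_mul_symbol' h, Int.toNat_of_nonneg hD]
  · symm
    refine Finset.sum_eq_zero fun d _ => ?_
    rw [extendZero, if_neg (by omega), zero_mul]

/-- The expansion of (1 - αt)/(1 - βt) at infinity is α/β times the series with inverse parameters
in 1/t. The difference of the two expansions is the formal delta function at t = 1/β, with all
coefficients proportional to β^n. -/
lemma extendZero_ratCoeff_sub {α β : ℂ} (hα : α ≠ 0) (hβ : β ≠ 0) (n : ℤ) :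
    extendZero (ratCoeff α β) n - α / β * extendZero (ratCoeff α⁻¹ β⁻¹) (-n)
      = (1 - α / β) * β ^ n := by
  rcases lt_trichotomy n 0 with hn | rfl | hn
  · obtain ⟨k, rfl⟩ : ∃ k : ℕ, n = -((k : ℤ) + 1) := ⟨(-n - 1).toNat, by omega⟩
    rw [extendZero, if_neg (by omega), extendZero, if_pos (by omega), neg_neg,
      show ((k : ℤ) + 1).toNat = k + 1 by omega, ratCoeff_succ, zpow_neg,
      show ((k : ℤ) + 1) = ((k + 1 : ℕ) : ℤ) by push_cast; rfl, zpow_natCast, inv_pow]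
    field_simp
    ring
  · simp [extendZero, ratCoeff]
  · obtain ⟨k, rfl⟩ : ∃ k : ℕ, n = (k : ℤ) + 1 := ⟨(n - 1).toNat, by omega⟩
    rw [extendZero, if_pos (by omega), extendZero, if_neg (by omega),
      show ((k : ℤ) + 1).toNat = k + 1 by omega, ratCoeff_succ,
      show ((k : ℤ) + 1) = ((k + 1 : ℕ) : ℤ) by push_cast; rfl, zpow_natCast]
    field_simp
    ring

/-- The commutator of two exponentials whose product has a single simple pole. -/
lemma gradedProd_sub {L M : LinForm P} {α β : ℂ} (hα : α ≠ 0) (hβ : β ≠ 0)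
    (h : ∀ n : ℕ, 0 < n → n * contraction L M n = β ^ n - α ^ n)
    (h' : ∀ n : ℕ, 0 < n → n * contraction M L n = β⁻¹ ^ n - α⁻¹ ^ n)
    (m' m : Osc P →₀ ℕ) (D : ℤ) :
    gradedProd L M m' m D - α / β * gradedProd M L m' m (deg m' + deg m - D)
      = (1 - α / β) * β ^ (D - deg m') * symbol (scale β L + M) m' m := by
  -- Reversing the summation index in the opposite product matches it with the reflected polynomial,
  -- so the two sums can be subtracted term by term. The coefficient β^(D - d) then assembles into
  -- the value of the polynomial at 1/β.
  rw [gradedProd_eq h, gradedProd_eq h', ← Finset.sum_range_reflect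
    (fun d => extendZero (ratCoeff α⁻¹ β⁻¹) ((deg m' + deg m : ℤ) - D - (d : ℕ)) *
      (gradedPoly M L m' m).coeff d), Finset.mul_sum, ← Finset.sum_sub_distrib]
  have hterm : ∀ d ∈ Finset.range (deg m' + deg m + 1),
      extendZero (ratCoeff α β) (D - d) * (gradedPoly L M m' m).coeff d
        - α / β * (extendZero (ratCoeff α⁻¹ β⁻¹)
            ((deg m' + deg m : ℤ) - D - ((deg m' + deg m + 1 - 1 - d : ℕ) : ℤ)) *
          (gradedPoly M L m' m).coeff (deg m' + deg m + 1 - 1 - d))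
      = (1 - α / β) * β ^ D * ((gradedPoly L M m' m).coeff d * β⁻¹ ^ d) := by
    intro d hd
    have hd' := Finset.mem_range.1 hd
    have hc : (gradedPoly M L m' m).coeff (deg m' + deg m + 1 - 1 - d)
        = (gradedPoly L M m' m).coeff d := by
      rw [gradedPoly_reflect, Polynomial.coeff_reflect, Polynomial.revAt_le (by omega)]
      congr 1
      omega
    rw [hc, show (deg m' + deg m : ℤ) - D - ((deg m' + deg m + 1 - 1 - d : ℕ) : ℤ)
      = -(D - d) by omega]
    have hk := extendZero_ratCoeff_sub hα hβ (D - d)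
    rw [zpow_sub₀ hβ, zpow_natCast] at hk
    rw [inv_pow]
    linear_combination (gradedPoly L M m' m).coeff d * hk
  rw [Finset.sum_congr rfl hterm, ← Finset.mul_sum,
    ← Polynomial.eval_eq_sum_range' (by have := natDegree_gradedPoly_le L M m' m; omega),
    eval_gradedPoly (inv_ne_zero hβ), inv_inv, zpow_sub₀ hβ, zpow_natCast, inv_pow]
  ring

end SymbolCommutator

section KernelAlgebra

variable {P : Params}

/-! ### Kernels with finite rows and columns -/

/-- All rows and columns are finite. -/
structure IsFinitary (T : Kernel P) : Prop where
  row : ∀ b', {b | T b' b ≠ 0}.Finite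
  col : ∀ b, {b' | T b' b ≠ 0}.Finite

lemma IsFinitary.zero : IsFinitary (0 : Kernel P) := ⟨fun _ => by simp, fun _ => by simp⟩

lemma IsFinitary.add {S T : Kernel P} (hS : IsFinitary S) (hT : IsFinitary T) :
    IsFinitary (S + T) := by
  constructor
  · intro b'
    refine ((hS.row b').union (hT.row b')).subset fun b hb => ?_
    by_contra h
    simp only [Set.mem_union, Set.mem_ofPred_eq, not_or, not_not] at h
    exact hb (by simp [h.1, h.2])
  · intro b'
    refine ((hS.col b').union (hT.col b')).subset fun b hb => ?_
    by_contra h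
    simp only [Set.mem_union, Set.mem_ofPred_eq, not_or, not_not] at h
    exact hb (by simp [h.1, h.2])

lemma IsFinitary.smul (t : ℂ) {T : Kernel P} (hT : IsFinitary T) : IsFinitary (t • T) :=
  ⟨fun b' => (hT.row b').subset fun b hb h => hb (by simp [h]),
    fun b' => (hT.col b').subset fun b hb h => hb (by simp [h])⟩

lemma IsFinitary.neg {T : Kernel P} (hT : IsFinitary T) : IsFinitary (-T) := by
  simpa using hT.smul (-1)

lemma IsFinitary.sub {S T : Kernel P} (hS : IsFinitary S) (hT : IsFinitary T) :
    IsFinitary (S - T) := by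
  simpa [sub_eq_add_neg] using hS.add hT.neg

lemma IsFinitary.sum {ι : Type*} (s : Finset ι) {T : ι → Kernel P}
    (hT : ∀ i ∈ s, IsFinitary (T i)) : IsFinitary (∑ i ∈ s, T i) :=
  Finset.sum_induction _ _ (fun _ _ => IsFinitary.add) IsFinitary.zero hT

lemma mul_support_left {S T : Kernel P} (hS : ∀ b', {b | S b' b ≠ 0}.Finite) (b' b : Basis P) :
    (Function.support fun c => S b' c * T c b).Finite :=
  (hS b').subset fun c hc h => hc (by simp [h])

lemma mul_support_right {S T : Kernel P} (hT : ∀ b, {b' | T b' b ≠ 0}.Finite) (b' b : Basis P) :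
    (Function.support fun c => S b' c * T c b).Finite :=
  (hT b).subset fun c hc h => hc (by simp [h])

lemma IsFinitary.mul {S T : Kernel P} (hS : IsFinitary S) (hT : IsFinitary T) :
    IsFinitary (S.mul T) := by
  constructor
  · intro b'
    refine ((hS.row b').biUnion fun c _ => hT.row c).subset fun b hb => ?_
    by_contra h
    simp only [Set.mem_iUnion, Set.mem_ofPred_eq, not_exists, not_not] at h
    refine hb ?_
    rw [Kernel.mul, finsum_eq_zero_of_forall_eq_zero]
    intro c
    by_cases hc : S b' c = 0
    · simp [hc]
    · simp [h c hc]
  · intro b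
    refine ((hT.col b).biUnion fun c _ => hS.col c).subset fun b' hb => ?_
    by_contra h
    simp only [Set.mem_iUnion, Set.mem_ofPred_eq, not_exists, not_not] at h
    refine hb ?_
    rw [Kernel.mul, finsum_eq_zero_of_forall_eq_zero]
    intro c
    by_cases hc : T c b = 0
    · simp [hc]
    · simp [h c hc]

lemma IsFinitary.add_mul {S S' : Kernel P} (hS : IsFinitary S) (hS' : IsFinitary S')
    (T : Kernel P) : (S + S').mul T = S.mul T + S'.mul T := by
  funext b' b
  simp only [Kernel.mul, Pi.add_apply, _root_.add_mul]
  exact finsum_add_distrib (mul_support_left hS.row b' b) (mul_support_left hS'.row b' b)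

lemma IsFinitary.mul_add {S : Kernel P} (hS : IsFinitary S) (T T' : Kernel P) :
    S.mul (T + T') = S.mul T + S.mul T' := by
  funext b' b
  simp only [Kernel.mul, Pi.add_apply, _root_.mul_add]
  exact finsum_add_distrib (mul_support_left hS.row b' b) (mul_support_left hS.row b' b)

/-- The primed versions take their finiteness from the right factor. Both kinds are needed because a
full exponential, unlike a mode, need not be finitary, and it occurs on either side of a commutator.
-/
lemma IsFinitary.add_mul' {T : Kernel P} (hT : IsFinitary T) (S S' : Kernel P) :
    (S + S').mul T = S.mul T + S'.mul T := by
  funext b' b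
  simp only [Kernel.mul, Pi.add_apply, _root_.add_mul]
  exact finsum_add_distrib (mul_support_right hT.col b' b) (mul_support_right hT.col b' b)

lemma IsFinitary.mul_add' {T T' : Kernel P} (hT : IsFinitary T) (hT' : IsFinitary T')
    (S : Kernel P) : S.mul (T + T') = S.mul T + S.mul T' := by
  funext b' b
  simp only [Kernel.mul, Pi.add_apply, _root_.mul_add]
  exact finsum_add_distrib (mul_support_right hT.col b' b) (mul_support_right hT'.col b' b)

lemma smul_mul (t : ℂ) (S T : Kernel P) : (t • S).mul T = t • S.mul T := by
  funext b' b
  simp only [Kernel.mul, Pi.smul_apply, smul_eq_mul, mul_assoc]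
  exact (smul_finsum t fun c => S b' c * T c b).symm

lemma mul_smul (t : ℂ) (S T : Kernel P) : S.mul (t • T) = t • S.mul T := by
  rw [← smul_mul]
  funext b' b
  simp only [Kernel.mul, Pi.smul_apply, smul_eq_mul]
  exact finsum_congr fun c => by ring

lemma IsFinitary.sum_mul {ι : Type*} (s : Finset ι) {S : ι → Kernel P}
    (hS : ∀ i ∈ s, IsFinitary (S i)) (T : Kernel P) :
    (∑ i ∈ s, S i).mul T = ∑ i ∈ s, (S i).mul T := by
  classical
  induction s using Finset.induction_on with
  | empty => funext b' b; simp [Kernel.mul]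
  | insert i s hi ih =>
    rw [Finset.sum_insert hi, Finset.sum_insert hi, (hS i (by simp)).add_mul
      (IsFinitary.sum s fun j hj => hS j (by simp [hj])), ih fun j hj => hS j (by simp [hj])]

lemma IsFinitary.mul_sum' {ι : Type*} (s : Finset ι) {T : ι → Kernel P}
    (hT : ∀ i ∈ s, IsFinitary (T i)) (S : Kernel P) :
    S.mul (∑ i ∈ s, T i) = ∑ i ∈ s, S.mul (T i) := by
  classical
  induction s using Finset.induction_on with
  | empty => funext b' b; simp [Kernel.mul]
  | insert i s hi ih =>
    rw [Finset.sum_insert hi, Finset.sum_insert hi, (hT i (by simp)).mul_add'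
      (IsFinitary.sum s fun j hj => hT j (by simp [hj])), ih fun j hj => hT j (by simp [hj])]

lemma IsFinitary.mul_sum {ι : Type*} (s : Finset ι) {S : Kernel P} (hS : IsFinitary S)
    (T : ι → Kernel P) : S.mul (∑ i ∈ s, T i) = ∑ i ∈ s, S.mul (T i) := by
  classical
  induction s using Finset.induction_on with
  | empty => funext b' b; simp [Kernel.mul]
  | insert i s hi ih => rw [Finset.sum_insert hi, Finset.sum_insert hi, hS.mul_add, ih]

lemma IsFinitary.sum_mul' {ι : Type*} (s : Finset ι) {T : Kernel P} (hT : IsFinitary T)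
    (S : ι → Kernel P) : (∑ i ∈ s, S i).mul T = ∑ i ∈ s, (S i).mul T := by
  classical
  induction s using Finset.induction_on with
  | empty => funext b' b; simp [Kernel.mul]
  | insert i s hi ih => rw [Finset.sum_insert hi, Finset.sum_insert hi, hT.add_mul', ih]

/-- Associativity if the outer factors are finitary. -/
lemma mul_assoc_outer {A C : Kernel P} (hA : IsFinitary A) (hC : IsFinitary C) (B : Kernel P) :
    (A.mul B).mul C = A.mul (B.mul C) := by
  funext b' b
  simp only [Kernel.mul]
  have h1 (c) : (∑ᶠ d, A b' d * B d c) * C c b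
      = ∑ d ∈ (hA.row b').toFinset, A b' d * B d c * C c b := by
    rw [finsum_eq_sum_of_support_subset (s := (hA.row b').toFinset), Finset.sum_mul]
    intro d hd
    simp only [Set.Finite.coe_toFinset, Set.mem_ofPred_eq]
    exact fun h => hd (by simp [h])
  have h2 (d) : A b' d * (∑ᶠ c, B d c * C c b)
      = ∑ c ∈ (hC.col b).toFinset, A b' d * B d c * C c b := by
    rw [finsum_eq_sum_of_support_subset (s := (hC.col b).toFinset), Finset.mul_sum]
    · exact Finset.sum_congr rfl fun _ _ => by ring
    intro d hd
    simp only [Set.Finite.coe_toFinset, Set.mem_ofPred_eq]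
    exact fun h => hd (by simp [h])
  rw [finsum_congr h1, finsum_congr h2, finsum_eq_sum_of_support_subset
    (s := (hC.col b).toFinset), finsum_eq_sum_of_support_subset (s := (hA.row b').toFinset),
    Finset.sum_comm]
  · intro d hd
    simp only [Set.Finite.coe_toFinset, Set.mem_ofPred_eq]
    exact fun h => hd (by simp [h])
  · intro d hd
    simp only [Set.Finite.coe_toFinset, Set.mem_ofPred_eq]
    exact fun h => hd (by simp [h])

/-- Associativity if the two left factors are finitary. -/
lemma mul_assoc_left {A B : Kernel P} (hA : IsFinitary A) (hB : IsFinitary B) (C : Kernel P) :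
    (A.mul B).mul C = A.mul (B.mul C) := by
  funext b' b
  simp only [Kernel.mul]
  set s := (hA.row b').toFinset
  have hs : ∀ d, d ∉ s → A b' d = 0 := fun d hd => by simpa [s] using hd
  -- The states that can be reached from `b'` in two steps form a finite set, so the iterated finite
  -- sums may be interchanged even though `C` is arbitrary.
  set t := (Set.Finite.biUnion (hA.row b') fun c _ => hB.row c).toFinset
  have ht : ∀ c, c ∉ t → ∀ d, A b' d * B d c = 0 := by
    intro c hc d
    by_contra h
    apply hc
    simp only [t, Set.Finite.mem_toFinset, Set.mem_iUnion]
    exact ⟨d, left_ne_zero_of_mul h, right_ne_zero_of_mul h⟩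
  have h1 (c) : (∑ᶠ d, A b' d * B d c) * C c b = ∑ d ∈ s, A b' d * B d c * C c b := by
    rw [finsum_eq_sum_of_support_subset (s := s), Finset.sum_mul]
    intro d hd
    by_contra h
    exact hd (by simp [hs d h])
  have h2 (d) : A b' d * (∑ᶠ c, B d c * C c b) = ∑ c ∈ t, A b' d * B d c * C c b := by
    by_cases hd : A b' d = 0
    · simp [hd]
    rw [finsum_eq_sum_of_support_subset (s := t), Finset.mul_sum]
    · exact Finset.sum_congr rfl fun _ _ => by ring
    intro c hc
    by_contra h
    have := ht c h d
    exact hc (by simp [(mul_eq_zero.1 this).resolve_left hd])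
  rw [finsum_congr h1, finsum_congr h2, finsum_eq_sum_of_support_subset (s := t),
    finsum_eq_sum_of_support_subset (s := s), Finset.sum_comm]
  · intro d hd
    by_contra h
    exact hd (Finset.sum_eq_zero fun c _ => by simp [hs d h])
  · intro c hc
    by_contra h
    exact hc (Finset.sum_eq_zero fun d _ => by simp [ht c h d])

/-- Associativity if the two right factors are finitary. -/
lemma mul_assoc_right {B C : Kernel P} (hB : IsFinitary B) (hC : IsFinitary C) (A : Kernel P) :
    (A.mul B).mul C = A.mul (B.mul C) := by
  funext b' b
  simp only [Kernel.mul]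
  set s := (hC.col b).toFinset
  have hs : ∀ d, d ∉ s → C d b = 0 := fun d hd => by simpa [s] using hd
  set t := (Set.Finite.biUnion (hC.col b) fun c _ => hB.col c).toFinset
  have ht : ∀ d, d ∉ t → ∀ c, B d c * C c b = 0 := by
    intro d hd c
    by_contra h
    apply hd
    simp only [t, Set.Finite.mem_toFinset, Set.mem_iUnion]
    exact ⟨c, right_ne_zero_of_mul h, left_ne_zero_of_mul h⟩
  have h1 (c) : (∑ᶠ d, A b' d * B d c) * C c b = ∑ d ∈ t, A b' d * B d c * C c b := by
    by_cases hc : C c b = 0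
    · simp [hc]
    rw [finsum_eq_sum_of_support_subset (s := t), Finset.sum_mul]
    intro d hd
    by_contra h
    have := ht d h c
    exact hd (by simp [(mul_eq_zero.1 this).resolve_right hc])
  have h2 (d) : A b' d * (∑ᶠ c, B d c * C c b) = ∑ c ∈ s, A b' d * B d c * C c b := by
    rw [finsum_eq_sum_of_support_subset (s := s), Finset.mul_sum]
    · exact Finset.sum_congr rfl fun _ _ => by ring
    intro c hc
    by_contra h
    exact hc (by simp [hs c h])
  rw [finsum_congr h1, finsum_congr h2, finsum_eq_sum_of_support_subset (s := s),
    finsum_eq_sum_of_support_subset (s := t), Finset.sum_comm]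
  · intro d hd
    by_contra h
    exact hd (Finset.sum_eq_zero fun c _ => by rw [mul_assoc, ht d h c, mul_zero])
  · intro c hc
    by_contra h
    exact hc (Finset.sum_eq_zero fun d _ => by simp [hs c h])

lemma isFinitary_diag (f : Momentum P → ℂ) : IsFinitary (diag f) := by
  constructor
  · intro b'
    refine (Set.finite_singleton b').subset fun b hb => ?_
    by_contra h
    exact hb (if_neg fun e => h e.symm)
  · intro b'
    refine (Set.finite_singleton b').subset fun b hb => ?_
    by_contra h
    exact hb (if_neg h)

lemma isFinitary_one : IsFinitary (Kernel.one P) := isFinitary_diag fun _ => 1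

lemma one_mul_kernel (T : Kernel P) : (Kernel.one P).mul T = T := by
  funext b' b
  rw [Kernel.mul, finsum_eq_single _ b' fun c hc => by simp [Kernel.one, hc.symm]]
  simp [Kernel.one]

lemma mul_one_kernel (T : Kernel P) : T.mul (Kernel.one P) = T := by
  funext b' b
  rw [Kernel.mul, finsum_eq_single _ b fun c hc => by simp [Kernel.one, hc]]
  simp [Kernel.one]

end KernelAlgebra

section Commutator

variable {P : Params}

/-! ### Zero modes -/

lemma sum_boson (f : Boson P → ℂ) :
    ∑ x, f x = ∑ i, f (.a i) + ∑ r, f (.b r) + ∑ r, f (.c r) := by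
  let e : Node P ⊕ Root P ⊕ Root P ≃ Boson P :=
    { toFun := fun x => match x with
        | .inl i => .a i
        | .inr (.inl r) => .b r
        | .inr (.inr r) => .c r
      invFun := fun x => match x with
        | .a i => .inl i
        | .b r => .inr (.inl r)
        | .c r => .inr (.inr r)
      left_inv := by rintro (i | r | r) <;> rfl
      right_inv := by rintro (i | r | r) <;> rfl }
  rw [← e.sum_comp, Fintype.sum_sum_type, Fintype.sum_sum_type, add_assoc]
  rfl

lemma momentumShift_a (L : LinForm P) (i : Node P) :
    momentumShift L (.a i) = ∑ j : Node P, L (.qhat (.a j)) * (P.kg * cartan i.1 j.1) := by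
  rw [momentumShift, sum_boson]
  simp [zeroComm]

lemma momentumShift_b (L : LinForm P) (r : Root P) :
    momentumShift L (.b r) = -L (.qhat (.b r)) := by
  rw [momentumShift, sum_boson]
  simp [zeroComm]

lemma momentumShift_c (L : LinForm P) (r : Root P) :
    momentumShift L (.c r) = L (.qhat (.c r)) := by
  rw [momentumShift, sum_boson]
  simp [zeroComm]

lemma momentumShift_add (L M : LinForm P) :
    momentumShift (L + M) = momentumShift L + momentumShift M := by
  funext x
  simp [momentumShift, add_mul, Finset.sum_add_distrib]

/-- The charges of `L` in `b^{ij}` and `c^{ij}` agree. -/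
def IsBalanced (L : LinForm P) : Prop := ∀ r : Root P, L (.qhat (.b r)) = L (.qhat (.c r))

/-- The part of `L` in the `p̂`, for given eigenvalues of these. -/
def phatPart (L : LinForm P) (μ : Boson P → ℂ) : ℂ := ∑ x : Boson P, L (.phat x) * μ x

/-- The coefficient of `log z` in the zero mode part of a field `L`. -/
def charge (L : LinForm P) (μ : Boson P → ℂ) : ℂ := ∑ x : Boson P, L (.qhat x) * μ x

/-- No charge in `a^i` and equal integral charges in `b^{ij}`, `c^{ij}`. -/
structure IsIntegral (L : LinForm P) : Prop where
  a : ∀ i, L (.qhat (.a i)) = 0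
  balanced : IsBalanced L
  int : ∀ r, ∃ k : ℤ, L (.qhat (.b r)) = k

lemma IsBalanced.shift_mem {L : LinForm P} (hL : IsBalanced L) (r : Root P) :
    momentumShift L (.b r) + momentumShift L (.c r) = 0 := by
  rw [momentumShift_b, momentumShift_c, hL r]
  ring

/-- The momentum after the application of `:exp L:`. -/
def IsBalanced.shift {L : LinForm P} (hL : IsBalanced L) (μ : Momentum P) : Momentum P :=
  ⟨μ.1 + momentumShift L, fun r => by
    obtain ⟨k, hk⟩ := μ.2 r
    refine ⟨k, ?_⟩
    have := hL.shift_mem r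
    simp only [Pi.add_apply]
    linear_combination hk + this⟩

lemma phatPart_add_right (L : LinForm P) (μ ν : Boson P → ℂ) :
    phatPart L (μ + ν) = phatPart L μ + phatPart L ν := by
  simp [phatPart, mul_add, Finset.sum_add_distrib]

lemma phatPart_add_left (L M : LinForm P) (μ : Boson P → ℂ) :
    phatPart (L + M) μ = phatPart L μ + phatPart M μ := by
  simp [phatPart, add_mul, Finset.sum_add_distrib]

lemma charge_add_right (L : LinForm P) (μ ν : Boson P → ℂ) :
    charge L (μ + ν) = charge L μ + charge L ν := by
  simp [charge, mul_add, Finset.sum_add_distrib]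

/-- The zero mode commutators of b and c have opposite signs, so equal charges in b and c cancel,
and `L` has no charge in a. Hence applying `M` does not affect the powers of z in `L`. -/
lemma IsIntegral.charge_shift {L M : LinForm P} (hL : IsIntegral L) (hM : IsBalanced M) :
    charge L (momentumShift M) = 0 := by
  rw [charge, sum_boson]
  simp only [hL.a, momentumShift_b, momentumShift_c, hL.balanced _, hM _]
  simp

/-- This is where the integrality of p_b + p_c in the momenta is used: it makes the powers of z in
the currents integral. -/
lemma IsIntegral.charge_int {L : LinForm P} (hL : IsIntegral L) (μ : Momentum P) :
    ∃ k : ℤ, charge L μ.1 = k := by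
  choose f hf using hL.int
  choose g hg using μ.2
  refine ⟨∑ r, f r * g r, ?_⟩
  rw [charge, sum_boson]
  simp only [hL.a, ← hL.balanced _, hf]
  push_cast
  rw [← Finset.sum_congr rfl fun r _ => congrArg (fun x => (f r : ℂ) * x) (hg r)]
  simp [mul_add, Finset.sum_add_distrib]

/-! ### Exponentials of fields -/

lemma vertex_apply (L : LinForm P) (b' b : Basis P) :
    vertex L b' b = if b'.1.1 = b.1.1 + momentumShift L then
      Complex.exp (phatPart L b.1.1) * symbol L b'.2 b.2 else 0 := rfl

/-- The substitution `z ↦ e^v z` in a field. -/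
def translate (v : ℂ) (L : LinForm P) : LinForm P
  | .osc x n => L (.osc x n) * Complex.exp (-(n * v))
  | .qhat x => L (.qhat x)
  | .phat x => L (.phat x) + v * L (.qhat x)

lemma translate_add (v : ℂ) (L M : LinForm P) :
    translate v (L + M) = translate v L + translate v M := by
  funext x
  cases x <;> simp only [translate, Pi.add_apply] <;> ring

lemma translate_neg (v : ℂ) (L : LinForm P) : translate v (-L) = -translate v L := by
  funext x
  cases x <;> simp only [translate, Pi.neg_apply] <;> ring

lemma translate_zero (v : ℂ) : translate v (0 : LinForm P) = 0 := by
  funext x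
  cases x <;> simp [translate]

lemma translate_translate (v w : ℂ) (L : LinForm P) :
    translate v (translate w L) = translate (v + w) L := by
  funext x
  cases x with
  | osc x n =>
    simp only [translate]
    rw [mul_assoc, ← Complex.exp_add]
    congr 2
    ring
  | qhat x => rfl
  | phat x => simp only [translate]; ring

lemma momentumShift_translate (v : ℂ) (L : LinForm P) :
    momentumShift (translate v L) = momentumShift L := rfl

lemma charge_translate (v : ℂ) (L : LinForm P) : charge (translate v L) = charge L := rfl

lemma phatPart_translate (v : ℂ) (L : LinForm P) (μ : Boson P → ℂ) :
    phatPart (translate v L) μ = phatPart L μ + v * charge L μ := by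
  simp only [phatPart, charge, translate, add_mul, Finset.sum_add_distrib, Finset.mul_sum]
  congr 1
  exact Finset.sum_congr rfl fun x _ => by ring

lemma symbol_congr {L M : LinForm P} (h : ∀ x n, L (.osc x n) = M (.osc x n))
    (m' m : Osc P →₀ ℕ) : symbol L m' m = symbol M m' m := by
  have h1 : expCreation L = expCreation M := by
    funext m
    simp only [expCreation, h]
  have h2 : expAnnihilation L = expAnnihilation M := by
    simp only [expAnnihilation, h]
  rw [symbol, symbol, h1, h2]

lemma translate_osc (v : ℂ) (L : LinForm P) (x : Boson P) (n : ℤ) :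
    translate v L (.osc x n) = scale (Complex.exp v) L (.osc x n) := by
  simp only [translate, scale]
  rw [← Complex.exp_int_mul]
  congr 2
  push_cast
  ring

lemma contraction_translate (v : ℂ) (L M : LinForm P) (n : ℕ) :
    contraction (translate v L) (translate v M) n = contraction L M n := by
  simp only [contraction, translate, Finset.mul_sum]
  refine Finset.sum_congr rfl fun y _ => Finset.sum_congr rfl fun x _ => ?_
  have : Complex.exp (-((-(n : ℤ) : ℤ) * v)) * Complex.exp (-((n : ℤ) * v)) = 1 := by
    rw [← Complex.exp_add]
    simp
  linear_combination M (.osc y (-(n : ℤ))) * L (.osc x n) * comm P x y n * this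

/-- The power of z in a matrix element is determined by the energy difference and the charge; all
dependence on z is this one exponential. -/
lemma vertex_translate {L : LinForm P} (v : ℂ) (b' b : Basis P) :
    vertex (translate v L) b' b
      = Complex.exp (v * (deg b'.2 - deg b.2 + charge L b.1.1)) * vertex L b' b := by
  rw [vertex_apply, vertex_apply, momentumShift_translate, phatPart_translate,
    symbol_congr (translate_osc v L), symbol_scale (Complex.exp_ne_zero v),
    ← Complex.exp_int_mul, Complex.exp_add, mul_add v, Complex.exp_add]
  split_ifs
  · push_cast
    rw [mul_comm v]
    rw [mul_comm v (_ - _)]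
    ring
  · simp

/-- The part of `:exp L:` which lowers the energy by `n`, up to the charge of `L`. -/
def selection (L : LinForm P) (n : ℤ) : Kernel P := fun b' b =>
  open Classical in
  if (deg b.2 : ℂ) = deg b'.2 + charge L b.1.1 + n then vertex L b' b else 0

lemma vertex_eq_zero {L : LinForm P} {b' b : Basis P}
    (h : b'.1.1 ≠ b.1.1 + momentumShift L) : vertex L b' b = 0 := by
  rw [vertex_apply, if_neg h]

/-- Given one outer state, the momentum of the other is fixed by the shift and its energy by the
selection rule, so finitely many monomials remain. -/
lemma isFinitary_selection {L : LinForm P} (hL : IsIntegral L) (n : ℤ) :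
    IsFinitary (selection L n) := by
  classical
  constructor
  · intro b'
    by_cases hμ : ∃ μ : Momentum P, b'.1.1 = μ.1 + momentumShift L
    · obtain ⟨μ, hμ⟩ := hμ
      obtain ⟨k, hk⟩ := hL.charge_int μ
      refine ((finite_deg_le (P := P) ((deg b'.2 + k + n).toNat)).image
        fun m => ((μ, m) : Basis P)).subset fun b hb => ?_
      have hb : selection L n b' b ≠ 0 := hb
      rw [selection] at hb
      split_ifs at hb with h1
      · have h2 : b'.1.1 = b.1.1 + momentumShift L := by
          by_contra h
          exact hb (vertex_eq_zero h)
        have h3 : b.1 = μ := Subtype.ext (add_right_cancel (h2.symm.trans hμ))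
        rw [h3, hk] at h1
        have h4 : (deg b.2 : ℤ) = deg b'.2 + k + n := by exact_mod_cast h1
        refine ⟨b.2, ?_, by rw [← h3]⟩
        change deg b.2 ≤ _
        omega
      · exact absurd rfl hb
    · refine Set.finite_empty.subset fun b hb => hμ ⟨b.1, ?_⟩
      have hb : selection L n b' b ≠ 0 := hb
      by_contra h
      apply hb
      rw [selection, vertex_eq_zero h, ite_self]
  · intro b
    obtain ⟨k, hk⟩ := hL.charge_int b.1
    refine ((finite_deg_le (P := P) ((deg b.2 - k - n).toNat)).image
        fun m => ((hL.balanced.shift b.1, m) : Basis P)).subset fun b' hb => ?_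
    have hb : selection L n b' b ≠ 0 := hb
    rw [selection] at hb
    split_ifs at hb with h1
    · have h2 : b'.1.1 = b.1.1 + momentumShift L := by
        by_contra h
        exact hb (vertex_eq_zero h)
      have h3 : hL.balanced.shift b.1 = b'.1 := Subtype.ext h2.symm
      rw [hk] at h1
      have h4 : (deg b.2 : ℤ) = deg b'.2 + k + n := by exact_mod_cast h1
      refine ⟨b'.2, ?_, by rw [h3]⟩
      change deg b'.2 ≤ _
      omega
    · exact absurd rfl hb

/-- Only one intermediate momentum contributes, and the selection rule fixes the intermediate energy
from the final one. The product is thus a zero mode factor times `gradedProd`. In the other order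
the intermediate energy is fixed from the initial state instead. -/
lemma selection_mul_vertex {L M : LinForm P} (hL : IsIntegral L) (hM : IsBalanced M) (n : ℤ)
    {b' b : Basis P} (hb : b'.1.1 = b.1.1 + momentumShift M + momentumShift L) {k : ℤ}
    (hk : charge L b.1.1 = k) :
    (selection L n).mul (vertex M) b' b = Complex.exp (phatPart L b.1.1 + phatPart M b.1.1) *
      (Complex.exp (phatPart L (momentumShift M)) *
        gradedProd L M b'.2 b.2 (deg b'.2 + k + n)) := by
  classical
  have hc : charge L (b.1.1 + momentumShift M) = k := by
    rw [charge_add_right, hL.charge_shift hM, hk, add_zero]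
  rw [Kernel.mul, gradedProd]
  have hsupp : ∀ c : Basis P, selection L n b' c * vertex M c b ≠ 0 →
      c.1 = hM.shift b.1 ∧ (deg c.2 : ℤ) = deg b'.2 + k + n := by
    intro c h
    have h1 : c.1.1 = b.1.1 + momentumShift M := by
      by_contra h'
      exact h (by rw [vertex_eq_zero h', mul_zero])
    refine ⟨Subtype.ext h1, ?_⟩
    by_contra h'
    refine h ?_
    rw [selection, if_neg, zero_mul]
    rw [h1, hc]
    exact fun h2 => h' (by exact_mod_cast h2)
  split_ifs with hD
  · rw [finsum_eq_sum_of_support_subset (s := (degFinset P (deg b'.2 + k + n).toNat).image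
      fun m => ((hM.shift b.1, m) : Basis P)), Finset.sum_image]
    · rw [Finset.mul_sum, Finset.mul_sum]
      refine Finset.sum_congr rfl fun m hm => ?_
      rw [mem_degFinset] at hm
      have hm' : (deg m : ℤ) = deg b'.2 + k + n := by omega
      rw [selection, if_pos, vertex_apply, if_pos, vertex_apply, if_pos, IsBalanced.shift,
        phatPart_add_right, Complex.exp_add, Complex.exp_add]
      · ring
      · rfl
      · exact hb
      · change (deg m : ℂ) = deg b'.2 + charge L (b.1.1 + momentumShift M) + n
        rw [hc]
        exact_mod_cast hm'
    · intro x _ y _ h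
      exact (Prod.ext_iff.1 h).2
    · intro c hc'
      obtain ⟨h1, h2⟩ := hsupp c hc'
      rw [Finset.coe_image]
      refine ⟨c.2, ?_, by rw [← h1]⟩
      rw [Finset.mem_coe, mem_degFinset]
      omega
  · rw [finsum_eq_zero_of_forall_eq_zero, mul_zero, mul_zero]
    intro c
    by_contra h
    have := (hsupp c h).2
    omega

lemma vertex_mul_selection {L M : LinForm P} (hL : IsIntegral L) (n : ℤ)
    {b' b : Basis P} (hb : b'.1.1 = b.1.1 + momentumShift M + momentumShift L) {k : ℤ}
    (hk : charge L b.1.1 = k) :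
    (vertex M).mul (selection L n) b' b = Complex.exp (phatPart L b.1.1 + phatPart M b.1.1) *
      (Complex.exp (phatPart M (momentumShift L)) *
        gradedProd M L b'.2 b.2 (deg b.2 - k - n)) := by
  classical
  rw [Kernel.mul, gradedProd]
  have hsupp : ∀ c : Basis P, vertex M b' c * selection L n c b ≠ 0 →
      c.1 = hL.balanced.shift b.1 ∧ (deg c.2 : ℤ) = deg b.2 - k - n := by
    intro c h
    have h1 : c.1.1 = b.1.1 + momentumShift L := by
      by_contra h'
      exact h (by rw [selection, vertex_eq_zero h', ite_self, mul_zero])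
    refine ⟨Subtype.ext h1, ?_⟩
    by_contra h'
    refine h ?_
    rw [selection, if_neg, mul_zero]
    rw [hk]
    intro h2
    have h3 : (deg b.2 : ℤ) = deg c.2 + k + n := by exact_mod_cast h2
    omega
  split_ifs with hD
  · rw [finsum_eq_sum_of_support_subset (s := (degFinset P (deg b.2 - k - n).toNat).image
      fun m => ((hL.balanced.shift b.1, m) : Basis P)), Finset.sum_image]
    · rw [Finset.mul_sum, Finset.mul_sum]
      refine Finset.sum_congr rfl fun m hm => ?_
      rw [mem_degFinset] at hm
      have hm' : (deg b.2 : ℤ) = deg m + k + n := by omega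
      rw [selection, if_pos, vertex_apply, if_pos, vertex_apply, if_pos, IsBalanced.shift,
        phatPart_add_right, Complex.exp_add, Complex.exp_add]
      · ring
      · rfl
      · change b'.1.1 = b.1.1 + momentumShift L + momentumShift M
        rw [hb]
        abel
      · rw [hk]
        exact_mod_cast hm'
    · intro x _ y _ h
      exact (Prod.ext_iff.1 h).2
    · intro c hc'
      obtain ⟨h1, h2⟩ := hsupp c hc'
      rw [Finset.coe_image]
      refine ⟨c.2, ?_, by rw [← h1]⟩
      rw [Finset.mem_coe, mem_degFinset]
      omega
  · rw [finsum_eq_zero_of_forall_eq_zero, mul_zero, mul_zero]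
    intro c
    by_contra h
    have := (hsupp c h).2
    omega

lemma selection_mul_vertex_eq_zero {L M : LinForm P} (n : ℤ)
    {b' b : Basis P} (hb : b'.1.1 ≠ b.1.1 + momentumShift M + momentumShift L) :
    (selection L n).mul (vertex M) b' b = 0 := by
  rw [Kernel.mul, finsum_eq_zero_of_forall_eq_zero]
  intro c
  by_cases h : c.1.1 = b.1.1 + momentumShift M
  · rw [selection, vertex_eq_zero (by rwa [h]), ite_self, zero_mul]
  · rw [vertex_eq_zero h, mul_zero]

lemma vertex_mul_selection_eq_zero {L M : LinForm P} (n : ℤ)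
    {b' b : Basis P} (hb : b'.1.1 ≠ b.1.1 + momentumShift M + momentumShift L) :
    (vertex M).mul (selection L n) b' b = 0 := by
  rw [Kernel.mul, finsum_eq_zero_of_forall_eq_zero]
  intro c
  by_cases h : c.1.1 = b.1.1 + momentumShift L
  · rw [vertex_eq_zero (by rwa [h, add_right_comm]), zero_mul]
  · rw [selection, vertex_eq_zero h, ite_self, mul_zero]

/-- The operator product of the fields `:exp L:` and `:exp M:` has at most a simple pole, at
`z = e^v w`, and the two orderings are expansions of the same rational function. -/
structure HasSimplePole (L M : LinForm P) (v w : ℂ) : Prop where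
  left : ∀ n : ℕ, 0 < n → n * contraction L M n = Complex.exp (n * v) - Complex.exp (n * w)
  right : ∀ n : ℕ, 0 < n →
    n * contraction M L n = Complex.exp (-(n * v)) - Complex.exp (-(n * w))
  zero : phatPart M (momentumShift L) = phatPart L (momentumShift M) + w - v

theorem selection_vertex_commutator {L M : LinForm P} (hL : IsIntegral L) (hM : IsBalanced M)
    {v w : ℂ} (h : HasSimplePole L M v w) (n : ℤ) :
    (selection L n).mul (vertex M) - (vertex M).mul (selection L n)
      = (Complex.exp (phatPart L (momentumShift M)) * (1 - Complex.exp (w - v)) *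
          Complex.exp (n * v)) • vertex (translate v L + M) := by
  funext b' b
  simp only [Pi.sub_apply, Pi.smul_apply, smul_eq_mul]
  have hs : momentumShift (translate v L + M) = momentumShift M + momentumShift L := by
    rw [momentumShift_add, momentumShift_translate, add_comm]
  by_cases hb : b'.1.1 = b.1.1 + momentumShift M + momentumShift L
  · obtain ⟨k, hk⟩ := hL.charge_int b.1
    -- The two intermediate energies add up to the sum of the outer energies, as required by
    -- `gradedProd_sub` with β = e^v and α = e^w.
    rw [selection_mul_vertex hL hM n hb hk, vertex_mul_selection hL n hb hk, vertex_apply,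
      hs, if_pos (by rw [hb, add_assoc]), phatPart_add_left, phatPart_translate, h.zero, hk]
    have hp := gradedProd_sub (L := L) (M := M) (α := Complex.exp w) (β := Complex.exp v)
      (Complex.exp_ne_zero _) (Complex.exp_ne_zero _)
      (fun n hn => by rw [h.left n hn, Complex.exp_nat_mul, Complex.exp_nat_mul])
      (fun n hn => by
        rw [h.right n hn, Complex.exp_neg, Complex.exp_neg, Complex.exp_nat_mul,
          Complex.exp_nat_mul, inv_pow, inv_pow]) b'.2 b.2 (deg b'.2 + k + n)
    have hsym : symbol (translate v L + M) b'.2 b.2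
        = symbol (scale (Complex.exp v) L + M) b'.2 b.2 :=
      symbol_congr (fun x n => by rw [Pi.add_apply, Pi.add_apply, translate_osc]) _ _
    rw [show (deg b'.2 + deg b.2 : ℤ) - (deg b'.2 + k + n) = deg b.2 - k - n by ring,
      show (deg b'.2 + k + n : ℤ) - deg b'.2 = k + n by ring, ← Complex.exp_int_mul,
      ← Complex.exp_sub, ← hsym] at hp
    -- The zero modes contribute an extra e^(w - v) in the reversed order, by `h.zero`. This is
    -- exactly the factor α/β with which the two oscillator products combine to a delta function.
    have e1 : Complex.exp (phatPart L (momentumShift M) + w - v)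
        = Complex.exp (phatPart L (momentumShift M)) * Complex.exp (w - v) := by
      rw [← Complex.exp_add]; congr 1; ring
    have e2 : Complex.exp (phatPart L b.1.1 + v * k + phatPart M b.1.1)
        * Complex.exp (n * v) = Complex.exp (phatPart L b.1.1 + phatPart M b.1.1) *
          Complex.exp (((k + n : ℤ) : ℂ) * v) := by
      rw [← Complex.exp_add, ← Complex.exp_add]; congr 1; push_cast; ring
    rw [e1]
    linear_combination Complex.exp (phatPart L b.1.1 + phatPart M b.1.1) *
      Complex.exp (phatPart L (momentumShift M)) * hp
      - Complex.exp (phatPart L (momentumShift M)) * (1 - Complex.exp (w - v)) *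
        symbol (translate v L + M) b'.2 b.2 * e2
  · rw [selection_mul_vertex_eq_zero n hb, vertex_mul_selection_eq_zero n hb,
      vertex_eq_zero (by rwa [hs, ← add_assoc])]
    simp

end Commutator

section Modes

variable {P : Params}

/-! ### Modes of currents -/

lemma integral_exp_int (m : ℤ) :
    ∫ θ in (0 : ℝ)..(2 * Real.pi), Complex.exp (m * (θ * Complex.I))
      = if m = 0 then 2 * (Real.pi : ℂ) else 0 := by
  split_ifs with h
  · simp [h]
  · have hc : (m * Complex.I : ℂ) ≠ 0 := mul_ne_zero (by exact_mod_cast h) Complex.I_ne_zero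
    have := integral_exp_mul_complex (a := 0) (b := 2 * Real.pi) hc
    simp only [mul_comm (_ : ℂ) Complex.I, ← mul_assoc] at this ⊢
    rw [mul_comm Complex.I] at this ⊢
    rw [this]
    have h1 : Complex.exp (m * Complex.I * ((2 * Real.pi : ℝ) : ℂ)) = 1 := by
      rw [← Complex.exp_int_mul_two_pi_mul_I m]
      congr 1
      push_cast
      ring
    rw [h1]
    simp

/-- `A(z)` is regular on the unit circle, and `B n` are the modes of `-1/((q-q⁻¹)z) A(z)`. -/
def HasModes (A : ℂ → Kernel P) (B : ℤ → Kernel P) : Prop :=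
  (∀ b' b, Continuous fun θ : ℝ => A (θ * Complex.I) b' b) ∧
    ∀ n, mode P (fun u => prefactor P u • A u) n = B n

lemma continuous_mode_integrand {A : ℂ → Kernel P}
    (hA : ∀ b' b, Continuous fun θ : ℝ => A (θ * Complex.I) b' b) (n : ℤ) (b' b : Basis P) :
    Continuous fun θ : ℝ => Complex.exp ((n + 1) * (θ * Complex.I)) *
      (prefactor P (θ * Complex.I) • A (θ * Complex.I)) b' b := by
  have h : (fun θ : ℝ => Complex.exp ((n + 1) * (θ * Complex.I)) *
      (prefactor P (θ * Complex.I) • A (θ * Complex.I)) b' b)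
      = fun θ : ℝ => -1 / P.qdiff * (Complex.exp (n * (θ * Complex.I)) *
        A (θ * Complex.I) b' b) := by
    funext θ
    simp only [prefactor, Pi.smul_apply, smul_eq_mul]
    rw [add_mul, one_mul, Complex.exp_add, ← div_div]
    field_simp [Complex.exp_ne_zero]
  rw [h]
  exact continuous_const.mul ((by fun_prop : Continuous fun θ : ℝ =>
    Complex.exp (n * (θ * Complex.I))).mul (hA b' b))

lemma HasModes.add {A A' : ℂ → Kernel P} {B B' : ℤ → Kernel P} (h : HasModes A B)
    (h' : HasModes A' B') : HasModes (fun u => A u + A' u) fun n => B n + B' n := by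
  refine ⟨fun b' b => (h.1 b' b).add (h'.1 b' b), fun n => ?_⟩
  beta_reduce
  funext b' b
  rw [← h.2 n, ← h'.2 n]
  simp only [Pi.add_apply, mode]
  rw [← mul_add, ← intervalIntegral.integral_add]
  · congr 2
    funext θ
    simp only [Pi.smul_apply, Pi.add_apply, smul_eq_mul]
    ring
  · exact (continuous_mode_integrand h.1 n b' b).intervalIntegrable _ _
  · exact (continuous_mode_integrand h'.1 n b' b).intervalIntegrable _ _

lemma HasModes.neg {A : ℂ → Kernel P} {B : ℤ → Kernel P} (h : HasModes A B) :
    HasModes (fun u => -A u) fun n => -B n := by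
  refine ⟨fun b' b => (h.1 b' b).neg, fun n => ?_⟩
  beta_reduce
  funext b' b
  rw [← h.2 n]
  simp only [Pi.neg_apply, mode, Pi.smul_apply, smul_eq_mul, mul_neg,
    intervalIntegral.integral_neg]

lemma HasModes.sub {A A' : ℂ → Kernel P} {B B' : ℤ → Kernel P} (h : HasModes A B)
    (h' : HasModes A' B') : HasModes (fun u => A u - A' u) fun n => B n - B' n := by
  simpa only [sub_eq_add_neg] using h.add h'.neg

lemma HasModes.zero : HasModes (fun _ => (0 : Kernel P)) fun _ => 0 := by
  refine ⟨fun _ _ => continuous_const, fun n => ?_⟩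
  funext b' b
  simp [mode]

lemma HasModes.sum {ι : Type*} (s : Finset ι) {A : ι → ℂ → Kernel P} {B : ι → ℤ → Kernel P}
    (h : ∀ i ∈ s, HasModes (A i) (B i)) :
    HasModes (fun u => ∑ i ∈ s, A i u) fun n => ∑ i ∈ s, B i n := by
  classical
  induction s using Finset.induction_on with
  | empty => simpa using HasModes.zero
  | insert i s hi ih =>
    simp only [Finset.sum_insert hi]
    exact (h i (by simp)).add (ih fun j hj => h j (by simp [hj]))

/-- Each matrix element is a single integral power of z, so the contour integral retains it or
annihilates it according to the selection rule. The prefactor supplies -1/(q - q⁻¹) and lowers the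
power by one, in agreement with the convention z^(-n-1). -/
lemma hasModes_vertex {L : LinForm P} (hL : IsIntegral L) :
    HasModes (fun u => vertex (translate u L)) fun n => (-1 / P.qdiff) • selection L n := by
  constructor
  · intro b' b
    simp only [vertex_translate]
    fun_prop
  · intro n
    funext b' b
    obtain ⟨k, hk⟩ := hL.charge_int b.1
    have h1 : ∀ θ : ℝ, Complex.exp ((n + 1) * (θ * Complex.I)) *
        (prefactor P (θ * Complex.I) • vertex (translate (θ * Complex.I) L)) b' b
        = (-1 / P.qdiff * vertex L b' b) *
          Complex.exp (((n + deg b'.2 - deg b.2 + k : ℤ) : ℂ) * (θ * Complex.I)) := by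
      intro θ
      simp only [prefactor, Pi.smul_apply, smul_eq_mul, vertex_translate, hk]
      have e : Complex.exp (((n + deg b'.2 - deg b.2 + k : ℤ) : ℂ) * (θ * Complex.I))
          = Complex.exp (n * (θ * Complex.I)) *
            Complex.exp (θ * Complex.I * (deg b'.2 - deg b.2 + k)) := by
        rw [← Complex.exp_add]; congr 1; push_cast; ring
      rw [e, add_mul (n : ℂ), one_mul, Complex.exp_add, ← div_div]
      field_simp [Complex.exp_ne_zero]
    simp only [mode, h1]
    rw [intervalIntegral.integral_const_mul, integral_exp_int]
    simp only [Pi.smul_apply, selection, smul_eq_mul]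
    have hiff : (n + deg b'.2 - deg b.2 + k : ℤ) = 0 ↔
        (deg b.2 : ℂ) = deg b'.2 + charge L b.1.1 + n := by
      rw [hk]
      constructor
      · intro h
        have : (deg b.2 : ℤ) = deg b'.2 + k + n := by omega
        exact_mod_cast this
      · intro h
        have : (deg b.2 : ℤ) = deg b'.2 + k + n := by exact_mod_cast h
        omega
    have hpi : (Real.pi : ℂ) ≠ 0 := by exact_mod_cast Real.pi_ne_zero
    by_cases h : (n + deg b'.2 - deg b.2 + k : ℤ) = 0
    · rw [if_pos h, if_pos (hiff.1 h)]
      field_simp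
    · rw [if_neg h, if_neg fun h' => h (hiff.2 h')]
      simp

/-- On the matrix elements kept by `selection` the translation factor is the constant e^(-nu). -/
lemma selection_eq_smul_translate (L : LinForm P) (n : ℤ) (u : ℂ) :
    selection L n = Complex.exp (n * u) • selection (translate u L) n := by
  funext b' b
  simp only [Pi.smul_apply, selection, smul_eq_mul]
  by_cases h : (deg b.2 : ℂ) = deg b'.2 + charge L b.1.1 + n
  · rw [if_pos h, if_pos (by rwa [charge_translate]), vertex_translate, ← mul_assoc, ← Complex.exp_add, h]
    have : n * u + u * (deg b'.2 - (deg b'.2 + charge L b.1.1 + n) + charge L b.1.1) = 0 := by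
      ring
    rw [this, Complex.exp_zero, one_mul]
  · rw [if_neg h, if_neg (by rwa [charge_translate]), mul_zero]

lemma IsIntegral.translate {L : LinForm P} (hL : IsIntegral L) (u : ℂ) :
    IsIntegral (translate u L) := ⟨hL.a, hL.balanced, hL.int⟩

/-- Pole and zero depend only on the ratio of the arguments: the oscillator contractions are
invariant under a common translation, and the changes of the zero mode parts vanish because the
mutual charges do. -/
lemma HasSimplePole.translate {L M : LinForm P} {v w : ℂ} (hL : IsIntegral L) (hM : IsBalanced M)
    (h : HasSimplePole L M v w) (hMa : charge M (momentumShift L) = 0) (u : ℂ) :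
    HasSimplePole (translate u L) (translate u M) v w := by
  constructor
  · intro n hn
    rw [contraction_translate, h.left n hn]
  · intro n hn
    rw [contraction_translate, h.right n hn]
  · rw [momentumShift_translate, momentumShift_translate, phatPart_translate, phatPart_translate,
      hMa, hL.charge_shift hM, h.zero]
    ring

/-- The commutator of the modes of `:exp L(z):` with `:exp M(e^u):`. -/
theorem selection_vertex_translate_commutator {L M : LinForm P} (hL : IsIntegral L)
    (hM : IsBalanced M) {v w : ℂ} (h : HasSimplePole L M v w) (n : ℤ) (u : ℂ) :
    (selection L n).mul (vertex (translate u M)) - (vertex (translate u M)).mul (selection L n)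
      = (Complex.exp (phatPart L (momentumShift M)) * (1 - Complex.exp (w - v)) *
          Complex.exp (n * (u + v))) • vertex (translate (u + v) L + translate u M) := by
  have hMa : charge M (momentumShift L) = 0 := by
    rw [charge, sum_boson]
    have : ∀ i, momentumShift L (.a i) = 0 := fun i => by simp [momentumShift_a, hL.a]
    simp only [this, momentumShift_b, momentumShift_c, hL.balanced _, hM _]
    simp
  have hc := selection_vertex_commutator (hL.translate u) (M := FreeBoson.translate u M) hM
    (h.translate hL hM hMa u) n
  rw [selection_eq_smul_translate L n u, smul_mul, mul_smul, ← smul_sub, hc, smul_smul,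
    translate_translate, add_comm v u, momentumShift_translate, phatPart_translate,
    hL.charge_shift hM, mul_zero, add_zero, mul_add, Complex.exp_add (n * u)]
  congr 1
  ring

end Modes

section Oscillators

variable {P : Params}

/-! ### Commutators of the oscillators with exponentials -/

lemma oscKernel_pos (x : Boson P) (n : ℕ) (b' b : Basis P) :
    oscKernel P x (n + 1 : ℤ) b' b = if b'.1 = b.1 then
      ∑ y : Boson P, comm P x y (n + 1) *
        MvPolynomial.coeff b'.2 (MvPolynomial.pderiv (y, n.succPNat)
          (MvPolynomial.monomial b.2 1)) else 0 := by
  have : (n + 1 : ℤ) = Int.ofNat (n + 1) := rfl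
  rw [oscKernel, this]
  congr 1
  simp only [oscOp, LinearMap.sum_apply, LinearMap.smul_apply, MvPolynomial.coeff_sum,
    MvPolynomial.coeff_smul, smul_eq_mul]
  rfl

lemma oscKernel_neg (x : Boson P) (n : ℕ) (b' b : Basis P) :
    oscKernel P x (-(n + 1 : ℤ)) b' b = if b'.1 = b.1 then
      MvPolynomial.coeff b'.2 (MvPolynomial.X (x, n.succPNat) * MvPolynomial.monomial b.2 1)
      else 0 := by
  have : (-(n + 1 : ℤ)) = Int.negSucc n := rfl
  rw [oscKernel, this]
  rfl

lemma coeff_pderiv_monomial (o : Osc P) (m' m : Osc P →₀ ℕ) :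
    MvPolynomial.coeff m' (MvPolynomial.pderiv o (MvPolynomial.monomial m (1 : ℂ)))
      = if m = m' + Finsupp.single o 1 then (m' o + 1 : ℂ) else 0 := by
  classical
  have h := congrArg (MvPowerSeries.coeff m')
    (MvPowerSeries.pderiv_coe (i := o) (MvPolynomial.monomial m (1 : ℂ)))
  rw [MvPolynomial.coeff_coe, MvPowerSeries.coeff_pderiv, MvPolynomial.coeff_coe,
    MvPolynomial.coeff_monomial] at h
  rw [← h, ite_mul, one_mul, zero_mul]

lemma coeff_X_mul_monomial (o : Osc P) (m' m : Osc P →₀ ℕ) :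
    MvPolynomial.coeff m' (MvPolynomial.X o * MvPolynomial.monomial m (1 : ℂ))
      = if m' = m + Finsupp.single o 1 then 1 else 0 := by
  classical
  rw [MvPolynomial.X, MvPolynomial.monomial_mul, one_mul, MvPolynomial.coeff_monomial]
  rw [add_comm]
  exact if_congr eq_comm rfl rfl

lemma isFinitary_oscKernel (x : Boson P) {n : ℤ} (hn : n ≠ 0) : IsFinitary (oscKernel P x n) := by
  classical
  have key : ∀ b' b : Basis P, oscKernel P x n b' b ≠ 0 →
      b'.1 = b.1 ∧ (deg b.2 : ℤ) = deg b'.2 + n := by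
    intro b' b h
    rcases lt_or_gt_of_ne hn with h0 | h0
    · obtain ⟨k, rfl⟩ : ∃ k : ℕ, n = -(k + 1 : ℤ) := ⟨(-n - 1).toNat, by omega⟩
      rw [oscKernel_neg] at h
      split_ifs at h with h1
      · refine ⟨h1, ?_⟩
        rw [coeff_X_mul_monomial] at h
        split_ifs at h with h2
        · rw [h2, map_add, deg_single]
          push_cast [Nat.succPNat_coe]
          ring
        · exact absurd rfl h
      · exact absurd rfl h
    · obtain ⟨k, rfl⟩ : ∃ k : ℕ, n = (k + 1 : ℤ) := ⟨(n - 1).toNat, by omega⟩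
      rw [oscKernel_pos] at h
      split_ifs at h with h1
      · refine ⟨h1, ?_⟩
        obtain ⟨y, -, hy⟩ := Finset.exists_ne_zero_of_sum_ne_zero h
        rw [coeff_pderiv_monomial] at hy
        split_ifs at hy with h2
        · rw [h2, map_add, deg_single]
          push_cast [Nat.succPNat_coe]
          ring
        · exact absurd (mul_zero _) hy
      · exact absurd rfl h
  constructor
  · intro b'
    refine ((finite_deg_le (P := P) ((deg b'.2 + n).toNat)).image
      fun m => ((b'.1, m) : Basis P)).subset fun b hb => ?_
    obtain ⟨h1, h2⟩ := key b' b hb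
    refine ⟨b.2, ?_, by rw [h1]⟩
    change deg b.2 ≤ _
    omega
  · intro b
    refine ((finite_deg_le (P := P) ((deg b.2 - n).toNat)).image
      fun m => ((b.1, m) : Basis P)).subset fun b' hb => ?_
    obtain ⟨h1, h2⟩ := key b' b hb
    refine ⟨b'.2, ?_, by rw [← h1]⟩
    change deg b'.2 ≤ _
    omega

lemma sum_coeff_mul_symbol (M : LinForm P) (p : Fock P) (m' : Osc P →₀ ℕ)
    {s : Finset (Osc P →₀ ℕ)} (hs : p.support ⊆ s) :
    ∑ c ∈ s, symbol M m' c * MvPolynomial.coeff c p = MvPowerSeries.coeff m'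
      (expCreation M * (expAnnihilation M p : MvPowerSeries (Osc P) ℂ)) := by
  have h (c : Osc P →₀ ℕ) (r : ℂ) : (MvPolynomial.monomial c r : Fock P)
      = MvPolynomial.C r * MvPolynomial.monomial c 1 := by
    rw [MvPolynomial.C_mul_monomial, mul_one]
  have hp : p = ∑ c ∈ s, MvPolynomial.monomial c (MvPolynomial.coeff c p) := by
    conv_lhs => rw [p.as_sum]
    refine Finset.sum_subset hs fun c _ hc => ?_
    rw [MvPolynomial.notMem_support_iff.1 hc, MvPolynomial.monomial_zero]
  conv_rhs => rw [hp]
  rw [map_sum, coe_sum_fock, Finset.mul_sum, map_sum]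
  refine Finset.sum_congr rfl fun c _ => ?_
  rw [h, map_mul (expAnnihilation M), MvPolynomial.algHom_C, MvPolynomial.algebraMap_eq,
    MvPolynomial.coe_mul, MvPolynomial.coe_C, mul_left_comm, MvPowerSeries.coeff_C_mul, mul_comm]
  rfl

open Classical in
/-- The operator on all Fock spaces given by one operator on the polynomials. -/
def liftKernel (T : Fock P →ₗ[ℂ] Fock P) : Kernel P := fun b' b =>
  if b'.1 = b.1 then MvPolynomial.coeff b'.2 (T (MvPolynomial.monomial b.2 1)) else 0

/-- The image of a monomial under `T` is a polynomial, so the product with the exponential is a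
finite sum and can be computed by applying the exponential to this polynomial. -/
lemma vertex_mul_liftKernel (M : LinForm P) (T : Fock P →ₗ[ℂ] Fock P) (b' b : Basis P) :
    (vertex M).mul (liftKernel T) b' b = if b'.1.1 = b.1.1 + momentumShift M then
      Complex.exp (phatPart M b.1.1) * MvPowerSeries.coeff b'.2 (expCreation M *
        (expAnnihilation M (T (MvPolynomial.monomial b.2 1)) : MvPowerSeries (Osc P) ℂ)) else 0 := by
  classical
  rw [Kernel.mul, finsum_eq_sum_of_support_subset
    (s := (T (MvPolynomial.monomial b.2 1)).support.image fun m => ((b.1, m) : Basis P)),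
    Finset.sum_image]
  · simp only [vertex_apply, liftKernel, if_true]
    split_ifs with h
    · rw [← sum_coeff_mul_symbol M _ b'.2 (Finset.Subset.refl _), Finset.mul_sum]
      exact Finset.sum_congr rfl fun c _ => by ring
    · simp
  · intro x _ y _ h
    exact (Prod.ext_iff.1 h).2
  · intro c hc
    have hc : vertex M b' c * liftKernel T c b ≠ 0 := hc
    have h1 := right_ne_zero_of_mul hc
    rw [liftKernel] at h1
    split_ifs at h1 with h2
    · rw [Finset.coe_image]
      exact ⟨c.2, by simpa using h1, by rw [← h2]⟩
    · exact absurd rfl h1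

/-- Translations commute with partial derivatives. -/
lemma expAnnihilation_pderiv (M : LinForm P) (o : Osc P) (p : Fock P) :
    expAnnihilation M (MvPolynomial.pderiv o p) = MvPolynomial.pderiv o (expAnnihilation M p) := by
  classical
  induction p using MvPolynomial.induction_on with
  | C a => simp [MvPolynomial.algHom_C, MvPolynomial.algebraMap_eq]
  | add p q hp hq => simp only [map_add, hp, hq]
  | mul_X p i hp =>
    rw [Derivation.leibniz, map_add, map_mul, Derivation.leibniz, smul_eq_mul, smul_eq_mul,
      smul_eq_mul, smul_eq_mul, map_mul, map_mul, hp, expAnnihilation_X, MvPolynomial.pderiv_X,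
      map_add, MvPolynomial.pderiv_C, add_zero, MvPolynomial.pderiv_X]
    congr 2
    by_cases h : i = o
    · subst h; simp
    · simp [Pi.single_eq_of_ne h]

/-- An annihilation mode is a derivation commuting with the translation part of the exponential. By
the Leibniz rule only its action on the creation part remains, which is multiplication by a scalar.
-/
theorem oscKernel_pos_commutator (x : Boson P) (n : ℕ) (M : LinForm P) :
    (oscKernel P x (n + 1 : ℤ)).mul (vertex M) - (vertex M).mul (oscKernel P x (n + 1 : ℤ))
      = (∑ y : Boson P, comm P x y (n + 1) * M (.osc y (-(n + 1 : ℤ)))) • vertex M := by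
  classical
  funext b' b
  simp only [Pi.sub_apply, Pi.smul_apply, smul_eq_mul]
  have hl : oscKernel P x (n + 1 : ℤ) = liftKernel (∑ y : Boson P, comm P x y (n + 1) •
      (MvPolynomial.pderiv (y, n.succPNat)).toLinearMap) := rfl
  have h1 : (oscKernel P x (n + 1 : ℤ)).mul (vertex M) b' b
      = ∑ y : Boson P, comm P x y (n + 1) * ((b'.2 (y, n.succPNat) + 1 : ℂ) *
          vertex M (b'.1, b'.2 + Finsupp.single (y, n.succPNat) 1) b) := by
    rw [Kernel.mul]
    simp only [oscKernel_pos, coeff_pderiv_monomial]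
    rw [finsum_eq_sum_of_support_subset (s := Finset.univ.image fun y : Boson P =>
      ((b'.1, b'.2 + Finsupp.single (y, n.succPNat) 1) : Basis P)), Finset.sum_image]
    · refine Finset.sum_congr rfl fun y _ => ?_
      rw [if_pos rfl, Finset.sum_eq_single y]
      · rw [if_pos rfl]; ring
      · intro z _ hz
        rw [if_neg, mul_zero]
        intro h
        have := Finsupp.single_left_injective one_ne_zero (add_left_cancel h)
        exact hz (Prod.ext_iff.1 this).1.symm
      · simp
    · intro y _ z _ h
      have := Finsupp.single_left_injective one_ne_zero (add_left_cancel (Prod.ext_iff.1 h).2)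
      exact (Prod.ext_iff.1 this).1
    · intro c hc
      have hc' := left_ne_zero_of_mul (show _ * _ ≠ (0 : ℂ) from hc)
      split_ifs at hc' with h1
      · obtain ⟨y, -, hy⟩ := Finset.exists_ne_zero_of_sum_ne_zero hc'
        split_ifs at hy with h2
        · rw [Finset.coe_image]
          exact ⟨y, by simp, by beta_reduce; rw [h1, ← h2]⟩
        · exact absurd (mul_zero _) hy
      · exact absurd rfl hc'
  rw [h1, hl, vertex_mul_liftKernel]
  simp only [vertex_apply]
  split_ifs with h
  · simp only [LinearMap.sum_apply, LinearMap.smul_apply, map_sum, map_smul, coe_sum_fock,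
      Finset.mul_sum, Finset.sum_mul, ← Finset.sum_sub_distrib]
    refine Finset.sum_congr rfl fun y _ => ?_
    have h3 : (b'.2 (y, n.succPNat) + 1 : ℂ) *
        symbol M (b'.2 + Finsupp.single (y, n.succPNat) 1) b.2
        = MvPowerSeries.coeff b'.2 (MvPowerSeries.pderiv ℂ (y, n.succPNat) (expCreation M *
          (expAnnihilation M (MvPolynomial.monomial b.2 1) : MvPowerSeries (Osc P) ℂ))) := by
      rw [MvPowerSeries.coeff_pderiv, mul_comm]
      rfl
    have h4 : MvPowerSeries.pderiv ℂ (y, n.succPNat) (expCreation M *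
          (expAnnihilation M (MvPolynomial.monomial b.2 1) : MvPowerSeries (Osc P) ℂ))
        = expCreation M * ((expAnnihilation M (MvPolynomial.pderiv (y, n.succPNat)
            (MvPolynomial.monomial b.2 1)) : Fock P) : MvPowerSeries (Osc P) ℂ)
          + MvPowerSeries.C (M (.osc y (-(n + 1 : ℤ)))) * (expCreation M *
          (expAnnihilation M (MvPolynomial.monomial b.2 1) : MvPowerSeries (Osc P) ℂ)) := by
      rw [Derivation.leibniz, MvPowerSeries.pderiv_coe, pderiv_expCreation,
        expAnnihilation_pderiv, smul_eq_mul, smul_eq_mul, MvPowerSeries.smul_eq_C_mul]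
      simp only [Nat.succPNat_coe, Nat.succ_eq_add_one, Nat.cast_add, Nat.cast_one]
      ring
    rw [h4, map_add, MvPowerSeries.coeff_C_mul] at h3
    have h5 : ((comm P x y (n + 1) • (expAnnihilation M) ((MvPolynomial.pderiv (y, n.succPNat))
          ((MvPolynomial.monomial b.2) (1 : ℂ))) : Fock P) : MvPowerSeries (Osc P) ℂ)
        = MvPowerSeries.C (comm P x y (n + 1)) * ((expAnnihilation M
          ((MvPolynomial.pderiv (y, n.succPNat)) ((MvPolynomial.monomial b.2) (1 : ℂ))) : Fock P) :
            MvPowerSeries (Osc P) ℂ) := by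
      rw [MvPolynomial.smul_eq_C_mul, MvPolynomial.coe_mul, MvPolynomial.coe_C]
    change _ - Complex.exp (phatPart M b.1.1) * MvPowerSeries.coeff b'.2 (expCreation M *
      ((comm P x y (n + 1) • (expAnnihilation M) ((MvPolynomial.pderiv (y, n.succPNat))
          ((MvPolynomial.monomial b.2) (1 : ℂ))) : Fock P) : MvPowerSeries (Osc P) ℂ)) = _
    rw [h5, mul_left_comm (expCreation M), MvPowerSeries.coeff_C_mul]
    rw [symbol] at h3 ⊢
    rw [symbol]
    linear_combination comm P x y (n + 1) * Complex.exp (phatPart M b.1.1) * h3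
  · simp

/-- Multiplication by a variable commutes with the creation part; moving it through the translation
adds the constant by which that variable is translated. -/
theorem oscKernel_neg_commutator (x : Boson P) (n : ℕ) (M : LinForm P) :
    (oscKernel P x (-(n + 1 : ℤ))).mul (vertex M) - (vertex M).mul (oscKernel P x (-(n + 1 : ℤ)))
      = (-transl M (x, n.succPNat)) • vertex M := by
  classical
  funext b' b
  simp only [Pi.sub_apply, Pi.smul_apply, smul_eq_mul]
  have hl : oscKernel P x (-(n + 1 : ℤ))
      = liftKernel (LinearMap.mulLeft ℂ (MvPolynomial.X (x, n.succPNat))) := rfl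
  set o : Osc P := (x, n.succPNat) with ho
  -- A monomial is hit by multiplication by `X o` from at most one monomial, which exists exactly if
  -- `o` occurs in it.
  have h1 : (oscKernel P x (-(n + 1 : ℤ))).mul (vertex M) b' b
      = if o ∈ b'.2.support then vertex M (b'.1, b'.2 - Finsupp.single o 1) b else 0 := by
    rw [Kernel.mul]
    simp only [oscKernel_neg, coeff_X_mul_monomial]
    rw [finsum_eq_single _ ((b'.1, b'.2 - Finsupp.single o 1) : Basis P)]
    · rw [if_pos rfl]
      split_ifs with h2 h3 h3
      · rw [one_mul]
      · exfalso
        apply h3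
        rw [h2, ← ho]
        simp
      · exfalso
        apply h2
        rw [tsub_add_cancel_of_le]
        rw [Finsupp.single_le_iff]
        have := Finsupp.mem_support_iff.1 h3
        omega
      · rw [zero_mul]
    · intro c hc
      split_ifs with h2 h3
      · exfalso
        apply hc
        rw [h3, add_tsub_cancel_right, h2]
      · rw [zero_mul]
      · rw [zero_mul]
  rw [h1, hl, vertex_mul_liftKernel]
  simp only [vertex_apply]
  by_cases h : b'.1.1 = b.1.1 + momentumShift M
  · simp only [if_pos h, LinearMap.mulLeft_apply]
    rw [map_mul (expAnnihilation M), expAnnihilation_X, MvPolynomial.coe_mul, MvPolynomial.coe_add, MvPolynomial.coe_C]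
    have h3 : (if o ∈ b'.2.support then Complex.exp (phatPart M b.1.1) *
        symbol M (b'.2 - Finsupp.single o 1) b.2 else 0) = Complex.exp (phatPart M b.1.1) *
        MvPowerSeries.coeff b'.2 (expCreation M * (((MvPolynomial.X o : Fock P) :
          MvPowerSeries (Osc P) ℂ) *
          (expAnnihilation M (MvPolynomial.monomial b.2 1) : MvPowerSeries (Osc P) ℂ))) := by
      rw [mul_left_comm (expCreation M), MvPolynomial.coe_X, MvPowerSeries.X,
        MvPowerSeries.coeff_monomial_mul, one_mul]
      have hiff : Finsupp.single o 1 ≤ b'.2 ↔ o ∈ b'.2.support := by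
        rw [Finsupp.single_le_iff, Finsupp.mem_support_iff]
        omega
      simp only [hiff, symbol, mul_ite, mul_zero]
    rw [h3, add_mul, mul_add, map_add, mul_left_comm (expCreation M) (MvPowerSeries.C _),
      MvPowerSeries.coeff_C_mul]
    rw [symbol]
    ring
  · simp [if_neg h]

/-! ### Heisenberg generators -/

/-- The operator `∑_x L(x_n) x_n` for fixed `n`. -/
def oscPart (L : LinForm P) (n : ℤ) : Kernel P := ∑ x : Boson P, L (.osc x n) • oscKernel P x n

lemma oscPart_add (L M : LinForm P) (n : ℤ) : oscPart (L + M) n = oscPart L n + oscPart M n := by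
  simp [oscPart, add_smul, Finset.sum_add_distrib]

lemma oscPart_sub (L M : LinForm P) (n : ℤ) : oscPart (L - M) n = oscPart L n - oscPart M n := by
  simp [oscPart, sub_smul, Finset.sum_sub_distrib]

lemma oscPart_zero (n : ℤ) : oscPart (0 : LinForm P) n = 0 := by simp [oscPart]

lemma oscPart_sum {ι : Type*} (s : Finset ι) (L : ι → LinForm P) (n : ℤ) :
    oscPart (∑ i ∈ s, L i) n = ∑ i ∈ s, oscPart (L i) n := by
  classical
  induction s using Finset.induction_on with
  | empty => simp [oscPart_zero]
  | insert i s hi ih => rw [Finset.sum_insert hi, Finset.sum_insert hi, oscPart_add, ih]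

lemma isFinitary_oscPart (L : LinForm P) {n : ℤ} (hn : n ≠ 0) : IsFinitary (oscPart L n) :=
  IsFinitary.sum _ fun x _ => (isFinitary_oscKernel x hn).smul _

lemma oscPart_mul_vertex_eq (L M : LinForm P) {n : ℤ} (hn : n ≠ 0) :
    (oscPart L n).mul (vertex M) - (vertex M).mul (oscPart L n)
      = ∑ x : Boson P, L (.osc x n) • ((oscKernel P x n).mul (vertex M)
          - (vertex M).mul (oscKernel P x n)) := by
  rw [oscPart, IsFinitary.sum_mul _ fun x _ => (isFinitary_oscKernel x hn).smul _,
    IsFinitary.mul_sum' _ fun x _ => (isFinitary_oscKernel x hn).smul _]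
  simp only [smul_mul, mul_smul, smul_sub, Finset.sum_sub_distrib]

/-- The commutator is the scalar `contraction L M n` times the exponential, so commutativity is a
statement about one number. -/
theorem oscPart_pos_commute {L M : LinForm P} {n : ℕ} (hn : 0 < n)
    (h : contraction L M n = 0) : (oscPart L n).mul (vertex M) = (vertex M).mul (oscPart L n) := by
  obtain ⟨k, rfl⟩ : ∃ k, n = k + 1 := ⟨n - 1, by omega⟩
  rw [← sub_eq_zero, oscPart_mul_vertex_eq _ _ (by exact_mod_cast hn.ne')]
  push_cast
  simp only [oscKernel_pos_commutator, smul_smul, ← Finset.sum_smul]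
  have : ∑ x : Boson P, L (.osc x (k + 1 : ℤ)) *
      ∑ y : Boson P, comm P x y (k + 1) * M (.osc y (-(k + 1 : ℤ))) = contraction L M (k + 1) := by
    simp only [contraction, Finset.mul_sum]
    rw [Finset.sum_comm]
    push_cast
    exact Finset.sum_congr rfl fun y _ => Finset.sum_congr rfl fun x _ => by ring
  rw [this, h, zero_smul]

theorem oscPart_neg_commute {L M : LinForm P} {n : ℕ} (hn : 0 < n)
    (h : contraction M L n = 0) :
    (oscPart L (-n)).mul (vertex M) = (vertex M).mul (oscPart L (-n)) := by
  obtain ⟨k, rfl⟩ : ∃ k, n = k + 1 := ⟨n - 1, by omega⟩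
  rw [← sub_eq_zero, oscPart_mul_vertex_eq _ _ (by omega)]
  push_cast
  simp only [oscKernel_neg_commutator, smul_smul, ← Finset.sum_smul]
  have : ∑ x : Boson P, L (.osc x (-(k + 1 : ℤ))) * -transl M (x, k.succPNat)
      = -contraction M L (k + 1) := by
    simp only [contraction, transl, mul_neg, Finset.sum_neg_distrib, Nat.succPNat_coe,
      Nat.succ_eq_add_one]
    push_cast
    rfl
  rw [this, h, neg_zero, zero_smul]

end Oscillators

section Numbers

variable {P : Params}

/-! ### `q`-numbers -/

lemma qpow_add (x y : ℂ) : P.qpow (x + y) = P.qpow x * P.qpow y := by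
  rw [Params.qpow, Params.qpow, Params.qpow, ← Complex.exp_add, add_mul]

lemma qpow_neg (x : ℂ) : P.qpow (-x) = (P.qpow x)⁻¹ := by
  rw [Params.qpow, Params.qpow, ← Complex.exp_neg, neg_mul]

lemma qpow_ne_zero (x : ℂ) : P.qpow x ≠ 0 := Complex.exp_ne_zero _

lemma qpow_natCast_mul (n : ℕ) (x : ℂ) : P.qpow (n * x) = P.qpow x ^ n := by
  rw [Params.qpow, Params.qpow, ← Complex.exp_nat_mul, mul_assoc]

/-- The conditions `|q| < 1` and `|p| < 1`. -/
structure IsContracting (P : Params) : Prop where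
  q : ‖P.qpow 1‖ < 1
  p : ‖P.qpow (2 * P.kg)‖ < 1

/-- Equality of q^(xn) and q^(-xn) would make the n-th power of q^(2x) equal to 1, against its
modulus being less than 1. With x = 1 and x = k + g this makes all the denominators [n] and [(k+g)n]
nonzero. -/
lemma sub_qpow_ne_zero {x : ℂ} (hx : ‖P.qpow (2 * x)‖ < 1) {n : ℕ} (hn : 0 < n) :
    P.qpow (x * n) - P.qpow (-(x * n)) ≠ 0 := by
  intro h
  have h1 : P.qpow (2 * x) ^ n = 1 := by
    rw [← qpow_natCast_mul, show (n : ℂ) * (2 * x) = x * n + x * n by ring, qpow_add]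
    have h2 : P.qpow (x * n) = (P.qpow (x * n))⁻¹ := by rw [← qpow_neg]; exact sub_eq_zero.1 h
    nth_rw 2 [h2]
    exact mul_inv_cancel₀ (qpow_ne_zero _)
  have h3 := pow_lt_one₀ (norm_nonneg _) hx hn.ne'
  rw [← norm_pow, h1, norm_one] at h3
  exact lt_irrefl _ h3

lemma IsContracting.norm_sq (hP : IsContracting P) : ‖P.qpow (2 * 1)‖ < 1 := by
  rw [show (2 * 1 : ℂ) = 1 + 1 by norm_num, qpow_add, norm_mul]
  exact mul_lt_one_of_nonneg_of_lt_one_left (norm_nonneg _) hP.q hP.q.le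

lemma IsContracting.qdiff_ne_zero (hP : IsContracting P) : P.qdiff ≠ 0 := by
  have := sub_qpow_ne_zero hP.norm_sq one_pos
  simpa [Params.qdiff] using this

lemma IsContracting.br_ne_zero (hP : IsContracting P) {n : ℕ} (hn : 0 < n) : P.br n ≠ 0 := by
  have := sub_qpow_ne_zero hP.norm_sq hn
  rw [one_mul] at this
  exact div_ne_zero this hP.qdiff_ne_zero

lemma IsContracting.br_kg_ne_zero (hP : IsContracting P) {n : ℕ} (hn : 0 < n) :
    P.br (P.kg * n) ≠ 0 :=
  div_ne_zero (sub_qpow_ne_zero hP.p hn) hP.qdiff_ne_zero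

lemma IsContracting.logq_ne_zero (hP : IsContracting P) : P.logq ≠ 0 := by
  intro h
  have := hP.q
  simp [Params.qpow, h] at this

lemma IsContracting.kg_ne_zero (hP : IsContracting P) : P.kg ≠ 0 := by
  intro h
  have := hP.p
  simp [Params.qpow, h] at this

lemma br_neg (x : ℂ) : P.br (-x) = -P.br x := by
  rw [Params.br, Params.br, neg_neg, ← neg_div, neg_sub]

lemma IsContracting.br_mul_qdiff (hP : IsContracting P) (x : ℂ) :
    P.br x * P.qdiff = P.qpow x - P.qpow (-x) := div_mul_cancel₀ _ hP.qdiff_ne_zero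

/-- `q ^ (n x)`. -/
def qexp (P : Params) (n : ℕ) (x : ℂ) : ℂ := Complex.exp (n * (x * P.logq))

lemma qexp_add (n : ℕ) (x y : ℂ) : qexp P n (x + y) = qexp P n x * qexp P n y := by
  rw [qexp, qexp, qexp, ← Complex.exp_add]; ring_nf

lemma qexp_neg (n : ℕ) (x : ℂ) : qexp P n (-x) = (qexp P n x)⁻¹ := by
  rw [qexp, qexp, ← Complex.exp_neg]; ring_nf

lemma qexp_sub (n : ℕ) (x y : ℂ) : qexp P n (x - y) = qexp P n x / qexp P n y := by
  rw [sub_eq_add_neg, qexp_add, qexp_neg, div_eq_mul_inv]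

lemma qexp_two (n : ℕ) : qexp P n 2 = qexp P n 1 ^ 2 := by
  rw [show (2 : ℂ) = 1 + 1 by norm_num, qexp_add, sq]

lemma qexp_two_mul (n : ℕ) (x : ℂ) : qexp P n (2 * x) = qexp P n x ^ 2 := by
  rw [two_mul, qexp_add, sq]

lemma qexp_ne_zero (n : ℕ) (x : ℂ) : qexp P n x ≠ 0 := Complex.exp_ne_zero _

lemma qpow_eq_qexp (n : ℕ) (x : ℂ) : P.qpow (x * n) = qexp P n x := by
  rw [Params.qpow, qexp]; ring_nf

end Numbers

section Atoms

variable {P : Params}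

/-! ### Fields attached to pairs `i < j` -/

/-- The membership condition of `Root`. -/
abbrev rootSet (P : Params) : Finset (ℕ × ℕ) :=
  (Finset.Icc 1 P.N ×ˢ Finset.Icc 1 P.N).filter fun ij => ij.1 < ij.2

lemma mem_rootSet {r s : ℕ} : (r, s) ∈ rootSet P ↔ 1 ≤ r ∧ r < s ∧ s ≤ P.N := by
  simp only [rootSet, Finset.mem_filter, Finset.mem_product, Finset.mem_Icc]
  omega

/-- `F` at the pair `(r, s)`, and zero if this is not a pair with `r < s`. -/
def atRoot {A : Type*} [Zero A] (F : Root P → A) (r s : ℕ) : A :=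
  if h : (r, s) ∈ rootSet P then F ⟨(r, s), h⟩ else 0

lemma atRoot_map {A B : Type*} [Zero A] [Zero B] (T : A → B) (hT : T 0 = 0) (F : Root P → A)
    (r s : ℕ) : T (atRoot F r s) = atRoot (fun ρ => T (F ρ)) r s := by
  unfold atRoot
  split_ifs <;> simp [hT]

lemma atRoot_apply (F : Root P → LinForm P) (r s : ℕ) (x : Mode P) :
    atRoot F r s x = atRoot (fun ρ => F ρ x) r s := atRoot_map (fun L : LinForm P => L x) rfl F r s

lemma atRoot_const (v : ℂ) (r s : ℕ) :
    atRoot (P := P) (fun _ => v) r s = if 1 ≤ r ∧ r < s ∧ s ≤ P.N then v else 0 := by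
  unfold atRoot
  by_cases h : (r, s) ∈ rootSet P
  · rw [dif_pos h, if_pos (mem_rootSet.1 h)]
  · rw [dif_neg h, if_neg fun h' => h (mem_rootSet.2 h')]

lemma atRoot_mul_const (f : Root P → ℂ) (v : ℂ) (r s : ℕ) :
    atRoot (fun ρ => f ρ * v) r s = atRoot f r s * v :=
  (atRoot_map (fun x => x * v) (zero_mul v) f r s).symm

lemma atRoot_const_mul (f : Root P → ℂ) (v : ℂ) (r s : ℕ) :
    atRoot (fun ρ => v * f ρ) r s = v * atRoot f r s :=
  (atRoot_map (fun x => v * x) (mul_zero v) f r s).symm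

lemma atRoot_add {A : Type*} [AddMonoid A] (F G : Root P → A) (r s : ℕ) :
    atRoot (fun ρ => F ρ + G ρ) r s = atRoot F r s + atRoot G r s := by
  unfold atRoot
  split_ifs <;> simp

lemma atRoot_sub {A : Type*} [AddGroup A] (F G : Root P → A) (r s : ℕ) :
    atRoot (fun ρ => F ρ - G ρ) r s = atRoot F r s - atRoot G r s := by
  unfold atRoot
  split_ifs <;> simp

lemma atRoot_neg {A : Type*} [AddGroup A] (F : Root P → A) (r s : ℕ) :
    atRoot (fun ρ => -F ρ) r s = -atRoot F r s := by
  unfold atRoot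
  split_ifs <;> simp

/-- `b^{ij}(q^α z; σ)`, zero for `i = j`. -/
def bHat (P : Params) (r s : ℕ) (σ α u : ℂ) : LinForm P :=
  atRoot (fun ρ => field 1 1 (.b ρ) σ (u + α * P.logq)) r s

/-- `c^{ij}(q^α z)`, zero for `i = j`. -/
def cHat (P : Params) (r s : ℕ) (α u : ℂ) : LinForm P :=
  atRoot (fun ρ => field 1 1 (.c ρ) 0 (u + α * P.logq)) r s

lemma bc_eq (r s : ℕ) (α u : ℂ) : bc P r s α u = bHat P r s 0 α u + cHat P r s α u :=
  atRoot_add (fun ρ => field 1 1 (.b ρ) 0 (u + α * P.logq))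
    (fun ρ => field 1 1 (.c ρ) 0 (u + α * P.logq)) r s

lemma bPlus_eq (r s : ℕ) (α u : ℂ) :
    bPlus P r s α u = atRoot (fun ρ => plusField (.b ρ) (u + α * P.logq)) r s := rfl

lemma bMinus_eq (r s : ℕ) (α u : ℂ) :
    bMinus P r s α u = atRoot (fun ρ => minusField (.b ρ) (u + α * P.logq)) r s := rfl

/-! ### Translation of the fields -/

/-- `L(z)` is obtained from `L(1)` by substitution. -/
def IsField (L : ℂ → LinForm P) : Prop := ∀ u, L u = translate u (L 0)

lemma IsField.add {L M : ℂ → LinForm P} (hL : IsField L) (hM : IsField M) :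
    IsField fun u => L u + M u := fun u => by
  rw [translate_add, ← hL u, ← hM u]

lemma IsField.neg {L : ℂ → LinForm P} (hL : IsField L) : IsField fun u => -L u := fun u => by
  rw [translate_neg, ← hL u]

lemma IsField.sub {L M : ℂ → LinForm P} (hL : IsField L) (hM : IsField M) :
    IsField fun u => L u - M u := by
  simpa only [sub_eq_add_neg] using hL.add hM.neg

lemma IsField.zero : IsField fun _ => (0 : LinForm P) := fun u => (translate_zero u).symm

lemma IsField.sum {ι : Type*} (s : Finset ι) {L : ι → ℂ → LinForm P}
    (hL : ∀ i ∈ s, IsField (L i)) : IsField fun u => ∑ i ∈ s, L i u := by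
  classical
  induction s using Finset.induction_on with
  | empty => simpa using IsField.zero
  | insert i s hi ih =>
    simp only [Finset.sum_insert hi]
    exact (hL i (by simp)).add (ih fun j hj => hL j (by simp [hj]))

lemma IsField.atRoot {L : Root P → ℂ → LinForm P} (hL : ∀ ρ, IsField (L ρ)) (r s : ℕ) :
    IsField fun u => atRoot (fun ρ => L ρ u) r s := fun u => by
  rw [atRoot_map (translate u) (translate_zero u)]
  exact congrArg (fun F => FreeBoson.atRoot F r s) (funext fun ρ => hL ρ u)

lemma translate_field (L M : ℂ) (x : Boson P) (α u v : ℂ) :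
    translate v (field L M x α u) = field L M x α (u + v) := by
  funext y
  cases y with
  | osc y n =>
    simp only [translate, field]
    split_ifs
    · rw [mul_add, neg_add, Complex.exp_add]
      ring
    · simp
  | qhat y => rfl
  | phat y =>
    simp only [translate, field]
    split_ifs <;> ring

lemma translate_plusField (x : Boson P) (u v : ℂ) :
    translate v (plusField x u) = plusField x (u + v) := by
  funext y
  cases y with
  | osc y n =>
    simp only [translate, plusField]
    split_ifs
    · rw [mul_add, neg_add, Complex.exp_add]
      ring
    · simp
  | qhat y => rfl
  | phat y => simp only [translate, plusField]; ring

lemma translate_minusField (x : Boson P) (u v : ℂ) :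
    translate v (minusField x u) = minusField x (u + v) := by
  funext y
  cases y with
  | osc y n =>
    simp only [translate, minusField]
    split_ifs
    · rw [mul_add, neg_add, Complex.exp_add]
      ring
    · simp
  | qhat y => rfl
  | phat y => simp only [translate, minusField]; ring

lemma isField_field (L M : ℂ) (x : Boson P) (α β : ℂ) :
    IsField fun u => field L M x α (u + β) := fun u => by
  rw [translate_field, zero_add, add_comm]

lemma isField_plusField (x : Boson P) (β : ℂ) : IsField fun u => plusField x (u + β) := fun u => by
  rw [translate_plusField, zero_add, add_comm]

lemma isField_minusField (x : Boson P) (β : ℂ) :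
    IsField fun u => minusField x (u + β) := fun u => by
  rw [translate_minusField, zero_add, add_comm]

lemma isField_bHat (r s : ℕ) (σ α : ℂ) : IsField fun u => bHat P r s σ α u :=
  IsField.atRoot (fun _ => isField_field _ _ _ _ _) r s

lemma isField_cHat (r s : ℕ) (α : ℂ) : IsField fun u => cHat P r s α u :=
  IsField.atRoot (fun _ => isField_field _ _ _ _ _) r s

lemma isField_bPlus (r s : ℕ) (α : ℂ) : IsField fun u => bPlus P r s α u :=
  IsField.atRoot (fun _ => isField_plusField _ _) r s

lemma isField_bMinus (r s : ℕ) (α : ℂ) : IsField fun u => bMinus P r s α u :=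
  IsField.atRoot (fun _ => isField_minusField _ _) r s

lemma isField_aPlus (i : Node P) (α : ℂ) : IsField fun u => aPlus P i α u :=
  isField_plusField _ _

lemma isField_aMinus (i : Node P) (α : ℂ) : IsField fun u => aMinus P i α u :=
  isField_minusField _ _

/-! ### Relations between the fields -/

lemma br_int_ne_zero (hP : IsContracting P) {n : ℤ} (hn : n ≠ 0) : P.br n ≠ 0 := by
  rcases lt_or_gt_of_ne hn with h | h
  · obtain ⟨k, rfl⟩ : ∃ k : ℕ, n = -(k : ℤ) := ⟨(-n).toNat, by omega⟩
    push_cast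
    rw [br_neg]
    exact neg_ne_zero.2 (hP.br_ne_zero (by omega))
  · obtain ⟨k, rfl⟩ : ∃ k : ℕ, n = (k : ℤ) := ⟨n.toNat, by omega⟩
    exact_mod_cast hP.br_ne_zero (by omega)

/-- All relations between `x(z; ±1)`, `x(q^{±1} z)` and `x_±(z)`. -/
lemma field_shift (hP : IsContracting P) (x : Boson P) (v σ : ℂ) (hσ : σ = 1 ∨ σ = -1) :
    field 1 1 x 0 (v + P.logq) - field 1 1 x σ v
        = (if σ = 1 then -minusField x v else plusField x v) ∧
      field 1 1 x 0 (v - P.logq) - field 1 1 x σ v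
        = (if σ = 1 then -plusField x v else minusField x v) := by
  have hne : (-1 : ℂ) ≠ 1 := by norm_num
  -- The coefficient of the difference is (q^(-τ|n|) - q^(-εn))/[n]. For each choice of signs it
  -- vanishes for one sign of n and equals ±(q - q⁻¹) for the other, which is how the half fields
  -- x_± arise.
  have hosc (n : ℤ) (hn : n ≠ 0) (τ : ℂ) (ε : ℤ) : -(P.br (1 * n) / P.br (1 * n) / P.br n *
      P.qpow (-(0 * (|n| : ℤ))) * Complex.exp (-(n * (v + ε * P.logq)))) -
      -(P.br (1 * n) / P.br (1 * n) / P.br n * P.qpow (-(τ * (|n| : ℤ))) *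
        Complex.exp (-(n * v))) = (P.qpow (-(τ * (|n| : ℤ))) - P.qpow (-(ε * n))) / P.br n *
          Complex.exp (-(n * v)) := by
    have h1 := br_int_ne_zero hP hn
    have e : Complex.exp (-(n * (v + ε * P.logq)))
        = P.qpow (-(ε * n)) * Complex.exp (-(n * v)) := by
      rw [Params.qpow, ← Complex.exp_add]; congr 1; ring
    have e0 : P.qpow (-(0 * (|n| : ℤ))) = 1 := by simp [Params.qpow]
    rw [e, e0, one_mul]
    field_simp
    ring
  have hosc' (n : ℤ) (hn : n ≠ 0) (τ : ℂ) := hosc n hn τ 1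
  have hosc'' (n : ℤ) (hn : n ≠ 0) (τ : ℂ) := hosc n hn τ (-1)
  have hdiv (n : ℤ) (hn : n ≠ 0) :
      (P.qpow n - P.qpow (-n)) / P.br n = P.qdiff := by
    rw [← hP.br_mul_qdiff, mul_comm, mul_div_assoc, div_self (br_int_ne_zero hP hn), mul_one]
  have hdiv' (n : ℤ) (hn : n ≠ 0) :
      (P.qpow (-n) - P.qpow n) / P.br n = -P.qdiff := by
    rw [← hdiv n hn, ← neg_div, neg_sub]
  constructor
  · funext y
    rcases hσ with rfl | rfl
    · rw [if_pos rfl]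
      cases y with
      | osc y n =>
        simp only [Pi.sub_apply, Pi.neg_apply, field, minusField]
        by_cases hy : y = x
        · rcases lt_trichotomy n 0 with hn | rfl | hn
          · rw [if_pos ⟨hy, hn.ne⟩, if_pos ⟨hy, hn.ne⟩, if_pos ⟨hy, hn⟩]
            have := hosc' n hn.ne 1
            simp only [Int.cast_one, one_mul, abs_of_neg hn, Int.cast_neg, neg_neg] at this ⊢
            rw [this, hdiv n hn.ne]
          · simp
          · rw [if_pos ⟨hy, hn.ne'⟩, if_pos ⟨hy, hn.ne'⟩, if_neg (by omega)]
            have := hosc' n hn.ne' 1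
            simp only [Int.cast_one, one_mul, abs_of_pos hn] at this ⊢
            rw [this]
            simp
        · simp [hy]
      | qhat y => simp [field, minusField]
      | phat y =>
        simp only [Pi.sub_apply, Pi.neg_apply, field, minusField]
        split_ifs <;> ring
    · rw [if_neg hne]
      cases y with
      | osc y n =>
        simp only [Pi.sub_apply, field, plusField]
        by_cases hy : y = x
        · rcases lt_trichotomy n 0 with hn | rfl | hn
          · rw [if_pos ⟨hy, hn.ne⟩, if_pos ⟨hy, hn.ne⟩, if_neg (by omega)]
            have := hosc' n hn.ne (-1)
            simp only [Int.cast_one, one_mul, abs_of_neg hn, Int.cast_neg, neg_neg,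
              neg_mul] at this ⊢
            rw [this]
            simp
          · simp
          · rw [if_pos ⟨hy, hn.ne'⟩, if_pos ⟨hy, hn.ne'⟩, if_pos ⟨hy, hn⟩]
            have := hosc' n hn.ne' (-1)
            simp only [Int.cast_one, one_mul, abs_of_pos hn, neg_mul, neg_neg] at this ⊢
            rw [this, hdiv n hn.ne']
        · simp [hy]
      | qhat y => simp [field, plusField]
      | phat y =>
        simp only [Pi.sub_apply, field, plusField]
        split_ifs <;> ring
  · funext y
    have hv : v - P.logq = v + ((-1 : ℤ) : ℂ) * P.logq := by push_cast; ring
    rw [hv]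
    rcases hσ with rfl | rfl
    · rw [if_pos rfl]
      cases y with
      | osc y n =>
        simp only [Pi.sub_apply, Pi.neg_apply, field, plusField]
        by_cases hy : y = x
        · rcases lt_trichotomy n 0 with hn | rfl | hn
          · rw [if_pos ⟨hy, hn.ne⟩, if_pos ⟨hy, hn.ne⟩, if_neg (by omega), hosc'' n hn.ne 1]
            simp [abs_of_neg hn]
          · simp
          · rw [if_pos ⟨hy, hn.ne'⟩, if_pos ⟨hy, hn.ne'⟩, if_pos ⟨hy, hn⟩, hosc'' n hn.ne' 1]
            simp only [abs_of_pos hn, Int.cast_neg, Int.cast_one, neg_mul, one_mul, neg_neg]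
            rw [hdiv' n hn.ne']
            ring
        · simp [hy]
      | qhat y => simp [field, plusField]
      | phat y =>
        simp only [Pi.sub_apply, Pi.neg_apply, field, plusField]
        split_ifs <;> push_cast <;> ring
    · rw [if_neg hne]
      cases y with
      | osc y n =>
        simp only [Pi.sub_apply, field, minusField]
        by_cases hy : y = x
        · rcases lt_trichotomy n 0 with hn | rfl | hn
          · rw [if_pos ⟨hy, hn.ne⟩, if_pos ⟨hy, hn.ne⟩, if_pos ⟨hy, hn⟩, hosc'' n hn.ne (-1)]
            simp only [abs_of_neg hn, Int.cast_neg, Int.cast_one, neg_mul, one_mul, neg_neg]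
            rw [hdiv' n hn.ne]
            ring
          · simp
          · rw [if_pos ⟨hy, hn.ne'⟩, if_pos ⟨hy, hn.ne'⟩, if_neg (by omega), hosc'' n hn.ne' (-1)]
            simp [abs_of_pos hn]
        · simp [hy]
      | qhat y => simp [field, minusField]
      | phat y =>
        simp only [Pi.sub_apply, field, minusField]
        split_ifs <;> push_cast <;> ring

variable (r s : ℕ) (α u : ℂ)

lemma bHat_sub (hP : IsContracting P) (σ : ℂ) (hσ : σ = 1 ∨ σ = -1) :
    bHat P r s 0 (α + 1) u - bHat P r s σ α u
        = (if σ = 1 then -bMinus P r s α u else bPlus P r s α u) ∧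
      bHat P r s 0 (α - 1) u - bHat P r s σ α u
        = (if σ = 1 then -bPlus P r s α u else bMinus P r s α u) := by
  have h := fun ρ : Root P => field_shift hP (.b ρ) (u + α * P.logq) σ hσ
  rw [bHat, bHat, bHat, ← atRoot_sub, ← atRoot_sub]
  simp only [show u + (α + 1) * P.logq = u + α * P.logq + P.logq by ring,
    show u + (α - 1) * P.logq = u + α * P.logq - P.logq by ring, (h _).1, (h _).2]
  rcases hσ with rfl | rfl
  · simp only [if_true, atRoot_neg]
    exact ⟨rfl, rfl⟩
  · have hne : (-1 : ℂ) ≠ 1 := by norm_num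
    simp only [if_neg hne]
    exact ⟨rfl, rfl⟩

/-- Together with the next three lemmas this removes the sign from the b-part of an exponent: the
two summands ε = ±1 of a current differ only in the argument of one c-field. This makes a uniform
computation in ε possible and the later coincidences visible. -/
lemma bPlus_sub_bc (hP : IsContracting P) :
    bPlus P r s α u - bc P r s (α + 1) u = -bHat P r s (-1) α u - cHat P r s (α + 1) u := by
  have h := (bHat_sub r s α u hP (-1) (Or.inr rfl)).1
  rw [if_neg (by norm_num)] at h
  rw [bc_eq, ← h]
  abel

lemma bMinus_sub_bc (hP : IsContracting P) :
    bMinus P r s α u - bc P r s (α - 1) u = -bHat P r s (-1) α u - cHat P r s (α - 1) u := by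
  have h := (bHat_sub r s α u hP (-1) (Or.inr rfl)).2
  rw [if_neg (by norm_num)] at h
  rw [bc_eq, ← h]
  abel

lemma neg_bMinus_sub_bc (hP : IsContracting P) :
    -bMinus P r s α u - bc P r s (α + 1) u = -bHat P r s 1 α u - cHat P r s (α + 1) u := by
  have h := (bHat_sub r s α u hP 1 (Or.inl rfl)).1
  rw [if_pos rfl] at h
  rw [bc_eq, ← h]
  abel

lemma neg_bPlus_sub_bc (hP : IsContracting P) :
    -bPlus P r s α u - bc P r s (α - 1) u = -bHat P r s 1 α u - cHat P r s (α - 1) u := by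
  have h := (bHat_sub r s α u hP 1 (Or.inl rfl)).2
  rw [if_pos rfl] at h
  rw [bc_eq, ← h]
  abel

end Atoms

section Coordinates

variable {P : Params}

/-! ### Coordinates of linear forms -/

/-- A multiple of the coefficient of a mode attached to the pair `(r, s)`. -/
def coord (w : ℂ) (x : Root P → Mode P) (r s : ℕ) : LinForm P →ₗ[ℂ] ℂ where
  toFun L := w * atRoot (fun ρ => L (x ρ)) r s
  map_add' L M := by
    rw [← mul_add, ← atRoot_add]
    rfl
  map_smul' t L := by
    rw [RingHom.id_apply, smul_eq_mul, mul_left_comm, ← atRoot_const_mul _ t]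
    rfl

/-- `[n]` times the coefficient of `b^{rs}_n`. -/
def bPos (n r s : ℕ) : LinForm P →ₗ[ℂ] ℂ := coord (P.br n) (fun ρ => .osc (.b ρ) n) r s

/-- `[n]` times the coefficient of `b^{rs}_{-n}`. -/
def bNeg (n r s : ℕ) : LinForm P →ₗ[ℂ] ℂ := coord (P.br n) (fun ρ => .osc (.b ρ) (-n)) r s

/-- `[n]` times the coefficient of `c^{rs}_n`. -/
def cPos (n r s : ℕ) : LinForm P →ₗ[ℂ] ℂ := coord (P.br n) (fun ρ => .osc (.c ρ) n) r s

/-- `[n]` times the coefficient of `c^{rs}_{-n}`. -/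
def cNeg (n r s : ℕ) : LinForm P →ₗ[ℂ] ℂ := coord (P.br n) (fun ρ => .osc (.c ρ) (-n)) r s

/-- The difference of the coefficients of `p̂_c^{rs}` and `p̂_b^{rs}`. -/
def pDiff (r s : ℕ) : LinForm P →ₗ[ℂ] ℂ :=
  coord 1 (fun ρ => .phat (.c ρ)) r s - coord 1 (fun ρ => .phat (.b ρ)) r s

/-- The coefficient of `q̂_b^{rs}`. -/
def qCoeff (r s : ℕ) : LinForm P →ₗ[ℂ] ℂ := coord 1 (fun ρ => .qhat (.b ρ)) r s

lemma atRoot_atRoot (F : Root P → Root P → ℂ) (hF : ∀ ρ ρ', ρ ≠ ρ' → F ρ ρ' = 0) (v : ℂ)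
    (hv : ∀ ρ, F ρ ρ = v) (r s r' s' : ℕ) :
    atRoot (fun ρ => atRoot (F ρ) r' s') r s
      = if r = r' ∧ s = s' ∧ 1 ≤ r ∧ r < s ∧ s ≤ P.N then v else 0 := by
  unfold atRoot
  by_cases h : (r, s) ∈ rootSet P
  · rw [dif_pos h]
    beta_reduce
    by_cases h' : (r', s') ∈ rootSet P
    · rw [dif_pos h']
      by_cases e : r = r' ∧ s = s'
      · obtain ⟨rfl, rfl⟩ := e
        rw [hv, if_pos ⟨rfl, rfl, mem_rootSet.1 h⟩]
      · rw [hF _ _ (fun h => e (by simpa using h)), if_neg fun h => e ⟨h.1, h.2.1⟩]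
    · rw [dif_neg h', if_neg]
      rintro ⟨rfl, rfl, -⟩
      exact h' h
  · rw [dif_neg h, if_neg fun h' => h (mem_rootSet.2 h'.2.2)]

lemma coord_atRoot (w : ℂ) (x : Root P → Mode P) (F : Root P → LinForm P)
    (hF : ∀ ρ ρ', ρ ≠ ρ' → F ρ' (x ρ) = 0) (v : ℂ) (hv : ∀ ρ, w * F ρ (x ρ) = v)
    (r s r' s' : ℕ) :
    coord w x r s (atRoot F r' s')
      = if r = r' ∧ s = s' ∧ 1 ≤ r ∧ r < s ∧ s ≤ P.N then v else 0 := by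
  change w * atRoot (fun ρ => atRoot F r' s' (x ρ)) r s = _
  rw [← atRoot_const_mul]
  simp only [atRoot_apply, ← atRoot_const_mul]
  exact atRoot_atRoot _ (fun ρ ρ' h => by rw [hF ρ ρ' h, mul_zero]) v hv r s r' s'

lemma coord_atRoot_zero (w : ℂ) (x : Root P → Mode P) (F : Root P → LinForm P)
    (hF : ∀ ρ ρ', F ρ' (x ρ) = 0) (r s r' s' : ℕ) : coord w x r s (atRoot F r' s') = 0 := by
  rw [coord_atRoot w x F (fun ρ ρ' _ => hF ρ ρ') 0 (fun ρ => by rw [hF, mul_zero]), ite_self]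

lemma coord_eq_zero (w : ℂ) (x : Root P → Mode P) (L : LinForm P) (hL : ∀ ρ, L (x ρ) = 0)
    (r s : ℕ) : coord w x r s L = 0 := by
  change w * atRoot (fun ρ => L (x ρ)) r s = 0
  simp only [hL, atRoot_const, ite_self, mul_zero]

section Values

variable (hP : IsContracting P) (n r s r' s' : ℕ) (hn : 0 < n) (σ α : ℂ)
include hP hn

lemma field_pos (x : Boson P) :
    P.br n * field 1 1 x σ (0 + α * P.logq) (.osc x n) = -qexp P n (-σ - α) := by
  have h := hP.br_ne_zero hn
  have hn' : (n : ℤ) ≠ 0 := by omega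
  simp only [field, hn', ne_eq, not_false_eq_true, and_self, if_true, one_mul, Int.cast_natCast,
    Nat.abs_cast]
  rw [div_self h, qexp_sub, Params.qpow, qexp, qexp, ← Complex.exp_sub, mul_neg, mul_assoc,
    ← Complex.exp_add]
  field_simp
  ring_nf

lemma field_neg (x : Boson P) :
    P.br n * field 1 1 x σ (0 + α * P.logq) (.osc x (-n)) = qexp P n (α - σ) := by
  have h := hP.br_ne_zero hn
  have hn' : -(n : ℤ) ≠ 0 := by omega
  simp only [field, hn', ne_eq, not_false_eq_true, and_self, if_true, one_mul, Int.cast_neg,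
    Int.cast_natCast, abs_neg, Nat.abs_cast, br_neg]
  rw [div_self (neg_ne_zero.2 h), Params.qpow, qexp, mul_neg, mul_assoc,
    ← Complex.exp_add]
  field_simp
  ring_nf

lemma plusField_pos (x : Boson P) :
    P.br n * plusField x (0 + α * P.logq) (.osc x n)
      = (qexp P n 1 - qexp P n (-1)) * qexp P n (-α) := by
  have hn' : 0 < (n : ℤ) := by omega
  simp only [plusField, hn', and_self, if_true, Int.cast_natCast]
  rw [← mul_assoc, hP.br_mul_qdiff]
  simp only [Params.qpow, qexp]
  ring_nf

lemma minusField_neg (x : Boson P) :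
    P.br n * minusField x (0 + α * P.logq) (.osc x (-n))
      = -(qexp P n 1 - qexp P n (-1)) * qexp P n α := by
  have hn' : -(n : ℤ) < 0 := by omega
  simp only [minusField, hn', and_self, if_true, Int.cast_neg, Int.cast_natCast]
  rw [mul_neg, ← mul_assoc, hP.br_mul_qdiff]
  simp only [Params.qpow, qexp]
  ring_nf

lemma bPos_bHat : bPos n r s (bHat P r' s' σ α 0)
    = if r = r' ∧ s = s' ∧ 1 ≤ r ∧ r < s ∧ s ≤ P.N then -qexp P n (-σ - α) else 0 := by
  rw [bPos, bHat]
  exact coord_atRoot _ _ _ (fun ρ ρ' h => by simp [field, h]) _ (fun ρ => field_pos hP n hn σ α _) _ _ _ _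

lemma bNeg_bHat : bNeg n r s (bHat P r' s' σ α 0)
    = if r = r' ∧ s = s' ∧ 1 ≤ r ∧ r < s ∧ s ≤ P.N then qexp P n (α - σ) else 0 := by
  rw [bNeg, bHat]
  exact coord_atRoot _ _ _ (fun ρ ρ' h => by simp [field, h]) _ (fun ρ => field_neg hP n hn σ α _) _ _ _ _

lemma cPos_cHat : cPos n r s (cHat P r' s' α 0)
    = if r = r' ∧ s = s' ∧ 1 ≤ r ∧ r < s ∧ s ≤ P.N then -qexp P n (-α) else 0 := by
  rw [cPos, cHat]
  exact coord_atRoot _ _ _ (fun ρ ρ' h => by simp [field, h]) _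
    (fun ρ => by rw [field_pos hP n hn 0 α, neg_zero, zero_sub]) _ _ _ _

lemma cNeg_cHat : cNeg n r s (cHat P r' s' α 0)
    = if r = r' ∧ s = s' ∧ 1 ≤ r ∧ r < s ∧ s ≤ P.N then qexp P n α else 0 := by
  rw [cNeg, cHat]
  exact coord_atRoot _ _ _ (fun ρ ρ' h => by simp [field, h]) _
    (fun ρ => by rw [field_neg hP n hn 0 α, sub_zero]) _ _ _ _

lemma bPos_bPlus : bPos n r s (bPlus P r' s' α 0)
    = if r = r' ∧ s = s' ∧ 1 ≤ r ∧ r < s ∧ s ≤ P.N then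
      (qexp P n 1 - qexp P n (-1)) * qexp P n (-α) else 0 := by
  rw [bPos, bPlus_eq]
  exact coord_atRoot _ _ _ (fun ρ ρ' h => by simp [plusField, h]) _
    (fun ρ => plusField_pos hP n hn α _) _ _ _ _

lemma bNeg_bMinus : bNeg n r s (bMinus P r' s' α 0)
    = if r = r' ∧ s = s' ∧ 1 ≤ r ∧ r < s ∧ s ≤ P.N then
      -(qexp P n 1 - qexp P n (-1)) * qexp P n α else 0 := by
  rw [bNeg, bMinus_eq]
  exact coord_atRoot _ _ _ (fun ρ ρ' h => by simp [minusField, h]) _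
    (fun ρ => minusField_neg hP n hn α _) _ _ _ _

end Values

section Vanishing

variable (n r s r' s' : ℕ) (σ α : ℂ) (i : Node P)

lemma bPos_cHat : bPos n r s (cHat P r' s' α 0) = 0 := by
  rw [bPos, cHat]
  exact coord_atRoot_zero _ _ _ (fun ρ ρ' => by simp [field]) _ _ _ _

lemma bNeg_cHat : bNeg n r s (cHat P r' s' α 0) = 0 := by
  rw [bNeg, cHat]
  exact coord_atRoot_zero _ _ _ (fun ρ ρ' => by simp [field]) _ _ _ _

lemma cPos_bHat : cPos n r s (bHat P r' s' σ α 0) = 0 := by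
  rw [cPos, bHat]
  exact coord_atRoot_zero _ _ _ (fun ρ ρ' => by simp [field]) _ _ _ _

lemma cNeg_bHat : cNeg n r s (bHat P r' s' σ α 0) = 0 := by
  rw [cNeg, bHat]
  exact coord_atRoot_zero _ _ _ (fun ρ ρ' => by simp [field]) _ _ _ _

lemma bPos_bMinus : bPos n r s (bMinus P r' s' α 0) = 0 := by
  rw [bPos, bMinus_eq]
  exact coord_atRoot_zero _ _ _ (fun ρ ρ' => by simp [minusField]) _ _ _ _

lemma bNeg_bPlus : bNeg n r s (bPlus P r' s' α 0) = 0 := by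
  rw [bNeg, bPlus_eq]
  exact coord_atRoot_zero _ _ _ (fun ρ ρ' => by
    have : ¬ 0 < -(n : ℤ) := by omega
    simp [plusField]) _ _ _ _

lemma cPos_bMinus : cPos n r s (bMinus P r' s' α 0) = 0 := by
  rw [cPos, bMinus_eq]
  exact coord_atRoot_zero _ _ _ (fun ρ ρ' => by simp [minusField]) _ _ _ _

lemma cNeg_bMinus : cNeg n r s (bMinus P r' s' α 0) = 0 := by
  rw [cNeg, bMinus_eq]
  exact coord_atRoot_zero _ _ _ (fun ρ ρ' => by simp [minusField]) _ _ _ _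

lemma cPos_bPlus : cPos n r s (bPlus P r' s' α 0) = 0 := by
  rw [cPos, bPlus_eq]
  exact coord_atRoot_zero _ _ _ (fun ρ ρ' => by simp [plusField]) _ _ _ _

lemma cNeg_bPlus : cNeg n r s (bPlus P r' s' α 0) = 0 := by
  rw [cNeg, bPlus_eq]
  exact coord_atRoot_zero _ _ _ (fun ρ ρ' => by simp [plusField]) _ _ _ _

lemma bPos_aPlus : bPos n r s (aPlus P i α 0) = 0 := by
  rw [bPos]
  exact coord_eq_zero _ _ _ (fun ρ => by simp [aPlus, plusField]) _ _

lemma bNeg_aPlus : bNeg n r s (aPlus P i α 0) = 0 := by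
  rw [bNeg]
  exact coord_eq_zero _ _ _ (fun ρ => by simp [aPlus, plusField]) _ _

lemma cPos_aPlus : cPos n r s (aPlus P i α 0) = 0 := by
  rw [cPos]
  exact coord_eq_zero _ _ _ (fun ρ => by simp [aPlus, plusField]) _ _

lemma cNeg_aPlus : cNeg n r s (aPlus P i α 0) = 0 := by
  rw [cNeg]
  exact coord_eq_zero _ _ _ (fun ρ => by simp [aPlus, plusField]) _ _

lemma bPos_aMinus : bPos n r s (aMinus P i α 0) = 0 := by
  rw [bPos]
  exact coord_eq_zero _ _ _ (fun ρ => by simp [aMinus, minusField]) _ _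

lemma bNeg_aMinus : bNeg n r s (aMinus P i α 0) = 0 := by
  rw [bNeg]
  exact coord_eq_zero _ _ _ (fun ρ => by simp [aMinus, minusField]) _ _

lemma cPos_aMinus : cPos n r s (aMinus P i α 0) = 0 := by
  rw [cPos]
  exact coord_eq_zero _ _ _ (fun ρ => by simp [aMinus, minusField]) _ _

lemma cNeg_aMinus : cNeg n r s (aMinus P i α 0) = 0 := by
  rw [cNeg]
  exact coord_eq_zero _ _ _ (fun ρ => by simp [aMinus, minusField]) _ _

lemma pDiff_bHat : pDiff r s (bHat P r' s' σ α 0)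
    = if r = r' ∧ s = s' ∧ 1 ≤ r ∧ r < s ∧ s ≤ P.N then -(α * P.logq) else 0 := by
  rw [pDiff, LinearMap.sub_apply, bHat, coord_atRoot_zero _ _ _ (fun ρ ρ' => by simp [field]),
    coord_atRoot _ _ _ (fun ρ ρ' h => by simp [field, h]) (α * P.logq)
      (fun ρ => by simp [field])]
  split_ifs <;> simp

lemma pDiff_cHat : pDiff r s (cHat P r' s' α 0)
    = if r = r' ∧ s = s' ∧ 1 ≤ r ∧ r < s ∧ s ≤ P.N then α * P.logq else 0 := by
  rw [pDiff, LinearMap.sub_apply, cHat,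
    coord_atRoot _ _ _ (fun ρ ρ' h => by simp [field, h]) (α * P.logq)
      (fun ρ => by simp [field]), coord_atRoot_zero _ _ _ (fun ρ ρ' => by simp [field]), sub_zero]

lemma pDiff_bPlus : pDiff r s (bPlus P r' s' α 0)
    = if r = r' ∧ s = s' ∧ 1 ≤ r ∧ r < s ∧ s ≤ P.N then -P.logq else 0 := by
  rw [pDiff, LinearMap.sub_apply, bPlus_eq,
    coord_atRoot_zero _ _ _ (fun ρ ρ' => by simp [plusField]),
    coord_atRoot _ _ _ (fun ρ ρ' h => by simp [plusField, h]) P.logq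
      (fun ρ => by simp [plusField])]
  split_ifs <;> simp

lemma pDiff_bMinus : pDiff r s (bMinus P r' s' α 0)
    = if r = r' ∧ s = s' ∧ 1 ≤ r ∧ r < s ∧ s ≤ P.N then P.logq else 0 := by
  rw [pDiff, LinearMap.sub_apply, bMinus_eq,
    coord_atRoot_zero _ _ _ (fun ρ ρ' => by simp [minusField]),
    coord_atRoot _ _ _ (fun ρ ρ' h => by simp [minusField, h]) (-P.logq)
      (fun ρ => by simp [minusField])]
  split_ifs <;> simp

lemma pDiff_aPlus : pDiff r s (aPlus P i α 0) = 0 := by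
  rw [pDiff, LinearMap.sub_apply, coord_eq_zero _ _ _ (fun ρ => by simp [aPlus, plusField]),
    coord_eq_zero _ _ _ (fun ρ => by simp [aPlus, plusField]), sub_zero]

lemma pDiff_aMinus : pDiff r s (aMinus P i α 0) = 0 := by
  rw [pDiff, LinearMap.sub_apply, coord_eq_zero _ _ _ (fun ρ => by simp [aMinus, minusField]),
    coord_eq_zero _ _ _ (fun ρ => by simp [aMinus, minusField]), sub_zero]

lemma qCoeff_bHat : qCoeff r s (bHat P r' s' σ α 0)
    = if r = r' ∧ s = s' ∧ 1 ≤ r ∧ r < s ∧ s ≤ P.N then 1 else 0 := by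
  rw [qCoeff, bHat]
  exact coord_atRoot _ _ _ (fun ρ ρ' h => by simp [field, h]) _ (fun ρ => by simp [field]) _ _ _ _

lemma qCoeff_cHat : qCoeff r s (cHat P r' s' α 0) = 0 := by
  rw [qCoeff, cHat]
  exact coord_atRoot_zero _ _ _ (fun ρ ρ' => by simp [field]) _ _ _ _

lemma qCoeff_bPlus : qCoeff r s (bPlus P r' s' α 0) = 0 := by
  rw [qCoeff, bPlus_eq]
  exact coord_atRoot_zero _ _ _ (fun ρ ρ' => by simp [plusField]) _ _ _ _

lemma qCoeff_bMinus : qCoeff r s (bMinus P r' s' α 0) = 0 := by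
  rw [qCoeff, bMinus_eq]
  exact coord_atRoot_zero _ _ _ (fun ρ ρ' => by simp [minusField]) _ _ _ _

lemma qCoeff_aPlus : qCoeff r s (aPlus P i α 0) = 0 := by
  rw [qCoeff]
  exact coord_eq_zero _ _ _ (fun ρ => by simp [aPlus, plusField]) _ _

lemma qCoeff_aMinus : qCoeff r s (aMinus P i α 0) = 0 := by
  rw [qCoeff]
  exact coord_eq_zero _ _ _ (fun ρ => by simp [aMinus, minusField]) _ _

end Vanishing

end Coordinates

section Contraction

variable {P : Params}

/-! ### Contraction against the fields -/

lemma contraction_add_right (L M M' : LinForm P) (n : ℕ) :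
    contraction L (M + M') n = contraction L M n + contraction L M' n := by
  simp [contraction, add_mul, Finset.sum_add_distrib]

lemma contraction_add_left (L L' M : LinForm P) (n : ℕ) :
    contraction (L + L') M n = contraction L M n + contraction L' M n := by
  simp [contraction, add_mul, mul_add, Finset.sum_add_distrib]

/-- Contraction as a bilinear form. -/
def contractionHom (n : ℕ) : LinForm P →+ LinForm P →+ ℂ :=
  AddMonoidHom.mk' (fun L => AddMonoidHom.mk' (fun M => n * contraction L M n) fun M M' => by
    rw [contraction_add_right, mul_add]) fun L L' => by
    ext M
    simp [contraction_add_left, mul_add]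

lemma contractionHom_apply (n : ℕ) (L M : LinForm P) :
    contractionHom n L M = n * contraction L M n := rfl

/-- The factor n cancels the 1/n in the commutators, and [n]² is split evenly between the two
coefficients. This is why `bPos`, `bNeg`, `cPos` and `cNeg` carry one factor [n]; their values are
then pure powers of q. -/
lemma contractionHom_eq {n : ℕ} (hn : 0 < n) (L M : LinForm P) :
    contractionHom n L M
      = ∑ i : Node P, ∑ j : Node P, M (.osc (.a i) (-n)) * L (.osc (.a j) n) *
          P.br (P.kg * n) * P.br (cartan j.1 i.1 * n)
        - ∑ ρ : Root P, (P.br n * M (.osc (.b ρ) (-n))) * (P.br n * L (.osc (.b ρ) n))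
        + ∑ ρ : Root P, (P.br n * M (.osc (.c ρ) (-n))) * (P.br n * L (.osc (.c ρ) n)) := by
  have hn' : (n : ℂ) ≠ 0 := by exact_mod_cast hn.ne'
  rw [contractionHom_apply, contraction, sum_boson]
  simp only [sum_boson, comm, mul_zero, Finset.sum_const_zero, add_zero, zero_add, mul_ite,
    Finset.sum_ite_eq', Finset.mem_univ, if_true]
  rw [mul_add, mul_add, sub_eq_add_neg, ← Finset.sum_neg_distrib]
  simp only [Finset.mul_sum]
  congr 1
  · congr 1
    · refine Finset.sum_congr rfl fun i _ => Finset.sum_congr rfl fun j _ => ?_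
      field_simp
    · refine Finset.sum_congr rfl fun i _ => ?_
      field_simp
  · refine Finset.sum_congr rfl fun i _ => ?_
    field_simp

lemma contractionHom_atRoot_right (n : ℕ) (L : LinForm P) (F : Root P → LinForm P) (r s : ℕ) :
    contractionHom n L (atRoot F r s) = atRoot (fun ρ => contractionHom n L (F ρ)) r s :=
  atRoot_map (contractionHom n L) (map_zero _) F r s

lemma contractionHom_atRoot_left (n : ℕ) (L : LinForm P) (F : Root P → LinForm P) (r s : ℕ) :
    contractionHom n (atRoot F r s) L = atRoot (fun ρ => contractionHom n (F ρ) L) r s :=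
  atRoot_map (fun M => contractionHom n M L) (by simp) F r s

variable (hP : IsContracting P) {n : ℕ} (hn : 0 < n) (L : LinForm P) (r s : ℕ) (σ α : ℂ)
include hP hn

lemma contractionHom_bHat_right :
    contractionHom n L (bHat P r s σ α 0) = -(bPos n r s L * qexp P n (α - σ)) := by
  rw [bHat, contractionHom_atRoot_right]
  change _ = -(P.br n * atRoot _ r s * _)
  rw [← atRoot_const_mul, ← atRoot_mul_const, ← atRoot_neg]
  congr 1
  funext ρ
  rw [contractionHom_eq hn]
  have h1 : ∑ x : Root P, P.br n * field 1 1 (.b ρ) σ (0 + α * P.logq) (.osc (.b x) (-n)) *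
      (P.br n * L (.osc (.b x) n)) = qexp P n (α - σ) * (P.br n * L (.osc (.b ρ) n)) := by
    rw [Finset.sum_eq_single ρ _ (by simp), field_neg hP n hn]
    intro ρ' _ h
    simp [field, h]
  rw [h1]
  simp [field, mul_comm]

lemma contractionHom_bHat_left :
    contractionHom n (bHat P r s σ α 0) L = bNeg n r s L * qexp P n (-σ - α) := by
  rw [bHat, contractionHom_atRoot_left]
  change _ = P.br n * atRoot _ r s * _
  rw [← atRoot_const_mul, ← atRoot_mul_const]
  congr 1
  funext ρ
  rw [contractionHom_eq hn]
  have h1 : ∑ x : Root P, P.br n * L (.osc (.b x) (-n)) * (P.br n *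
      field 1 1 (.b ρ) σ (0 + α * P.logq) (.osc (.b x) n))
      = P.br n * L (.osc (.b ρ) (-n)) * -qexp P n (-σ - α) := by
    rw [Finset.sum_eq_single ρ _ (by simp), field_pos hP n hn]
    intro ρ' _ h
    simp [field, h]
  rw [h1]
  simp [field]

end Contraction

section Contraction

variable {P : Params}

lemma coord_apply (w : ℂ) (x : Root P → Mode P) (r s : ℕ) (L : LinForm P) :
    coord w x r s L = w * atRoot (fun ρ => L (x ρ)) r s := rfl

lemma br_cartan_mul (hP : IsContracting P) (n : ℕ) (x : ℂ) :
    P.qdiff * P.br (x * n) = qexp P n x - qexp P n (-x) := by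
  rw [mul_comm, hP.br_mul_qdiff, ← neg_mul, qpow_eq_qexp, qpow_eq_qexp]

section Oscillators

variable (hP : IsContracting P) {n : ℕ} (hn : 0 < n) (L : LinForm P) (r s : ℕ) (α : ℂ)
include hP hn

lemma contractionHom_cHat_right :
    contractionHom n L (cHat P r s α 0) = cPos n r s L * qexp P n α := by
  rw [cHat, contractionHom_atRoot_right]
  change _ = P.br n * atRoot _ r s * _
  rw [← atRoot_const_mul, ← atRoot_mul_const]
  congr 1
  funext ρ
  rw [contractionHom_eq hn]
  have h1 : ∑ x : Root P, P.br n * field 1 1 (.c ρ) 0 (0 + α * P.logq) (.osc (.c x) (-n)) *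
      (P.br n * L (.osc (.c x) n)) = qexp P n α * (P.br n * L (.osc (.c ρ) n)) := by
    rw [Finset.sum_eq_single ρ _ (by simp), field_neg hP n hn, sub_zero]
    intro ρ' _ h
    simp [field, h]
  rw [h1]
  simp [field, mul_comm]

lemma contractionHom_cHat_left :
    contractionHom n (cHat P r s α 0) L = -(cNeg n r s L * qexp P n (-α)) := by
  rw [cHat, contractionHom_atRoot_left]
  change _ = -(P.br n * atRoot _ r s * _)
  rw [← atRoot_const_mul, ← atRoot_mul_const, ← atRoot_neg]
  congr 1
  funext ρ
  rw [contractionHom_eq hn]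
  have h1 : ∑ x : Root P, P.br n * L (.osc (.c x) (-n)) * (P.br n *
      field 1 1 (.c ρ) 0 (0 + α * P.logq) (.osc (.c x) n))
      = P.br n * L (.osc (.c ρ) (-n)) * -qexp P n (-α) := by
    rw [Finset.sum_eq_single ρ _ (by simp), field_pos hP n hn, neg_zero, zero_sub]
    intro ρ' _ h
    simp [field, h]
  rw [h1]
  simp [field]

lemma contractionHom_bMinus_right :
    contractionHom n L (bMinus P r s α 0)
      = bPos n r s L * ((qexp P n 1 - qexp P n (-1)) * qexp P n α) := by
  rw [bMinus_eq, contractionHom_atRoot_right]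
  change _ = P.br n * atRoot _ r s * _
  rw [← atRoot_const_mul, ← atRoot_mul_const]
  congr 1
  funext ρ
  rw [contractionHom_eq hn]
  have h1 : ∑ x : Root P, P.br n * minusField (.b ρ) (0 + α * P.logq) (.osc (.b x) (-n)) *
      (P.br n * L (.osc (.b x) n))
      = -(qexp P n 1 - qexp P n (-1)) * qexp P n α * (P.br n * L (.osc (.b ρ) n)) := by
    rw [Finset.sum_eq_single ρ _ (by simp), minusField_neg hP n hn]
    intro ρ' _ h
    simp [minusField, h]
  rw [h1]
  simp [minusField]
  ring

/-- The field b_- contains no annihilation oscillators. -/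
lemma contractionHom_bMinus_left : contractionHom n (bMinus P r s α 0) L = 0 := by
  rw [bMinus_eq, contractionHom_atRoot_left]
  have h : (fun ρ => contractionHom n (minusField (.b ρ) (0 + α * P.logq)) L)
      = fun _ : Root P => (0 : ℂ) := by
    funext ρ
    rw [contractionHom_eq hn]
    have h0 : ¬ (n : ℤ) < 0 := by omega
    simp only [minusField, h0, and_false, if_false, reduceCtorEq, false_and, mul_zero, zero_mul,
      Finset.sum_const_zero, sub_zero, add_zero]
  rw [h, atRoot_const, ite_self]

end Oscillators

/-- The contraction of `L` with `a^i_{-n}`, up to a scalar. -/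
def aPos (n : ℕ) (i : Node P) : LinForm P →ₗ[ℂ] ℂ where
  toFun L := qexp P n (-(P.kg / 2)) * ∑ x : Node P, L (.osc (.a x) n) * P.br (cartan x.1 i.1 * n)
  map_add' L M := by
    simp only [Pi.add_apply, add_mul, Finset.sum_add_distrib, mul_add]
  map_smul' t L := by
    simp only [Pi.smul_apply, smul_eq_mul, RingHom.id_apply, Finset.mul_sum]
    exact Finset.sum_congr rfl fun _ _ => by ring

/-- The contraction of `a^i_n` with `L`, up to a scalar. -/
def aNeg (n : ℕ) (i : Node P) : LinForm P →ₗ[ℂ] ℂ where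
  toFun L := qexp P n (-(P.kg / 2)) *
    ∑ x : Node P, L (.osc (.a x) (-n)) * P.br (cartan i.1 x.1 * n)
  map_add' L M := by
    simp only [Pi.add_apply, add_mul, Finset.sum_add_distrib, mul_add]
  map_smul' t L := by
    simp only [Pi.smul_apply, smul_eq_mul, RingHom.id_apply, Finset.mul_sum]
    exact Finset.sum_congr rfl fun _ _ => by ring

/-- The commutator of the `p̂_a` in `L` with `q̂^i_a / (k + g)`. -/
def aZero (i : Node P) : LinForm P →ₗ[ℂ] ℂ where
  toFun L := ∑ x : Node P, L (.phat (.a x)) * cartan x.1 i.1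
  map_add' L M := by
    simp only [Pi.add_apply, add_mul, Finset.sum_add_distrib]
  map_smul' t L := by
    simp only [Pi.smul_apply, smul_eq_mul, RingHom.id_apply, Finset.mul_sum]
    exact Finset.sum_congr rfl fun _ _ => by ring

section Values

variable (n : ℕ) (i : Node P)

lemma aPos_apply (L : LinForm P) : aPos n i L
    = qexp P n (-(P.kg / 2)) * ∑ x : Node P, L (.osc (.a x) n) * P.br (cartan x.1 i.1 * n) := rfl

lemma aNeg_apply (L : LinForm P) : aNeg n i L
    = qexp P n (-(P.kg / 2)) * ∑ x : Node P, L (.osc (.a x) (-n)) * P.br (cartan i.1 x.1 * n) := rfl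

lemma aPos_eq_zero {L : LinForm P} (h : ∀ x, L (.osc (.a x) n) = 0) : aPos n i L = 0 := by
  change qexp P n (-(P.kg / 2)) * _ = 0
  simp [h]

lemma aNeg_eq_zero {L : LinForm P} (h : ∀ x, L (.osc (.a x) (-n)) = 0) : aNeg n i L = 0 := by
  change qexp P n (-(P.kg / 2)) * _ = 0
  simp [h]

lemma aZero_eq_zero {L : LinForm P} (h : ∀ x, L (.phat (.a x)) = 0) : aZero i L = 0 := by
  change ∑ x : Node P, L (.phat (.a x)) * cartan x.1 i.1 = 0
  simp [h]

lemma atRoot_eq_zero {F : Root P → LinForm P} {x : Mode P} (h : ∀ ρ, F ρ x = 0) (r s : ℕ) :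
    atRoot F r s x = 0 := by
  rw [atRoot_apply]
  simp [h, atRoot_const]

variable (r s : ℕ) (σ α : ℂ)

lemma aPos_bHat : aPos n i (bHat P r s σ α 0) = 0 :=
  aPos_eq_zero n i fun x => atRoot_eq_zero (fun ρ => by simp [field]) r s

lemma aPos_cHat : aPos n i (cHat P r s α 0) = 0 :=
  aPos_eq_zero n i fun x => atRoot_eq_zero (fun ρ => by simp [field]) r s

lemma aPos_bPlus : aPos n i (bPlus P r s α 0) = 0 := by
  rw [bPlus_eq]
  exact aPos_eq_zero n i fun x => atRoot_eq_zero (fun ρ => by simp [plusField]) r s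

lemma aPos_bMinus : aPos n i (bMinus P r s α 0) = 0 := by
  rw [bMinus_eq]
  exact aPos_eq_zero n i fun x => atRoot_eq_zero (fun ρ => by simp [minusField]) r s

lemma aNeg_bHat : aNeg n i (bHat P r s σ α 0) = 0 :=
  aNeg_eq_zero n i fun x => atRoot_eq_zero (fun ρ => by simp [field]) r s

lemma aNeg_cHat : aNeg n i (cHat P r s α 0) = 0 :=
  aNeg_eq_zero n i fun x => atRoot_eq_zero (fun ρ => by simp [field]) r s

lemma aNeg_bPlus : aNeg n i (bPlus P r s α 0) = 0 := by
  rw [bPlus_eq]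
  exact aNeg_eq_zero n i fun x => atRoot_eq_zero (fun ρ => by simp [plusField]) r s

lemma aNeg_bMinus : aNeg n i (bMinus P r s α 0) = 0 := by
  rw [bMinus_eq]
  exact aNeg_eq_zero n i fun x => atRoot_eq_zero (fun ρ => by simp [minusField]) r s

lemma aZero_bHat : aZero i (bHat P r s σ α 0) = 0 :=
  aZero_eq_zero i fun x => atRoot_eq_zero (fun ρ => by simp [field]) r s

lemma aZero_cHat : aZero i (cHat P r s α 0) = 0 :=
  aZero_eq_zero i fun x => atRoot_eq_zero (fun ρ => by simp [field]) r s

lemma aZero_bPlus : aZero i (bPlus P r s α 0) = 0 := by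
  rw [bPlus_eq]
  exact aZero_eq_zero i fun x => atRoot_eq_zero (fun ρ => by simp [plusField]) r s

lemma aZero_bMinus : aZero i (bMinus P r s α 0) = 0 := by
  rw [bMinus_eq]
  exact aZero_eq_zero i fun x => atRoot_eq_zero (fun ρ => by simp [minusField]) r s

lemma aPos_aMinus (m : Node P) : aPos n i (aMinus P m α 0) = 0 :=
  aPos_eq_zero n i fun x => by simp [aMinus, minusField]

lemma aNeg_aPlus (m : Node P) : aNeg n i (aPlus P m α 0) = 0 :=
  aNeg_eq_zero n i fun x => by
    have : ¬ 0 < -(n : ℤ) := by omega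
    simp [aPlus, plusField]

lemma aZero_aPlus (m : Node P) : aZero i (aPlus P m α 0) = P.logq * cartan m.1 i.1 := by
  change ∑ x : Node P, _ * cartan x.1 i.1 = _
  rw [Finset.sum_eq_single m _ (by simp)]
  · simp [aPlus, plusField]
  · intro x _ h
    simp [aPlus, plusField, h]

lemma aZero_aMinus (m : Node P) : aZero i (aMinus P m α 0) = -(P.logq * cartan m.1 i.1) := by
  change ∑ x : Node P, _ * cartan x.1 i.1 = _
  rw [Finset.sum_eq_single m _ (by simp)]
  · simp [aMinus, minusField]
  · intro x _ h
    simp [aMinus, minusField, h]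

lemma aPos_aPlus (hP : IsContracting P) (hn : 0 < n) (m : Node P) :
    aPos n i (aPlus P m α 0) = qexp P n (-(P.kg / 2) - α) *
      (qexp P n (cartan m.1 i.1) - qexp P n (-cartan m.1 i.1)) := by
  change _ * ∑ x : Node P, _ * P.br (cartan x.1 i.1 * n) = _
  have hn' : 0 < (n : ℤ) := by omega
  rw [Finset.sum_eq_single m _ (by simp), ← br_cartan_mul hP, sub_eq_add_neg, qexp_add]
  · simp only [aPlus, plusField, hn', and_self, if_true, qexp, Int.cast_natCast]
    ring_nf
  · intro x _ h
    simp [aPlus, plusField, h]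

lemma aNeg_aMinus (hP : IsContracting P) (hn : 0 < n) (m : Node P) :
    aNeg n i (aMinus P m α 0) = -(qexp P n (-(P.kg / 2) + α) *
      (qexp P n (cartan i.1 m.1) - qexp P n (-cartan i.1 m.1))) := by
  change _ * ∑ x : Node P, _ * P.br (cartan i.1 x.1 * n) = _
  have hn' : -(n : ℤ) < 0 := by omega
  rw [Finset.sum_eq_single m _ (by simp), ← br_cartan_mul hP, qexp_add]
  · simp only [aMinus, minusField, hn', and_self, if_true, qexp, Int.cast_natCast, Int.cast_neg]
    ring_nf
  · intro x _ h
    simp [aMinus, minusField, h]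

/-- The factor [(k+g)n] of the commutator cancels against the denominator in (1/(k+g) a^i), leaving
only the Cartan matrix and the shift q^(-(k+g)n/2) built into `aPos`. -/
lemma contractionHom_field_right (hP : IsContracting P) (hn : 0 < n) (L : LinForm P) :
    contractionHom n L (field 1 P.kg (.a i) (P.kg / 2) 0) = aPos n i L := by
  have hb := hP.br_ne_zero hn
  have hk := hP.br_kg_ne_zero hn
  rw [contractionHom_eq hn]
  have h1 : ∀ ρ, field 1 P.kg (.a i) (P.kg / 2) 0 (.osc (.b ρ) (-n)) = 0 := fun ρ => by
    simp [field]
  have h2 : ∀ ρ, field 1 P.kg (.a i) (P.kg / 2) 0 (.osc (.c ρ) (-n)) = 0 := fun ρ => by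
    simp [field]
  simp only [h1, h2, mul_zero, zero_mul, Finset.sum_const_zero, sub_zero, add_zero]
  rw [Finset.sum_eq_single i _ (by simp)]
  · rw [aPos_apply, Finset.mul_sum]
    refine Finset.sum_congr rfl fun x _ => ?_
    have hn' : -(n : ℤ) ≠ 0 := by omega
    simp only [field, hn', ne_eq, not_false_eq_true, and_self, if_true, Int.cast_neg,
      Int.cast_natCast, abs_neg, Nat.abs_cast, mul_neg, br_neg, one_mul, mul_zero, neg_zero,
      Complex.exp_zero, mul_one]
    rw [← neg_mul (P.kg / 2), qpow_eq_qexp, div_neg, neg_div_neg_eq]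
    field_simp
  · intro x _ h
    simp [field, h]

lemma contractionHom_field_left (hP : IsContracting P) (hn : 0 < n) (L : LinForm P) :
    contractionHom n (field 1 P.kg (.a i) (P.kg / 2) 0) L = -aNeg n i L := by
  have hb := hP.br_ne_zero hn
  have hk := hP.br_kg_ne_zero hn
  rw [contractionHom_eq hn]
  have h1 : ∀ ρ, field 1 P.kg (.a i) (P.kg / 2) 0 (.osc (.b ρ) n) = 0 := fun ρ => by
    simp [field]
  have h2 : ∀ ρ, field 1 P.kg (.a i) (P.kg / 2) 0 (.osc (.c ρ) n) = 0 := fun ρ => by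
    simp [field]
  simp only [h1, h2, mul_zero, Finset.sum_const_zero, sub_zero, add_zero]
  rw [aNeg_apply, Finset.mul_sum, ← Finset.sum_neg_distrib]
  refine Finset.sum_congr rfl fun x _ => ?_
  rw [Finset.sum_eq_single i _ (by simp)]
  · have hn' : (n : ℤ) ≠ 0 := by omega
    simp only [field, hn', ne_eq, not_false_eq_true, and_self, if_true,
      Int.cast_natCast, Nat.abs_cast, one_mul, mul_zero, neg_zero,
      Complex.exp_zero, mul_one]
    rw [← neg_mul (P.kg / 2), qpow_eq_qexp]
    field_simp
  · intro y _ h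
    simp [field, h]

end Values

/-! ### Zero mode parts -/

lemma momentumShift_eq_phat (L M : LinForm P) :
    phatPart L (momentumShift M)
      = ∑ x : Node P, L (.phat (.a x)) * ∑ y : Node P, M (.qhat (.a y)) * (P.kg * cartan x.1 y.1)
        - ∑ ρ : Root P, L (.phat (.b ρ)) * M (.qhat (.b ρ))
        + ∑ ρ : Root P, L (.phat (.c ρ)) * M (.qhat (.c ρ)) := by
  rw [phatPart, sum_boson, sub_eq_add_neg, ← Finset.sum_neg_distrib]
  simp only [momentumShift_a, momentumShift_b, momentumShift_c, mul_neg]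

/-- The zero mode contraction as a bilinear form. -/
def zeroContraction : LinForm P →+ LinForm P →+ ℂ :=
  AddMonoidHom.mk' (fun L => AddMonoidHom.mk' (fun M => phatPart L (momentumShift M)) fun M M' => by
    rw [momentumShift_add, phatPart_add_right]) fun L L' => by
    ext M
    simp [phatPart_add_left]

lemma zeroContraction_apply (L M : LinForm P) :
    zeroContraction L M = phatPart L (momentumShift M) := rfl

lemma zeroContraction_atRoot_right (L : LinForm P) (F : Root P → LinForm P) (r s : ℕ) :
    zeroContraction L (atRoot F r s) = atRoot (fun ρ => zeroContraction L (F ρ)) r s :=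
  atRoot_map (zeroContraction L) (map_zero _) F r s

lemma zeroContraction_atRoot_left (L : LinForm P) (F : Root P → LinForm P) (r s : ℕ) :
    zeroContraction (atRoot F r s) L = atRoot (fun ρ => zeroContraction (F ρ) L) r s :=
  atRoot_map (fun M => zeroContraction M L) (by simp) F r s

variable (L : LinForm P) (r s : ℕ) (σ α : ℂ)

lemma zeroContraction_bHat_right :
    zeroContraction L (bHat P r s σ α 0) = -coord 1 (fun ρ => .phat (.b ρ)) r s L := by
  rw [bHat, zeroContraction_atRoot_right]
  rw [coord_apply, one_mul, ← atRoot_neg]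
  congr 1
  funext ρ
  rw [zeroContraction_apply, momentumShift_eq_phat]
  simp [field]

lemma zeroContraction_cHat_right :
    zeroContraction L (cHat P r s α 0) = coord 1 (fun ρ => .phat (.c ρ)) r s L := by
  rw [cHat, zeroContraction_atRoot_right]
  rw [coord_apply, one_mul]
  congr 1
  funext ρ
  rw [zeroContraction_apply, momentumShift_eq_phat]
  simp [field]

lemma zeroContraction_bMinus_right : zeroContraction L (bMinus P r s α 0) = 0 := by
  rw [bMinus_eq, zeroContraction_atRoot_right]
  have : (fun ρ => zeroContraction L (minusField (.b ρ) (0 + α * P.logq)))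
      = fun _ : Root P => (0 : ℂ) := by
    funext ρ
    rw [zeroContraction_apply, momentumShift_eq_phat]
    simp [minusField]
  rw [this, atRoot_const, ite_self]

lemma zeroContraction_field_right (hP : IsContracting P) (i : Node P) :
    zeroContraction L (field 1 P.kg (.a i) (P.kg / 2) 0) = aZero i L := by
  have hk := hP.kg_ne_zero
  rw [zeroContraction_apply, momentumShift_eq_phat]
  simp only [field, reduceCtorEq, if_false, mul_zero, Finset.sum_const_zero, sub_zero, add_zero,
    Boson.a.injEq, ite_mul, zero_mul, Finset.sum_ite_eq', Finset.mem_univ, if_true]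
  refine Finset.sum_congr rfl fun x _ => ?_
  field_simp

variable {L} (hL : IsIntegral L)
include hL

/-- Equal charges in b and c see opposite signs of the zero mode commutator, so only the difference
of the coefficients of p̂_c and p̂_b matters. -/
lemma IsIntegral.zeroContraction_eq (M : LinForm P) :
    zeroContraction M L
      = ∑ ρ : Root P, (M (.phat (.c ρ)) - M (.phat (.b ρ))) * L (.qhat (.b ρ)) := by
  rw [zeroContraction_apply, momentumShift_eq_phat]
  simp only [hL.a, ← hL.balanced _, sub_mul, Finset.sum_sub_distrib]
  simp
  ring

lemma IsIntegral.zeroContraction_bHat :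
    zeroContraction (bHat P r s σ α 0) L = -(α * P.logq * qCoeff r s L) := by
  rw [bHat, zeroContraction_atRoot_left]
  rw [qCoeff, coord_apply, one_mul, ← atRoot_const_mul, ← atRoot_neg]
  congr 1
  funext ρ
  rw [hL.zeroContraction_eq]
  simp [field]

lemma IsIntegral.zeroContraction_cHat :
    zeroContraction (cHat P r s α 0) L = α * P.logq * qCoeff r s L := by
  rw [cHat, zeroContraction_atRoot_left]
  rw [qCoeff, coord_apply, one_mul, ← atRoot_const_mul]
  congr 1
  funext ρ
  rw [hL.zeroContraction_eq]
  simp [field]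

lemma IsIntegral.zeroContraction_bMinus :
    zeroContraction (bMinus P r s α 0) L = P.logq * qCoeff r s L := by
  rw [bMinus_eq, zeroContraction_atRoot_left]
  rw [qCoeff, coord_apply, one_mul, ← atRoot_const_mul]
  congr 1
  funext ρ
  rw [hL.zeroContraction_eq]
  simp [minusField]

lemma IsIntegral.zeroContraction_field (i : Node P) :
    zeroContraction (field 1 P.kg (.a i) (P.kg / 2) 0) L = 0 := by
  rw [hL.zeroContraction_eq]
  simp [field]

end Contraction

section Forms

variable {P : Params}

/-! ### The exponents in the currents -/

/-- The exponents in the screening current. -/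
def screeningForm (i : Node P) (j : ℕ) (ε u : ℂ) : LinForm P :=
  -field 1 P.kg (.a i) (P.kg / 2) u
    + (bHat P (i + 1) j 0 (P.N - j) u + cHat P (i + 1) j (P.N - j) u)
    + (-bHat P i j 1 (P.N - j) u - cHat P i j (P.N - j - ε) u)
    + ∑ l ∈ Finset.Icc (j + 1) P.N,
      (bMinus P (i + 1) l (P.N - l + 1) u - bMinus P i l (P.N - l) u)

/-- The exponents in `E^{+,m}`. -/
def raisingForm (m : Node P) (j : ℕ) (ε u : ℂ) : LinForm P :=
  (bHat P j m 0 (j - 1) u + cHat P j m (j - 1) u)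
    + (-bHat P j (m + 1) (-1) (j - 1) u - cHat P j (m + 1) (j - 1 + ε) u)
    + ∑ l ∈ Finset.Ico 1 j, (bPlus P l (m + 1) (l - 1) u - bPlus P l m l u)

/-- The exponents in the first part of `E^{-,m}`, where `1 ≤ j ≤ m`. -/
def loweringForm (m : Node P) (j : ℕ) (ε u : ℂ) : LinForm P :=
  (bHat P j (m + 1) 0 (-(P.k + j)) u + cHat P j (m + 1) (-(P.k + j)) u)
    + (-bHat P j m 1 (-(P.k + j)) u - cHat P j m (-(P.k + j + ε)) u)
    + ∑ l ∈ Finset.Icc (j + 1) m.1,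
      (bMinus P l (m + 1) (-(P.k + l - 1)) u - bMinus P l m (-(P.k + l)) u)
    + tailMinus P m u

/-- The exponents in the second part of `E^{-,m}`, where `m + 1 ≤ j ≤ N`. -/
def loweringForm' (m : Node P) (j : ℕ) (ε u : ℂ) : LinForm P :=
  (bHat P m j 0 (P.k + j - 1) u + cHat P m j (P.k + j - 1) u)
    + (-bHat P (m + 1) j (-1) (P.k + j - 1) u - cHat P (m + 1) j (P.k + j - 1 + ε) u)
    + tailPlus P m j u

/-! ### Contraction with the screening current -/

/-- The contraction with the tail in the screening current. -/
def bTail (n j r : ℕ) : LinForm P →ₗ[ℂ] ℂ :=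
  ∑ l ∈ Finset.Icc (j + 1) P.N, qexp P n (-l) • bPos n r l

/-- The zero mode contraction with the tail in the screening current. -/
def qTail (j r : ℕ) : LinForm P →ₗ[ℂ] ℂ := ∑ l ∈ Finset.Icc (j + 1) P.N, qCoeff r l

variable (hP : IsContracting P) {n : ℕ} (hn : 0 < n) (L : LinForm P) (i : Node P) (j : ℕ) (ε : ℂ)

-- Reduces contraction with the screening exponent to a few coordinate functionals of `L`. Their
-- values on each elementary field are known, so every contraction needed later becomes a finite
-- computation with powers of q.
include hP hn in
lemma contractionHom_screeningForm_right : contractionHom n L (screeningForm i j ε 0)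
    = -aPos n i L + (cPos n (i + 1) j L - bPos n (i + 1) j L) * qexp P n (P.N - j)
      + bPos n i j L * qexp P n (P.N - j - 1) - cPos n i j L * qexp P n (P.N - j - ε)
      + (qexp P n 1 - qexp P n (-1)) *
        (qexp P n (P.N + 1) * bTail n j (i + 1) L - qexp P n P.N * bTail n j i L) := by
  simp only [screeningForm, map_add, map_sub, map_neg, map_sum, contractionHom_bHat_right hP hn,
    contractionHom_cHat_right hP hn, contractionHom_bMinus_right hP hn,
    contractionHom_field_right n i hP hn, bTail, LinearMap.sum_apply, LinearMap.smul_apply,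
    smul_eq_mul, Finset.mul_sum, mul_sub, Finset.sum_sub_distrib]
  have h (x : ℂ) (l : ℕ) : qexp P n (x - l) = qexp P n x * qexp P n (-l) := by
    rw [← qexp_add, sub_eq_add_neg]
  have h' (x : ℂ) (l : ℕ) : qexp P n (x - l + 1) = qexp P n (x + 1) * qexp P n (-l) := by
    rw [← qexp_add]; ring_nf
  have e1 : ∀ f : ℕ → ℂ, ∑ l ∈ Finset.Icc (j + 1) P.N,
      f l * ((qexp P n 1 - qexp P n (-1)) * qexp P n (P.N - l + 1))
      = ∑ l ∈ Finset.Icc (j + 1) P.N, (qexp P n 1 - qexp P n (-1)) *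
        (qexp P n (P.N + 1) * (qexp P n (-l) * f l)) := fun f =>
    Finset.sum_congr rfl fun l _ => by rw [h']; ring
  have e2 : ∀ f : ℕ → ℂ, ∑ l ∈ Finset.Icc (j + 1) P.N,
      f l * ((qexp P n 1 - qexp P n (-1)) * qexp P n (P.N - l))
      = ∑ l ∈ Finset.Icc (j + 1) P.N, (qexp P n 1 - qexp P n (-1)) *
        (qexp P n P.N * (qexp P n (-l) * f l)) := fun f =>
    Finset.sum_congr rfl fun l _ => by rw [h]; ring
  rw [e1, e2, sub_zero, sub_right_comm]
  ring

include hP hn in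
lemma contractionHom_screeningForm_left : contractionHom n (screeningForm i j ε 0) L
    = aNeg n i L + (bNeg n (i + 1) j L - cNeg n (i + 1) j L) * qexp P n (-(P.N - j))
      - bNeg n i j L * qexp P n (-1 - (P.N - j)) + cNeg n i j L * qexp P n (-(P.N - j - ε)) := by
  simp only [screeningForm, map_add, map_sub, map_neg, map_sum, contractionHom_bHat_left hP hn,
    contractionHom_cHat_left hP hn, contractionHom_bMinus_left hP hn,
    contractionHom_field_left n i hP hn, AddMonoidHom.add_apply, AddMonoidHom.sub_apply,
    AddMonoidHom.neg_apply, AddMonoidHom.finsetSum_apply, sub_zero, Finset.sum_const_zero]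
  ring_nf

include hP in
lemma zeroContraction_screeningForm_right : zeroContraction L (screeningForm i j ε 0)
    = -aZero i L + pDiff (i + 1) j L - pDiff i j L := by
  simp only [screeningForm, map_add, map_sub, map_neg, map_sum, zeroContraction_bHat_right,
    zeroContraction_cHat_right, zeroContraction_bMinus_right, zeroContraction_field_right _ hP,
    pDiff, LinearMap.sub_apply, sub_zero, Finset.sum_const_zero]
  ring

lemma IsIntegral.zeroContraction_screeningForm {L : LinForm P} (hL : IsIntegral L) :
    zeroContraction (screeningForm i j ε 0) L
      = P.logq * (ε * qCoeff i j L + qTail j (i + 1) L - qTail j i L) := by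
  simp only [screeningForm, map_add, map_sub, map_neg, map_sum, hL.zeroContraction_bHat,
    hL.zeroContraction_cHat, hL.zeroContraction_bMinus, hL.zeroContraction_field,
    AddMonoidHom.add_apply, AddMonoidHom.sub_apply,
    AddMonoidHom.neg_apply, AddMonoidHom.finsetSum_apply, Finset.sum_sub_distrib, qTail,
    LinearMap.sum_apply, mul_add, mul_sub, Finset.mul_sum]
  ring

section Tails

variable (r r' s' : ℕ) (σ α : ℂ) (m : Node P)

lemma sum_tail_ite (v : ℕ → ℂ) :
    ∑ l ∈ Finset.Icc (j + 1) P.N,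
      (if r = r' ∧ l = s' ∧ 1 ≤ r ∧ r < l ∧ l ≤ P.N then v l else 0)
      = if r = r' ∧ j < s' ∧ 1 ≤ r ∧ r < s' ∧ s' ≤ P.N then v s' else 0 := by
  by_cases h : r = r' ∧ j < s' ∧ 1 ≤ r ∧ r < s' ∧ s' ≤ P.N
  · rw [if_pos h, Finset.sum_eq_single s', if_pos ⟨h.1, rfl, h.2.2⟩]
    · intro l _ hl
      rw [if_neg fun h => hl h.2.1]
    · intro hs
      exact absurd (Finset.mem_Icc.2 ⟨h.2.1, h.2.2.2.2⟩) hs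
  · rw [if_neg h]
    refine Finset.sum_eq_zero fun l hl => if_neg ?_
    rintro ⟨h1, rfl, h2⟩
    exact h ⟨h1, by have := Finset.mem_Icc.1 hl; omega, h2⟩

lemma bTail_apply (L : LinForm P) :
    bTail n j r L = ∑ l ∈ Finset.Icc (j + 1) P.N, qexp P n (-l) * bPos n r l L := by
  simp [bTail, LinearMap.sum_apply]

lemma qTail_apply (L : LinForm P) :
    qTail j r L = ∑ l ∈ Finset.Icc (j + 1) P.N, qCoeff r l L := by
  simp [qTail, LinearMap.sum_apply]

include hP hn in
lemma bTail_bHat : bTail n j r (bHat P r' s' σ α 0)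
    = if r = r' ∧ j < s' ∧ 1 ≤ r ∧ r < s' ∧ s' ≤ P.N then -qexp P n (-σ - α - s') else 0 := by
  simp only [bTail_apply, bPos_bHat hP n _ _ _ _ hn, mul_ite, mul_zero]
  rw [sum_tail_ite j r r' s' fun l => qexp P n (-l) * -qexp P n (-σ - α), mul_neg, ← qexp_add]
  ring_nf

include hP hn in
lemma bTail_bPlus : bTail n j r (bPlus P r' s' α 0)
    = if r = r' ∧ j < s' ∧ 1 ≤ r ∧ r < s' ∧ s' ≤ P.N then
      (qexp P n 1 - qexp P n (-1)) * qexp P n (-α - s') else 0 := by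
  simp only [bTail_apply, bPos_bPlus hP n _ _ _ _ hn, mul_ite, mul_zero]
  rw [sum_tail_ite j r r' s' fun l => qexp P n (-l) *
    ((qexp P n 1 - qexp P n (-1)) * qexp P n (-α)), sub_eq_add_neg (-α), qexp_add]
  congr 1
  ring

lemma bTail_cHat : bTail n j r (cHat P r' s' α 0) = 0 := by
  simp [bTail_apply, bPos_cHat]

lemma bTail_bMinus : bTail n j r (bMinus P r' s' α 0) = 0 := by
  simp [bTail_apply, bPos_bMinus]

lemma bTail_aPlus : bTail n j r (aPlus P m α 0) = 0 := by
  simp [bTail_apply, bPos_aPlus]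

lemma bTail_aMinus : bTail n j r (aMinus P m α 0) = 0 := by
  simp [bTail_apply, bPos_aMinus]

lemma qTail_bHat : qTail j r (bHat P r' s' σ α 0)
    = if r = r' ∧ j < s' ∧ 1 ≤ r ∧ r < s' ∧ s' ≤ P.N then 1 else 0 := by
  simp only [qTail_apply, qCoeff_bHat]
  exact sum_tail_ite j r r' s' fun _ => 1

lemma qTail_cHat : qTail j r (cHat P r' s' α 0) = 0 := by
  simp [qTail_apply, qCoeff_cHat]

lemma qTail_bPlus : qTail j r (bPlus P r' s' α 0) = 0 := by
  simp [qTail_apply, qCoeff_bPlus]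

lemma qTail_bMinus : qTail j r (bMinus P r' s' α 0) = 0 := by
  simp [qTail_apply, qCoeff_bMinus]

lemma qTail_aPlus : qTail j r (aPlus P m α 0) = 0 := by
  simp [qTail_apply, qCoeff_aPlus]

lemma qTail_aMinus : qTail j r (aMinus P m α 0) = 0 := by
  simp [qTail_apply, qCoeff_aMinus]

end Tails

/-! ### Integrality -/

lemma IsIntegral.add {L M : LinForm P} (hL : IsIntegral L) (hM : IsIntegral M) :
    IsIntegral (L + M) := by
  refine ⟨fun i => by simp [hL.a, hM.a], fun r => ?_, fun r => ?_⟩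
  · simp only [Pi.add_apply, hL.balanced r, hM.balanced r]
  · obtain ⟨x, hx⟩ := hL.int r
    obtain ⟨y, hy⟩ := hM.int r
    exact ⟨x + y, by simp [hx, hy]⟩

lemma IsIntegral.neg {L : LinForm P} (hL : IsIntegral L) : IsIntegral (-L) := by
  refine ⟨fun i => by simp [hL.a], fun r => ?_, fun r => ?_⟩
  · simp only [Pi.neg_apply, hL.balanced r]
  · obtain ⟨x, hx⟩ := hL.int r
    exact ⟨-x, by simp [hx]⟩

lemma IsIntegral.of_qhat {L : LinForm P} (h : ∀ x, L (.qhat x) = 0) : IsIntegral L :=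
  ⟨fun i => h _, fun r => by rw [h, h], fun r => ⟨0, by simp [h]⟩⟩

/-- The q̂ part of a field depends neither on its argument nor on σ, so b and c enter with the same
charge, 0 or 1, although their arguments differ. -/
lemma isIntegral_pair (r s : ℕ) (σ α β u : ℂ) : IsIntegral (bHat P r s σ α u + cHat P r s β u) := by
  unfold bHat cHat
  rw [← atRoot_add]
  unfold atRoot
  split_ifs with h
  · refine ⟨fun i => by simp [field], fun r => by simp [field], fun r => ?_⟩
    by_cases hr : r = ⟨_, h⟩
    · exact ⟨1, by simp [field, hr]⟩
    · exact ⟨0, by simp [field, hr]⟩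
  · exact .of_qhat fun _ => rfl

lemma isIntegral_neg_pair (r s : ℕ) (σ α β u : ℂ) :
    IsIntegral (-bHat P r s σ α u - cHat P r s β u) := by
  simpa only [neg_add, ← sub_eq_add_neg] using (isIntegral_pair r s σ α β u).neg

end Forms

section Forms

variable {P : Params}

/-! ### Operator product expansions with the screening current -/

lemma sum_Ico_ite (j r : ℕ) (p : ℕ → Prop) [DecidablePred p] (v : ℕ → ℂ) :
    ∑ l ∈ Finset.Ico 1 j, (if r = l ∧ p l then v l else 0)
      = if 1 ≤ r ∧ r < j ∧ p r then v r else 0 := by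
  by_cases h : 1 ≤ r ∧ r < j ∧ p r
  · rw [if_pos h, Finset.sum_eq_single r, if_pos ⟨rfl, h.2.2⟩]
    · intro l _ hl
      rw [if_neg fun h => hl h.1.symm]
    · intro hs
      exact absurd (Finset.mem_Ico.2 ⟨h.1, h.2.1⟩) hs
  · rw [if_neg h]
    refine Finset.sum_eq_zero fun l hl => if_neg ?_
    rintro ⟨rfl, h2⟩
    have := Finset.mem_Ico.1 hl
    exact h ⟨this.1, this.2, h2⟩

lemma sum_Icc_ite (a b r : ℕ) (p : ℕ → Prop) [DecidablePred p] (v : ℕ → ℂ) :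
    ∑ l ∈ Finset.Icc a b, (if r = l ∧ p l then v l else 0)
      = if a ≤ r ∧ r ≤ b ∧ p r then v r else 0 := by
  by_cases h : a ≤ r ∧ r ≤ b ∧ p r
  · rw [if_pos h, Finset.sum_eq_single r, if_pos ⟨rfl, h.2.2⟩]
    · intro l _ hl
      rw [if_neg fun h => hl h.1.symm]
    · intro hs
      exact absurd (Finset.mem_Icc.2 ⟨h.1, h.2.1⟩) hs
  · rw [if_neg h]
    refine Finset.sum_eq_zero fun l hl => if_neg ?_
    rintro ⟨rfl, h2⟩
    have := Finset.mem_Icc.1 hl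
    exact h ⟨this.1, this.2, h2⟩

lemma sum_Icc_ite' (a b s : ℕ) (p q : Prop) [Decidable p] [Decidable q] (v : ℕ → ℂ) :
    ∑ l ∈ Finset.Icc a b, (if p ∧ s = l ∧ q then v l else 0)
      = if a ≤ s ∧ s ≤ b ∧ p ∧ q then v s else 0 := by
  rw [← sum_Icc_ite a b s (fun _ => p ∧ q) v]
  exact Finset.sum_congr rfl fun l _ => by congr 1; simp only [eq_iff_iff]; tauto

/-- The values of the contractions of `L` with a screening exponent. -/
structure HasOPE (L M : LinForm P) (e e' ζ : ℂ) : Prop where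
  right : ∀ n : ℕ, 0 < n → contractionHom n L M = qexp P n e - qexp P n e'
  left : ∀ n : ℕ, 0 < n → contractionHom n M L = qexp P n (-e) - qexp P n (-e')
  zero_right : zeroContraction L M = ζ * P.logq
  zero_left : zeroContraction M L = (ζ + e' - e) * P.logq

lemma HasOPE.hasSimplePole {L M : LinForm P} {e e' ζ : ℂ} (h : HasOPE L M e e' ζ) :
    HasSimplePole L M (e * P.logq) (e' * P.logq) where
  left n hn := h.right n hn
  right n hn := by
    rw [← contractionHom_apply, h.left n hn, qexp, qexp]
    ring_nf
  zero := by
    rw [← zeroContraction_apply, ← zeroContraction_apply, h.zero_left, h.zero_right]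
    ring

section Raising

variable (hP : IsContracting P) (i m : Node P) (j j' : ℕ) (ε ε' : ℂ)

lemma isIntegral_raisingForm (u : ℂ) : IsIntegral (raisingForm m j ε u) := by
  refine ((isIntegral_pair ..).add (isIntegral_neg_pair ..)).add (.of_qhat fun x => ?_)
  rw [Finset.sum_apply]
  refine Finset.sum_eq_zero fun l _ => ?_
  rw [Pi.sub_apply, bPlus_eq, bPlus_eq, atRoot_eq_zero (fun ρ => by simp [plusField]),
    atRoot_eq_zero (fun ρ => by simp [plusField]), sub_zero]

variable (hj : 1 ≤ j ∧ j ≤ m) (hj' : i + 1 ≤ j' ∧ j' ≤ P.N)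
include hP hj hj'

/-- Only the pairs (i, m + 1), (i, m) and (i + 1, m + 1) for (j, j') interact. For each of them the
value is a difference of two n-th powers, hence one pole and one zero. -/
lemma contraction_raising_screening {n : ℕ} (hn : 0 < n) :
    contractionHom n (raisingForm m j ε 0) (screeningForm i j' ε' 0) =
      if j = i ∧ j' = m + 1 then qexp P n (P.N - m - i) - qexp P n (P.N - m - i - ε - ε')
      else if j = i ∧ j' = m then
        qexp P n (P.N - m - i + 1 - ε') - qexp P n (P.N - m - i + 2)
      else if j = i + 1 ∧ j' = m + 1 then
        qexp P n (P.N - m - i - 1 - ε) - qexp P n (P.N - m - i - 2) else 0 := by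
  rw [contractionHom_screeningForm_right hP hn]
  simp only [raisingForm, map_add, map_sub, map_neg, map_sum,
    bPos_bHat hP n _ _ _ _ hn, bPos_bPlus hP n _ _ _ _ hn, bPos_cHat, cPos_bHat,
    cPos_cHat hP n _ _ _ _ hn, cPos_bPlus, bTail_bHat hP hn, bTail_bPlus hP hn, bTail_cHat,
    aPos_bHat, aPos_cHat, aPos_bPlus, Finset.sum_sub_distrib, sum_Ico_ite,
    Finset.sum_const_zero, sub_zero, add_zero, zero_add, neg_zero, zero_sub]
  have hi := Finset.mem_Ico.1 i.2
  have hm := Finset.mem_Ico.1 m.2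
  -- All index conditions are decided by the position of j relative to i, i + 1 and of j' relative
  -- to m, m + 1; in every case a rational identity in powers of q is left.
  rcases (by omega : j < i ∨ j = i ∨ j = i + 1 ∨ i + 1 < j) with h | h | h | h <;>
  rcases (by omega : j' < m ∨ j' = m ∨ j' = m + 1 ∨ m + 1 < j') with h' | h' | h' | h' <;>
  (try (exfalso; omega)) <;>
  simp (disch := omega) only [if_pos, if_neg, mul_zero, zero_mul, sub_zero, add_zero, zero_add,
    neg_zero, zero_sub, sub_self] <;>
  (try subst h) <;> (try subst h') <;> (try push_cast) <;>
  (try simp only [sub_eq_add_neg, qexp_add, qexp_neg, neg_add, neg_neg, qexp_two]) <;>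
  (try field_simp [qexp_ne_zero]) <;> (try ring)

lemma contraction_screening_raising {n : ℕ} (hn : 0 < n) :
    contractionHom n (screeningForm i j' ε' 0) (raisingForm m j ε 0) =
      if j = i ∧ j' = m + 1 then qexp P n (-(P.N - m - i)) - qexp P n (-(P.N - m - i - ε - ε'))
      else if j = i ∧ j' = m then
        qexp P n (-(P.N - m - i + 1 - ε')) - qexp P n (-(P.N - m - i + 2))
      else if j = i + 1 ∧ j' = m + 1 then
        qexp P n (-(P.N - m - i - 1 - ε)) - qexp P n (-(P.N - m - i - 2)) else 0 := by
  rw [contractionHom_screeningForm_left hP hn]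
  simp only [raisingForm, map_add, map_sub, map_neg, map_sum,
    bNeg_bHat hP n _ _ _ _ hn, bNeg_bPlus, bNeg_cHat, cNeg_bHat,
    cNeg_cHat hP n _ _ _ _ hn, cNeg_bPlus,
    aNeg_bHat, aNeg_cHat, aNeg_bPlus, Finset.sum_sub_distrib,
    Finset.sum_const_zero, sub_zero, add_zero, zero_add, neg_zero, zero_sub]
  have hi := Finset.mem_Ico.1 i.2
  have hm := Finset.mem_Ico.1 m.2
  rcases (by omega : j < i ∨ j = i ∨ j = i + 1 ∨ i + 1 < j) with h | h | h | h <;>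
  rcases (by omega : j' < m ∨ j' = m ∨ j' = m + 1 ∨ m + 1 < j') with h' | h' | h' | h' <;>
  (try (exfalso; omega)) <;>
  simp (disch := omega) only [if_pos, if_neg, mul_zero, zero_mul, sub_zero, add_zero, zero_add,
    neg_zero, zero_sub, sub_self] <;>
  (try subst h) <;> (try subst h') <;> (try push_cast) <;>
  (try simp only [sub_eq_add_neg, qexp_add, qexp_neg, neg_add, neg_neg, qexp_two]) <;>
  (try field_simp [qexp_ne_zero]) <;> (try ring)

/-- The zero mode exponents have to be matched with the oscillator contractions: the values in the
two orders must differ by the exponent of the zero minus that of the pole, as `HasOPE` demands. -/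
lemma zeroContraction_raising_screening :
    zeroContraction (raisingForm m j ε 0) (screeningForm i j' ε' 0) =
      (if j' = m + 1 then (if j = i then ε else if j = i + 1 then 1 - ε else 0)
        else if j = i + 1 ∧ j' = m then -1 else 0) * P.logq := by
  rw [zeroContraction_screeningForm_right hP]
  simp only [raisingForm, map_add, map_sub, map_neg, map_sum, pDiff_bHat, pDiff_cHat, pDiff_bPlus,
    aZero_bHat, aZero_cHat, aZero_bPlus, Finset.sum_sub_distrib, sum_Ico_ite,
    Finset.sum_const_zero, sub_zero, add_zero, zero_add, neg_zero, zero_sub]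
  have hi := Finset.mem_Ico.1 i.2
  have hm := Finset.mem_Ico.1 m.2
  rcases (by omega : j < i ∨ j = i ∨ j = i + 1 ∨ i + 1 < j) with h | h | h | h <;>
  rcases (by omega : j' < m ∨ j' = m ∨ j' = m + 1 ∨ m + 1 < j') with h' | h' | h' | h' <;>
  rcases (by omega : i.1 + 1 = j' ∨ i.1 + 1 < j') with h'' | h'' <;>
  (try (exfalso; omega)) <;>
  simp (disch := omega) only [if_pos, if_neg, mul_zero, zero_mul, sub_zero, add_zero, zero_add,
    neg_zero, zero_sub, sub_self] <;>
  (try push_cast) <;> (try ring)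

lemma zeroContraction_screening_raising :
    zeroContraction (screeningForm i j' ε' 0) (raisingForm m j ε 0) =
      (if j = i ∧ j' = m + 1 then -ε' else if j = i ∧ j' = m then 1 + ε'
        else if j = i + 1 ∧ j' = m then -1 else 0) * P.logq := by
  rw [(isIntegral_raisingForm ..).zeroContraction_screeningForm]
  simp only [raisingForm, map_add, map_sub, map_neg, map_sum, qCoeff_bHat, qCoeff_cHat,
    qCoeff_bPlus, qTail_bHat, qTail_cHat, qTail_bPlus,
    Finset.sum_const_zero, sub_zero, add_zero, zero_add, neg_zero, zero_sub]
  have hi := Finset.mem_Ico.1 i.2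
  have hm := Finset.mem_Ico.1 m.2
  rcases (by omega : j < i ∨ j = i ∨ j = i + 1 ∨ i + 1 < j) with h | h | h | h <;>
  rcases (by omega : j' < m ∨ j' = m ∨ j' = m + 1 ∨ m + 1 < j') with h' | h' | h' | h' <;>
  rcases (by omega : i.1 + 1 = j' ∨ i.1 + 1 < j') with h'' | h'' <;>
  (try (exfalso; omega)) <;>
  simp (disch := omega) only [if_pos, if_neg, mul_zero, zero_mul, sub_zero, add_zero, zero_add,
    neg_zero, zero_sub, sub_self] <;>
  (try push_cast) <;> (try ring)

end Raising

end Forms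

/-! ### Contractions of the lowering currents with the screening current. -/

section Lowering

variable {P : Params}

lemma cartan_self (i : ℕ) : cartan i i = 2 := by simp [cartan]

lemma cartan_succ_right {i j : ℕ} (h : i + 1 = j) : cartan i j = -1 := by
  rw [cartan, if_neg (by omega), if_pos (Or.inl h)]

lemma cartan_succ_left {i j : ℕ} (h : j + 1 = i) : cartan i j = -1 := by
  rw [cartan, if_neg (by omega), if_pos (Or.inr h)]

lemma cartan_eq_zero {i j : ℕ} (h : i + 1 < j ∨ j + 1 < i) : cartan i j = 0 := by
  rw [cartan, if_neg (by omega), if_neg (by omega)]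

/-- The sum telescopes, since (q^n - q^(-n)) q^(-2nl) is the difference of q^(n(1 - 2l)) at l and at
l + 1. -/
lemma sum_qexp (n J N : ℕ) (h : J ≤ N + 1) :
    ∑ l ∈ Finset.Icc J N, (qexp P n 1 - qexp P n (-1)) * qexp P n (-(2 * l))
      = qexp P n (1 - 2 * J) - qexp P n (-1 - 2 * N) := by
  have := Finset.sum_Ico_sub (fun l : ℕ => -qexp P n (1 - 2 * l)) h
  rw [show Finset.Ico J (N + 1) = Finset.Icc J N from by ext; simp] at this
  rw [show qexp P n (1 - 2 * J) - qexp P n (-1 - 2 * N)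
    = -qexp P n (1 - 2 * (N + 1 : ℕ)) - -qexp P n (1 - 2 * J) by push_cast; ring_nf, ← this]
  refine Finset.sum_congr rfl fun l _ => ?_
  rw [sub_mul, ← qexp_add, ← qexp_add]
  push_cast
  ring_nf

/-- The tail l ≥ j of a lowering exponent meets the tail l > j' of the screening exponent in l ≥
max(j, j' + 1), and the contraction over this overlap is a telescoping sum. -/
lemma sum_tailPlus (n N j j' r m : ℕ) (x : ℂ) (h1 : 1 ≤ r) (hr : r ≤ j') (hj : j ≤ N + 1)
    (hj' : j' ≤ N) :
    ∑ l ∈ Finset.Icc j N, (if r = m ∧ j' < l ∧ 1 ≤ r ∧ r < l ∧ l ≤ N then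
        (qexp P n 1 - qexp P n (-1)) * qexp P n (-(x + l) - l) else 0)
      = if r = m then qexp P n (-x) *
        (qexp P n (1 - 2 * (max j (j' + 1) : ℕ)) - qexp P n (-1 - 2 * N)) else 0 := by
  split_ifs with h
  · rw [← sum_qexp n _ N (by omega), Finset.mul_sum,
      show Finset.Icc (max j (j' + 1)) N = (Finset.Icc j N).filter (fun l => j' + 1 ≤ l) from by
        ext; simp; omega, Finset.sum_filter]
    refine Finset.sum_congr rfl fun l hl => ?_
    have := (Finset.mem_Icc.1 hl).2
    by_cases hl' : j' + 1 ≤ l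
    · rw [if_pos hl', if_pos ⟨h, by omega⟩, show -(x + l) - l = -x + -(2 * l) by ring, qexp_add]
      ring
    · rw [if_neg hl', if_neg (by omega)]
  · exact Finset.sum_eq_zero fun l _ => if_neg fun h' => h h'.1

lemma cartan_cases (m i : ℕ) : m + 1 < i ∧ cartan m i = 0 ∨ m + 1 = i ∧ cartan m i = -1 ∨
    m = i ∧ cartan m i = 2 ∨ m = i + 1 ∧ cartan m i = -1 ∨ i + 1 < m ∧ cartan m i = 0 := by
  rcases (by omega : m + 1 < i ∨ m + 1 = i ∨ m = i ∨ m = i + 1 ∨ i + 1 < m) with h | h | h | h | h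
  · exact Or.inl ⟨h, cartan_eq_zero (by omega)⟩
  · exact Or.inr (Or.inl ⟨h, cartan_succ_right h⟩)
  · exact Or.inr (Or.inr (Or.inl ⟨h, by rw [h, cartan_self]⟩))
  · exact Or.inr (Or.inr (Or.inr (Or.inl ⟨h, cartan_succ_left (by omega)⟩)))
  · exact Or.inr (Or.inr (Or.inr (Or.inr ⟨h, cartan_eq_zero (by omega)⟩)))

lemma cartan_comm (i j : ℕ) : cartan i j = cartan j i := by
  unfold cartan
  congr 1
  · exact propext eq_comm
  · congr 1
    exact propext or_comm

lemma aPos_aPlus_half (hP : IsContracting P) {n : ℕ} (hn : 0 < n) (i m : Node P) :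
    aPos n i (aPlus P m (P.kg / 2) 0) = qexp P n (-P.k - P.N) *
      (qexp P n (cartan m.1 i.1) - qexp P n (-cartan m.1 i.1)) := by
  rw [aPos_aPlus n i _ hP hn, show -(P.kg / 2) - P.kg / 2 = -P.k - P.N by
    rw [Params.kg]; ring]

lemma aNeg_aMinus_half (hP : IsContracting P) {n : ℕ} (hn : 0 < n) (i m : Node P) :
    aNeg n i (aMinus P m (-(P.kg / 2)) 0) = -(qexp P n (-P.k - P.N) *
      (qexp P n (cartan m.1 i.1) - qexp P n (-cartan m.1 i.1))) := by
  rw [cartan_comm, aNeg_aMinus n i _ hP hn, show -(P.kg / 2) + -(P.kg / 2) = -P.k - P.N by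
    rw [Params.kg]; ring]

section Second

variable (hP : IsContracting P) (i m : Node P) (j j' : ℕ) (ε ε' : ℂ)

lemma isIntegral_loweringForm' (u : ℂ) : IsIntegral (loweringForm' m j ε u) := by
  refine ((isIntegral_pair ..).add (isIntegral_neg_pair ..)).add
    (.add (.of_qhat fun x => rfl) (.of_qhat fun x => ?_))
  rw [Finset.sum_apply]
  refine Finset.sum_eq_zero fun l _ => ?_
  rw [Pi.sub_apply, bPlus_eq, bPlus_eq, atRoot_eq_zero (fun ρ => by simp [plusField]),
    atRoot_eq_zero (fun ρ => by simp [plusField]), sub_zero]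

variable (hj : m + 1 ≤ j ∧ j ≤ P.N) (hεs : ε = 1 ∨ ε = -1)
  (hε : j = m + 1 → ε = 1) (hj' : i + 1 ≤ j' ∧ j' ≤ P.N)
include hP hj hj' hεs hε

-- Only equal labels j = j' interact, and only for m = i or m + 1 = i. The sign hypothesis at j = m
-- + 1 is needed because b^{jj} = c^{jj} = 0: the exponent there does not depend on ε, and the
-- uniform formula is right only for ε = 1.
set_option maxHeartbeats 1000000 in
lemma contraction_lowering'_screening {n : ℕ} (hn : 0 < n) :
    contractionHom n (loweringForm' m j ε 0) (screeningForm i j' ε' 0) =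
      if m.1 = i ∧ j = j' then
        qexp P n (P.N - P.k - 2 * j + 1 - ε') - qexp P n (P.N - P.k - 2 * j + 1 + ε)
      else if m.1 + 1 = i ∧ j = j' then
        qexp P n (P.N - P.k - 2 * j + 1) - qexp P n (P.N - P.k - 2 * j + 1 - ε - ε')
      else 0 := by
  have hi := Finset.mem_Ico.1 i.2
  have hm := Finset.mem_Ico.1 m.2
  rw [contractionHom_screeningForm_right hP hn]
  have e1 (l : ℕ) : -(P.k + (l : ℂ) - 1) - l = -(P.k - 1 + l) - l := by ring
  simp only [loweringForm', tailPlus, map_add, map_sub, map_neg, map_sum,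
    bPos_bHat hP n _ _ _ _ hn, bPos_bPlus hP n _ _ _ _ hn, bPos_cHat, cPos_bHat,
    cPos_cHat hP n _ _ _ _ hn, cPos_bPlus, bTail_bHat hP hn, bTail_bPlus hP hn, bTail_cHat,
    aPos_bHat, aPos_cHat, aPos_bPlus, bPos_aPlus, cPos_aPlus, bTail_aPlus,
    aPos_aPlus_half hP hn, Finset.sum_sub_distrib, sum_Icc_ite', e1,
    Finset.sum_const_zero, sub_zero, add_zero, zero_add, neg_zero, zero_sub]
  rw [sum_tailPlus n P.N j j' (i + 1) m P.k (by omega) (by omega) (by omega) (by omega),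
    sum_tailPlus n P.N j j' i m P.k (by omega) (by omega) (by omega) (by omega),
    sum_tailPlus n P.N j j' (i + 1) (m + 1) (P.k - 1) (by omega) (by omega) (by omega) (by omega),
    sum_tailPlus n P.N j j' i (m + 1) (P.k - 1) (by omega) (by omega) (by omega) (by omega)]
  have hε' : j = m + 1 ∧ ε = 1 ∨ m + 1 < j ∧ ε = 1 ∨ m + 1 < j ∧ ε = -1 := by
    rcases (by omega : j = m + 1 ∨ m + 1 < j) with h | h
    exacts [Or.inl ⟨h, hε h⟩, Or.inr (hεs.imp (⟨h, ·⟩) (⟨h, ·⟩))]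
  clear hε hεs
  -- The maximum from the overlap of the two tails is resolved together with the position of j
  -- relative to j'.
  have hjj : j < j' ∧ max j (j' + 1) = j' + 1 ∨ j = j' ∧ max j (j' + 1) = j' + 1 ∨
    j = j' + 1 ∧ max j (j' + 1) = j' + 1 ∨ j' + 1 < j ∧ max j (j' + 1) = j := by omega
  rcases cartan_cases m i with ⟨h, hc⟩ | ⟨h, hc⟩ | ⟨h, hc⟩ | ⟨h, hc⟩ | ⟨h, hc⟩ <;>
  rcases hε' with ⟨h1, rfl⟩ | ⟨h1, rfl⟩ | ⟨h1, rfl⟩ <;>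
  rcases hjj with ⟨h', hm⟩ | ⟨h', hm⟩ | ⟨h', hm⟩ | ⟨h', hm⟩ <;>
  rw [hc, hm] <;> clear hc hm <;>
  (try (exfalso; omega)) <;>
  simp (disch := omega) only [if_pos, if_neg, mul_zero, zero_mul, sub_zero, add_zero, zero_add,
    neg_zero, zero_sub, sub_self] <;>
  (try subst h') <;> (try push_cast) <;>
  (try simp only [sub_eq_add_neg, qexp_add, qexp_neg, neg_add, neg_neg, qexp_two, mul_add,
    qexp_two_mul, mul_one, inv_inv]) <;>
  (try field_simp [qexp_ne_zero]) <;> (try ring)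

lemma contraction_screening_lowering' {n : ℕ} (hn : 0 < n) :
    contractionHom n (screeningForm i j' ε' 0) (loweringForm' m j ε 0) =
      if m.1 = i ∧ j = j' then
        qexp P n (-(P.N - P.k - 2 * j + 1 - ε')) - qexp P n (-(P.N - P.k - 2 * j + 1 + ε))
      else if m.1 + 1 = i ∧ j = j' then
        qexp P n (-(P.N - P.k - 2 * j + 1)) - qexp P n (-(P.N - P.k - 2 * j + 1 - ε - ε'))
      else 0 := by
  have hi := Finset.mem_Ico.1 i.2
  have hm := Finset.mem_Ico.1 m.2
  rw [contractionHom_screeningForm_left hP hn]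
  simp only [loweringForm', tailPlus, map_add, map_sub, map_neg, map_sum,
    bNeg_bHat hP n _ _ _ _ hn, bNeg_bPlus, bNeg_cHat, cNeg_bHat,
    cNeg_cHat hP n _ _ _ _ hn, cNeg_bPlus, aNeg_bHat, aNeg_cHat, aNeg_bPlus, bNeg_aPlus,
    cNeg_aPlus, aNeg_aPlus, Finset.sum_sub_distrib,
    Finset.sum_const_zero, sub_zero, add_zero, zero_add, neg_zero, zero_sub]
  have hε' : j = m + 1 ∧ ε = 1 ∨ m + 1 < j ∧ ε = 1 ∨ m + 1 < j ∧ ε = -1 := by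
    rcases (by omega : j = m + 1 ∨ m + 1 < j) with h | h
    exacts [Or.inl ⟨h, hε h⟩, Or.inr (hεs.imp (⟨h, ·⟩) (⟨h, ·⟩))]
  clear hε hεs
  rcases (by omega : m.1 + 1 < i ∨ m.1 + 1 = i ∨ m.1 = i ∨ m.1 = i + 1 ∨ i + 1 < m.1)
    with h | h | h | h | h <;>
  rcases hε' with ⟨h1, rfl⟩ | ⟨h1, rfl⟩ | ⟨h1, rfl⟩ <;>
  rcases (by omega : j < j' ∨ j = j' ∨ j = j' + 1 ∨ j' + 1 < j) with h' | h' | h' | h' <;>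
  (try (exfalso; omega)) <;>
  simp (disch := omega) only [if_pos, if_neg, mul_zero, zero_mul, sub_zero, add_zero, zero_add,
    neg_zero, zero_sub, sub_self] <;>
  (try subst h') <;> (try push_cast) <;>
  (try simp only [sub_eq_add_neg, qexp_add, qexp_neg, neg_add, neg_neg, qexp_two, mul_add,
    qexp_two_mul, mul_one, inv_inv]) <;>
  (try field_simp [qexp_ne_zero]) <;> (try ring)

lemma zeroContraction_lowering'_screening :
    zeroContraction (loweringForm' m j ε 0) (screeningForm i j' ε' 0) =
      (if j = j' then (if m.1 + 1 = i then ε else if m.1 = i then -ε else 0)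
        else if j' < j then -cartan m i else 0)
        * P.logq := by
  have hi := Finset.mem_Ico.1 i.2
  have hm := Finset.mem_Ico.1 m.2
  rw [zeroContraction_screeningForm_right hP]
  simp only [loweringForm', tailPlus, map_add, map_sub, map_neg, map_sum, pDiff_bHat, pDiff_cHat,
    pDiff_bPlus, pDiff_aPlus, aZero_bHat, aZero_cHat, aZero_bPlus, aZero_aPlus,
    Finset.sum_sub_distrib, sum_Icc_ite',
    Finset.sum_const_zero, sub_zero, add_zero, zero_add, neg_zero, zero_sub]
  have hε' : j = m + 1 ∧ ε = 1 ∨ m + 1 < j ∧ ε = 1 ∨ m + 1 < j ∧ ε = -1 := by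
    rcases (by omega : j = m + 1 ∨ m + 1 < j) with h | h
    exacts [Or.inl ⟨h, hε h⟩, Or.inr (hεs.imp (⟨h, ·⟩) (⟨h, ·⟩))]
  clear hε hεs
  rcases cartan_cases m i with ⟨h, hc⟩ | ⟨h, hc⟩ | ⟨h, hc⟩ | ⟨h, hc⟩ | ⟨h, hc⟩ <;>
  rcases hε' with ⟨h1, rfl⟩ | ⟨h1, rfl⟩ | ⟨h1, rfl⟩ <;>
  rcases (by omega : j < j' ∨ j = j' ∨ j = j' + 1 ∨ j' + 1 < j) with h' | h' | h' | h' <;>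
  rcases (by omega : i.1 + 1 = j' ∨ i.1 + 1 < j') with h'' | h'' <;>
  rw [hc] <;> clear hc <;>
  (try (exfalso; omega)) <;>
  simp (disch := omega) only [if_pos, if_neg, mul_zero, zero_mul, sub_zero, add_zero, zero_add,
    neg_zero, zero_sub, sub_self] <;>
  (try push_cast) <;> (try ring)

lemma zeroContraction_screening_lowering' :
    zeroContraction (screeningForm i j' ε' 0) (loweringForm' m j ε 0) =
      (if j = j' then (if m.1 + 1 = i then -ε' else if m.1 = i then ε' else 0)
        else if j' < j then -cartan m i else 0)
        * P.logq := by
  have hi := Finset.mem_Ico.1 i.2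
  have hm := Finset.mem_Ico.1 m.2
  rw [(isIntegral_loweringForm' ..).zeroContraction_screeningForm]
  simp only [loweringForm', tailPlus, map_add, map_sub, map_neg, map_sum, qCoeff_bHat,
    qCoeff_cHat, qCoeff_bPlus, qCoeff_aPlus, qTail_bHat, qTail_cHat, qTail_bPlus, qTail_aPlus,
    Finset.sum_sub_distrib,
    Finset.sum_const_zero, sub_zero, add_zero, zero_add, neg_zero, zero_sub]
  have hε' : j = m + 1 ∧ ε = 1 ∨ m + 1 < j ∧ ε = 1 ∨ m + 1 < j ∧ ε = -1 := by
    rcases (by omega : j = m + 1 ∨ m + 1 < j) with h | h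
    exacts [Or.inl ⟨h, hε h⟩, Or.inr (hεs.imp (⟨h, ·⟩) (⟨h, ·⟩))]
  clear hε hεs
  rcases cartan_cases m i with ⟨h, hc⟩ | ⟨h, hc⟩ | ⟨h, hc⟩ | ⟨h, hc⟩ | ⟨h, hc⟩ <;>
  rcases hε' with ⟨h1, rfl⟩ | ⟨h1, rfl⟩ | ⟨h1, rfl⟩ <;>
  rcases (by omega : j < j' ∨ j = j' ∨ j = j' + 1 ∨ j' + 1 < j) with h' | h' | h' | h' <;>
  rcases (by omega : i.1 + 1 = j' ∨ i.1 + 1 < j') with h'' | h'' <;>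
  rw [hc] <;> clear hc <;>
  (try (exfalso; omega)) <;>
  simp (disch := omega) only [if_pos, if_neg, mul_zero, zero_mul, sub_zero, add_zero, zero_add,
    neg_zero, zero_sub, sub_self] <;>
  (try push_cast) <;> (try ring)

end Second

end Lowering

section Lowering

variable {P : Params}

variable (hP : IsContracting P) (i m : Node P) (j j' : ℕ) (ε ε' : ℂ)

lemma isIntegral_loweringForm (u : ℂ) : IsIntegral (loweringForm m j ε u) := by
  have h (r s : ℕ) (α : ℂ) (x : Boson P) : bMinus P r s α u (.qhat x) = 0 := by
    rw [bMinus_eq, atRoot_eq_zero (fun ρ => by simp [minusField])]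
  refine (((isIntegral_pair ..).add (isIntegral_neg_pair ..)).add (.of_qhat fun x => ?_)).add
    (.add (.of_qhat fun x => rfl) (.of_qhat fun x => ?_)) <;>
  simp [h]

variable (hj : 1 ≤ j ∧ j ≤ m) (hεs : ε = 1 ∨ ε = -1)
  (hε : j = m → ε = -1) (hj' : i + 1 ≤ j' ∧ j' ≤ P.N)
include hP hj hj' hεs hε

/-- Here the interacting pairs (j, j') are (i, m), (i, m + 1) and (i + 1, m). At j = m the exponent
is independent of ε, since b^{mm} = c^{mm} = 0, and agrees with the uniform formula for ε = -1. -/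
lemma contraction_lowering_screening {n : ℕ} (hn : 0 < n) :
    contractionHom n (loweringForm m j ε 0) (screeningForm i j' ε' 0) =
      if j = i ∧ j' = m then
        qexp P n (P.N + P.k + i - m) - qexp P n (P.N + P.k + i - m + ε - ε')
      else if j = i ∧ j' = m + 1 then
        qexp P n (P.N + P.k + i - m - 1 - ε') - qexp P n (P.N + P.k + i - m - 2)
      else if j = i + 1 ∧ j' = m then
        qexp P n (P.N + P.k + i - m + 1 + ε) - qexp P n (P.N + P.k + i - m + 2)
      else 0 := by
  have hi := Finset.mem_Ico.1 i.2
  have hm := Finset.mem_Ico.1 m.2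
  rw [contractionHom_screeningForm_right hP hn]
  simp only [loweringForm, tailMinus, map_add, map_sub, map_neg, map_sum,
    bPos_bHat hP n _ _ _ _ hn, bPos_bMinus, bPos_cHat, cPos_bHat,
    cPos_cHat hP n _ _ _ _ hn, cPos_bMinus, bTail_bHat hP hn, bTail_bMinus, bTail_cHat,
    aPos_bHat, aPos_cHat, aPos_bMinus, bPos_aMinus, cPos_aMinus, bTail_aMinus,
    aPos_aMinus,
    Finset.sum_const_zero, sub_zero, add_zero, zero_add, neg_zero, zero_sub]
  have hε' : j = m ∧ ε = -1 ∨ j < m ∧ ε = 1 ∨ j < m ∧ ε = -1 := by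
    rcases (by omega : j = m ∨ j < m) with h | h
    exacts [Or.inl ⟨h, hε h⟩, Or.inr (hεs.imp (⟨h, ·⟩) (⟨h, ·⟩))]
  clear hε hεs
  rcases hε' with ⟨h1, rfl⟩ | ⟨h1, rfl⟩ | ⟨h1, rfl⟩ <;>
  rcases (by omega : j < i ∨ j = i ∨ j = i + 1 ∨ i + 1 < j) with h | h | h | h <;>
  rcases (by omega : j' < m ∨ j' = m ∨ j' = m + 1 ∨ m + 1 < j') with h' | h' | h' | h' <;>
  (try (exfalso; omega)) <;>
  simp (disch := omega) only [if_pos, if_neg, mul_zero, zero_mul, sub_zero, add_zero, zero_add,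
    neg_zero, zero_sub, sub_self] <;>
  (try subst h) <;> (try subst h') <;> (try push_cast) <;>
  (try simp only [sub_eq_add_neg, qexp_add, qexp_neg, neg_add, neg_neg, qexp_two, inv_inv]) <;>
  (try field_simp [qexp_ne_zero]) <;> (try ring)

set_option maxHeartbeats 1000000 in
lemma contraction_screening_lowering {n : ℕ} (hn : 0 < n) :
    contractionHom n (screeningForm i j' ε' 0) (loweringForm m j ε 0) =
      if j = i ∧ j' = m then
        qexp P n (-(P.N + P.k + i - m)) - qexp P n (-(P.N + P.k + i - m + ε - ε'))
      else if j = i ∧ j' = m + 1 then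
        qexp P n (-(P.N + P.k + i - m - 1 - ε')) - qexp P n (-(P.N + P.k + i - m - 2))
      else if j = i + 1 ∧ j' = m then
        qexp P n (-(P.N + P.k + i - m + 1 + ε)) - qexp P n (-(P.N + P.k + i - m + 2))
      else 0 := by
  have hi := Finset.mem_Ico.1 i.2
  have hm := Finset.mem_Ico.1 m.2
  rw [contractionHom_screeningForm_left hP hn]
  simp only [loweringForm, tailMinus, map_add, map_sub, map_neg, map_sum,
    bNeg_bHat hP n _ _ _ _ hn, bNeg_bMinus hP n _ _ _ _ hn, bNeg_cHat, cNeg_bHat,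
    cNeg_cHat hP n _ _ _ _ hn, cNeg_bMinus, aNeg_bHat, aNeg_cHat, aNeg_bMinus, bNeg_aMinus,
    cNeg_aMinus, aNeg_aMinus_half hP hn, Finset.sum_sub_distrib, sum_Icc_ite', sum_Icc_ite,
    Finset.sum_const_zero, sub_zero, add_zero, zero_add, neg_zero, zero_sub]
  have hε' : j = m ∧ ε = -1 ∨ j < m ∧ ε = 1 ∨ j < m ∧ ε = -1 := by
    rcases (by omega : j = m ∨ j < m) with h | h
    exacts [Or.inl ⟨h, hε h⟩, Or.inr (hεs.imp (⟨h, ·⟩) (⟨h, ·⟩))]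
  clear hε hεs
  rcases cartan_cases m i with ⟨h0, hc⟩ | ⟨h0, hc⟩ | ⟨h0, hc⟩ | ⟨h0, hc⟩ | ⟨h0, hc⟩ <;>
  rw [hc] <;> clear hc <;>
  rcases hε' with ⟨h1, rfl⟩ | ⟨h1, rfl⟩ | ⟨h1, rfl⟩ <;>
  rcases (by omega : j < i ∨ j = i ∨ j = i + 1 ∨ i + 1 < j) with h | h | h | h <;>
  rcases (by omega : j' < m ∨ j' = m ∨ j' = m + 1 ∨ m + 1 < j') with h' | h' | h' | h' <;>
  (try (exfalso; omega)) <;>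
  simp (disch := omega) only [if_pos, if_neg, mul_zero, zero_mul, sub_zero, add_zero, zero_add,
    neg_zero, zero_sub, sub_self] <;>
  (try subst h) <;> (try subst h') <;> (try simp only [h0]) <;> (try push_cast) <;>
  (try simp only [sub_eq_add_neg, qexp_add, qexp_neg, neg_add, neg_neg, qexp_two, inv_inv]) <;>
  (try field_simp [qexp_ne_zero]) <;> (try ring)

set_option maxHeartbeats 1000000 in
lemma zeroContraction_lowering_screening :
    zeroContraction (loweringForm m j ε 0) (screeningForm i j' ε' 0) =
      (if j = i ∧ j' = m then -1 - ε else if j = i ∧ j' = m + 1 then 1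
        else if j = i + 1 ∧ j' = m then ε else 0)
        * P.logq := by
  have hi := Finset.mem_Ico.1 i.2
  have hm := Finset.mem_Ico.1 m.2
  rw [zeroContraction_screeningForm_right hP]
  simp only [loweringForm, tailMinus, map_add, map_sub, map_neg, map_sum, pDiff_bHat, pDiff_cHat,
    pDiff_bMinus, pDiff_aMinus, aZero_bHat, aZero_cHat, aZero_bMinus, aZero_aMinus,
    Finset.sum_sub_distrib, sum_Icc_ite', sum_Icc_ite,
    Finset.sum_const_zero, sub_zero, add_zero, zero_add, neg_zero, zero_sub]
  have hε' : j = m ∧ ε = -1 ∨ j < m ∧ ε = 1 ∨ j < m ∧ ε = -1 := by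
    rcases (by omega : j = m ∨ j < m) with h | h
    exacts [Or.inl ⟨h, hε h⟩, Or.inr (hεs.imp (⟨h, ·⟩) (⟨h, ·⟩))]
  clear hε hεs
  rcases cartan_cases m i with ⟨h0, hc⟩ | ⟨h0, hc⟩ | ⟨h0, hc⟩ | ⟨h0, hc⟩ | ⟨h0, hc⟩ <;>
  rw [hc] <;> clear hc <;>
  rcases hε' with ⟨h1, rfl⟩ | ⟨h1, rfl⟩ | ⟨h1, rfl⟩ <;>
  rcases (by omega : j < i ∨ j = i ∨ j = i + 1 ∨ i + 1 < j) with h | h | h | h <;>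
  rcases (by omega : j' < m ∨ j' = m ∨ j' = m + 1 ∨ m + 1 < j') with h' | h' | h' | h' <;>
  rcases (by omega : i.1 + 1 = j' ∨ i.1 + 1 < j') with h'' | h'' <;>
  (try (exfalso; omega)) <;>
  simp (disch := omega) only [if_pos, if_neg, mul_zero, zero_mul, sub_zero, add_zero, zero_add,
    neg_zero, zero_sub, sub_self] <;>
  (try push_cast) <;> (try ring)

set_option maxHeartbeats 1000000 in
lemma zeroContraction_screening_lowering :
    zeroContraction (screeningForm i j' ε' 0) (loweringForm m j ε 0) =
      (if j = i ∧ j' = m then -1 - ε' else if j = i ∧ j' = m + 1 then ε'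
        else if j = i + 1 ∧ j' = m then 1 else 0)
        * P.logq := by
  have hi := Finset.mem_Ico.1 i.2
  have hm := Finset.mem_Ico.1 m.2
  rw [(isIntegral_loweringForm ..).zeroContraction_screeningForm]
  simp only [loweringForm, tailMinus, map_add, map_sub, map_neg, map_sum, qCoeff_bHat,
    qCoeff_cHat, qCoeff_bMinus, qCoeff_aMinus, qTail_bHat, qTail_cHat, qTail_bMinus, qTail_aMinus,
    Finset.sum_const_zero, sub_zero, add_zero, zero_add, neg_zero, zero_sub]
  have hε' : j = m ∧ ε = -1 ∨ j < m ∧ ε = 1 ∨ j < m ∧ ε = -1 := by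
    rcases (by omega : j = m ∨ j < m) with h | h
    exacts [Or.inl ⟨h, hε h⟩, Or.inr (hεs.imp (⟨h, ·⟩) (⟨h, ·⟩))]
  clear hε hεs
  rcases hε' with ⟨h1, rfl⟩ | ⟨h1, rfl⟩ | ⟨h1, rfl⟩ <;>
  rcases (by omega : j < i ∨ j = i ∨ j = i + 1 ∨ i + 1 < j) with h | h | h | h <;>
  rcases (by omega : j' < m ∨ j' = m ∨ j' = m + 1 ∨ m + 1 < j') with h' | h' | h' | h' <;>
  rcases (by omega : i.1 + 1 = j' ∨ i.1 + 1 < j') with h'' | h'' <;>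
  (try (exfalso; omega)) <;>
  simp (disch := omega) only [if_pos, if_neg, mul_zero, zero_mul, sub_zero, add_zero, zero_add,
    neg_zero, zero_sub, sub_self] <;>
  (try push_cast) <;> (try ring)

end Lowering

section Coincidences

variable {P : Params}

/-! ### Coincidence of exponents at the poles -/

section Shift

variable (r s : ℕ) (σ α x u : ℂ)

lemma bHat_shift : bHat P r s σ α (u + x * P.logq) = bHat P r s σ (α + x) u := by
  simp only [bHat, show u + x * P.logq + α * P.logq = u + (α + x) * P.logq by ring]

lemma cHat_shift : cHat P r s α (u + x * P.logq) = cHat P r s (α + x) u := by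
  simp only [cHat, show u + x * P.logq + α * P.logq = u + (α + x) * P.logq by ring]

lemma bPlus_shift : bPlus P r s α (u + x * P.logq) = bPlus P r s (α + x) u := by
  simp only [bPlus, show u + x * P.logq + α * P.logq = u + (α + x) * P.logq by ring]

lemma bMinus_shift : bMinus P r s α (u + x * P.logq) = bMinus P r s (α + x) u := by
  simp only [bMinus, show u + x * P.logq + α * P.logq = u + (α + x) * P.logq by ring]

lemma aPlus_shift (i : Node P) : aPlus P i α (u + x * P.logq) = aPlus P i (α + x) u := by
  simp only [aPlus, show u + x * P.logq + α * P.logq = u + (α + x) * P.logq by ring]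

lemma aMinus_shift (i : Node P) : aMinus P i α (u + x * P.logq) = aMinus P i (α + x) u := by
  simp only [aMinus, show u + x * P.logq + α * P.logq = u + (α + x) * P.logq by ring]

end Shift

lemma sum_Icc_succ_left {M : Type*} [AddCommMonoid M] {a b : ℕ} (h : a ≤ b) (f : ℕ → M) :
    ∑ l ∈ Finset.Icc a b, f l = f a + ∑ l ∈ Finset.Icc (a + 1) b, f l := by
  rw [show Finset.Icc a b = insert a (Finset.Icc (a + 1) b) from by ext; simp; omega,
    Finset.sum_insert (by simp)]

/-- The combinations of fields of `b^{ij}` that vanish. -/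
lemma bHat_relations (hP : IsContracting P) (r s : ℕ) (α u : ℂ) :
    bHat P r s 0 (α - 1) u = bHat P r s 1 α u - bPlus P r s α u ∧
    bHat P r s 0 (α + 1) u = bHat P r s 1 α u - bMinus P r s α u ∧
    bHat P r s 0 (α - 1) u = bHat P r s (-1) α u + bMinus P r s α u ∧
    bHat P r s 0 (α + 1) u = bHat P r s (-1) α u + bPlus P r s α u := by
  have h1 := bHat_sub r s α u hP 1 (Or.inl rfl)
  have h2 := bHat_sub r s α u hP (-1) (Or.inr rfl)
  rw [if_pos rfl, if_pos rfl] at h1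
  rw [if_neg (by norm_num), if_neg (by norm_num)] at h2
  refine ⟨?_, ?_, ?_, ?_⟩
  · rw [sub_eq_iff_eq_add.1 h1.2]; abel
  · rw [sub_eq_iff_eq_add.1 h1.1]; abel
  · rw [sub_eq_iff_eq_add.1 h2.2]; abel
  · rw [sub_eq_iff_eq_add.1 h2.1]; abel

variable (hP : IsContracting P) (i m : Node P) (u : ℂ)

/-- At the pole the c^{i,m+1} fields of the two currents have arguments that are exchanged when both
signs are flipped; nothing else in the exponents depends on the signs. -/
lemma raising_screening_swap :
    raisingForm m i 1 (u + (P.N - m - i) * P.logq) + screeningForm i (m + 1) 1 u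
      = raisingForm m i (-1) (u + (P.N - m - i) * P.logq) + screeningForm i (m + 1) (-1) u := by
  simp only [raisingForm, screeningForm, bHat_shift, cHat_shift, bPlus_shift]
  rw [show (i : ℂ) - 1 + 1 + (P.N - m - i) = P.N - (m + 1 : ℕ) - -1 by push_cast; ring,
    show (i : ℂ) - 1 + -1 + (P.N - m - i) = P.N - (m + 1 : ℕ) - 1 by push_cast; ring]
  abel

-- Residues for the labels (i, m) and (i + 1, m + 1) agree at the common pole. The sign ε passes
-- from the raising exponent to the screening exponent with reversed sign; the rest follows by
-- trading shifted b fields for b_± at the endpoints of the tails.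
include hP in
lemma raising_screening_pair (ε : ℂ) :
    raisingForm m i ε (u + (P.N - m - i) * P.logq) + screeningForm i m 1 u
      = raisingForm m (i + 1) (-1) (u + (P.N - m - i) * P.logq)
        + screeningForm i (m + 1) (-ε) u := by
  have hi := Finset.mem_Ico.1 i.2
  have hm := Finset.mem_Ico.1 m.2
  have r1 := (bHat_relations hP i m (P.N - m) u).1
  have r2 := bHat_relations hP i (m + 1) (P.N - m - 1) u
  have r3 := (bHat_relations hP (i + 1) (m + 1) (P.N - m) u).2.2.1
  simp only [raisingForm, screeningForm, bHat_shift, cHat_shift, bPlus_shift]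
  rw [Finset.sum_Ico_succ_top hi.1, sum_Icc_succ_left (a := m + 1) (b := P.N) (by omega)]
  simp only [Nat.cast_add, Nat.cast_one,
    show (i : ℂ) - 1 + (P.N - m - i) = P.N - m - 1 by ring,
    show (i : ℂ) + 1 - 1 + (P.N - m - i) = P.N - m by ring,
    show (i : ℂ) + (P.N - m - i) = P.N - m by ring,
    show (i : ℂ) - 1 + ε + (P.N - m - i) = P.N - m - 1 + ε by ring,
    show (i : ℂ) + 1 - 1 + -1 + (P.N - m - i) = P.N - m - 1 by ring,
    show (P.N : ℂ) - (m + 1) = P.N - m - 1 by ring, sub_neg_eq_add, sub_add_cancel, r1, r3]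
  -- Two expressions for the same b^{i,m+1} field, one through σ = 1 and one through σ = -1;
  -- comparing them expresses the field with σ = -1 through the one with σ = 1 and the half fields.
  have r4 := r2.1.symm.trans r2.2.2.1
  have r5 : bHat P i (m + 1) (-1) (P.N - m - 1) u = bHat P i (m + 1) 1 (P.N - m - 1) u
      - bPlus P i (m + 1) (P.N - m - 1) u - bMinus P i (m + 1) (P.N - m - 1) u := by
    rw [r4]; abel
  rw [r5]
  abel

/-- At the pole the arguments of the two c^{i,m} fields are q^(N-m-ε) z and q^(N-m-ε') z, so the
exponent is symmetric in the two signs. -/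
lemma lowering_screening_swap :
    loweringForm m i 1 (u + (P.N + P.k + i - m) * P.logq) + screeningForm i m (-1) u
      = loweringForm m i (-1) (u + (P.N + P.k + i - m) * P.logq) + screeningForm i m 1 u := by
  simp only [loweringForm, screeningForm, bHat_shift, cHat_shift, bMinus_shift]
  rw [show -(P.k + (i : ℂ) + 1) + (P.N + P.k + i - m) = P.N - m - 1 by ring,
    show -(P.k + (i : ℂ) + -1) + (P.N + P.k + i - m) = P.N - m - -1 by ring]
  abel

-- Residues for the labels (i, m + 1) and (i + 1, m) coincide at the pole, the sign ε passing from
-- the lowering to the screening exponent.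
include hP in
lemma lowering_screening_pair (h : i.1 + 1 ≤ m) (ε : ℂ) :
    loweringForm m i ε (u + (P.N + P.k + i - m) * P.logq) + screeningForm i (m + 1) (-1) u
      = loweringForm m (i + 1) (-1) (u + (P.N + P.k + i - m) * P.logq)
        + screeningForm i m ε u := by
  have hi := Finset.mem_Ico.1 i.2
  have hm := Finset.mem_Ico.1 m.2
  have r1 := (bHat_relations hP i (m + 1) (P.N - m - 1) u).2.1
  have r2 := (bHat_relations hP (i + 1) m (P.N - m - 1) u).2.1
  rw [sub_add_cancel] at r1 r2
  simp only [loweringForm, screeningForm, bHat_shift, cHat_shift, bMinus_shift]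
  rw [sum_Icc_succ_left h, sum_Icc_succ_left (a := m + 1) (b := P.N) (by omega)]
  simp only [Nat.cast_add, Nat.cast_one,
    show -(P.k + (i : ℂ)) + (P.N + P.k + i - m) = P.N - m by ring,
    show -(P.k + (i : ℂ) + ε) + (P.N + P.k + i - m) = P.N - m - ε by ring,
    show -(P.k + ((i : ℂ) + 1) - 1) + (P.N + P.k + i - m) = P.N - m by ring,
    show -(P.k + ((i : ℂ) + 1)) + (P.N + P.k + i - m) = P.N - m - 1 by ring,
    show -(P.k + ((i : ℂ) + 1) + -1) + (P.N + P.k + i - m) = P.N - m by ring,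
    show (P.N : ℂ) - (m + 1) = P.N - m - 1 by ring, sub_neg_eq_add, sub_add_cancel, r1, r2]
  abel

/-- Both exponents contain c^{i,j} because m + 1 = i; flipping both signs exchanges the two
arguments at the pole. -/
lemma lowering'_screening_swap (h : m.1 + 1 = i) (j : ℕ) :
    loweringForm' m j 1 (u + (P.N - P.k - 2 * j + 1) * P.logq) + screeningForm i j 1 u
      = loweringForm' m j (-1) (u + (P.N - P.k - 2 * j + 1) * P.logq)
        + screeningForm i j (-1) u := by
  simp only [loweringForm', screeningForm, bHat_shift, cHat_shift, h]
  rw [show P.k + (j : ℂ) - 1 + 1 + (P.N - P.k - 2 * j + 1) = P.N - j - -1 by ring,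
    show P.k + (j : ℂ) - 1 + -1 + (P.N - P.k - 2 * j + 1) = P.N - j - 1 by ring]
  abel

-- The residue of the label j with signs 1, 1 equals that of the label j + 1 with signs -1, -1. This
-- makes the diagonal commutators telescope in j.
include hP in
lemma lowering'_screening_pair (j : ℕ) (hj : j + 1 ≤ P.N) :
    loweringForm' i j 1 (u + (P.N - P.k - 2 * j) * P.logq) + screeningForm i j 1 u
      = loweringForm' i (j + 1) (-1) (u + (P.N - P.k - 2 * j) * P.logq)
        + screeningForm i (j + 1) (-1) u := by
  have r1 := (bHat_relations hP i j (P.N - j) u).1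
  have r2 := (bHat_relations hP (i + 1) j (P.N - j - 1) u).2.2.2
  have r3 := (bHat_relations hP (i + 1) (j + 1) (P.N - j) u).2.2.1
  have r4 := (bHat_relations hP i (j + 1) (P.N - j - 1) u).2.1
  rw [sub_add_cancel] at r2 r4
  simp only [loweringForm', tailPlus, screeningForm, bHat_shift, cHat_shift, bPlus_shift]
  rw [sum_Icc_succ_left (a := j) (b := P.N) (by omega)]
  have hs := sum_Icc_succ_left hj fun l : ℕ =>
    bMinus P (i + 1) l (P.N - l + 1) u - bMinus P i l (P.N - l) u
  rw [hs]
  simp only [Nat.cast_add, Nat.cast_one,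
    show P.k + (j : ℂ) - 1 + (P.N - P.k - 2 * j) = P.N - j - 1 by ring,
    show P.k + (j : ℂ) + (P.N - P.k - 2 * j) = P.N - j by ring,
    show P.k + ((j : ℂ) + 1) - 1 + (P.N - P.k - 2 * j) = P.N - j by ring,
    show P.k + ((j : ℂ) + 1) - 1 + -1 + (P.N - P.k - 2 * j) = P.N - j - 1 by ring,
    show (P.N : ℂ) - (j + 1) = P.N - j - 1 by ring, sub_neg_eq_add, sub_add_cancel, r1, r2, r3, r4]
  abel

/-! ### The remaining total difference -/

/-- The exponent in the total difference `[E^{-,i}_n, S^i(z)]`. -/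
def boundaryForm (i : Node P) (u : ℂ) : LinForm P :=
  aPlus P i (-(P.kg / 2)) u - field 1 P.kg (.a i) (P.kg / 2) u

lemma bHat_self (r : ℕ) (σ α u : ℂ) : bHat P r r σ α u = 0 := by
  unfold bHat atRoot
  rw [dif_neg fun h => by have := mem_rootSet.1 h; omega]

lemma cHat_self (r : ℕ) (α u : ℂ) : cHat P r r α u = 0 := by
  unfold cHat atRoot
  rw [dif_neg fun h => by have := mem_rootSet.1 h; omega]

lemma bMinus_self (r : ℕ) (α u : ℂ) : bMinus P r r α u = 0 := by
  rw [bMinus_eq]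
  unfold atRoot
  rw [dif_neg fun h => by have := mem_rootSet.1 h; omega]

-- At the last label N all b and c fields cancel at the pole z ↦ q^(-(k+g)) z, and only the a^i
-- fields survive.
include hP in
lemma lowering'_screening_boundary :
    loweringForm' i P.N 1 (u + -P.kg * P.logq) + screeningForm i P.N 1 u = boundaryForm i u := by
  have r1 := (bHat_relations hP i P.N 0 u).1
  have r2 := (bHat_relations hP (i + 1) P.N (-1) u).2.2.2
  simp only [loweringForm', tailPlus, screeningForm, boundaryForm, bHat_shift, cHat_shift,
    bPlus_shift, aPlus_shift, Finset.Icc_self, Finset.sum_singleton,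
    Finset.Icc_eq_empty_of_lt (Nat.lt_succ_self P.N), Finset.sum_empty]
  rw [show P.k + (P.N : ℂ) - 1 + -P.kg = 0 - 1 by rw [Params.kg]; ring,
    show P.k + (P.N : ℂ) - 1 + 1 + -P.kg = 0 by rw [Params.kg]; ring,
    show P.k + (P.N : ℂ) + -P.kg = 0 by rw [Params.kg]; ring,
    show P.kg / 2 + -P.kg = -(P.kg / 2) by ring, sub_self, r1]
  rw [neg_add_cancel] at r2
  rw [r2]
  simp only [zero_sub]
  abel

/-- Up to the common shift q^(-(k+g)|n|/2), the coefficient of x_n on the left is (q^((k+g)n) -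
q^(-(k+g)n))/[(k+g)n] up to sign, which is ±(q - q⁻¹). This is the identity that singles out p =
q^(2(k+g)): the two arguments on the left have ratio p. -/
lemma field_kg_sub (hP : IsContracting P) (x : Boson P) (v : ℂ) :
    field 1 P.kg x (P.kg / 2) (v + P.kg * P.logq) - field 1 P.kg x (P.kg / 2) (v - P.kg * P.logq)
      = plusField x (v + P.kg / 2 * P.logq) - minusField x (v - P.kg / 2 * P.logq) := by
  have hk := hP.kg_ne_zero
  have hexp (l : ℕ) (w y : ℂ) : Complex.exp (w + l * (y * P.logq))
      = Complex.exp w * qexp P l y := by rw [qexp, Complex.exp_add]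
  funext y
  cases y with
  | osc y n =>
    simp only [Pi.sub_apply, field, plusField, minusField]
    by_cases hy : y = x
    · rcases lt_trichotomy n 0 with hn | rfl | hn
      · obtain ⟨l, rfl⟩ : ∃ l : ℕ, n = -(l : ℤ) := ⟨(-n).toNat, by omega⟩
        have hl : 0 < l := by omega
        have h1 := hP.br_ne_zero hl
        have h2 := hP.br_kg_ne_zero hl
        have h3 := br_cartan_mul hP l P.kg
        rw [if_pos ⟨hy, hn.ne⟩, if_pos ⟨hy, hn.ne⟩, if_neg (by omega), if_pos ⟨hy, hn⟩]
        simp only [Int.cast_neg, Int.cast_natCast, abs_neg, Nat.abs_cast, one_mul]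
        rw [show P.kg * -(l : ℂ) = -(P.kg * l) by ring, br_neg, br_neg,
          show -(P.kg / 2 * (l : ℂ)) = -(P.kg / 2) * l by ring, qpow_eq_qexp,
          show -(-(l : ℂ) * (v + P.kg * P.logq)) = l * v + l * (P.kg * P.logq) by ring,
          show -(-(l : ℂ) * (v - P.kg * P.logq)) = l * v + l * (-P.kg * P.logq) by ring,
          show -(-(l : ℂ) * (v - P.kg / 2 * P.logq)) = l * v + l * (-(P.kg / 2) * P.logq) by ring,
          hexp, hexp, hexp]
        generalize qexp P l P.kg = A at *
        generalize qexp P l (-P.kg) = B at *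
        generalize qexp P l (-(P.kg / 2)) = C at *
        generalize Complex.exp (l * v) = E at *
        generalize P.br (P.kg * l) = F at *
        field_simp
        linear_combination (-(C * E)) * h3
      · simp
      · obtain ⟨l, rfl⟩ : ∃ l : ℕ, n = (l : ℤ) := ⟨n.toNat, by omega⟩
        have hl : 0 < l := by omega
        have h1 := hP.br_ne_zero hl
        have h2 := hP.br_kg_ne_zero hl
        have h3 := br_cartan_mul hP l P.kg
        rw [if_pos ⟨hy, hn.ne'⟩, if_pos ⟨hy, hn.ne'⟩, if_pos ⟨hy, hn⟩, if_neg (by omega)]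
        simp only [Int.cast_natCast, Nat.abs_cast, one_mul]
        rw [show -(P.kg / 2 * (l : ℂ)) = -(P.kg / 2) * l by ring, qpow_eq_qexp,
          show -((l : ℂ) * (v + P.kg * P.logq)) = -(l * v) + l * (-P.kg * P.logq) by ring,
          show -((l : ℂ) * (v - P.kg * P.logq)) = -(l * v) + l * (P.kg * P.logq) by ring,
          show -((l : ℂ) * (v + P.kg / 2 * P.logq)) = -(l * v) + l * (-(P.kg / 2) * P.logq) by ring,
          hexp, hexp, hexp]
        generalize qexp P l P.kg = A at *
        generalize qexp P l (-P.kg) = B at *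
        generalize qexp P l (-(P.kg / 2)) = C at *
        generalize Complex.exp (-(l * v)) = E at *
        generalize P.br (P.kg * l) = F at *
        field_simp
        linear_combination (-(C * E)) * h3
    · simp [hy]
  | qhat y => simp [field, plusField, minusField]
  | phat y =>
    simp only [Pi.sub_apply, field, plusField, minusField]
    split_ifs
    · field_simp
      ring
    · ring

-- After cancellation of b and c the exponent is a_- minus the field (1/(k+g))a^i at z. By
-- `field_kg_sub` this equals a_+ minus the same field at pz, the boundary exponent at the shifted
-- point.
include hP in
lemma lowering_screening_boundary :
    loweringForm i i (-1) (u + P.kg * P.logq) + screeningForm i (i + 1) (-1) u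
      = boundaryForm i (u + P.logp) := by
  have hi := Finset.mem_Ico.1 i.2
  have r1 := (bHat_relations hP i (i + 1) (P.N - i - 1) u).2.1
  have r2 := field_kg_sub hP (.a i) (u + P.kg * P.logq)
  rw [show u + P.kg * P.logq + P.kg * P.logq = u + P.logp by rw [Params.logp]; ring,
    add_sub_cancel_right] at r2
  have e : ∀ l : ℕ, -(P.k + (l : ℂ)) + P.kg = P.N - l := fun l => by rw [Params.kg]; ring
  have e' : ∀ l : ℕ, -(P.k + (l : ℂ) - 1) + P.kg = P.N - l + 1 := fun l => by
    rw [Params.kg]; ring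
  simp only [loweringForm, tailMinus, screeningForm, boundaryForm, bHat_shift, cHat_shift,
    bMinus_shift, aMinus_shift, bHat_self, cHat_self, e, e',
    Finset.Icc_eq_empty_of_lt (Nat.lt_succ_self i.1), Finset.sum_empty]
  rw [sum_Icc_succ_left (a := i + 1) (b := P.N) hi.2]
  simp only [Finset.sum_sub_distrib, bMinus_self, Nat.cast_add, Nat.cast_one,
    show (P.N : ℂ) - (i + 1) = P.N - i - 1 by ring]
  rw [sub_add_cancel] at r1
  rw [r1, aPlus, aMinus, show u + (-(P.kg / 2) + P.kg) * P.logq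
    = u + P.kg * P.logq - P.kg / 2 * P.logq by ring, show u + P.logp + -(P.kg / 2) * P.logq
    = u + P.kg * P.logq + P.kg / 2 * P.logq by rw [Params.logp]; ring,
    ← sub_eq_zero]
  rw [← sub_eq_zero] at r2
  rw [← r2]
  abel

end Coincidences

section Bracket

variable {P : Params}

/-! ### Commutators -/

/-- The commutator. -/
def bracket (A B : Kernel P) : Kernel P := A.mul B - B.mul A

lemma bracket_smul_left (t : ℂ) (A B : Kernel P) : bracket (t • A) B = t • bracket A B := by
  rw [bracket, smul_mul, mul_smul, ← smul_sub, bracket]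

lemma bracket_smul_right (t : ℂ) (A B : Kernel P) : bracket A (t • B) = t • bracket A B := by
  rw [bracket, smul_mul, mul_smul, ← smul_sub, bracket]

lemma bracket_add_left {A A' : Kernel P} (hA : IsFinitary A) (hA' : IsFinitary A')
    (B : Kernel P) : bracket (A + A') B = bracket A B + bracket A' B := by
  rw [bracket, hA.add_mul hA', hA.mul_add' hA', bracket, bracket]
  abel

lemma bracket_sub_left {A A' : Kernel P} (hA : IsFinitary A) (hA' : IsFinitary A')
    (B : Kernel P) : bracket (A - A') B = bracket A B - bracket A' B := by
  rw [sub_eq_add_neg, ← neg_one_smul ℂ A', bracket_add_left hA (hA'.smul _), bracket_smul_left,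
    neg_one_smul, ← sub_eq_add_neg]

lemma bracket_sum_left {ι : Type*} (s : Finset ι) {A : ι → Kernel P}
    (hA : ∀ i ∈ s, IsFinitary (A i)) (B : Kernel P) :
    bracket (∑ i ∈ s, A i) B = ∑ i ∈ s, bracket (A i) B := by
  rw [bracket, IsFinitary.sum_mul s hA, IsFinitary.mul_sum' s hA, ← Finset.sum_sub_distrib]
  rfl

lemma bracket_add_right {A : Kernel P} (hA : IsFinitary A) (B B' : Kernel P) :
    bracket A (B + B') = bracket A B + bracket A B' := by
  rw [bracket, hA.mul_add, hA.add_mul', bracket, bracket]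
  abel

lemma bracket_sub_right {A : Kernel P} (hA : IsFinitary A) (B B' : Kernel P) :
    bracket A (B - B') = bracket A B - bracket A B' := by
  rw [sub_eq_add_neg, ← neg_one_smul ℂ B', bracket_add_right hA, bracket_smul_right,
    neg_one_smul, ← sub_eq_add_neg]

lemma bracket_sum_right {ι : Type*} (s : Finset ι) {A : Kernel P} (hA : IsFinitary A)
    (B : ι → Kernel P) : bracket A (∑ i ∈ s, B i) = ∑ i ∈ s, bracket A (B i) := by
  rw [bracket, hA.mul_sum, hA.sum_mul', ← Finset.sum_sub_distrib]
  rfl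

/-- The commutator of a mode of a vertex operator with another vertex operator. -/
theorem HasOPE.bracket_eq {L M : ℂ → LinForm P} (hL : IsField L) (hM : IsField M)
    (hLi : IsIntegral (L 0)) (hMb : IsBalanced (M 0)) {e e' ζ : ℂ} (h : HasOPE (L 0) (M 0) e e' ζ)
    (n : ℤ) (u : ℂ) :
    bracket (selection (L 0) n) (vertex (M u))
      = (P.qpow ζ * (1 - P.qpow (e' - e)) * Complex.exp (n * (u + e * P.logq))) •
        vertex (L (u + e * P.logq) + M u) := by
  rw [hM u, hL (u + _), bracket, selection_vertex_translate_commutator hLi hMb h.hasSimplePole,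
    ← zeroContraction_apply, h.zero_right, Params.qpow, Params.qpow, sub_mul]

/-- A pair without oscillator contractions is treated as the degenerate case in which pole and zero
coincide, so the coefficient 1 - e^(w - v) vanishes. The zero modes need not commute trivially; it
suffices that both orders give the same factor. -/
theorem bracket_eq_zero {L M : ℂ → LinForm P} (hM : IsField M)
    (hLi : IsIntegral (L 0)) (hMb : IsBalanced (M 0))
    (h1 : ∀ n : ℕ, 0 < n → contractionHom n (L 0) (M 0) = 0)
    (h2 : ∀ n : ℕ, 0 < n → contractionHom n (M 0) (L 0) = 0)
    (h3 : zeroContraction (M 0) (L 0) = zeroContraction (L 0) (M 0)) (n : ℤ) (u : ℂ) :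
    bracket (selection (L 0) n) (vertex (M u)) = 0 := by
  have h : HasSimplePole (L 0) (M 0) 0 0 :=
    ⟨fun n hn => by rw [← contractionHom_apply, h1 n hn]; simp,
      fun n hn => by rw [← contractionHom_apply, h2 n hn]; simp,
      by rw [← zeroContraction_apply, h3, zeroContraction_apply]; ring⟩
  rw [hM u, bracket, selection_vertex_translate_commutator hLi hMb h]
  simp

/-- `f 1 - f (-1)`. -/
def alternate {A : Type*} [Sub A] (f : ℂ → A) : A := f 1 - f (-1)

/-- The commutator of a pair of summands of the currents. -/
def pairBracket (L M : ℂ → ℂ → LinForm P) (n : ℤ) (u : ℂ) : Kernel P :=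
  alternate fun ε => alternate fun ε' => bracket (selection (L ε 0) n) (vertex (M ε' u))

end Bracket

/-! ### The currents as alternating sums of normal ordered exponentials. -/

section Currents

variable {P : Params}

lemma IsBalanced.add {L M : LinForm P} (hL : IsBalanced L) (hM : IsBalanced M) :
    IsBalanced (L + M) := fun r => by simp only [Pi.add_apply, hL r, hM r]

lemma isField_screeningForm (i : Node P) (j : ℕ) (ε : ℂ) : IsField (screeningForm i j ε) := by
  refine ((IsField.add (IsField.neg fun u => ?_) ((isField_bHat _ _ _ _).add (isField_cHat _ _ _))).add
    ((isField_bHat _ _ _ _).neg.sub (isField_cHat _ _ _))).add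
    (IsField.sum _ fun l _ => (isField_bMinus _ _ _).sub (isField_bMinus _ _ _))
  rw [translate_field, zero_add]

lemma isBalanced_screeningForm (i : Node P) (j : ℕ) (ε u : ℂ) :
    IsBalanced (screeningForm i j ε u) := by
  refine ((IsBalanced.add (fun r => by simp [field]) (isIntegral_pair ..).balanced).add
    (isIntegral_neg_pair ..).balanced).add (IsIntegral.of_qhat fun x => ?_).balanced
  have h (r s : ℕ) (α : ℂ) (x : Boson P) : bMinus P r s α u (.qhat x) = 0 := by
    rw [bMinus_eq, atRoot_eq_zero (fun ρ => by simp [minusField])]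
  simp [h]

lemma isField_raisingForm (m : Node P) (j : ℕ) (ε : ℂ) : IsField (raisingForm m j ε) :=
  (((isField_bHat _ _ _ _).add (isField_cHat _ _ _)).add
    ((isField_bHat _ _ _ _).neg.sub (isField_cHat _ _ _))).add
    (IsField.sum _ fun l _ => (isField_bPlus _ _ _).sub (isField_bPlus _ _ _))

lemma isField_tailMinus (m : Node P) : IsField (tailMinus P m) :=
  (isField_aMinus _ _).add (IsField.sum _ fun l _ => (isField_bMinus _ _ _).sub (isField_bMinus _ _ _))

lemma isField_tailPlus (m : Node P) (j : ℕ) : IsField (tailPlus P m j) :=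
  (isField_aPlus _ _).add (IsField.sum _ fun l _ => (isField_bPlus _ _ _).sub (isField_bPlus _ _ _))

lemma isField_loweringForm (m : Node P) (j : ℕ) (ε : ℂ) : IsField (loweringForm m j ε) :=
  ((((isField_bHat _ _ _ _).add (isField_cHat _ _ _)).add
    ((isField_bHat _ _ _ _).neg.sub (isField_cHat _ _ _))).add
    (IsField.sum _ fun l _ => (isField_bMinus _ _ _).sub (isField_bMinus _ _ _))).add
    (isField_tailMinus m)

lemma isField_loweringForm' (m : Node P) (j : ℕ) (ε : ℂ) : IsField (loweringForm' m j ε) :=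
  (((isField_bHat _ _ _ _).add (isField_cHat _ _ _)).add
    ((isField_bHat _ _ _ _).neg.sub (isField_cHat _ _ _))).add (isField_tailPlus m j)

variable (hP : IsContracting P) (i m : Node P)
include hP

/-- Rewriting b_± through the shifted fields turns the sum over ε = ±1 into a difference of two
values of one family of exponents. -/
lemma screening_eq (u : ℂ) : screening P i u = prefactor P u •
    ∑ j ∈ Finset.Icc (i.1 + 1) P.N, -alternate fun ε => vertex (screeningForm i j ε u) := by
  refine congrArg (prefactor P u • ·) (Finset.sum_congr rfl fun j _ => ?_)
  rw [alternate, neg_sub (vertex _) (vertex _), neg_bMinus_sub_bc _ _ _ _ hP, neg_bPlus_sub_bc _ _ _ _ hP, bc_eq,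
    screeningForm, screeningForm, sub_neg_eq_add]

lemma Eplus_eq (u : ℂ) : Eplus P m u = prefactor P u •
    ∑ j ∈ Finset.Icc 1 m.1, alternate fun ε => vertex (raisingForm m j ε u) := by
  refine congrArg (prefactor P u • ·) (Finset.sum_congr rfl fun j _ => ?_)
  have e1 := bPlus_sub_bc j (m + 1) (j - 1) u hP
  have e2 := bMinus_sub_bc j (m + 1) (j - 1) u hP
  rw [sub_add_cancel] at e1
  rw [show (j : ℂ) - 1 - 1 = j - 2 by ring] at e2
  rw [alternate, e1, e2, bc_eq, raisingForm, raisingForm, sub_add_cancel,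
    show (j : ℂ) - 1 + -1 = j - 2 by ring]

lemma Eminus_eq (u : ℂ) : Eminus P m u = prefactor P u •
    ((∑ j ∈ Finset.Ico 1 m.1, -alternate fun ε => vertex (loweringForm m j ε u))
      + vertex (loweringForm m m (-1) u) - vertex (loweringForm' m (m + 1) 1 u)
      - ∑ j ∈ Finset.Icc (m.1 + 2) P.N, alternate fun ε => vertex (loweringForm' m j ε u)) := by
  refine congrArg (prefactor P u • ·) (congrArg₂ (· - ·) (congrArg₂ (· - ·)
    (congrArg₂ (· + ·) ?_ ?_) ?_) ?_)
  · refine Finset.sum_congr rfl fun j _ => ?_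
    have e1 := neg_bMinus_sub_bc j m (-(P.k + j)) u hP
    have e2 := neg_bPlus_sub_bc j m (-(P.k + j)) u hP
    rw [show -(P.k + (j : ℂ)) + 1 = -(P.k + j - 1) by ring] at e1
    rw [show -(P.k + (j : ℂ)) - 1 = -(P.k + j + 1) by ring] at e2
    rw [alternate, neg_sub (vertex _) (vertex _), e1, e2, bc_eq, loweringForm, loweringForm,
      show -(P.k + (j : ℂ) + -1) = -(P.k + j - 1) by ring]
  -- Since b^{mm} = c^{mm} = 0, the exponent at j = m is independent of the sign; the value -1 is
  -- chosen so that the term fits as the second half of an alternating pair.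
  · rw [loweringForm, bc_eq, bHat_self, cHat_self,
      Finset.Icc_eq_empty_of_lt (Nat.lt_succ_self m.1)]
    simp
  · rw [loweringForm', bc_eq, bHat_self, cHat_self]
    push_cast
    rw [show P.k + ((m.1 : ℂ) + 1) - 1 = P.k + m.1 by ring]
    simp
  · refine Finset.sum_congr rfl fun j _ => ?_
    have e1 := bPlus_sub_bc (m + 1) j (P.k + j - 1) u hP
    have e2 := bMinus_sub_bc (m + 1) j (P.k + j - 1) u hP
    rw [sub_add_cancel] at e1
    rw [show P.k + (j : ℂ) - 1 - 1 = P.k + j - 2 by ring] at e2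
    rw [alternate, e1, e2, bc_eq, loweringForm', loweringForm', sub_add_cancel,
      show P.k + (j : ℂ) - 1 + -1 = P.k + j - 2 by ring]

end Currents

/-! ### Modes of the currents as sums of `selection` operators. -/

section Modes

variable {P : Params}

lemma IsField.hasModes {L : ℂ → LinForm P} (h : IsField L) (hL : IsIntegral (L 0)) :
    HasModes (fun u => vertex (L u)) fun n => (-1 / P.qdiff) • selection (L 0) n := by
  have := hasModes_vertex hL
  simpa only [← h _] using this

lemma HasModes.alternate {L : ℂ → ℂ → LinForm P} (h : ∀ ε, IsField (L ε))
    (hL : ∀ ε, IsIntegral (L ε 0)) :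
    HasModes (fun u => alternate fun ε => vertex (L ε u))
      fun n => FreeBoson.alternate fun ε => (-1 / P.qdiff) • selection (L ε 0) n :=
  ((h 1).hasModes (hL 1)).sub ((h (-1)).hasModes (hL (-1)))

variable (hP : IsContracting P) (i m : Node P) (n : ℤ)
include hP

lemma mode_Eplus : mode P (Eplus P m) n = (-1 / P.qdiff) •
    ∑ j ∈ Finset.Icc 1 m.1, alternate fun ε => selection (raisingForm m j ε 0) n := by
  have h := (HasModes.sum (Finset.Icc 1 m.1) fun j _ => HasModes.alternate
    (isField_raisingForm m j) fun ε => isIntegral_raisingForm m j ε 0).2 n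
  have e : Eplus P m = fun u => prefactor P u •
      ∑ j ∈ Finset.Icc 1 m.1, alternate fun ε => vertex (raisingForm m j ε u) :=
    funext (Eplus_eq hP m)
  rw [e, h, Finset.smul_sum]
  exact Finset.sum_congr rfl fun j _ => (smul_sub _ _ _).symm

lemma mode_Eminus : mode P (Eminus P m) n = (-1 / P.qdiff) •
    ((∑ j ∈ Finset.Ico 1 m.1, -alternate fun ε => selection (loweringForm m j ε 0) n)
      + selection (loweringForm m m (-1) 0) n - selection (loweringForm' m (m + 1) 1 0) n
      - ∑ j ∈ Finset.Icc (m.1 + 2) P.N,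
        alternate fun ε => selection (loweringForm' m j ε 0) n) := by
  have h1 := HasModes.sum (Finset.Ico 1 m.1) fun j _ => (HasModes.alternate
    (isField_loweringForm m j) fun ε => isIntegral_loweringForm m j ε 0).neg
  have h2 := (isField_loweringForm m m (-1)).hasModes (isIntegral_loweringForm m m (-1) 0)
  have h3 := (isField_loweringForm' m (m + 1) 1).hasModes (isIntegral_loweringForm' m (m + 1) 1 0)
  have h4 := HasModes.sum (Finset.Icc (m.1 + 2) P.N) fun j _ => HasModes.alternate
    (isField_loweringForm' m j) fun ε => isIntegral_loweringForm' m j ε 0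
  have h := (((h1.add h2).sub h3).sub h4).2 n
  rw [show Eminus P m = _ from funext (Eminus_eq hP m)]
  rw [h, smul_sub, smul_sub, smul_add, Finset.smul_sum, Finset.smul_sum]
  simp only [alternate, smul_neg, smul_sub]

end Modes

/-! ### Values of the commutators and cancellation in double sums. -/

section Values

variable {P : Params}

/-- The free parameters x and ζ' allow the pole and the exponents to be brought to a common form, so
that equal residues from different pairs can be recognised and cancelled. -/
lemma HasOPE.bracket_eq_of {L M : ℂ → LinForm P} (hL : IsField L) (hM : IsField M)
    (hLi : IsIntegral (L 0)) (hMb : IsBalanced (M 0)) {e e' ζ : ℂ} (h : HasOPE (L 0) (M 0) e e' ζ)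
    (n : ℤ) (u : ℂ) {x ζ' : ℂ} (hx : e = x) (hζ : ζ + (e' - e) = ζ') :
    bracket (selection (L 0) n) (vertex (M u))
      = ((P.qpow ζ - P.qpow ζ') * Complex.exp (n * (u + x * P.logq))) •
        vertex (L (u + x * P.logq) + M u) := by
  subst hx hζ
  rw [h.bracket_eq hL hM hLi hMb, qpow_add, mul_sub, mul_one]

lemma HasOPE.bracket_eq_zero {L M : ℂ → LinForm P} (hL : IsField L) (hM : IsField M)
    (hLi : IsIntegral (L 0)) (hMb : IsBalanced (M 0)) {e e' ζ : ℂ} (h : HasOPE (L 0) (M 0) e e' ζ)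
    (n : ℤ) (u : ℂ) (he : e' = e) : bracket (selection (L 0) n) (vertex (M u)) = 0 := by
  rw [h.bracket_eq_of hL hM hLi hMb n u rfl (show ζ + (e' - e) = ζ by rw [he]; ring), sub_self,
    zero_mul, zero_smul]

lemma sum_sum_ite {α β M : Type*} [DecidableEq α] [DecidableEq β] [AddCommMonoid M] (s : Finset α)
    (t : Finset β) (x : α) (y : β) (W : M) :
    ∑ j ∈ s, ∑ j' ∈ t, (if j = x ∧ j' = y then W else 0) = if x ∈ s ∧ y ∈ t then W else 0 := by
  simp only [ite_and, Finset.sum_ite_irrel, Finset.sum_ite_eq', Finset.sum_const_zero]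

/-- A double sum whose only two terms cancel. -/
lemma sum_pair_eq_zero {α β M : Type*} [DecidableEq α] [DecidableEq β] [AddCommGroup M]
    {s : Finset α} {t : Finset β} {T : α → β → M} (x x' : α) (y y' : β) (W : M)
    (h : x ∈ s ∧ y ∈ t ↔ x' ∈ s ∧ y' ∈ t)
    (hT : ∀ j ∈ s, ∀ j' ∈ t, T j j' = (if j = x ∧ j' = y then W else 0)
      - (if j = x' ∧ j' = y' then W else 0)) :
    ∑ j ∈ s, ∑ j' ∈ t, T j j' = 0 := by
  rw [Finset.sum_congr rfl fun j hj => Finset.sum_congr rfl fun j' hj' => hT j hj j' hj']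
  simp only [Finset.sum_sub_distrib, sum_sum_ite, h, sub_self]

end Values

/-! ### The raising currents commute with the screening current. -/

section Raising

variable {P : Params} (hP : IsContracting P) (i m : Node P) {j j' : ℕ} (ε ε' : ℂ)
  (n : ℤ) (u : ℂ)
include hP

lemma hasOPE_raising_swap (h : 1 ≤ i.1 ∧ i.1 ≤ m) (h' : i.1 + 1 ≤ m + 1 ∧ m.1 + 1 ≤ P.N) :
    HasOPE (raisingForm m i ε 0) (screeningForm i (m + 1) ε' 0) (P.N - m - i)
      (P.N - m - i - ε - ε') ε where
  right n hn := by rw [contraction_raising_screening hP i m _ _ _ _ h h' hn, if_pos ⟨rfl, rfl⟩]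
  left n hn := by rw [contraction_screening_raising hP i m _ _ _ _ h h' hn, if_pos ⟨rfl, rfl⟩]
  zero_right := by
    rw [zeroContraction_raising_screening hP i m _ _ _ _ h h', if_pos rfl, if_pos rfl]
  zero_left := by
    rw [zeroContraction_screening_raising hP i m _ _ _ _ h h', if_pos ⟨rfl, rfl⟩]
    ring

lemma hasOPE_raising_left (h : 1 ≤ i.1 ∧ i.1 ≤ m) (h' : i.1 + 1 ≤ m ∧ m.1 ≤ P.N) :
    HasOPE (raisingForm m i ε 0) (screeningForm i m ε' 0) (P.N - m - i + 1 - ε')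
      (P.N - m - i + 2) 0 where
  right n hn := by
    rw [contraction_raising_screening hP i m _ _ _ _ h h' hn, if_neg (by omega),
      if_pos ⟨rfl, rfl⟩]
  left n hn := by
    rw [contraction_screening_raising hP i m _ _ _ _ h h' hn, if_neg (by omega),
      if_pos ⟨rfl, rfl⟩]
  zero_right := by
    rw [zeroContraction_raising_screening hP i m _ _ _ _ h h', if_neg (by omega),
      if_neg (by omega)]
  zero_left := by
    rw [zeroContraction_screening_raising hP i m _ _ _ _ h h', if_neg (by omega),
      if_pos ⟨rfl, rfl⟩]
    ring

lemma hasOPE_raising_right (h : 1 ≤ i.1 + 1 ∧ i.1 + 1 ≤ m)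
    (h' : i.1 + 1 ≤ m + 1 ∧ m.1 + 1 ≤ P.N) :
    HasOPE (raisingForm m (i + 1) ε 0) (screeningForm i (m + 1) ε' 0) (P.N - m - i - 1 - ε)
      (P.N - m - i - 2) (1 - ε) where
  right n hn := by
    rw [contraction_raising_screening hP i m _ _ _ _ h h' hn, if_neg (by omega),
      if_neg (by omega), if_pos ⟨rfl, rfl⟩]
  left n hn := by
    rw [contraction_screening_raising hP i m _ _ _ _ h h' hn, if_neg (by omega),
      if_neg (by omega), if_pos ⟨rfl, rfl⟩]
  zero_right := by
    rw [zeroContraction_raising_screening hP i m _ _ _ _ h h', if_pos rfl, if_neg (by omega),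
      if_pos rfl]
  zero_left := by
    rw [zeroContraction_screening_raising hP i m _ _ _ _ h h', if_neg (by omega),
      if_neg (by omega), if_neg (by omega)]
    ring

lemma bracket_raising_eq_zero (h : 1 ≤ j ∧ j ≤ m) (h' : i + 1 ≤ j' ∧ j' ≤ P.N)
    (h1 : ¬(j = i ∧ j' = m + 1)) (h2 : ¬(j = i ∧ j' = m)) (h3 : ¬(j = i + 1 ∧ j' = m + 1)) :
    bracket (selection (raisingForm m j ε 0) n) (vertex (screeningForm i j' ε' u)) = 0 := by
  refine bracket_eq_zero (isField_screeningForm i j' ε') (isIntegral_raisingForm ..)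
    (isBalanced_screeningForm i j' ε' 0) (fun n hn => ?_) (fun n hn => ?_) ?_ n u
  · rw [contraction_raising_screening hP i m _ _ _ _ h h' hn, if_neg h1, if_neg h2, if_neg h3]
  · rw [contraction_screening_raising hP i m _ _ _ _ h h' hn, if_neg h1, if_neg h2, if_neg h3]
  · rw [zeroContraction_raising_screening hP i m _ _ _ _ h h',
      zeroContraction_screening_raising hP i m _ _ _ _ h h', if_neg h1, if_neg h2]
    split_ifs with a b c <;> first | rfl | omega

/-- The pair (i, m + 1) vanishes by itself, the pairs (i, m) and (i + 1, m + 1) are opposite to each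
other, and no other pair interacts. The right side records this in a form ready for summation. -/
lemma pairBracket_raising (h : 1 ≤ j ∧ j ≤ m) (h' : i + 1 ≤ j' ∧ j' ≤ P.N) :
    pairBracket (raisingForm m j) (screeningForm i j') n u
      = (if j = i ∧ j' = m then pairBracket (raisingForm m i) (screeningForm i m) n u else 0)
        - (if j = i + 1 ∧ j' = m + 1 then pairBracket (raisingForm m i) (screeningForm i m) n u
          else 0) := by
  have hL j ε := isField_raisingForm (P := P) m j ε
  have hM j ε := isField_screeningForm (P := P) i j ε
  have hLi j ε := isIntegral_raisingForm (P := P) m j ε 0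
  have hMb j ε := isBalanced_screeningForm (P := P) i j ε 0
  by_cases h1 : j = i ∧ j' = m + 1
  · obtain ⟨rfl, rfl⟩ := h1
    rw [if_neg (by omega), if_neg (by omega), sub_zero]
    have H ε ε' := hasOPE_raising_swap hP i m ε ε' h h'
    simp only [pairBracket, alternate]
    -- For opposite signs zero and pole coincide. For equal signs the coefficients are q - q⁻¹ and
    -- q⁻¹ - q, and the residues agree by `raising_screening_swap`.
    rw [(H 1 1).bracket_eq_of (hL _ _) (hM _ _) (hLi _ _) (hMb _ _) n u rfl
        (show _ = -1 by ring),
      (H (-1) (-1)).bracket_eq_of (hL _ _) (hM _ _) (hLi _ _) (hMb _ _) n u rfl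
        (show _ = 1 by ring),
      (H 1 (-1)).bracket_eq_zero (hL _ _) (hM _ _) (hLi _ _) (hMb _ _) n u (by ring),
      (H (-1) 1).bracket_eq_zero (hL _ _) (hM _ _) (hLi _ _) (hMb _ _) n u (by ring),
      raising_screening_swap, sub_zero, zero_sub, sub_neg_eq_add, ← add_smul]
    ring_nf
    rw [zero_smul]
  by_cases h2 : j = i ∧ j' = m
  · rw [if_pos h2, if_neg (by omega), sub_zero, h2.1, h2.2]
  by_cases h3 : j = i + 1 ∧ j' = m + 1
  · obtain ⟨rfl, rfl⟩ := h3
    have hi := Finset.mem_Ico.1 i.2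
    have hm := Finset.mem_Ico.1 m.2
    have H ε' := hasOPE_raising_right hP i m (-1) ε' h h'
    have H' ε' := hasOPE_raising_right hP i m 1 ε' h h'
    have G ε := hasOPE_raising_left hP i m ε 1 (by omega) (by omega)
    have G' ε := hasOPE_raising_left hP i m ε (-1) (by omega) (by omega)
    rw [if_neg (by omega), if_pos ⟨rfl, rfl⟩, zero_sub]
    -- The four brackets with a genuine pole have their poles at the same point, so their residues
    -- can be compared. The coefficients are q^2 - 1 on one side and 1 - q^2 on the other.
    have hx : (P.N : ℂ) - m - i - 1 - -1 = P.N - m - i := by ring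
    have hx' : (P.N : ℂ) - m - i + 1 - 1 = P.N - m - i := by ring
    simp only [pairBracket, alternate]
    rw [(H' 1).bracket_eq_zero (hL _ _) (hM _ _) (hLi _ _) (hMb _ _) n u (by ring),
      (H' (-1)).bracket_eq_zero (hL _ _) (hM _ _) (hLi _ _) (hMb _ _) n u (by ring),
      (G' 1).bracket_eq_zero (hL _ _) (hM _ _) (hLi _ _) (hMb _ _) n u (by ring),
      (G' (-1)).bracket_eq_zero (hL _ _) (hM _ _) (hLi _ _) (hMb _ _) n u (by ring),
      (H 1).bracket_eq_of (hL _ _) (hM _ _) (hLi _ _) (hMb _ _) n u hx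
        (show _ = 0 by ring),
      (H (-1)).bracket_eq_of (hL _ _) (hM _ _) (hLi _ _) (hMb _ _) n u hx
        (show _ = 0 by ring),
      (G 1).bracket_eq_of (hL _ _) (hM _ _) (hLi _ _) (hMb _ _) n u hx'
        (show _ = 2 by ring),
      (G (-1)).bracket_eq_of (hL _ _) (hM _ _) (hLi _ _) (hMb _ _) n u hx'
        (show _ = 2 by ring),
      raising_screening_pair hP, raising_screening_pair hP, neg_neg,
      show (1 : ℂ) - -1 = 2 by norm_num, ← neg_sub (P.qpow 0) (P.qpow 2), neg_mul, neg_smul,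
      neg_smul]
    abel
  · rw [if_neg h2, if_neg h3, sub_zero]
    simp only [pairBracket, alternate, bracket_raising_eq_zero hP i m _ _ n u h h' h1 h2 h3,
      sub_zero]

theorem sum_pairBracket_raising : ∑ j ∈ Finset.Icc 1 m.1, ∑ j' ∈ Finset.Icc (i.1 + 1) P.N,
    pairBracket (raisingForm m j) (screeningForm i j') n u = 0 := by
  have hi := Finset.mem_Ico.1 i.2
  have hm := Finset.mem_Ico.1 m.2
  refine sum_pair_eq_zero i.1 (i.1 + 1) m.1 (m.1 + 1) _ ?_ fun j hj j' hj' =>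
    pairBracket_raising hP i m n u (Finset.mem_Icc.1 hj) (Finset.mem_Icc.1 hj')
  -- Each of the two pairs lies in the summation range exactly when i < m, so they appear or
  -- disappear together.
  simp only [Finset.mem_Icc]
  omega

end Raising

/-! ### The summands of the lowering currents with j ≤ m. -/

section Lowering

variable {P : Params} (hP : IsContracting P) (i m : Node P) {j j' : ℕ} (ε ε' : ℂ)
  (n : ℤ) (u : ℂ)
include hP

lemma hasOPE_lowering_swap (hε : ε = 1 ∨ ε = -1) (h : 1 ≤ i.1 ∧ i.1 ≤ m)
    (h' : i.1 + 1 ≤ m ∧ m.1 ≤ P.N) :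
    HasOPE (loweringForm m i ε 0) (screeningForm i m ε' 0) (P.N + P.k + i - m)
      (P.N + P.k + i - m + ε - ε') (-1 - ε) where
  right n hn := by
    rw [contraction_lowering_screening hP i m _ _ _ _ h hε (by omega) h' hn, if_pos ⟨rfl, rfl⟩]
  left n hn := by
    rw [contraction_screening_lowering hP i m _ _ _ _ h hε (by omega) h' hn, if_pos ⟨rfl, rfl⟩]
  zero_right := by
    rw [zeroContraction_lowering_screening hP i m _ _ _ _ h hε (by omega) h', if_pos ⟨rfl, rfl⟩]
  zero_left := by
    rw [zeroContraction_screening_lowering hP i m _ _ _ _ h hε (by omega) h', if_pos ⟨rfl, rfl⟩]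
    ring

lemma hasOPE_lowering_left (hε : ε = 1 ∨ ε = -1) (hε' : i.1 = m → ε = -1) (h : 1 ≤ i.1 ∧ i.1 ≤ m)
    (h' : i.1 + 1 ≤ m + 1 ∧ m.1 + 1 ≤ P.N) :
    HasOPE (loweringForm m i ε 0) (screeningForm i (m + 1) ε' 0) (P.N + P.k + i - m - 1 - ε')
      (P.N + P.k + i - m - 2) 1 where
  right n hn := by
    rw [contraction_lowering_screening hP i m _ _ _ _ h hε hε' h' hn, if_neg (by omega),
      if_pos ⟨rfl, rfl⟩]
  left n hn := by
    rw [contraction_screening_lowering hP i m _ _ _ _ h hε hε' h' hn, if_neg (by omega),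
      if_pos ⟨rfl, rfl⟩]
  zero_right := by
    rw [zeroContraction_lowering_screening hP i m _ _ _ _ h hε hε' h', if_neg (by omega),
      if_pos ⟨rfl, rfl⟩]
  zero_left := by
    rw [zeroContraction_screening_lowering hP i m _ _ _ _ h hε hε' h', if_neg (by omega),
      if_pos ⟨rfl, rfl⟩]
    ring

lemma hasOPE_lowering_right (hε : ε = 1 ∨ ε = -1) (hε' : i.1 + 1 = m → ε = -1)
    (h : 1 ≤ i.1 + 1 ∧ i.1 + 1 ≤ m) (h' : i.1 + 1 ≤ m ∧ m.1 ≤ P.N) :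
    HasOPE (loweringForm m (i + 1) ε 0) (screeningForm i m ε' 0) (P.N + P.k + i - m + 1 + ε)
      (P.N + P.k + i - m + 2) ε where
  right n hn := by
    rw [contraction_lowering_screening hP i m _ _ _ _ h hε hε' h' hn, if_neg (by omega),
      if_neg (by omega), if_pos ⟨rfl, rfl⟩]
  left n hn := by
    rw [contraction_screening_lowering hP i m _ _ _ _ h hε hε' h' hn, if_neg (by omega),
      if_neg (by omega), if_pos ⟨rfl, rfl⟩]
  zero_right := by
    rw [zeroContraction_lowering_screening hP i m _ _ _ _ h hε hε' h', if_neg (by omega),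
      if_neg (by omega), if_pos ⟨rfl, rfl⟩]
  zero_left := by
    rw [zeroContraction_screening_lowering hP i m _ _ _ _ h hε hε' h', if_neg (by omega),
      if_neg (by omega), if_pos ⟨rfl, rfl⟩]
    ring

lemma bracket_lowering_eq_zero (hε : ε = 1 ∨ ε = -1) (hε' : j = m → ε = -1) (h : 1 ≤ j ∧ j ≤ m)
    (h' : i + 1 ≤ j' ∧ j' ≤ P.N)
    (h1 : ¬(j = i ∧ j' = m)) (h2 : ¬(j = i ∧ j' = m + 1)) (h3 : ¬(j = i + 1 ∧ j' = m)) :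
    bracket (selection (loweringForm m j ε 0) n) (vertex (screeningForm i j' ε' u)) = 0 := by
  refine bracket_eq_zero (isField_screeningForm i j' ε') (isIntegral_loweringForm ..)
    (isBalanced_screeningForm i j' ε' 0) (fun n hn => ?_) (fun n hn => ?_) ?_ n u
  · rw [contraction_lowering_screening hP i m _ _ _ _ h hε hε' h' hn, if_neg h1, if_neg h2,
      if_neg h3]
  · rw [contraction_screening_lowering hP i m _ _ _ _ h hε hε' h' hn, if_neg h1, if_neg h2,
      if_neg h3]
  · rw [zeroContraction_lowering_screening hP i m _ _ _ _ h hε hε' h',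
      zeroContraction_screening_lowering hP i m _ _ _ _ h hε hε' h', if_neg h1, if_neg h2,
      if_neg h3, if_neg h1, if_neg h2, if_neg h3]

end Lowering

/-- `f 1 - f (-1)`, without the first term at the boundary. -/
def alternateBelow {A : Type*} [AddGroup A] (j m : ℕ) (f : ℂ → A) : A :=
  (if j < m then f 1 else 0) - f (-1)

/-- `f 1 - f (-1)`, without the second term at the boundary. -/
def alternateAbove {A : Type*} [AddGroup A] (m j : ℕ) (f : ℂ → A) : A :=
  f 1 - if m < j then f (-1) else 0

section Lowering

variable {P : Params} (hP : IsContracting P) (i m : Node P) {j j' : ℕ} (n : ℤ) (u : ℂ)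

/-- The sum of the commutators of the summands of `E^{-,m}` labelled by `j ≤ m` with the summands of
the screening current labelled by `j'`. -/
def lowerBracket (j j' : ℕ) : Kernel P :=
  alternateBelow j m fun ε => alternate fun ε' =>
    bracket (selection (loweringForm m j ε 0) n) (vertex (screeningForm i j' ε' u))

/-- The sum of the commutators of the summands of `E^{-,m}` labelled by `j > m` with the summands of
the screening current labelled by `j'`. -/
def upperBracket (j j' : ℕ) : Kernel P :=
  alternateAbove (m + 1) j fun ε => alternate fun ε' =>
    bracket (selection (loweringForm' m j ε 0) n) (vertex (screeningForm i j' ε' u))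

include hP

/-- Equal signs give no pole; the two mixed terms carry opposite coefficients and, by
`lowering_screening_swap`, the same exponent. -/
lemma lowerBracket_swap (h : 1 ≤ i.1 ∧ i.1 ≤ m) (h' : i.1 + 1 ≤ m ∧ m.1 ≤ P.N) :
    lowerBracket i m n u i m = 0 := by
  have hL j ε := isField_loweringForm (P := P) m j ε
  have hM j ε := isField_screeningForm (P := P) i j ε
  have hLi j ε := isIntegral_loweringForm (P := P) m j ε 0
  have hMb j ε := isBalanced_screeningForm (P := P) i j ε 0
  have H ε' := hasOPE_lowering_swap hP i m 1 ε' (Or.inl rfl) h h'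
  have H' ε' := hasOPE_lowering_swap hP i m (-1) ε' (Or.inr rfl) h h'
  simp only [lowerBracket, alternateBelow, alternate]
  rw [if_pos (by omega),
    (H 1).bracket_eq_zero (hL _ _) (hM _ _) (hLi _ _) (hMb _ _) n u (by ring),
    (H' (-1)).bracket_eq_zero (hL _ _) (hM _ _) (hLi _ _) (hMb _ _) n u (by ring),
    (H (-1)).bracket_eq_of (hL _ _) (hM _ _) (hLi _ _) (hMb _ _) n u rfl (show _ = 0 by ring),
    (H' 1).bracket_eq_of (hL _ _) (hM _ _) (hLi _ _) (hMb _ _) n u rfl (show _ = -2 by ring),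
    lowering_screening_swap, show (-1 : ℂ) - 1 = -2 by norm_num, show (-1 : ℂ) - -1 = 0 by norm_num,
    ← neg_sub (P.qpow 0) (P.qpow (-2)), neg_mul, neg_smul]
  abel

/-- The two labels have a common pole and, by `lowering_screening_pair`, the same exponents there.
Their coefficients are q⁻¹ - q and q - q⁻¹ up to sign, which makes the sums opposite. -/
lemma lowerBracket_pair (h : 1 ≤ i.1 + 1 ∧ i.1 + 1 ≤ m) (h' : i.1 + 1 ≤ m ∧ m.1 + 1 ≤ P.N) :
    lowerBracket i m n u (i + 1) m = -lowerBracket i m n u i (m + 1) := by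
  have hi := Finset.mem_Ico.1 i.2
  have hL j ε := isField_loweringForm (P := P) m j ε
  have hM j ε := isField_screeningForm (P := P) i j ε
  have hLi j ε := isIntegral_loweringForm (P := P) m j ε 0
  have hMb j ε := isBalanced_screeningForm (P := P) i j ε 0
  have H ε' := hasOPE_lowering_right hP i m (-1) ε' (Or.inr rfl) (by simp) h (by omega)
  have G ε' := hasOPE_lowering_left hP i m 1 ε' (Or.inl rfl) (by omega) (by omega) (by omega)
  have G' ε' := hasOPE_lowering_left hP i m (-1) ε' (Or.inr rfl) (by simp) (by omega) (by omega)
  -- The terms with sign 1 at the label i + 1 are regular; they are absent altogether when i + 1 =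
  -- m.
  have hz : (if i.1 + 1 < m.1 then
      bracket (selection (loweringForm m (i + 1) 1 0) n) (vertex (screeningForm i m 1 u))
      - bracket (selection (loweringForm m (i + 1) 1 0) n) (vertex (screeningForm i m (-1) u))
      else 0) = 0 := by
    split_ifs with hlt
    · have H' ε' := hasOPE_lowering_right hP i m 1 ε' (Or.inl rfl) (by omega) h (by omega)
      rw [(H' 1).bracket_eq_zero (hL _ _) (hM _ _) (hLi _ _) (hMb _ _) n u (by ring),
        (H' (-1)).bracket_eq_zero (hL _ _) (hM _ _) (hLi _ _) (hMb _ _) n u (by ring), sub_zero]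
    · rfl
  have hx : (P.N : ℂ) + P.k + i - m + 1 + -1 = P.N + P.k + i - m := by ring
  have hx' : (P.N : ℂ) + P.k + i - m - 1 - -1 = P.N + P.k + i - m := by ring
  simp only [lowerBracket, alternateBelow, alternate]
  rw [hz, if_pos (by omega),
    (G 1).bracket_eq_zero (hL _ _) (hM _ _) (hLi _ _) (hMb _ _) n u (by ring),
    (G' 1).bracket_eq_zero (hL _ _) (hM _ _) (hLi _ _) (hMb _ _) n u (by ring),
    (H 1).bracket_eq_of (hL _ _) (hM _ _) (hLi _ _) (hMb _ _) n u hx (show _ = 1 by ring),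
    (H (-1)).bracket_eq_of (hL _ _) (hM _ _) (hLi _ _) (hMb _ _) n u hx (show _ = 1 by ring),
    (G (-1)).bracket_eq_of (hL _ _) (hM _ _) (hLi _ _) (hMb _ _) n u hx' (show _ = -1 by ring),
    (G' (-1)).bracket_eq_of (hL _ _) (hM _ _) (hLi _ _) (hMb _ _) n u hx' (show _ = -1 by ring),
    lowering_screening_pair hP i m u h.2, lowering_screening_pair hP i m u h.2,
    ← neg_sub (P.qpow 1) (P.qpow (-1)), neg_mul, neg_smul, neg_smul]
  abel

/-- For m = i the partner label i + 1 is out of range, so this residue is not cancelled. It is the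
part of the total difference taken at pz. -/
lemma lowerBracket_boundary : lowerBracket i i n u i (i + 1)
    = (P.qdiff * Complex.exp (n * (u + P.kg * P.logq))) • vertex (boundaryForm i (u + P.logp)) := by
  have hi := Finset.mem_Ico.1 i.2
  have hL j ε := isField_loweringForm (P := P) i j ε
  have hM j ε := isField_screeningForm (P := P) i j ε
  have hLi j ε := isIntegral_loweringForm (P := P) i j ε 0
  have hMb j ε := isBalanced_screeningForm (P := P) i j ε 0
  have G' ε' := hasOPE_lowering_left hP i i (-1) ε' (Or.inr rfl) (by simp) (by omega) (by omega)
  have hx' : (P.N : ℂ) + P.k + i - i - 1 - -1 = P.kg := by rw [Params.kg]; ring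
  simp only [lowerBracket, alternateBelow, alternate]
  rw [if_neg (lt_irrefl _),
    (G' 1).bracket_eq_zero (hL _ _) (hM _ _) (hLi _ _) (hMb _ _) n u (by ring),
    (G' (-1)).bracket_eq_of (hL _ _) (hM _ _) (hLi _ _) (hMb _ _) n u hx' (show _ = -1 by ring),
    lowering_screening_boundary hP, Params.qdiff]
  abel

lemma lowerBracket_eq_zero (h : 1 ≤ j ∧ j ≤ m) (h' : i + 1 ≤ j' ∧ j' ≤ P.N)
    (h1 : ¬(j = i ∧ j' = m)) (h2 : ¬(j = i ∧ j' = m + 1)) (h3 : ¬(j = i + 1 ∧ j' = m)) :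
    lowerBracket i m n u j j' = 0 := by
  have hz ε' := bracket_lowering_eq_zero hP i m (-1) ε' n u (Or.inr rfl) (by simp) h h' h1 h2 h3
  simp only [lowerBracket, alternateBelow, alternate, hz, sub_zero]
  split_ifs with hlt
  · have hz' ε' := bracket_lowering_eq_zero hP i m 1 ε' n u (Or.inl rfl) (by omega) h h' h1 h2 h3
    simp only [hz', sub_zero]
  · rfl

theorem sum_lowerBracket (h : m.1 ≠ i) : ∑ j ∈ Finset.Icc 1 m.1,
    ∑ j' ∈ Finset.Icc (i.1 + 1) P.N, lowerBracket i m n u j j' = 0 := by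
  have hi := Finset.mem_Ico.1 i.2
  have hm := Finset.mem_Ico.1 m.2
  refine sum_pair_eq_zero i.1 (i.1 + 1) (m.1 + 1) m.1 (lowerBracket i m n u i (m + 1)) ?_
    fun j hj j' hj' => ?_
  -- For m ≠ i the two cancelling pairs are in range under the same condition i < m; for m = i only
  -- one of them is.
  · simp only [Finset.mem_Icc]
    omega
  replace hj := Finset.mem_Icc.1 hj
  replace hj' := Finset.mem_Icc.1 hj'
  by_cases h1 : j = i ∧ j' = m
  · rw [if_neg (by omega), if_neg (by omega), h1.1, h1.2, lowerBracket_swap hP i m n u (by omega)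
      (by omega), sub_zero]
  by_cases h2 : j = i ∧ j' = m + 1
  · rw [if_pos h2, if_neg (by omega), h2.1, h2.2, sub_zero]
  by_cases h3 : j = i + 1 ∧ j' = m
  · rw [if_neg (by omega), if_pos h3, h3.1, h3.2, zero_sub,
      lowerBracket_pair hP i m n u (by omega) (by omega)]
  · rw [if_neg h2, if_neg h3, sub_zero, lowerBracket_eq_zero hP i m n u hj hj' h1 h2 h3]

theorem sum_lowerBracket_self : ∑ j ∈ Finset.Icc 1 i.1,
    ∑ j' ∈ Finset.Icc (i.1 + 1) P.N, lowerBracket i i n u j j'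
      = (P.qdiff * Complex.exp (n * (u + P.kg * P.logq))) •
        vertex (boundaryForm i (u + P.logp)) := by
  have hi := Finset.mem_Ico.1 i.2
  have h : ∀ j ∈ Finset.Icc 1 i.1, ∀ j' ∈ Finset.Icc (i.1 + 1) P.N, lowerBracket i i n u j j'
      = if j = i ∧ j' = i + 1 then lowerBracket i i n u i (i + 1) else 0 := by
    intro j hj j' hj'
    replace hj := Finset.mem_Icc.1 hj
    replace hj' := Finset.mem_Icc.1 hj'
    split_ifs with h2
    · rw [h2.1, h2.2]
    · exact lowerBracket_eq_zero hP i i n u hj hj' (by omega) h2 (by omega)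
  rw [Finset.sum_congr rfl fun j hj => Finset.sum_congr rfl fun j' hj' => h j hj j' hj',
    sum_sum_ite, if_pos ⟨Finset.mem_Icc.2 (by omega), Finset.mem_Icc.2 (by omega)⟩,
    lowerBracket_boundary hP]

end Lowering

/-! ### The summands of the lowering currents with j > m. -/

section Upper

variable {P : Params} (hP : IsContracting P) (i m : Node P) {j j' : ℕ} (ε ε' : ℂ) (n : ℤ) (u : ℂ)
include hP

lemma hasOPE_lowering'_self (hε : ε = 1 ∨ ε = -1) (hε' : j = i + 1 → ε = 1)
    (h : i.1 + 1 ≤ j ∧ j ≤ P.N) :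
    HasOPE (loweringForm' i j ε 0) (screeningForm i j ε' 0) (P.N - P.k - 2 * j + 1 - ε')
      (P.N - P.k - 2 * j + 1 + ε) (-ε) where
  right n hn := by
    rw [contraction_lowering'_screening hP i i _ _ _ _ h hε hε' h hn, if_pos ⟨rfl, rfl⟩]
  left n hn := by
    rw [contraction_screening_lowering' hP i i _ _ _ _ h hε hε' h hn, if_pos ⟨rfl, rfl⟩]
  zero_right := by
    rw [zeroContraction_lowering'_screening hP i i _ _ _ _ h hε hε' h, if_pos rfl,
      if_neg (by omega), if_pos rfl]
  zero_left := by
    rw [zeroContraction_screening_lowering' hP i i _ _ _ _ h hε hε' h, if_pos rfl,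
      if_neg (by omega), if_pos rfl]
    ring

lemma hasOPE_lowering'_succ (hm : m.1 + 1 = i) (hε : ε = 1 ∨ ε = -1) (h : i.1 + 1 ≤ j ∧ j ≤ P.N) :
    HasOPE (loweringForm' m j ε 0) (screeningForm i j ε' 0) (P.N - P.k - 2 * j + 1)
      (P.N - P.k - 2 * j + 1 - ε - ε') ε where
  right n hn := by
    rw [contraction_lowering'_screening hP i m _ _ _ _ (by omega) hε (by omega) h hn,
      if_neg (by omega), if_pos ⟨hm, rfl⟩]
  left n hn := by
    rw [contraction_screening_lowering' hP i m _ _ _ _ (by omega) hε (by omega) h hn,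
      if_neg (by omega), if_pos ⟨hm, rfl⟩]
  zero_right := by
    rw [zeroContraction_lowering'_screening hP i m _ _ _ _ (by omega) hε (by omega) h, if_pos rfl,
      if_pos hm]
  zero_left := by
    rw [zeroContraction_screening_lowering' hP i m _ _ _ _ (by omega) hε (by omega) h, if_pos rfl,
      if_pos hm]
    ring

lemma bracket_lowering'_eq_zero (hε : ε = 1 ∨ ε = -1) (hε' : j = m + 1 → ε = 1)
    (h : m + 1 ≤ j ∧ j ≤ P.N) (h' : i + 1 ≤ j' ∧ j' ≤ P.N)
    (h1 : ¬(m.1 = i ∧ j = j')) (h2 : ¬(m.1 + 1 = i ∧ j = j')) :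
    bracket (selection (loweringForm' m j ε 0) n) (vertex (screeningForm i j' ε' u)) = 0 := by
  refine bracket_eq_zero (isField_screeningForm i j' ε') (isIntegral_loweringForm' ..)
    (isBalanced_screeningForm i j' ε' 0) (fun n hn => ?_) (fun n hn => ?_) ?_ n u
  · rw [contraction_lowering'_screening hP i m _ _ _ _ h hε hε' h' hn, if_neg h1, if_neg h2]
  · rw [contraction_screening_lowering' hP i m _ _ _ _ h hε hε' h' hn, if_neg h1, if_neg h2]
  · rw [zeroContraction_lowering'_screening hP i m _ _ _ _ h hε hε' h',
      zeroContraction_screening_lowering' hP i m _ _ _ _ h hε hε' h']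
    split_ifs with a b c <;> first | rfl | omega

lemma upperBracket_eq_zero (h : m + 1 ≤ j ∧ j ≤ P.N) (h' : i + 1 ≤ j' ∧ j' ≤ P.N)
    (h1 : ¬(m.1 = i ∧ j = j')) (h2 : ¬(m.1 + 1 = i ∧ j = j')) :
    upperBracket i m n u j j' = 0 := by
  have hz ε' := bracket_lowering'_eq_zero hP i m 1 ε' n u (Or.inl rfl) (by simp) h h' h1 h2
  simp only [upperBracket, alternateAbove, alternate, hz, sub_zero]
  split_ifs with hlt
  · have hz' ε' := bracket_lowering'_eq_zero hP i m (-1) ε' n u (Or.inr rfl) (by omega) h h' h1 h2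
    simp only [hz', sub_zero]
  · rw [sub_zero]

/-- Mixed signs give no pole, and for equal signs the coefficients are opposite while the exponents
agree by `lowering'_screening_swap`. -/
lemma upperBracket_succ (hm : m.1 + 1 = i) (h : i + 1 ≤ j ∧ j ≤ P.N) :
    upperBracket i m n u j j = 0 := by
  have hL j ε := isField_loweringForm' (P := P) m j ε
  have hM j ε := isField_screeningForm (P := P) i j ε
  have hLi j ε := isIntegral_loweringForm' (P := P) m j ε 0
  have hMb j ε := isBalanced_screeningForm (P := P) i j ε 0
  have H ε' := hasOPE_lowering'_succ hP i m 1 ε' hm (Or.inl rfl) h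
  have H' ε' := hasOPE_lowering'_succ hP i m (-1) ε' hm (Or.inr rfl) h
  simp only [upperBracket, alternateAbove, alternate]
  rw [if_pos (by omega),
    (H (-1)).bracket_eq_zero (hL _ _) (hM _ _) (hLi _ _) (hMb _ _) n u (by ring),
    (H' 1).bracket_eq_zero (hL _ _) (hM _ _) (hLi _ _) (hMb _ _) n u (by ring),
    (H 1).bracket_eq_of (hL _ _) (hM _ _) (hLi _ _) (hMb _ _) n u rfl (show _ = -1 by ring),
    (H' (-1)).bracket_eq_of (hL _ _) (hM _ _) (hLi _ _) (hMb _ _) n u rfl (show _ = 1 by ring),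
    lowering'_screening_swap i m u hm j, ← neg_sub (P.qpow 1) (P.qpow (-1)), neg_mul, neg_smul]
  abel

theorem sum_upperBracket (h : m.1 ≠ i) : ∑ j ∈ Finset.Icc (m.1 + 1) P.N,
    ∑ j' ∈ Finset.Icc (i.1 + 1) P.N, upperBracket i m n u j j' = 0 := by
  refine Finset.sum_eq_zero fun j hj => Finset.sum_eq_zero fun j' hj' => ?_
  replace hj := Finset.mem_Icc.1 hj
  replace hj' := Finset.mem_Icc.1 hj'
  by_cases h2 : m.1 + 1 = i ∧ j = j'
  · obtain ⟨hm, rfl⟩ := h2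
    exact upperBracket_succ hP i m n u hm hj'
  · exact upperBracket_eq_zero hP i m n u hj hj' (by omega) h2

/-- The residue of the product of the summands of `E^{-,i}` and the screening current labelled
by `j`. -/
def selfResidue (j : ℕ) : Kernel P :=
  (P.qdiff * Complex.exp (n * (u + (P.N - P.k - 2 * j) * P.logq))) •
    vertex (loweringForm' i j 1 (u + (P.N - P.k - 2 * j) * P.logq) + screeningForm i j 1 u)

/-- The term with sign 1 has its residue at the pole attached to its own label, the term with sign
-1 at the pole attached to the preceding label, where `lowering'_screening_pair` identifies the
exponents. The first label i + 1 has no second term. -/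
lemma upperBracket_self (h : i + 1 ≤ j + 1 ∧ j + 1 ≤ P.N) :
    upperBracket i i n u (j + 1) (j + 1)
      = (if i.1 + 1 < j + 1 then selfResidue i n u j else 0) - selfResidue i n u (j + 1) := by
  have hL j ε := isField_loweringForm' (P := P) i j ε
  have hM j ε := isField_screeningForm (P := P) i j ε
  have hLi j ε := isIntegral_loweringForm' (P := P) i j ε 0
  have hMb j ε := isBalanced_screeningForm (P := P) i j ε 0
  have H ε' := hasOPE_lowering'_self hP i 1 ε' (Or.inl rfl) (by simp) h
  have hx : (P.N : ℂ) - P.k - 2 * (j + 1 : ℕ) + 1 - 1 = P.N - P.k - 2 * (j + 1 : ℕ) := by ring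
  simp only [upperBracket, alternateAbove, alternate]
  rw [(H (-1)).bracket_eq_zero (hL _ _) (hM _ _) (hLi _ _) (hMb _ _) n u (by ring),
    (H 1).bracket_eq_of (hL _ _) (hM _ _) (hLi _ _) (hMb _ _) n u hx (show _ = 1 by ring),
    ← neg_sub (P.qpow 1) (P.qpow (-1)), neg_mul, neg_smul]
  split_ifs with hlt
  · have H' ε' := hasOPE_lowering'_self hP i (-1) ε' (Or.inr rfl) (by omega) h
    have hx' : (P.N : ℂ) - P.k - 2 * (j + 1 : ℕ) + 1 - -1 = P.N - P.k - 2 * j := by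
      push_cast; ring
    rw [(H' 1).bracket_eq_zero (hL _ _) (hM _ _) (hLi _ _) (hMb _ _) n u (by ring),
      (H' (-1)).bracket_eq_of (hL _ _) (hM _ _) (hLi _ _) (hMb _ _) n u hx' (show _ = -1 by ring),
      ← lowering'_screening_pair hP i u j h.2, neg_neg, selfResidue, selfResidue, Params.qdiff]
    abel
  · rw [selfResidue, Params.qdiff]
    abel

theorem sum_upperBracket_self : ∑ j ∈ Finset.Icc (i.1 + 1) P.N,
    ∑ j' ∈ Finset.Icc (i.1 + 1) P.N, upperBracket i i n u j j'
      = -(P.qdiff * Complex.exp (n * (u + -P.kg * P.logq))) • vertex (boundaryForm i u) := by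
  have hi := Finset.mem_Ico.1 i.2
  have h1 : ∀ j ∈ Finset.Icc (i.1 + 1) P.N, ∑ j' ∈ Finset.Icc (i.1 + 1) P.N,
      upperBracket i i n u j j' = upperBracket i i n u j j := fun j hj =>
    Finset.sum_eq_single_of_mem j hj fun j' hj' hne =>
      upperBracket_eq_zero hP i i n u (Finset.mem_Icc.1 hj) (Finset.mem_Icc.1 hj') (by omega)
        (by omega)
  -- The diagonal terms telescope: each residue cancels against the next label, and only the one at
  -- the upper end is left.
  have h2 : ∀ J, i.1 + 1 ≤ J → J ≤ P.N → ∑ j ∈ Finset.Icc (i.1 + 1) J,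
      upperBracket i i n u j j = -selfResidue i n u J := by
    intro J hJ
    induction J, hJ using Nat.le_induction with
    | base =>
      intro hN
      rw [Finset.Icc_self, Finset.sum_singleton, upperBracket_self hP i n u ⟨le_rfl, hN⟩,
        if_neg (lt_irrefl _), zero_sub]
    | succ J hJ ih =>
      intro hN
      rw [Finset.sum_Icc_succ_top (by omega), ih (by omega),
        upperBracket_self hP i n u ⟨by omega, hN⟩, if_pos (by omega)]
      abel
  -- At J = N the pole becomes q^(-(k+g)) z, since N - k - 2N = -(k + g), and the residue is the
  -- boundary operator at z.
  rw [Finset.sum_congr rfl h1, h2 P.N (by omega) le_rfl, selfResidue,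
    show (P.N : ℂ) - P.k - 2 * P.N = -P.kg by rw [Params.kg]; ring,
    lowering'_screening_boundary hP, neg_smul]

end Upper

/-! ### Contractions of the Cartan generators with the screening current. -/

section CartanForms

variable {P : Params}

/-- The field of the modes `H^m_n`, `n > 0`, and of `K_m`. -/
def cartanPlus (m : Node P) : LinForm P :=
  ∑ j ∈ Finset.Icc 1 m.1, (bPlus P j (m + 1) (P.k / 2 + j - 1) 0 - bPlus P j m (P.k / 2 + j) 0)
    + aPlus P m (P.N / 2) 0
    + ∑ j ∈ Finset.Icc (m.1 + 1) P.N,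
      (bPlus P m j (P.k / 2 + j) 0 - bPlus P (m + 1) j (P.k / 2 + j - 1) 0)

/-- The field of the modes `H^m_n`, `n < 0`. -/
def cartanMinus (m : Node P) : LinForm P :=
  ∑ j ∈ Finset.Icc 1 m.1,
      (bMinus P j (m + 1) (-(P.k / 2 + j - 1)) 0 - bMinus P j m (-(P.k / 2 + j)) 0)
    + aMinus P m (-(P.N / 2)) 0
    + ∑ j ∈ Finset.Icc (m.1 + 1) P.N,
      (bMinus P m j (-(P.k / 2 + j)) 0 - bMinus P (m + 1) j (-(P.k / 2 + j - 1)) 0)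

variable (hP : IsContracting P) (i m : Node P) (j' : ℕ) (ε' : ℂ)
  (hj' : i + 1 ≤ j' ∧ j' ≤ P.N)
include hP hj'

-- The a^i part and the b part of H^m contract to opposite values: the a part gives the Cartan
-- matrix entry, and the tails in b give telescoping sums with the same endpoints.
set_option maxHeartbeats 1000000 in
lemma contraction_cartanPlus_screening {n : ℕ} (hn : 0 < n) :
    contractionHom n (cartanPlus m) (screeningForm i j' ε' 0) = 0 := by
  have hi := Finset.mem_Ico.1 i.2
  have hm := Finset.mem_Ico.1 m.2
  rw [contractionHom_screeningForm_right hP hn]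
  have e1 (l : ℕ) : -(P.k / 2 + (l : ℂ) - 1) - l = -(P.k / 2 - 1 + l) - l := by ring
  simp only [cartanPlus, map_add, map_sub, map_neg, map_sum,
    bPos_bPlus hP n _ _ _ _ hn, cPos_bPlus, bTail_bPlus hP hn, aPos_bPlus, bPos_aPlus, cPos_aPlus,
    bTail_aPlus, aPos_aPlus n i _ hP hn, Finset.sum_sub_distrib, sum_Icc_ite', sum_Icc_ite, e1,
    Finset.sum_const_zero, sub_zero, add_zero, zero_add, neg_zero, zero_sub]
  rw [show -(P.kg / 2) - (P.N : ℂ) / 2 = -(P.k / 2) - P.N by rw [Params.kg]; ring,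
    sum_tailPlus n P.N (m + 1) j' (i + 1) m (P.k / 2) (by omega) (by omega) (by omega) (by omega),
    sum_tailPlus n P.N (m + 1) j' i m (P.k / 2) (by omega) (by omega) (by omega) (by omega),
    sum_tailPlus n P.N (m + 1) j' (i + 1) (m + 1) (P.k / 2 - 1) (by omega) (by omega) (by omega)
      (by omega),
    sum_tailPlus n P.N (m + 1) j' i (m + 1) (P.k / 2 - 1) (by omega) (by omega) (by omega)
      (by omega)]
  have hjj : m.1 < j' ∧ max (m.1 + 1) (j' + 1) = j' + 1 ∨
    m.1 = j' ∧ max (m.1 + 1) (j' + 1) = j' + 1 ∨ j' < m.1 ∧ max (m.1 + 1) (j' + 1) = m + 1 := by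
    omega
  have hmi := cartan_cases m i
  -- Orients this case so that rewriting from right to left eliminates one of the indices in every
  -- equational case.
  rw [@eq_comm _ m.1 (i.1 + 1)] at hmi
  rcases hmi with ⟨h, hc⟩ | ⟨h, hc⟩ | ⟨h, hc⟩ | ⟨h, hc⟩ | ⟨h, hc⟩ <;>
  rcases (by omega : j' < m.1 ∨ j' = m.1 ∨ j' = m.1 + 1 ∨ m.1 + 1 < j') with h' | h' | h' | h' <;>
  rcases hjj with ⟨h'', hm⟩ | ⟨h'', hm⟩ | ⟨h'', hm⟩ <;>
  rw [hc, hm] <;> clear hc hm <;>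
  (try (exfalso; omega)) <;>
  simp (disch := omega) only [if_pos, if_neg, mul_zero, zero_mul, sub_zero, add_zero, zero_add,
    neg_zero, zero_sub, sub_self] <;>
  (try subst h') <;> (try simp only [← h]) <;> (try push_cast) <;>
  (try simp only [sub_eq_add_neg, qexp_add, qexp_neg, neg_add, neg_neg, qexp_two, mul_add,
    qexp_two_mul, mul_one, inv_inv]) <;>
  (try field_simp [qexp_ne_zero]) <;> (try ring)

lemma contraction_screening_cartanMinus {n : ℕ} (hn : 0 < n) :
    contractionHom n (screeningForm i j' ε' 0) (cartanMinus m) = 0 := by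
  have hi := Finset.mem_Ico.1 i.2
  have hm := Finset.mem_Ico.1 m.2
  rw [contractionHom_screeningForm_left hP hn]
  simp only [cartanMinus, map_add, map_sub, map_neg, map_sum,
    bNeg_bMinus hP n _ _ _ _ hn, cNeg_bMinus, aNeg_bMinus, bNeg_aMinus, cNeg_aMinus,
    aNeg_aMinus n i _ hP hn, Finset.sum_sub_distrib, sum_Icc_ite', sum_Icc_ite,
    Finset.sum_const_zero, sub_zero, add_zero, zero_add, neg_zero, zero_sub]
  rw [show -(P.kg / 2) + -((P.N : ℂ) / 2) = -(P.k / 2) - P.N by rw [Params.kg]; ring,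
    cartan_comm i.1 m.1]
  have hmi := cartan_cases m i
  rw [@eq_comm _ m.1 (i.1 + 1)] at hmi
  rcases hmi with ⟨h, hc⟩ | ⟨h, hc⟩ | ⟨h, hc⟩ | ⟨h, hc⟩ | ⟨h, hc⟩ <;>
  rcases (by omega : j' < m.1 ∨ j' = m.1 ∨ j' = m.1 + 1 ∨ m.1 + 1 < j') with h' | h' | h' | h' <;>
  rw [hc] <;> clear hc <;>
  (try (exfalso; omega)) <;>
  simp (disch := omega) only [if_pos, if_neg, mul_zero, zero_mul, sub_zero, add_zero, zero_add,
    neg_zero, zero_sub, sub_self] <;>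
  (try subst h') <;> (try simp only [← h]) <;> (try push_cast) <;>
  (try simp only [sub_eq_add_neg, qexp_add, qexp_neg, neg_add, neg_neg, qexp_two, mul_add,
    qexp_two_mul, mul_one, inv_inv]) <;>
  (try field_simp [qexp_ne_zero]) <;> (try ring)

lemma zeroContraction_cartanPlus_screening :
    zeroContraction (cartanPlus m) (screeningForm i j' ε' 0) = 0 := by
  have hi := Finset.mem_Ico.1 i.2
  have hm := Finset.mem_Ico.1 m.2
  rw [zeroContraction_screeningForm_right hP]
  simp only [cartanPlus, map_add, map_sub, map_neg, map_sum,
    pDiff_bPlus, pDiff_aPlus, aZero_bPlus, aZero_aPlus,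
    Finset.sum_sub_distrib, sum_Icc_ite', sum_Icc_ite,
    Finset.sum_const_zero, sub_zero, add_zero, zero_add, neg_zero, zero_sub]
  have hmi := cartan_cases m i
  rw [@eq_comm _ m.1 (i.1 + 1)] at hmi
  rcases hmi with ⟨h, hc⟩ | ⟨h, hc⟩ | ⟨h, hc⟩ | ⟨h, hc⟩ | ⟨h, hc⟩ <;>
  rcases (by omega : j' < m.1 ∨ j' = m.1 ∨ j' = m.1 + 1 ∨ m.1 + 1 < j') with h' | h' | h' | h' <;>
  rw [hc] <;> clear hc <;>
  (try (exfalso; omega)) <;>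
  simp (disch := omega) only [if_pos, if_neg, mul_zero, zero_mul, sub_zero, add_zero, zero_add,
    neg_zero, zero_sub, sub_self] <;> ring

end CartanForms

/-! ### The generators H^m_n and K_m commute with the screening current. -/

section CartanCommutes

variable {P : Params}

lemma bracket_alternate_left {f : ℂ → Kernel P} (hf : ∀ ε, IsFinitary (f ε)) (B : Kernel P) :
    bracket (alternate f) B = alternate fun ε => bracket (f ε) B :=
  bracket_sub_left (hf _) (hf _) _

lemma bracket_alternate_right {A : Kernel P} (hA : IsFinitary A) (g : ℂ → Kernel P) :
    bracket A (alternate g) = alternate fun ε => bracket A (g ε) :=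
  bracket_sub_right hA _ _

lemma bracket_neg_right (A B : Kernel P) : bracket A (-B) = -bracket A B := by
  rw [← neg_one_smul ℂ B, bracket_smul_right, neg_one_smul]

lemma bracket_neg_left (A B : Kernel P) : bracket (-A) B = -bracket A B := by
  rw [← neg_one_smul ℂ A, bracket_smul_left, neg_one_smul]

lemma IsFinitary.alternate {f : ℂ → Kernel P} (hf : ∀ ε, IsFinitary (f ε)) :
    IsFinitary (alternate f) := (hf _).sub (hf _)

lemma bracket_screening (hP : IsContracting P) {A : Kernel P} (hA : IsFinitary A) (i : Node P)
    (u : ℂ) : bracket A (screening P i u) = prefactor P u •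
      ∑ j ∈ Finset.Icc (i.1 + 1) P.N,
        -alternate fun ε => bracket A (vertex (screeningForm i j ε u)) := by
  rw [screening_eq hP, bracket_smul_right, bracket_sum_right _ hA]
  simp only [bracket_neg_right, bracket_alternate_right hA]

lemma bracket_screening_eq_zero (hP : IsContracting P) {A : Kernel P} (hA : IsFinitary A)
    (i : Node P) (u : ℂ) (h : ∀ (j : ℕ) (ε : ℂ), i + 1 ≤ j ∧ j ≤ P.N →
      bracket A (vertex (screeningForm i j ε u)) = 0) : bracket A (screening P i u) = 0 := by
  rw [bracket_screening hP hA, Finset.sum_eq_zero, smul_zero]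
  intro j hj
  simp only [alternate, h j _ (Finset.mem_Icc.1 hj), sub_zero, neg_zero]

section Modes

variable (P)

lemma oscPart_bPlus (r s : ℕ) (α : ℂ) {n : ℤ} (hn : 0 < n) :
    oscPart (bPlus P r s α 0) n = (P.qdiff * P.qpow (-(α * |n|))) • bMode P r s n := by
  unfold bPlus bMode
  split_ifs with h
  · rw [oscPart, Finset.sum_eq_single (.b ⟨(r, s), h⟩)]
    · rw [plusField, if_pos ⟨rfl, hn⟩, Params.qpow, abs_of_pos hn]
      ring_nf
    · intro x _ hx
      rw [plusField, if_neg fun h => hx h.1, zero_smul]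
    · simp
  · rw [oscPart_zero, smul_zero]

lemma oscPart_bMinus (r s : ℕ) (α : ℂ) {n : ℤ} (hn : n < 0) :
    oscPart (bMinus P r s (-α) 0) n = (-P.qdiff * P.qpow (-(α * |n|))) • bMode P r s n := by
  unfold bMinus bMode
  split_ifs with h
  · rw [oscPart, Finset.sum_eq_single (.b ⟨(r, s), h⟩)]
    · rw [minusField, if_pos ⟨rfl, hn⟩, Params.qpow, abs_of_neg hn]
      push_cast
      ring_nf
    · intro x _ hx
      rw [minusField, if_neg fun h => hx h.1, zero_smul]
    · simp
  · rw [oscPart_zero, smul_zero]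

lemma oscPart_aPlus (m : Node P) (α : ℂ) {n : ℤ} (hn : 0 < n) :
    oscPart (aPlus P m α 0) n = (P.qdiff * P.qpow (-(α * |n|))) • oscKernel P (.a m) n := by
  unfold aPlus
  rw [oscPart, Finset.sum_eq_single (.a m)]
  · rw [plusField, if_pos ⟨rfl, hn⟩, Params.qpow, abs_of_pos hn]
    ring_nf
  · intro x _ hx
    rw [plusField, if_neg fun h => hx h.1, zero_smul]
  · simp

lemma oscPart_aMinus (m : Node P) (α : ℂ) {n : ℤ} (hn : n < 0) :
    oscPart (aMinus P m (-α) 0) n = (-P.qdiff * P.qpow (-(α * |n|))) • oscKernel P (.a m) n := by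
  unfold aMinus
  rw [oscPart, Finset.sum_eq_single (.a m)]
  · rw [minusField, if_pos ⟨rfl, hn⟩, Params.qpow, abs_of_neg hn]
    push_cast
    ring_nf
  · intro x _ hx
    rw [minusField, if_neg fun h => hx h.1, zero_smul]
  · simp

lemma oscPart_cartanPlus (m : Node P) {n : ℤ} (hn : 0 < n) :
    oscPart (cartanPlus m) n = P.qdiff • H P m n := by
  simp only [cartanPlus, H, oscPart_add, oscPart_sub, oscPart_sum, oscPart_bPlus P _ _ _ hn,
    oscPart_aPlus P _ _ hn, smul_add, smul_sub, Finset.smul_sum, smul_smul]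

lemma oscPart_cartanMinus (m : Node P) {n : ℤ} (hn : n < 0) :
    oscPart (cartanMinus m) n = -P.qdiff • H P m n := by
  simp only [cartanMinus, H, oscPart_add, oscPart_sub, oscPart_sum, oscPart_bMinus P _ _ _ hn,
    oscPart_aMinus P _ _ hn, smul_add, smul_sub, Finset.smul_sum, smul_smul]

end Modes

variable (hP : IsContracting P)
include hP

lemma isFinitary_H (m : Node P) {n : ℤ} (hn : n ≠ 0) : IsFinitary (H P m n) := by
  rcases lt_or_gt_of_ne hn with h | h
  · have := (isFinitary_oscPart (cartanMinus m) hn).smul (-P.qdiff)⁻¹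
    rwa [oscPart_cartanMinus P m h, smul_smul,
      inv_mul_cancel₀ (neg_ne_zero.2 hP.qdiff_ne_zero), one_smul] at this
  · have := (isFinitary_oscPart (cartanPlus m) hn).smul (P.qdiff)⁻¹
    rwa [oscPart_cartanPlus P m h, smul_smul, inv_mul_cancel₀ hP.qdiff_ne_zero, one_smul] at this

omit hP in
lemma contraction_translate_right (L M : LinForm P) (u : ℂ) (n : ℕ) :
    contraction L (translate u M) n = contraction L M n * Complex.exp (n * u) := by
  simp only [contraction, Finset.sum_mul]
  refine Finset.sum_congr rfl fun y _ => ?_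
  simp only [translate, Finset.mul_sum, Finset.sum_mul]
  push_cast
  rw [neg_mul, neg_neg]
  ring_nf

omit hP in
lemma contraction_translate_left (L M : LinForm P) (u : ℂ) (n : ℕ) :
    contraction (translate u L) M n = contraction L M n * Complex.exp (-(n * u)) := by
  simp only [contraction, Finset.sum_mul, translate, Finset.mul_sum]
  push_cast
  refine Finset.sum_congr rfl fun y _ => Finset.sum_congr rfl fun x _ => ?_
  ring_nf

omit hP in
lemma contraction_eq_zero {L M : LinForm P} {n : ℕ} (hn : 0 < n)
    (h : contractionHom n L M = 0) : contraction L M n = 0 := by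
  rw [contractionHom_apply] at h
  exact (mul_eq_zero.1 h).resolve_left (by exact_mod_cast hn.ne')

/-- For n > 0 the contraction is with the creation part of each screening exponent, for n < 0 with
its annihilation part. Both vanish at z = 1, and translation to general z only multiplies them by a
scalar. -/
theorem bracket_H_screening (m i : Node P) {n : ℤ} (hn : n ≠ 0) (u : ℂ) :
    bracket (H P m n) (screening P i u) = 0 := by
  refine bracket_screening_eq_zero hP (isFinitary_H hP m hn) i u fun j ε hj => ?_
  rw [isField_screeningForm i j ε u]
  rcases lt_or_gt_of_ne hn with h | h
  · obtain ⟨k, rfl⟩ : ∃ k : ℕ, n = -k := ⟨n.natAbs, by omega⟩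
    have hk : 0 < k := by omega
    have h0 : contraction (translate u (screeningForm i j ε 0)) (cartanMinus m) k = 0 := by
      rw [contraction_translate_left,
        contraction_eq_zero hk (contraction_screening_cartanMinus hP i m j ε hj hk), zero_mul]
    have h1 := oscPart_neg_commute hk h0
    rw [← sub_eq_zero, ← bracket, oscPart_cartanMinus P m h, bracket_smul_left] at h1
    exact (smul_eq_zero.1 h1).resolve_left (neg_ne_zero.2 hP.qdiff_ne_zero)
  · obtain ⟨k, rfl⟩ : ∃ k : ℕ, n = k := ⟨n.natAbs, by omega⟩
    have hk : 0 < k := by omega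
    have h0 : contraction (cartanPlus m) (translate u (screeningForm i j ε 0)) k = 0 := by
      rw [contraction_translate_right,
        contraction_eq_zero hk (contraction_cartanPlus_screening hP i m j ε hj hk), zero_mul]
    have h1 := oscPart_pos_commute hk h0
    rw [← sub_eq_zero, ← bracket, oscPart_cartanPlus P m h, bracket_smul_left] at h1
    exact (smul_eq_zero.1 h1).resolve_left hP.qdiff_ne_zero

omit hP in
lemma phatPart_bPlus (r s : ℕ) (α u : ℂ) (μ : Momentum P) :
    phatPart (bPlus P r s α u) μ.1 = P.logq * bMomentum P μ r s := by
  unfold bPlus bMomentum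
  split_ifs with h
  · rw [phatPart, Finset.sum_eq_single (.b ⟨(r, s), h⟩)]
    · rw [plusField, if_pos rfl]
    · intro x _ hx
      rw [plusField, if_neg hx, zero_mul]
    · simp
  · simp [phatPart]

omit hP in
lemma phatPart_aPlus (m : Node P) (α u : ℂ) (μ : Momentum P) :
    phatPart (aPlus P m α u) μ.1 = P.logq * μ.1 (.a m) := by
  unfold aPlus
  rw [phatPart, Finset.sum_eq_single (.a m)]
  · rw [plusField, if_pos rfl]
  · intro x _ hx
    rw [plusField, if_neg hx, zero_mul]
  · simp

/-- `phatPart` as a homomorphism. -/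
def phatHom (μ : Boson P → ℂ) : LinForm P →+ ℂ where
  toFun L := phatPart L μ
  map_zero' := by simp [phatPart]
  map_add' L M := by simp [phatPart, add_mul, Finset.sum_add_distrib]

omit hP in
lemma phatPart_cartanPlus (m : Node P) (μ : Momentum P) :
    phatPart (cartanPlus m) μ.1 = P.logq * weight P m μ := by
  have e L : phatPart L μ.1 = phatHom μ.1 L := rfl
  have h r s α u : phatHom μ.1 (bPlus P r s α u) = _ := phatPart_bPlus r s α u μ
  have h' m α u : phatHom μ.1 (aPlus P m α u) = _ := phatPart_aPlus m α u μ
  rw [e]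
  simp only [cartanPlus, weight, map_add, map_sub, map_sum, h, h', mul_add, mul_sub,
    Finset.mul_sum]

omit hP in
lemma diag_mul_apply (f : Momentum P → ℂ) (B : Kernel P) (b' b : Basis P) :
    (diag f).mul B b' b = f b'.1 * B b' b := by
  rw [Kernel.mul, finsum_eq_single _ b' fun c hc => by rw [diag, if_neg hc.symm, zero_mul], diag,
    if_pos rfl]

omit hP in
lemma mul_diag_apply (f : Momentum P → ℂ) (B : Kernel P) (b' b : Basis P) :
    B.mul (diag f) b' b = B b' b * f b.1 := by
  rw [Kernel.mul, finsum_eq_single _ b fun c hc => by rw [diag, if_neg hc, mul_zero], diag,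
    if_pos rfl]

omit hP in
lemma bracket_diag_vertex {f : Momentum P → ℂ} {L : LinForm P}
    (h : ∀ μ' μ : Momentum P, μ'.1 = μ.1 + momentumShift L → f μ' = f μ) :
    bracket (diag f) (vertex L) = 0 := by
  funext b' b
  rw [bracket, Pi.sub_apply, Pi.sub_apply, diag_mul_apply, mul_diag_apply]
  by_cases hb : b'.1.1 = b.1.1 + momentumShift L
  · rw [h _ _ hb, mul_comm, sub_self]
    rfl
  · rw [vertex_eq_zero hb, mul_zero, zero_mul, sub_self]
    rfl

/-- The p̂ part of `cartanPlus` is log q times the weight, so invariance of the weight under the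
shift is the vanishing of the zero mode contraction; log q is nonzero because |q| < 1. -/
lemma weight_screening_shift (m i : Node P) {j : ℕ} (hj : i + 1 ≤ j ∧ j ≤ P.N) (ε u : ℂ)
    {μ' μ : Momentum P} (h : μ'.1 = μ.1 + momentumShift (screeningForm i j ε u)) :
    weight P m μ' = weight P m μ := by
  have h1 := phatPart_cartanPlus m μ'
  have h2 := zeroContraction_cartanPlus_screening hP i m j ε hj
  rw [isField_screeningForm i j ε u, momentumShift_translate] at h
  rw [h, show phatPart (cartanPlus m) (μ.1 + momentumShift (screeningForm i j ε 0))
    = phatPart (cartanPlus m) μ.1 + zeroContraction (cartanPlus m) (screeningForm i j ε 0) by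
      rw [zeroContraction_apply]; simp [phatPart, mul_add, Finset.sum_add_distrib], h2, add_zero,
    phatPart_cartanPlus] at h1
  exact (mul_left_cancel₀ hP.logq_ne_zero h1).symm

theorem bracket_diag_weight_screening (m i : Node P) (f : ℂ → ℂ) (u : ℂ) :
    bracket (diag fun μ => f (weight P m μ)) (screening P i u) = 0 :=
  bracket_screening_eq_zero hP (isFinitary_diag _) i u fun _ ε hj =>
    bracket_diag_vertex fun _ _ h => by rw [weight_screening_shift hP m i hj ε u h]

end CartanCommutes

/-! ### Commutators of the modes of E^{±,m} with the full screening current. -/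

section CurrentCommutes

section Interchange

variable {A : Type*} [AddCommGroup A] (g : ℂ → ℂ → A)

lemma alternate_alternate : (alternate fun ε => alternate fun ε' => g ε ε')
    = alternate fun ε' => alternate fun ε => g ε ε' := by
  simp only [alternate]
  abel

lemma alternate_alternateBelow (j m : ℕ) :
    (alternate fun ε' => alternateBelow j m fun ε => g ε ε')
      = alternateBelow j m fun ε => alternate fun ε' => g ε ε' := by
  simp only [alternate, alternateBelow]
  split_ifs <;> abel

lemma alternate_alternateAbove (j m : ℕ) :
    (alternate fun ε' => alternateAbove j m fun ε => g ε ε')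
      = alternateAbove j m fun ε => alternate fun ε' => g ε ε' := by
  simp only [alternate, alternateAbove]
  split_ifs <;> abel

end Interchange

variable {P : Params} (hP : IsContracting P) (m i : Node P) (n : ℤ) (u : ℂ)
include hP

lemma isFinitary_mode_Eplus : IsFinitary (mode P (Eplus P m) n) := by
  rw [mode_Eplus hP]
  exact (IsFinitary.sum _ fun j _ => .alternate fun ε =>
    isFinitary_selection (isIntegral_raisingForm ..) n).smul _

theorem bracket_Eplus_screening : bracket (mode P (Eplus P m) n) (screening P i u) = 0 := by
  have hf j ε : IsFinitary (selection (raisingForm m j ε 0) n) :=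
    isFinitary_selection (isIntegral_raisingForm ..) n
  rw [mode_Eplus hP, bracket_smul_left, bracket_sum_left _ fun j _ => .alternate (hf j)]
  simp only [bracket_screening hP (IsFinitary.alternate (hf _)), Finset.sum_neg_distrib,
    bracket_alternate_left (hf _), ← Finset.smul_sum]
  have := sum_pairBracket_raising hP i m n u
  simp only [pairBracket, alternate_alternate fun ε ε' =>
    bracket (selection (raisingForm m _ ε 0) n) (vertex (screeningForm i _ ε' u))] at this
  rw [this, neg_zero, smul_zero, smul_zero]

omit hP in
lemma isFinitary_alternateBelow {f : ℂ → Kernel P} (hf : ∀ ε, IsFinitary (f ε)) (j k : ℕ) :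
    IsFinitary (alternateBelow j k f) := by
  refine IsFinitary.sub ?_ (hf _)
  split_ifs
  exacts [hf _, .zero]

omit hP in
lemma isFinitary_alternateAbove {f : ℂ → Kernel P} (hf : ∀ ε, IsFinitary (f ε)) (j k : ℕ) :
    IsFinitary (alternateAbove j k f) := by
  refine IsFinitary.sub (hf _) ?_
  split_ifs
  exacts [hf _, .zero]

omit hP in
lemma bracket_alternateBelow {f : ℂ → Kernel P} (hf : ∀ ε, IsFinitary (f ε)) (j k : ℕ)
    (B : Kernel P) :
    bracket (alternateBelow j k f) B = alternateBelow j k fun ε => bracket (f ε) B := by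
  unfold alternateBelow
  split_ifs
  · exact bracket_sub_left (hf _) (hf _) _
  · rw [zero_sub, zero_sub, bracket_neg_left]

omit hP in
lemma bracket_alternateAbove {f : ℂ → Kernel P} (hf : ∀ ε, IsFinitary (f ε)) (j k : ℕ)
    (B : Kernel P) :
    bracket (alternateAbove j k f) B = alternateAbove j k fun ε => bracket (f ε) B := by
  unfold alternateAbove
  split_ifs
  · exact bracket_sub_left (hf _) (hf _) _
  · rw [sub_zero, sub_zero]

/-- The two unpaired terms of E^{-,m} are absorbed into the sums over j ≤ m and j > m as incomplete
alternating pairs at j = m and j = m + 1. -/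
lemma mode_Eminus_eq : mode P (Eminus P m) n = (1 / P.qdiff) •
    (∑ j ∈ Finset.Icc 1 m.1,
        alternateBelow j m (fun ε => selection (loweringForm m j ε 0) n)
      + ∑ j ∈ Finset.Icc (m.1 + 1) P.N,
        alternateAbove (m + 1) j fun ε => selection (loweringForm' m j ε 0) n) := by
  have hm := Finset.mem_Ico.1 m.2
  have e1 : ∑ j ∈ Finset.Icc 1 m.1,
      alternateBelow j m (fun ε => selection (loweringForm m j ε 0) n)
      = ∑ j ∈ Finset.Ico 1 m.1, alternate (fun ε => selection (loweringForm m j ε 0) n)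
        - selection (loweringForm m m (-1) 0) n := by
    rw [show Finset.Icc 1 m.1 = Finset.Ico 1 (m.1 + 1) from by ext; simp,
      Finset.sum_Ico_succ_top hm.1, sub_eq_add_neg]
    refine congrArg₂ (· + ·) (Finset.sum_congr rfl fun j hj => ?_) ?_
    · rw [alternateBelow, if_pos (Finset.mem_Ico.1 hj).2, alternate]
    · rw [alternateBelow, if_neg (lt_irrefl _), zero_sub]
  have e2 : ∑ j ∈ Finset.Icc (m.1 + 1) P.N,
      alternateAbove (m + 1) j (fun ε => selection (loweringForm' m j ε 0) n)
      = selection (loweringForm' m (m + 1) 1 0) n + ∑ j ∈ Finset.Icc (m.1 + 2) P.N,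
        alternate (fun ε => selection (loweringForm' m j ε 0) n) := by
    rw [sum_Icc_succ_left (by omega)]
    refine congrArg₂ (· + ·) ?_ (Finset.sum_congr rfl fun j hj => ?_)
    · rw [alternateAbove, if_neg (lt_irrefl _), sub_zero]
    · have := Finset.mem_Icc.1 hj
      rw [alternateAbove, if_pos (by omega), alternate]
  rw [mode_Eminus hP, e1, e2, Finset.sum_neg_distrib, neg_div, neg_smul, ← smul_neg]
  congr 1
  abel

lemma isFinitary_mode_Eminus : IsFinitary (mode P (Eminus P m) n) := by
  rw [mode_Eminus_eq hP]
  exact ((IsFinitary.sum _ fun j _ => isFinitary_alternateBelow (fun ε =>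
    isFinitary_selection (isIntegral_loweringForm ..) n) ..).add
    (IsFinitary.sum _ fun j _ => isFinitary_alternateAbove (fun ε =>
      isFinitary_selection (isIntegral_loweringForm' ..) n) ..)).smul _

lemma bracket_Eminus_screening_eq : bracket (mode P (Eminus P m) n) (screening P i u)
    = (-prefactor P u / P.qdiff) •
      (∑ j ∈ Finset.Icc 1 m.1, ∑ j' ∈ Finset.Icc (i.1 + 1) P.N, lowerBracket i m n u j j'
      + ∑ j ∈ Finset.Icc (m.1 + 1) P.N, ∑ j' ∈ Finset.Icc (i.1 + 1) P.N,
        upperBracket i m n u j j') := by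
  have hf j ε : IsFinitary (selection (loweringForm m j ε 0) n) :=
    isFinitary_selection (isIntegral_loweringForm ..) n
  have hf' j ε : IsFinitary (selection (loweringForm' m j ε 0) n) :=
    isFinitary_selection (isIntegral_loweringForm' ..) n
  have h1 j := isFinitary_alternateBelow (hf j) j m
  have h2 j := isFinitary_alternateAbove (hf' j) (m + 1) j
  rw [mode_Eminus_eq hP, bracket_smul_left,
    bracket_add_left (.sum _ fun j _ => h1 j) (.sum _ fun j _ => h2 j),
    bracket_sum_left _ fun j _ => h1 j, bracket_sum_left _ fun j _ => h2 j]
  simp only [bracket_screening hP (h1 _), bracket_screening hP (h2 _), Finset.sum_neg_distrib,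
    bracket_alternateBelow (hf _), bracket_alternateAbove (hf' _), ← Finset.smul_sum,
    alternate_alternateBelow, alternate_alternateAbove, lowerBracket, upperBracket]
  rw [← smul_add, ← neg_add, smul_neg, smul_neg, smul_smul, ← neg_smul]
  congr 1
  ring

theorem bracket_Eminus_screening_of_ne (h : m.1 ≠ i) :
    bracket (mode P (Eminus P m) n) (screening P i u) = 0 := by
  rw [bracket_Eminus_screening_eq hP, sum_lowerBracket hP i m n u h, sum_upperBracket hP i m n u h,
    add_zero, smul_zero]

/-- The total difference arising in the commutator of `E^{-,i}_n` with the screening current. -/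
def boundary (i : Node P) (n : ℤ) (u : ℂ) : Kernel P :=
  Complex.exp (n * (u - P.kg * P.logq)) • vertex (boundaryForm i u)

/-- The uncancelled residue from j ≤ i lives at z ↦ q^(k+g) z and the one from j > i at z ↦
q^(-(k+g)) z. Relative to the factor (q^(-(k+g)) z)^n in `boundary` these are its values at pz and
at z, with opposite signs. -/
theorem bracket_Eminus_screening_self :
    bracket (mode P (Eminus P i) n) (screening P i u)
      = (1 / (P.qdiff * Complex.exp u)) • (boundary i n (u + P.logp) - boundary i n u) := by
  rw [bracket_Eminus_screening_eq hP, sum_lowerBracket_self hP, sum_upperBracket_self hP,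
    boundary, boundary, prefactor,
    show u + P.logp - P.kg * P.logq = u + P.kg * P.logq by rw [Params.logp]; ring,
    show u + -P.kg * P.logq = u - P.kg * P.logq by ring, neg_smul, ← sub_eq_add_neg, ← smul_smul,
    ← smul_smul, ← smul_sub, smul_smul]
  congr 1
  have := hP.qdiff_ne_zero
  field_simp

end CurrentCommutes

open Filter Topology

/-! ### Two-sided telescoping series -/

/-- In a two-sided limit the ends move independently. Freezing one end bounds the sequence at the
other. -/
lemma eventually_norm_le_of_tendsto_sub {f : ℤ → ℂ} {L : ℂ}
    (h : Tendsto (fun p : ℤ × ℤ => f (p.2 + 1) - f p.1) (atBot ×ˢ atTop) (𝓝 L)) :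
    ∃ C : ℝ, (∀ᶠ m in atTop, ‖f m‖ ≤ C) ∧ ∀ᶠ m in atBot, ‖f m‖ ≤ C := by
  obtain ⟨pa, ha, pb, hb, hab⟩ := eventually_prod_iff.1 (h.eventually (Metric.ball_mem_nhds L one_pos))
  obtain ⟨a, haa⟩ := ha.exists
  obtain ⟨b, hbb⟩ := hb.exists
  have key : ∀ x y, pa x → pb y → ‖f (y + 1) - f x‖ ≤ 1 + ‖L‖ := fun x y hx hy => by
    have h1 : ‖f (y + 1) - f x - L‖ < 1 := mem_ball_iff_norm.1 (hab hx hy)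
    have h2 := norm_add_le (f (y + 1) - f x - L) L
    rw [sub_add_cancel] at h2
    linarith
  refine ⟨1 + ‖L‖ + ‖f a‖ + ‖f (b + 1)‖, ?_, ?_⟩
  · have h1 : ∀ᶠ m in atTop, pb (m - 1) := (tendsto_atTop_add_const_right _ (-1) tendsto_id).eventually hb
    filter_upwards [h1] with m hm
    have h2 := key a (m - 1) haa hm
    have h3 := norm_add_le (f (m - 1 + 1) - f a) (f a)
    rw [sub_add_cancel, sub_add_cancel] at h3
    rw [sub_add_cancel] at h2
    linarith [norm_nonneg (f (b + 1))]
  · filter_upwards [ha] with m hm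
    have h2 := key m b hm hbb
    have h3 := norm_sub_le (f (b + 1)) (f (b + 1) - f m)
    rw [sub_sub_cancel] at h3
    linarith [norm_nonneg (f a)]

/-- If the series of differences of `x ^ n W` converges for all `n`, where `x` tends to `0` and `∞` at
the two ends, then its sum is zero. -/
lemma tendsto_telescope_zero {x W : ℤ → ℂ} (hx : ∀ m, x m ≠ 0) (hx0 : Tendsto x atTop (𝓝 0))
    (hx1 : Tendsto (fun m => (x m)⁻¹) atBot (𝓝 0))
    (h : ∀ n : ℤ, ∃ L, Tendsto (fun p : ℤ × ℤ =>
      x (p.2 + 1) ^ n * W (p.2 + 1) - x p.1 ^ n * W p.1) (atBot ×ˢ atTop) (𝓝 L)) (n : ℤ) :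
    Tendsto (fun p : ℤ × ℤ => x (p.2 + 1) ^ n * W (p.2 + 1) - x p.1 ^ n * W p.1)
      (atBot ×ˢ atTop) (𝓝 0) := by
  have hb (n : ℤ) := let ⟨_, hL⟩ := h n
    eventually_norm_le_of_tendsto_sub (f := fun m => x m ^ n * W m) hL
  have h1 : Tendsto (fun m => x m ^ n * W m) atTop (𝓝 0) := by
    -- At the end where x tends to 0, boundedness for the exponent n - 1 leaves one spare factor x.
    obtain ⟨C, hC, -⟩ := hb (n - 1)
    have := hx0.zero_mul_isBoundedUnder_le ⟨C, eventually_map.2 hC⟩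
    refine this.congr fun m => ?_
    rw [← mul_assoc, ← zpow_one_add₀ (hx m)]
    ring_nf
  have h2 : Tendsto (fun m => x m ^ n * W m) atBot (𝓝 0) := by
    -- At the other end x⁻¹ tends to 0, so boundedness for the exponent n + 1 is used.
    obtain ⟨C, -, hC⟩ := hb (n + 1)
    have := hx1.zero_mul_isBoundedUnder_le ⟨C, eventually_map.2 hC⟩
    refine this.congr fun m => ?_
    rw [zpow_add_one₀ (hx m)]
    field_simp [hx m]
  have h3 := ((h1.comp (tendsto_atTop_add_const_right _ 1 tendsto_id)).comp
    (tendsto_snd (f := (atBot : Filter ℤ)) (g := (atTop : Filter ℤ)))).sub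
    (h2.comp (tendsto_fst (f := (atBot : Filter ℤ)) (g := (atTop : Filter ℤ))))
  rw [sub_zero] at h3
  exact h3

lemma tendsto_exp_add_int_mul {w : ℂ} (hw : w.re < 0) (c : ℂ) :
    Tendsto (fun m : ℤ => Complex.exp (c + m * w)) atTop (𝓝 0) ∧
      Tendsto (fun m : ℤ => (Complex.exp (c + m * w))⁻¹) atBot (𝓝 0) := by
  have hre (m : ℤ) : (c + m * w).re = c.re + m * w.re := by simp
  constructor
  · rw [tendsto_zero_iff_norm_tendsto_zero]
    simp only [Complex.norm_exp, hre]
    exact Real.tendsto_exp_atBot.comp (tendsto_atBot_add_const_left _ _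
      ((tendsto_intCast_atTop_atTop (R := ℝ)).atTop_mul_const_of_neg hw))
  · rw [tendsto_zero_iff_norm_tendsto_zero]
    simp only [← Complex.exp_neg, Complex.norm_exp, Complex.neg_re, hre]
    exact Real.tendsto_exp_atBot.comp (tendsto_neg_atTop_atBot.comp
      (tendsto_atTop_add_const_left _ _
        ((tendsto_intCast_atBot_iff (R := ℝ) |>.2 tendsto_id).atBot_mul_const_of_neg hw)))

lemma sum_Icc_int_sub (f : ℤ → ℂ) {a b : ℤ} (h : a ≤ b + 1) :
    ∑ m ∈ Finset.Icc a b, (f (m + 1) - f m) = f (b + 1) - f a := by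
  obtain ⟨k, rfl⟩ : ∃ k : ℕ, b = a + k - 1 := ⟨(b + 1 - a).toNat, by omega⟩
  induction k with
  | zero => simp
  | succ k ih =>
    rw [show Finset.Icc a (a + (k + 1 : ℕ) - 1) = insert (a + k) (Finset.Icc a (a + k - 1)) from by
        ext; simp; omega, Finset.sum_insert (by simp), ih (by omega)]
    push_cast
    ring_nf

/-! ### The algebra of the Drinfeld generators -/

section Algebra

variable {P : Params} (hP : IsContracting P)
include hP

lemma IsUq.isFinitary {X : Kernel P} (hX : IsUq P X) : IsFinitary X := by
  induction hX with
  | gen X hX =>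
    cases hX with
    | H i n hn => exact isFinitary_H hP i hn
    | K i => exact isFinitary_diag _
    | Kinv i => exact isFinitary_diag _
    | Eplus i n => exact isFinitary_mode_Eplus hP i n
    | Eminus i n => exact isFinitary_mode_Eminus hP i n
  | one => exact isFinitary_one
  | smul t X _ h => exact h.smul t
  | add X Y _ _ h h' => exact h.add h'
  | mul X Y _ _ h h' => exact h.mul h'

end Algebra

open Filter Topology

/-! ### Linearity of matrix elements and Jackson integrals. -/

section MatrixElements

variable {P : Params} {φ v : State P} {T T' : Kernel P}

lemma MatrixElementConverges.add (h : MatrixElementConverges φ T v)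
    (h' : MatrixElementConverges φ T' v) : MatrixElementConverges φ (T + T') v :=
  (Summable.add h h').congr fun b => by simp only [Pi.add_apply]; ring

lemma MatrixElementConverges.smul (t : ℂ) (h : MatrixElementConverges φ T v) :
    MatrixElementConverges φ (t • T) v :=
  (Summable.mul_left t h).congr fun b => by simp only [Pi.smul_apply, smul_eq_mul]; ring

lemma matrixElement_add (h : MatrixElementConverges φ T v) (h' : MatrixElementConverges φ T' v) :
    matrixElement φ (T + T') v = matrixElement φ T v + matrixElement φ T' v := by
  rw [matrixElement, matrixElement, matrixElement, ← Summable.tsum_add h h']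
  exact tsum_congr fun b => by simp only [Pi.add_apply]; ring

lemma matrixElement_smul (t : ℂ) : matrixElement φ (t • T) v = t * matrixElement φ T v := by
  rw [matrixElement, matrixElement, ← tsum_mul_left]
  exact tsum_congr fun b => by simp only [Pi.smul_apply, smul_eq_mul]; ring

lemma HasJacksonIntegral.congr {s p l : ℂ} {f g : ℂ → ℂ} (hf : HasJacksonIntegral s p f l)
    (h : ∀ m : ℤ, g (s + m * p) = f (s + m * p)) : HasJacksonIntegral s p g l :=
  HasSum.congr_fun hf fun m => by rw [h]

lemma HasJacksonIntegral.add {s p l l' : ℂ} {f g : ℂ → ℂ} (hf : HasJacksonIntegral s p f l)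
    (hg : HasJacksonIntegral s p g l') :
    HasJacksonIntegral s p (fun u => f u + g u) (l + l') :=
  HasSum.congr_fun (HasSum.add hf hg) fun m => by ring

lemma HasJacksonIntegral.const_mul {s p l : ℂ} {f : ℂ → ℂ} (t : ℂ)
    (hf : HasJacksonIntegral s p f l) : HasJacksonIntegral s p (fun u => t * f u) (t * l) :=
  HasSum.congr_fun (HasSum.mul_left t hf) fun m => by ring

lemma HasJacksonIntegral.unique {s p l l' : ℂ} {f : ℂ → ℂ} (hf : HasJacksonIntegral s p f l)
    (hg : HasJacksonIntegral s p f l') : l = l' := HasSum.unique hf hg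

/-- `Y S Z`. -/
def sandwich (Y Z S : Kernel P) : Kernel P := (Y.mul S).mul Z

lemma sandwich_smul (Y Z : Kernel P) (t : ℂ) (S : Kernel P) :
    sandwich Y Z (t • S) = t • sandwich Y Z S := by
  rw [sandwich, mul_smul, smul_mul, sandwich]

lemma sandwich_add {Y Z : Kernel P} (hY : IsFinitary Y) (hZ : IsFinitary Z) (S S' : Kernel P) :
    sandwich Y Z (S + S') = sandwich Y Z S + sandwich Y Z S' := by
  rw [sandwich, hY.mul_add, hZ.add_mul', sandwich, sandwich]

lemma sandwich_mul_left {Y X : Kernel P} (hY : IsFinitary Y) (hX : IsFinitary X)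
    (Z S : Kernel P) : sandwich (Y.mul X) Z S = sandwich Y Z (X.mul S) := by
  rw [sandwich, mul_assoc_left hY hX, sandwich]

lemma sandwich_mul_right {Y X Z : Kernel P} (hY : IsFinitary Y) (hX : IsFinitary X)
    (hZ : IsFinitary Z) (S : Kernel P) : sandwich Y (X.mul Z) S = sandwich Y Z (S.mul X) := by
  rw [sandwich, ← mul_assoc_right hX hZ, mul_assoc_outer hY hX, sandwich]

/-- All rebracketing is legitimate because only the middle factor `S` may fail to be finitary. -/
lemma sandwich_bracket {Y X Z : Kernel P} (hY : IsFinitary Y) (hX : IsFinitary X)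
    (hZ : IsFinitary Z) (S : Kernel P) :
    sandwich (Y.mul X) Z S = sandwich Y (X.mul Z) S + sandwich Y Z (bracket X S) := by
  rw [sandwich_mul_left hY hX, sandwich_mul_right hY hX hZ, ← sandwich_add hY hZ, bracket,
    add_sub_cancel]

end MatrixElements

/-! ### The screening charge commutes with the algebra. -/

section ScreeningCharge

variable {P : Params} (hP : IsContracting P) {i : Node P} {logs : ℂ} {φ v : State P}
  (hconv : ScreeningChargeConverges P i logs φ v)

/-- The Jackson integrals of `⟨φ|Y X S(z) Z|v⟩` and `⟨φ|Y S(z) X Z|v⟩` agree. -/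
def ChargeCommutes (i : Node P) (logs : ℂ) (φ v : State P) (X : Kernel P) : Prop :=
  ∀ Y Z : Kernel P, IsUq P Y → IsUq P Z → ∀ l l' : ℂ,
    HasJacksonIntegral logs P.logp
      (fun u => matrixElement φ (sandwich (Y.mul X) Z (screening P i u)) v) l →
    HasJacksonIntegral logs P.logp
      (fun u => matrixElement φ (sandwich Y (X.mul Z) (screening P i u)) v) l' → l = l'

include hP

lemma chargeCommutes_of_bracket_eq_zero {X : Kernel P} (hX : IsUq P X)
    (h : ∀ u, bracket X (screening P i u) = 0) : ChargeCommutes i logs φ v X := by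
  intro Y Z hY hZ l l' hl hl'
  refine hl.unique (hl'.congr fun m => ?_)
  rw [sandwich_bracket (hY.isFinitary hP) (hX.isFinitary hP) (hZ.isFinitary hP), h,
    ← zero_smul ℂ (0 : Kernel P), sandwich_smul, zero_smul, add_zero]

include hconv

lemma chargeCommutes_add {X X' : Kernel P} (hX : IsUq P X) (hX' : IsUq P X')
    (h : ChargeCommutes i logs φ v X) (h' : ChargeCommutes i logs φ v X') :
    ChargeCommutes i logs φ v (X + X') := by
  intro Y Z hY hZ l l' hl hl'
  -- The integrals of the summands converge separately by hypothesis, so the integral of the sum may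
  -- be split.
  obtain ⟨c1, l1, h1⟩ := hconv Z (Y.mul X) hZ (.mul _ _ hY hX)
  obtain ⟨c2, l2, h2⟩ := hconv Z (Y.mul X') hZ (.mul _ _ hY hX')
  obtain ⟨c3, l3, h3⟩ := hconv (X.mul Z) Y (.mul _ _ hX hZ) hY
  obtain ⟨c4, l4, h4⟩ := hconv (X'.mul Z) Y (.mul _ _ hX' hZ) hY
  have fY := hY.isFinitary hP
  have fZ := hZ.isFinitary hP
  have fX := hX.isFinitary hP
  have fX' := hX'.isFinitary hP
  have e1 : l = l1 + l2 := hl.unique <| (h1.add h2).congr fun m => by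
    rw [sandwich, fY.mul_add, (fY.mul fX).add_mul (fY.mul fX'), fZ.add_mul',
      matrixElement_add (c1 m) (c2 m)]
  have e2 : l' = l3 + l4 := hl'.unique <| (h3.add h4).congr fun m => by
    rw [sandwich, fX.add_mul fX', IsFinitary.mul_add' (fX.mul fZ) (fX'.mul fZ),
      matrixElement_add (c3 m) (c4 m)]
  rw [e1, e2, h Y Z hY hZ l1 l3 h1 h3, h' Y Z hY hZ l2 l4 h2 h4]

omit hP in
lemma chargeCommutes_smul {X : Kernel P} (hX : IsUq P X) (h : ChargeCommutes i logs φ v X)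
    (t : ℂ) : ChargeCommutes i logs φ v (t • X) := by
  intro Y Z hY hZ l l' hl hl'
  obtain ⟨c1, l1, h1⟩ := hconv Z (Y.mul X) hZ (.mul _ _ hY hX)
  obtain ⟨c3, l3, h3⟩ := hconv (X.mul Z) Y (.mul _ _ hX hZ) hY
  have e1 : l = t * l1 := hl.unique <| (h1.const_mul t).congr fun m => by
    rw [sandwich, mul_smul, smul_mul, smul_mul, matrixElement_smul]
  have e2 : l' = t * l3 := hl'.unique <| (h3.const_mul t).congr fun m => by
    rw [sandwich, smul_mul, mul_smul, matrixElement_smul]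
  rw [e1, e2, h Y Z hY hZ l1 l3 h1 h3]

/-- The factors are moved across one at a time. The intermediate integral, with `X` on the left and
`X'` on the right of the screening current, exists because the hypothesis covers all states
generated by the algebra on both sides. -/
lemma chargeCommutes_mul {X X' : Kernel P} (hX : IsUq P X) (hX' : IsUq P X')
    (h : ChargeCommutes i logs φ v X) (h' : ChargeCommutes i logs φ v X') :
    ChargeCommutes i logs φ v (X.mul X') := by
  intro Y Z hY hZ l l' hl hl'
  have fY := hY.isFinitary hP
  have fX := hX.isFinitary hP
  have fX' := hX'.isFinitary hP
  obtain ⟨-, k, hk⟩ := hconv (X'.mul Z) (Y.mul X) (.mul _ _ hX' hZ) (.mul _ _ hY hX)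
  rw [← mul_assoc_left fY fX] at hl
  rw [mul_assoc_left fX fX'] at hl'
  exact (h' _ Z (.mul _ _ hY hX) hZ l k hl hk).trans
    (h Y _ hY (.mul _ _ hX' hZ) k l' hk hl')

/-- The only case in which the integrands differ. Their difference is a total p-difference, and the
convergence for all modes of E^{-,i}, not just the given one, forces its boundary terms to vanish.
-/
lemma chargeCommutes_Eminus_self (n : ℤ) :
    ChargeCommutes i logs φ v (mode P (Eminus P i) n) := by
  intro Y Z hY hZ l l' hl hl'
  have fY := hY.isFinitary hP
  have fZ := hZ.isFinitary hP
  have hX (n : ℤ) : IsUq P (mode P (Eminus P i) n) := .gen _ (.Eminus i n)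
  set u : ℤ → ℂ := fun m => logs + m * P.logp with hu
  set x : ℤ → ℂ := fun m => Complex.exp (u m - P.kg * P.logq) with hxdef
  set V : ℤ → Kernel P := fun m => sandwich Y Z (vertex (boundaryForm i (u m))) with hV
  have hx (m : ℤ) : x m ≠ 0 := Complex.exp_ne_zero _
  have hp : Complex.exp P.logp ≠ 1 := by
    intro h
    have := hP.p
    rw [Params.qpow, ← Params.logp, h, norm_one] at this
    exact lt_irrefl _ this
  have hre : P.logp.re < 0 := by
    have := hP.p
    rwa [Params.qpow, ← Params.logp, Complex.norm_exp, Real.exp_lt_one_iff] at this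
  have hu1 (m : ℤ) : u m + P.logp = u (m + 1) := by
    simp only [hu]; push_cast; ring
  have hu2 (m : ℤ) : Complex.exp (u m) = Complex.exp logs * Complex.exp (m * P.logp) :=
    Complex.exp_add _ _
  have hx1 (m : ℤ) : x (m + 1) = x m * Complex.exp P.logp := by
    simp only [hxdef, ← hu1, ← Complex.exp_add]
    congr 1
    ring
  -- The dependence on n is only through the scalar x^n; the operator `V m` is common to all modes.
  have hB (n m : ℤ) : sandwich Y Z (boundary i n (u m)) = x m ^ n • V m := by
    rw [boundary, sandwich_smul, Complex.exp_int_mul]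
  have hkey (n m : ℤ) : sandwich (Y.mul (mode P (Eminus P i) n)) Z (screening P i (u m))
      = sandwich Y ((mode P (Eminus P i) n).mul Z) (screening P i (u m))
        + (1 / (P.qdiff * Complex.exp (u m))) • 
          (x (m + 1) ^ n • V (m + 1) + (-1 : ℂ) • x m ^ n • V m) := by
    rw [sandwich_bracket fY ((hX n).isFinitary hP) fZ, bracket_Eminus_screening_self hP,
      sandwich_smul, hu1, sub_eq_add_neg, ← neg_one_smul ℂ (boundary i n (u m)),
      sandwich_add fY fZ, sandwich_smul, hB, hB]
  have hc (m : ℤ) : 1 / (P.qdiff * Complex.exp (u m)) ≠ 0 :=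
    one_div_ne_zero (mul_ne_zero hP.qdiff_ne_zero (Complex.exp_ne_zero _))
  have hD (n m : ℤ) :
      MatrixElementConverges φ (x (m + 1) ^ n • V (m + 1) + (-1 : ℂ) • x m ^ n • V m) v := by
    have c1 : MatrixElementConverges φ
        (sandwich (Y.mul (mode P (Eminus P i) n)) Z (screening P i (u m))) v :=
      (hconv Z (Y.mul (mode P (Eminus P i) n)) hZ (.mul _ _ hY (hX n))).1 m
    have c2 : MatrixElementConverges φ
        (sandwich Y ((mode P (Eminus P i) n).mul Z) (screening P i (u m))) v :=
      (hconv ((mode P (Eminus P i) n).mul Z) Y (.mul _ _ (hX n) hZ) hY).1 m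
    have c3 := (c1.add (c2.smul (-1))).smul (1 / (P.qdiff * Complex.exp (u m)))⁻¹
    rw [hkey, neg_one_smul ℂ (sandwich _ _ _), ← sub_eq_add_neg, add_sub_cancel_left, smul_smul,
      inv_mul_cancel₀ (hc m),
      one_smul] at c3
    exact c3
  -- A priori only differences of neighbouring boundary operators have convergent matrix elements.
  -- The differences for n = 1 and n = 0 are two independent combinations of `V m` and `V (m + 1)`,
  -- since p ≠ 1, so `V m` alone converges and the difference may be split.
  have hVc (m : ℤ) : MatrixElementConverges φ (V m) v := by
    have c := ((hD 1 m).add ((hD 0 m).smul (-x (m + 1)))).smul (x (m + 1) - x m)⁻¹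
    have hne : x (m + 1) - x m ≠ 0 := by
      rw [hx1, sub_ne_zero]
      intro h
      exact hp (mul_left_cancel₀ (hx m) (h.trans (mul_one _).symm))
    have e : V m = (x (m + 1) - x m)⁻¹ • ((x (m + 1) ^ (1 : ℤ) • V (m + 1)
        + (-1 : ℂ) • x m ^ (1 : ℤ) • V m)
        + -x (m + 1) • (x (m + 1) ^ (0 : ℤ) • V (m + 1) + (-1 : ℂ) • x m ^ (0 : ℤ) • V m)) := by
      rw [eq_inv_smul_iff₀ hne]
      simp only [zpow_one, zpow_zero, one_smul]
      module
    rw [e]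
    exact c
  set W : ℤ → ℂ := fun m => matrixElement φ (V m) v with hW
  have hterm (n m : ℤ) :
      matrixElement φ (sandwich (Y.mul (mode P (Eminus P i) n)) Z (screening P i (u m))) v
      = matrixElement φ (sandwich Y ((mode P (Eminus P i) n).mul Z) (screening P i (u m))) v
        + 1 / (P.qdiff * Complex.exp (u m)) * (x (m + 1) ^ n * W (m + 1) - x m ^ n * W m) := by
    have c2 : MatrixElementConverges φ
        (sandwich Y ((mode P (Eminus P i) n).mul Z) (screening P i (u m))) v :=
      (hconv ((mode P (Eminus P i) n).mul Z) Y (.mul _ _ (hX n) hZ) hY).1 m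
    have hs (m' : ℤ) := (hVc m').smul (x m' ^ n)
    rw [hkey, matrixElement_add c2 ((hD n m).smul _), matrixElement_smul,
      matrixElement_add (hs _) ((hs _).smul _), matrixElement_smul, matrixElement_smul,
      matrixElement_smul]
    ring
  have hC : (1 - Complex.exp P.logp) / P.qdiff ≠ 0 :=
    div_ne_zero (sub_ne_zero.2 hp.symm) hP.qdiff_ne_zero
  have hlim (n : ℤ) (l l' : ℂ)
      (hl : HasJacksonIntegral logs P.logp (fun u => matrixElement φ
        (sandwich (Y.mul (mode P (Eminus P i) n)) Z (screening P i u)) v) l)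
      (hl' : HasJacksonIntegral logs P.logp (fun u => matrixElement φ
        (sandwich Y ((mode P (Eminus P i) n).mul Z) (screening P i u)) v) l') :
      Tendsto (fun p : ℤ × ℤ => x (p.2 + 1) ^ n * W (p.2 + 1) - x p.1 ^ n * W p.1)
        (atBot ×ˢ atTop) (𝓝 (((1 - Complex.exp P.logp) / P.qdiff)⁻¹ * (l - l'))) := by
    have h := (HasSum.sub hl hl').mul_left ((1 - Complex.exp P.logp) / P.qdiff)⁻¹
    have h2 : HasSum (fun m : ℤ => x (m + 1) ^ n * W (m + 1) - x m ^ n * W m) _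
        (SummationFilter.conditional ℤ) := h.congr_fun fun m => by
      have e := hterm n m
      rw [eq_inv_mul_iff_mul_eq₀ hC, ← mul_sub, ← sub_mul]
      change _ = _ * ((matrixElement φ (sandwich _ _ (screening P i (u m))) v
        - matrixElement φ (sandwich _ _ (screening P i (u m))) v) * _)
      -- The weight s p^m of the Jackson integral cancels the factor 1/z at z = s p^m, which leaves
      -- (1 - p)/(q - q⁻¹) times a pure difference.
      rw [e, add_sub_cancel_left, hu2]
      have := hP.qdiff_ne_zero
      have h1 := Complex.exp_ne_zero logs
      have h2 := Complex.exp_ne_zero (m * P.logp)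
      field_simp
    have h3 : Tendsto (fun p : ℤ × ℤ => ∑ m ∈ Finset.Icc p.1 p.2,
        (x (m + 1) ^ n * W (m + 1) - x m ^ n * W m)) (atBot ×ˢ atTop) _ := tendsto_map'_iff.1 h2
    refine h3.congr' ?_
    filter_upwards [prod_mem_prod (eventually_le_atBot (0 : ℤ)) (eventually_ge_atTop (0 : ℤ))]
      with p hp
    exact sum_Icc_int_sub (fun m => x m ^ n * W m)
      ((show p.1 ≤ 0 from hp.1).trans ((show 0 ≤ p.2 from hp.2).trans (by omega)))
  have hxl := tendsto_exp_add_int_mul hre (logs - P.kg * P.logq)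
  have hxe (m : ℤ) : Complex.exp (logs - P.kg * P.logq + m * P.logp) = x m := by
    simp only [hxdef, hu]
    congr 1
    ring
  simp only [hxe] at hxl
  -- For every integer n both integrals converge by hypothesis, so each of the telescoping series
  -- converges to some limit; this is the input that makes the limit zero.
  have h0 := tendsto_telescope_zero hx hxl.1 hxl.2 (W := W) (fun n => by
    obtain ⟨-, l1, h1⟩ := hconv Z (Y.mul (mode P (Eminus P i) n)) hZ (.mul _ _ hY (hX n))
    obtain ⟨-, l2, h2⟩ := hconv ((mode P (Eminus P i) n).mul Z) Y (.mul _ _ (hX n) hZ) hY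
    exact ⟨_, hlim n l1 l2 h1 h2⟩) n
  have := tendsto_nhds_unique (hlim n l l' hl hl') h0
  exact sub_eq_zero.1 ((mul_eq_zero.1 this).resolve_left (inv_ne_zero hC))

theorem chargeCommutes {X : Kernel P} (hX : IsUq P X) : ChargeCommutes i logs φ v X := by
  induction hX with
  | gen X hX =>
    have hU := IsUq.gen X hX
    cases hX with
    | H m n hn =>
      exact chargeCommutes_of_bracket_eq_zero hP hU fun u => bracket_H_screening hP m i hn u
    | K m =>
      exact chargeCommutes_of_bracket_eq_zero hP hU fun u =>
        bracket_diag_weight_screening hP m i P.qpow u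
    | Kinv m =>
      exact chargeCommutes_of_bracket_eq_zero hP hU fun u =>
        bracket_diag_weight_screening hP m i (fun x => P.qpow (-x)) u
    | Eplus m n =>
      exact chargeCommutes_of_bracket_eq_zero hP hU fun u => bracket_Eplus_screening hP m i n u
    | Eminus m n =>
      by_cases h : m = i
      · subst h
        exact chargeCommutes_Eminus_self hP hconv n
      · exact chargeCommutes_of_bracket_eq_zero hP hU fun u =>
          bracket_Eminus_screening_of_ne hP m i n u fun h' => h (Subtype.ext h')
  | one =>
    refine chargeCommutes_of_bracket_eq_zero hP .one fun u => ?_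
    rw [bracket, one_mul_kernel, mul_one_kernel, sub_self]
  | smul t X hX h => exact chargeCommutes_smul hconv hX h t
  | add X Y hX hY h h' => exact chargeCommutes_add hP hconv hX hY h h'
  | mul X Y hX hY h h' => exact chargeCommutes_mul hP hconv hX hY h h'

end ScreeningCharge

end FreeBoson

end

open FreeBoson in
theorem corollary5 (P : Params)
    (hq : ‖P.qpow 1‖ < 1)
    (hp : ‖P.qpow (2 * P.kg)‖ < 1)
    (i : Node P) (logs : ℂ) (φ v : State P)
    (hconv : ScreeningChargeConverges P i logs φ v)
    (X Y Z : Kernel P) (hX : IsUq P X) (hY : IsUq P Y) (hZ : IsUq P Z) :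
    ∃ l : ℂ,
      HasJacksonIntegral logs P.logp
        (fun u => matrixElement φ ((Y.mul (X.mul (screening P i u))).mul Z) v) l ∧
      HasJacksonIntegral logs P.logp
        (fun u => matrixElement φ ((Y.mul ((screening P i u).mul X)).mul Z) v) l := by
  have hP : IsContracting P := ⟨hq, hp⟩
  obtain ⟨-, l, hl⟩ := hconv Z (Y.mul X) hZ (.mul _ _ hY hX)
  obtain ⟨-, l', hl'⟩ := hconv (X.mul Z) Y (.mul _ _ hX hZ) hY
  -- Existence of both integrals comes from the hypothesis with the enlarged outer factors `Y.mul X`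
  -- and `X.mul Z`; only the equality of their values needs the commutation result.
  obtain rfl : l = l' := chargeCommutes hP hconv hX Y Z hY hZ l l' hl hl'
  have fX := hX.isFinitary hP
  have fY := hY.isFinitary hP
  have fZ := hZ.isFinitary hP
  exact ⟨l, hl.congr fun m => congrArg (matrixElement φ · v) (sandwich_mul_left fY fX Z _).symm,
    hl'.congr fun m => congrArg (matrixElement φ · v) (sandwich_mul_right fY fX fZ _).symm⟩
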